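/- Let $F$ be Thompson's group: the group, under composition, of all piecewise-linear homeomorphisms of $[0,1]$ whose slopes are powers of two and whose finitely many breakpoints have dyadic rational coordinates. A \emph{strand diagram} is a finite directed acyclic graph embedded in the unit square, with a unique univalent source on the top side, a unique univalent sink on the bottom side, and all other vertices in the interior, each being a \emph{split} (one incoming edge, then a left and a right outgoing edge) or a \emph{merge} (a left and a right incoming edge, then one outgoing edge). It \emph{represents} $f\in F$ if every $x\in[0,1]$ that enters at the source leaves at the sink as $f(x)$, where at a split a number $y<\tfrac12$ goes left and becomes $2y$, a number $y\ge\tfrac12$ goes right and becomes $2y-1$, and at a merge a number $y$ becomes $y/2$ if it arrives from the left and $(y+1)/2$ if it arrives from the right. An \emph{annular strand diagram} is a finite directed graph embedded in the annulus, free loops (directed cycles without vertices) being allowed, such that every vertex is a split or a merge and every directed cycle has positive winding number around the central hole. Annular strand diagrams are considered up to isotopy. Identifying the top and the bottom of the square, so that source and sink are glued, and deleting the resulting vertex turns a strand diagram into an annular strand diagram. The \emph{reductions} of an annular strand diagram are: (I) a merge whose outgoing edge enters a split is replaced by two parallel strands, the left incoming edge being joined to the left outgoing edge and the right to the right; (II)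 a split whose left and right outgoing edges are the left and right incoming edges of one merge, these two edges bounding a disc that is a region of the complement, is replaced by a single strand; (III) two concentric free loops with nothing in between are replaced by one free loop. Two annular strand diagrams are \emph{equivalent} if they are connected by a sequence of reductions and inverse reductions, and an annular strand diagram is \emph{reduced} if it admits no reduction. A \emph{reduced annular strand diagram of} $f\in F$ is a reduced annular strand diagram that is equivalent to the annular strand diagram obtained by gluing some strand diagram that represents $f$. \textbf{Theorem.} Every $f\in F$ has a reduced annular strand diagram, which is unique up to isotopy. Two elements of $F$ are conjugate in $F$ if and only if they have the same (that is, isotopic) reduced annular strand diagram. -/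

import Mathlib

noncomputable section

/-! ### Thompson's group `F` -/

/-- A real number of the form `m / 2 ^ n`. -/
def IsDyadic (x : ℝ) : Prop := ∃ (m : ℤ) (n : ℕ), x = m / 2 ^ n

lemma IsDyadic.add {x y : ℝ} (hx : IsDyadic x) (hy : IsDyadic y) : IsDyadic (x + y) := by
  obtain ⟨a, n, rfl⟩ := hx
  obtain ⟨b, k, rfl⟩ := hy
  refine ⟨a * 2 ^ k + b * 2 ^ n, n + k, ?_⟩
  push_cast
  rw [pow_add]
  field_simp

lemma IsDyadic.neg {x : ℝ} (hx : IsDyadic x) : IsDyadic (-x) := by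
  obtain ⟨a, n, rfl⟩ := hx
  exact ⟨-a, n, by push_cast; ring⟩

lemma IsDyadic.zpow_mul {x : ℝ} (hx : IsDyadic x) (k : ℤ) : IsDyadic ((2 : ℝ) ^ k * x) := by
  obtain ⟨a, n, rfl⟩ := hx
  obtain ⟨j, rfl | rfl⟩ := k.eq_nat_or_neg
  · exact ⟨2 ^ j * a, n, by push_cast; rw [zpow_natCast]; ring⟩
  · refine ⟨a, j + n, ?_⟩
    rw [zpow_neg, zpow_natCast, pow_add]
    field_simp

/-- An increasing homeomorphism `f` of `[0,1]` is dyadic piecewise linear if there is a finite set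
`B` of breakpoints, all with dyadic coordinates `(b, f b)`, such that on every interval without
breakpoints in its interior `f` is affine with slope a power of two. -/
def IsDyadicPL (f : unitInterval ≃o unitInterval) : Prop :=
  ∃ B : Finset unitInterval, 0 ∈ B ∧ 1 ∈ B ∧
    (∀ b ∈ B, IsDyadic (b : ℝ) ∧ IsDyadic (f b : ℝ)) ∧
    ∀ a b : unitInterval, a ≤ b → (∀ t ∈ B, ¬ (a < t ∧ t < b)) →
      ∃ k : ℤ, ∀ x : unitInterval, a ≤ x → x ≤ b → (f x : ℝ) = f a + (2 : ℝ) ^ k * (x - a)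

/-- For every point there is a breakpoint below it with no breakpoint strictly in between. -/
lemma exists_breakpoint_below (B : Finset unitInterval) (h0 : 0 ∈ B) (x : unitInterval) :
    ∃ a ∈ B, a ≤ x ∧ ∀ t ∈ B, ¬ (a < t ∧ t < x) := by
  have hne : (B.filter (· ≤ x)).Nonempty :=
    ⟨0, by simp [h0]⟩
  refine ⟨(B.filter (· ≤ x)).max' hne, ?_, ?_, ?_⟩
  · exact (Finset.mem_filter.1 (Finset.max'_mem _ hne)).1
  · exact (Finset.mem_filter.1 (Finset.max'_mem _ hne)).2
  · rintro t ht ⟨h1, h2⟩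
    exact absurd (Finset.le_max' _ t (Finset.mem_filter.2 ⟨ht, h2.le⟩)) (not_le.2 h1)

lemma IsDyadicPL.isDyadic_iff {f : unitInterval ≃o unitInterval} (hf : IsDyadicPL f)
    (x : unitInterval) : IsDyadic (f x : ℝ) ↔ IsDyadic (x : ℝ) := by
  obtain ⟨B, h0, -, hB, haff⟩ := hf
  obtain ⟨a, ha, hax, hfree⟩ := exists_breakpoint_below B h0 x
  obtain ⟨k, hk⟩ := haff a x hax hfree
  have h := hk x hax le_rfl
  constructor
  · intro hx
    have h2 : (x : ℝ) = a + (2 : ℝ) ^ (-k) * ((f x : ℝ) + -(f a : ℝ)) := by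
      rw [h, zpow_neg]
      field_simp
      ring
    rw [h2]
    exact (hB a ha).1.add ((hx.add (hB a ha).2.neg).zpow_mul _)
  · intro hx
    rw [h, sub_eq_add_neg]
    exact (hB a ha).2.add ((hx.add (hB a ha).1.neg).zpow_mul _)

/-- Thompson's group `F`: the piecewise linear homeomorphisms of the unit interval all of whose
slopes are powers of two and all of whose breakpoints have dyadic coordinates. (Positive slopes
force such a homeomorphism to be increasing.) Multiplication is composition. -/
def ThompsonF : Subgroup (unitInterval ≃o unitInterval) where
  carrier := {f | IsDyadicPL f}
  one_mem' := by
    refine ⟨{0, 1}, by simp, by simp, ?_, ?_⟩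
    · have d0 : IsDyadic 0 := ⟨0, 0, by simp⟩
      have d1 : IsDyadic 1 := ⟨1, 0, by simp⟩
      intro b hb
      rcases Finset.mem_insert.1 hb with rfl | hb
      · exact ⟨d0, d0⟩
      · rw [Finset.mem_singleton.1 hb]
        exact ⟨d1, d1⟩
    · intro a b _ _
      refine ⟨0, fun x _ _ => ?_⟩
      simp
  mul_mem' := by
    intro g f hg hf
    have hfd := IsDyadicPL.isDyadic_iff hf
    have hgd := IsDyadicPL.isDyadic_iff hg
    obtain ⟨C, -, -, hC, hgaff⟩ := hg
    obtain ⟨B, h0, h1, hB, hfaff⟩ := hf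
    refine ⟨B ∪ C.image f.symm, by simp [h0], by simp [h1], ?_, ?_⟩
    · intro b hb
      rcases Finset.mem_union.1 hb with hb | hb
      · exact ⟨(hB b hb).1, (hgd (f b)).2 (hB b hb).2⟩
      · obtain ⟨c, hc, rfl⟩ := Finset.mem_image.1 hb
        have h3 : IsDyadic (f.symm c : ℝ) := by
          rw [← hfd, f.apply_symm_apply]
          exact (hC c hc).1
        exact ⟨h3, (hgd _).2 ((hfd _).2 h3)⟩
    · intro a b hab hfree
      obtain ⟨k, hk⟩ := hfaff a b hab fun t ht => hfree t (Finset.mem_union_left _ ht)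
      obtain ⟨j, hj⟩ := hgaff (f a) (f b) (f.monotone hab) (by
        rintro t ht ⟨h2, h3⟩
        refine hfree (f.symm t) (Finset.mem_union_right _ (Finset.mem_image_of_mem _ ht)) ⟨?_, ?_⟩
        · rwa [OrderIso.lt_symm_apply]
        · rwa [OrderIso.symm_apply_lt])
      refine ⟨j + k, fun x hax hxb => ?_⟩
      have h4 := hj (f x) (f.monotone hax) (f.monotone hxb)
      rw [hk x hax hxb] at h4
      have h5 : ((g * f) x : ℝ) = g (f x) := rfl
      have h6 : ((g * f) a : ℝ) = g (f a) := rfl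
      rw [h5, h6, h4, zpow_add₀ two_ne_zero]
      ring
  inv_mem' := by
    intro f hf
    obtain ⟨B, h0, h1, hB, haff⟩ := hf
    have e0 : f 0 = 0 := f.map_bot
    have e1 : f 1 = 1 := f.map_top
    refine ⟨B.image f, Finset.mem_image.2 ⟨0, h0, e0⟩, Finset.mem_image.2 ⟨1, h1, e1⟩, ?_, ?_⟩
    · intro b hb
      obtain ⟨c, hc, rfl⟩ := Finset.mem_image.1 hb
      have h3 : f⁻¹ (f c) = c := f.symm_apply_apply c
      rw [h3]
      exact ⟨(hB c hc).2, (hB c hc).1⟩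
    · intro a b hab hfree
      obtain ⟨k, hk⟩ := haff (f.symm a) (f.symm b) (f.symm.monotone hab) (by
        rintro t ht ⟨h2, h3⟩
        refine hfree (f t) (Finset.mem_image_of_mem _ ht) ⟨?_, ?_⟩
        · rwa [OrderIso.symm_apply_lt] at h2
        · rwa [OrderIso.lt_symm_apply] at h3)
      refine ⟨-k, fun x hax hxb => ?_⟩
      have h4 := hk (f.symm x) (f.symm.monotone hax) (f.symm.monotone hxb)
      rw [f.apply_symm_apply, f.apply_symm_apply] at h4
      have h5 : (f⁻¹ x : ℝ) = f.symm x := rfl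
      have h6 : (f⁻¹ a : ℝ) = f.symm a := rfl
      rw [h5, h6, h4, zpow_neg]
      field_simp
      ring

/-! ### Split-merge graphs drawn on a surface

Diagrams are drawn with all strands directed downwards; "left" and "right" refer to the picture.
An embedded graph is recorded, up to isotopy, by its combinatorial embedding: the left-to-right
order of the strands at every vertex, together with the set of regions (connected components of the
complement) and the regions lying immediately to the left and right of every edge. -/

/-- A finite directed graph all of whose interior vertices are splits or merges, together with
the regions of its complement. Edges need not have end vertices (free loops, source, sink). -/
structure StrandGraph where
  /-- splits -/
  S : Type
  /-- merges -/
  M : Type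
  /-- edges -/
  E : Type
  /-- regions of the complement -/
  R : Type
  [finS : Fintype S]
  [finM : Fintype M]
  [finE : Fintype E]
  [finR : Fintype R]
  /-- the edge entering a split -/
  splitIn : S → E
  /-- the left edge leaving a split -/
  splitLeft : S → E
  /-- the right edge leaving a split -/
  splitRight : S → E
  /-- the left edge entering a merge -/
  mergeLeft : M → E
  /-- the right edge entering a merge -/
  mergeRight : M → E
  /-- the edge leaving a merge -/
  mergeOut : M → E
  /-- the region to the left of an edge -/
  left : E → R
  /-- the region to the right of an edge -/
  right : E → R
  /-- an edge leaves at most one vertex, in at most one position -/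
  tail_injective : Function.Injective (Sum.elim splitLeft (Sum.elim splitRight mergeOut))
  /-- an edge enters at most one vertex, in at most one position -/
  head_injective : Function.Injective (Sum.elim splitIn (Sum.elim mergeLeft mergeRight))
  /-- the three corners at a split -/
  split_corners : ∀ s, left (splitIn s) = left (splitLeft s) ∧
    right (splitLeft s) = left (splitRight s) ∧ right (splitRight s) = right (splitIn s)
  /-- the three corners at a merge -/
  merge_corners : ∀ m, left (mergeOut m) = left (mergeLeft m) ∧
    right (mergeLeft m) = left (mergeRight m) ∧ right (mergeRight m) = right (mergeOut m)

namespace StrandGraph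

attribute [instance] StrandGraph.finS StrandGraph.finM StrandGraph.finE StrandGraph.finR

variable (G : StrandGraph)

/-- The edges that leave some split or merge. -/
def tails : Set G.E := Set.range (Sum.elim G.splitLeft (Sum.elim G.splitRight G.mergeOut))

/-- The edges that enter some split or merge. -/
def heads : Set G.E := Set.range (Sum.elim G.splitIn (Sum.elim G.mergeLeft G.mergeRight))

/-- `e'` leaves the vertex that `e` enters. -/
def Follows (e e' : G.E) : Prop :=
  (∃ s, e = G.splitIn s ∧ (e' = G.splitLeft s ∨ e' = G.splitRight s)) ∨
    ∃ m, (e = G.mergeLeft m ∨ e = G.mergeRight m) ∧ e' = G.mergeOut m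

/-- The edges `e :: l`, in this order, form a closed directed walk through vertices. -/
def IsClosedWalk (e : G.E) (l : List G.E) : Prop :=
  List.IsChain G.Follows (e :: (l ++ [e]))

open Classical in
/-- An integral dual chain `c` describes a curve in general position which crosses each edge `e`
(algebraically) `c e` times from right to left. `G.dualBoundary c r` is the number of
end points minus the number of starting points of the curve in the region `r`. -/
def dualBoundary (c : G.E → ℤ) (r : G.R) : ℤ :=
  (∑ e, if G.left e = r then c e else 0) - ∑ e, if G.right e = r then c e else 0

open Classical in
/-- The coboundary of an integer function on the vertices: its value at the end point of an edge
minus its value at the starting point (`0` where the edge does not begin or end at a split or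
merge; in particular `0` on free loops). -/
def coboundary (φ : G.S → ℤ) (ψ : G.M → ℤ) (e : G.E) : ℤ :=
  (∑ s, φ s * ((if G.splitIn s = e then 1 else 0) - (if G.splitLeft s = e then 1 else 0)
      - (if G.splitRight s = e then 1 else 0))) +
    ∑ m, ψ m * ((if G.mergeLeft m = e then 1 else 0) + (if G.mergeRight m = e then 1 else 0)
      - (if G.mergeOut m = e then 1 else 0))

/-- The surface on which the graph is drawn is planar: it is connected (any two regions can be
joined by crossing edges), and every closed curve bounds (its intersection numbers with the edges
are the coboundary of a winding number function on the vertices). Given connectedness, the second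
condition says, in ranks, `V - E + R = 1 + C` (`C` the number of components), which is Euler's
formula for the sphere. -/
def IsPlanar : Prop :=
  (∀ r r', Relation.EqvGen (fun p q => ∃ e, G.left e = p ∧ G.right e = q) r r') ∧
    ∀ c : G.E → ℤ, (∀ r, G.dualBoundary c r = 0) → ∃ φ ψ, c = G.coboundary φ ψ

/-- `H` arises from `G` by deleting the splits `kS`, merges `kM`, edges `kE` and regions `kR`,
and then identifying edges as generated by `gE` and regions as generated by `gR`; everything else
is unchanged. The correspondence is recorded by the maps `σ μ π ρ` (the values of `π`
and `ρ` on deleted edges and regions are irrelevant). -/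
structure Collapse (G H : StrandGraph) (kS : Set G.S) (kM : Set G.M) (kE : Set G.E) (kR : Set G.R)
    (gE : G.E → G.E → Prop) (gR : G.R → G.R → Prop)
    (σ : H.S → G.S) (μ : H.M → G.M) (π : G.E → H.E) (ρ : G.R → H.R) : Prop where
  split_injective : Function.Injective σ
  split_range : Set.range σ = kSᶜ
  merge_injective : Function.Injective μ
  merge_range : Set.range μ = kMᶜ
  edge_surj : ∀ e', ∃ e, e ∉ kE ∧ π e = e'
  edge_ker : ∀ e e', e ∉ kE → e' ∉ kE → (π e = π e' ↔ Relation.EqvGen gE e e')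
  region_surj : ∀ r', ∃ r, r ∉ kR ∧ ρ r = r'
  region_ker : ∀ r r', r ∉ kR → r' ∉ kR → (ρ r = ρ r' ↔ Relation.EqvGen gR r r')
  splitIn : ∀ s, H.splitIn s = π (G.splitIn (σ s))
  splitLeft : ∀ s, H.splitLeft s = π (G.splitLeft (σ s))
  splitRight : ∀ s, H.splitRight s = π (G.splitRight (σ s))
  mergeLeft : ∀ m, H.mergeLeft m = π (G.mergeLeft (μ m))
  mergeRight : ∀ m, H.mergeRight m = π (G.mergeRight (μ m))
  mergeOut : ∀ m, H.mergeOut m = π (G.mergeOut (μ m))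
  left : ∀ e, e ∉ kE → G.left e ∉ kR → H.left (π e) = ρ (G.left e)
  right : ∀ e, e ∉ kE → G.right e ∉ kR → H.right (π e) = ρ (G.right e)

end StrandGraph

/-! ### Strand diagrams in the square -/

/-- A `(1,1)`-strand diagram: a directed acyclic graph in the unit square with one
univalent source on the top side, one univalent sink on the bottom side, and otherwise only splits
and merges, in the interior of the square. -/
structure StrandDiagram extends StrandGraph where
  /-- the edge leaving the source -/
  source : E
  /-- the edge entering the sink -/
  sink : E
  tails_eq : toStrandGraph.tails = {source}ᶜ
  heads_eq : toStrandGraph.heads = {sink}ᶜ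
  acyclic : ∀ e l, ¬ toStrandGraph.IsClosedWalk e l
  planar : toStrandGraph.IsPlanar
  /-- the left side of the square lies in a single region -/
  left_side : left source = left sink
  /-- the right side of the square lies in a single region -/
  right_side : right source = right sink

namespace StrandDiagram

/-- A number `x ∈ [0,1]` enters the diagram at the source. At a split it goes to the left
if its first binary digit is `0` and to the right if it is `1`, losing this digit; at a merge it
gets a new first digit, `0` if it comes from the left and `1` if it comes from the
right. `D.Carries x e y` says that it travels along the edge `e` as the number `y`. -/
inductive Carries (D : StrandDiagram) (x : ℝ) : D.E → ℝ → Prop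
  | source : Carries D x D.source x
  | splitLeft (s : D.S) (y : ℝ) : Carries D x (D.splitIn s) y → y < 1 / 2 →
      Carries D x (D.splitLeft s) (2 * y)
  | splitRight (s : D.S) (y : ℝ) : Carries D x (D.splitIn s) y → 1 / 2 ≤ y →
      Carries D x (D.splitRight s) (2 * y - 1)
  | mergeLeft (m : D.M) (y : ℝ) : Carries D x (D.mergeLeft m) y →
      Carries D x (D.mergeOut m) (y / 2)
  | mergeRight (m : D.M) (y : ℝ) : Carries D x (D.mergeRight m) y →
      Carries D x (D.mergeOut m) ((y + 1) / 2)

/-- `D` is a strand diagram for the element `f` of Thompson's group `F`. -/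
def Represents (D : StrandDiagram) (f : ThompsonF) : Prop :=
  ∀ x : unitInterval, D.Carries x D.sink (f.1 x : ℝ)

end StrandDiagram

/-! ### Annular strand diagrams -/

/-- An annular strand diagram: a directed graph embedded in the annulus, possibly with free loops,
all of whose vertices are splits or merges, and all of whose directed cycles have positive winding
number around the central hole. The winding number of a cycle is its
intersection number with a curve `c` from the region `inner` of the inner boundary circle to
the region `outer` of the outer boundary circle (by planarity it does not
depend on `c`; the counterclockwise direction is positive). -/
structure AnnularDiagram extends StrandGraph where
  inner : R
  outer : R
  /-- an edge without starting point has no end point: it is a free loop -/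
  tails_eq_heads : toStrandGraph.tails = toStrandGraph.heads
  planar : toStrandGraph.IsPlanar
  winding : ∃ c : E → ℤ,
    (open Classical in ∀ r, toStrandGraph.dualBoundary c r =
      (if r = outer then 1 else 0) - (if r = inner then 1 else 0)) ∧
    (∀ e l, toStrandGraph.IsClosedWalk e l → 0 < ((e :: l).map c).sum) ∧
    ∀ e, e ∉ toStrandGraph.tails → 0 < c e

/-- `A` is obtained from the strand diagram `D` by identifying the top and the bottom of the
square, and the source with the sink, and deleting the resulting vertex. With strands
directed counterclockwise, the right side of the square becomes the inner circle. -/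
def StrandDiagram.IsClosure (D : StrandDiagram) (A : AnnularDiagram) : Prop :=
  ∃ σ μ π ρ, StrandGraph.Collapse D.toStrandGraph A.toStrandGraph ∅ ∅ ∅ ∅
      (fun e e' => e = D.source ∧ e' = D.sink) (fun _ _ => False) σ μ π ρ ∧
    A.inner = ρ (D.right D.source) ∧ A.outer = ρ (D.left D.source)

namespace AnnularDiagram

/-- Isotopy of annular strand diagrams, as isomorphism of their combinatorial embeddings. -/
def Isotopic (A B : AnnularDiagram) : Prop :=
  ∃ σ μ π ρ, StrandGraph.Collapse A.toStrandGraph B.toStrandGraph ∅ ∅ ∅ ∅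
      (fun _ _ => False) (fun _ _ => False) σ μ π ρ ∧
    B.inner = ρ A.inner ∧ B.outer = ρ A.outer

/-- The region `r` is bounded exactly by the right side of `e` and the left side of `e'`, and it does
not touch the boundary of the annulus. -/
def IsBetween (A : AnnularDiagram) (r : A.R) (e e' : A.E) : Prop :=
  r ≠ A.inner ∧ r ≠ A.outer ∧ (∀ x, A.right x = r ↔ x = e) ∧ ∀ x, A.left x = r ↔ x = e'

/-- Reduction of type I: a merge followed immediately by a split is replaced by two
parallel strands. The regions above the merge and below the split become one. -/
def ReducesI (A B : AnnularDiagram) : Prop :=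
  ∃ (m : A.M) (s : A.S), A.mergeOut m = A.splitIn s ∧
    ∃ σ μ π ρ, StrandGraph.Collapse A.toStrandGraph B.toStrandGraph {s} {m} {A.mergeOut m} ∅
        (fun e e' => (e = A.mergeLeft m ∧ e' = A.splitLeft s) ∨
          (e = A.mergeRight m ∧ e' = A.splitRight s))
        (fun r r' => r = A.right (A.mergeLeft m) ∧ r' = A.right (A.splitLeft s)) σ μ π ρ ∧
      B.inner = ρ A.inner ∧ B.outer = ρ A.outer

/-- Reduction of type II: a split followed immediately by a merge, where the two edges
from the split to the merge bound a disc, is replaced by a single strand. -/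
def ReducesII (A B : AnnularDiagram) : Prop :=
  ∃ (s : A.S) (m : A.M), A.splitLeft s = A.mergeLeft m ∧ A.splitRight s = A.mergeRight m ∧
    A.IsBetween (A.right (A.splitLeft s)) (A.splitLeft s) (A.splitRight s) ∧
    ∃ σ μ π ρ, StrandGraph.Collapse A.toStrandGraph B.toStrandGraph {s} {m}
        {A.splitLeft s, A.splitRight s} {A.right (A.splitLeft s)}
        (fun e e' => e = A.splitIn s ∧ e' = A.mergeOut m) (fun _ _ => False) σ μ π ρ ∧
      B.inner = ρ A.inner ∧ B.outer = ρ A.outer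

/-- Reduction of type III: two concentric free loops with nothing in between are combined into
one. -/
def ReducesIII (A B : AnnularDiagram) : Prop :=
  ∃ (a b : A.E), a ≠ b ∧ a ∉ A.tails ∧ b ∉ A.tails ∧ A.IsBetween (A.right a) a b ∧
    ∃ σ μ π ρ, StrandGraph.Collapse A.toStrandGraph B.toStrandGraph ∅ ∅ ∅ {A.right a}
        (fun e e' => e = a ∧ e' = b) (fun _ _ => False) σ μ π ρ ∧
      B.inner = ρ A.inner ∧ B.outer = ρ A.outer

/-- A single reduction. -/
def Reduces (A B : AnnularDiagram) : Prop := ReducesI A B ∨ ReducesII A B ∨ ReducesIII A B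

/-- Two annular strand diagrams are equivalent if one can be obtained from the other by a
sequence of reductions and inverse reductions (and isotopies). -/
def Equivalent : AnnularDiagram → AnnularDiagram → Prop :=
  Relation.EqvGen fun A B => Isotopic A B ∨ Reduces A B

/-- Not subject to any reduction. -/
def IsReduced (A : AnnularDiagram) : Prop := ∀ B, ¬ Reduces A B

/-- `A` is the reduced annular strand diagram of `f`: it is reduced, and equivalent to the annular
diagram obtained from a strand diagram for `f` by gluing the top to the bottom. -/
def IsReducedDiagramOf (A : AnnularDiagram) (f : ThompsonF) : Prop :=
  A.IsReduced ∧ ∃ (D : StrandDiagram) (A₀ : AnnularDiagram),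
    D.Represents f ∧ D.IsClosure A₀ ∧ A₀.Equivalent A

end AnnularDiagram

end

/-!
An annular diagram is compared with an element `f` of Thompson's group by means of colorings. A
coloring by `f` (`JointedGraph.IsColoring`) gives every edge a piecewise linear map of the unit
interval into itself such that the map of an edge at the unary end of a split or merge is glued from
those of the two edges at its binary end, and such that crossing a cut between the two
boundaries amounts to applying `f`. The end points of the intervals on the two sides of a region agree
up to the action of `f`, and the trajectories of irrational points through the diagram correspond
to the orbits of `f`. Three facts give the theorem.

*Colorings are invariant.* A reduction preserves the set of elements by which a diagram is colored
(`Reduces.colored_iff`): each of the three moves cuts out some vertices or loops, leaving joints that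
are then smoothed, and trajectories are followed through both steps. The delicate point is to undo a
reduction of type I: the intervals on the two strands have to be adjacent. By planarity a
winding number would otherwise separate the trajectories on both sides of their common end point
(`adjacent_cutI`).

*Reduced diagrams are rigid.* Two reduced diagrams colored by the same `f` are isotopic
(`IsReduced.isotopic_of_colored`). In a reduced diagram no merge is followed by a split, so the merges
and the splits form two forests (`biForest`), whose intervals are nested and are contracted
by powers of `f` and of its inverse towards fixed points. Near such a fixed point the contracted
interval is determined by the slopes of `f` and the dyadic structure (`Contracts.exists_prefix`), so
that both forests can be recovered from `f` (`BiForest.exists_sim`). The free loops carry the maximal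
intervals of fixed points, and the regions are recovered from the end points of the intervals.

*Closures are colored.* Labeling the edges of a strand diagram for `f` by the points of the source
that flow through them colors its closure by `f` (`Represents.colored`). Conversely, in a coloring of
the closure by `g` the map at the source is an element of Thompson's group which conjugates `f` to
`g` (`Represents.isConj`). A strand diagram for `f` exists, since `f` maps some dyadic subdivision
affinely to another one (`exists_represents`).

A reduced diagram of `f` exists, since reductions terminate, and it is colored exactly by the
conjugates of `f` (`IsReducedDiagramOf.colored_iff`). With rigidity this gives uniqueness and
shows that conjugacy is the same as having isotopic reduced diagrams.
-/

open scoped unitInterval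
open Relation (EqvGen ReflTransGen)
open Function (Injective)
open unitInterval (nonneg' le_one')
open Finset (sum_add_distrib sum_sub_distrib mul_sum sum_congr mem_univ)

noncomputable section

/-! ### Binary digits and piecewise linear maps of the unit interval -/

/-- The two affine maps of the unit interval onto its halves: `half b` prepends the binary
digit `b`. -/
def half (b : Bool) (y : I) : I :=
  ⟨(y + (if b then 1 else 0)) / 2, by
    have h0 := y.2.1
    have h1 := y.2.2
    constructor <;> split_ifs <;> linarith⟩

lemma half_coe (b : Bool) (y : I) : (half b y : ℝ) = (y + (if b then 1 else 0)) / 2 := rfl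

lemma half_false_coe (y : I) : (half false y : ℝ) = y / 2 := by simp [half_coe]

lemma half_true_coe (y : I) : (half true y : ℝ) = (y + 1) / 2 := by simp [half_coe]

lemma exists_half (y : I) : ∃ b z, y = half b z := by
  have h0 := y.2.1
  have h1 := y.2.2
  by_cases h : (y : ℝ) ≤ 1 / 2
  · exact ⟨false, ⟨2 * y, by constructor <;> linarith⟩, Subtype.ext (by rw [half_false_coe]; simp)⟩
  · exact ⟨true, ⟨2 * y - 1, by constructor <;> linarith⟩,
      Subtype.ext (by rw [half_true_coe]; simp)⟩

lemma half_strictMono (b : Bool) : StrictMono (half b) := by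
  intro x y h
  have h' : (x : ℝ) < y := h
  show (half b x : ℝ) < half b y
  rw [half_coe, half_coe]
  linarith

lemma half_irrational {b : Bool} {y : I} : Irrational (half b y : ℝ) ↔ Irrational (y : ℝ) := by
  have h : (half b y : ℝ) = (y + ((if b then 1 else 0 : ℕ) : ℝ)) / ((2 : ℕ) : ℝ) := by
    rw [half_coe]; cases b <;> simp
  rw [h, irrational_div_natCast_iff, irrational_add_natCast_iff]
  simp

lemma half_inj {b b' : Bool} {y y' : I} (hy : Irrational (y : ℝ)) (h : half b y = half b' y') :
    b = b' ∧ y = y' := by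
  have h1 : (half b y : ℝ) = half b' y' := by rw [h]
  rw [half_coe, half_coe] at h1
  have a0 := y.2.1
  have a1 := y.2.2
  have c0 := y'.2.1
  have c1 := y'.2.2
  have e1 : (y : ℝ) ≠ 1 := fun e => by rw [e] at hy; exact not_irrational_one hy
  have e0 : (y : ℝ) ≠ 0 := fun e => by rw [e] at hy; exact not_irrational_zero hy
  cases b <;> cases b' <;> simp at h1
  · exact ⟨rfl, Subtype.ext h1⟩
  · exact absurd (by linarith) e1
  · exact absurd (by linarith) e0
  · exact ⟨rfl, Subtype.ext h1⟩

/-- `halves w` prepends the word `w` of binary digits. -/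
def halves : List Bool → I → I
  | [], y => y
  | b :: w, y => half b (halves w y)

@[simp] lemma halves_nil (y : I) : halves [] y = y := rfl

@[simp] lemma halves_cons (b : Bool) (w : List Bool) (y : I) :
    halves (b :: w) y = half b (halves w y) := rfl

lemma halves_append (u v : List Bool) (y : I) : halves (u ++ v) y = halves u (halves v y) := by
  induction u with
  | nil => rfl
  | cons b u ih => simp [ih]

lemma halves_strictMono (w : List Bool) : StrictMono (halves w) := by
  induction w with
  | nil => exact strictMono_id
  | cons b w ih => exact (half_strictMono b).comp ih

lemma halves_irrational {w : List Bool} {y : I} :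
    Irrational (halves w y : ℝ) ↔ Irrational (y : ℝ) := by
  induction w with
  | nil => rfl
  | cons b w ih => rw [halves_cons, half_irrational, ih]

/-- The natural number with binary digits `w`. -/
def wordVal : List Bool → ℕ
  | [] => 0
  | b :: w => (if b then 2 ^ w.length else 0) + wordVal w

lemma wordVal_lt (w : List Bool) : wordVal w < 2 ^ w.length := by
  induction w with
  | nil => simp [wordVal]
  | cons b w ih => cases b <;> simp [wordVal, pow_succ] <;> omega

lemma halves_coe (w : List Bool) (y : I) :
    (halves w y : ℝ) = (wordVal w + y) / 2 ^ w.length := by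
  induction w with
  | nil => simp [wordVal]
  | cons b w ih =>
    rw [halves_cons, half_coe, ih]
    cases b
    · simp [wordVal, pow_succ]; field_simp
    · simp [wordVal, pow_succ]; field_simp; ring

lemma two_pow_length_pos (w : List Bool) : (0 : ℝ) < 2 ^ w.length := by positivity

lemma one_lt_two_pow_length {w : List Bool} (hw : w ≠ []) : (1 : ℝ) < 2 ^ w.length :=
  one_lt_pow₀ (by norm_num) (by simpa using hw)

lemma halves_fix_irrational {w : List Bool} {y : I} (hy : Irrational (y : ℝ))
    (h : halves w y = y) : w = [] := by
  by_contra hw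
  have h1 := congrArg (fun z : I => (z : ℝ)) h
  simp only [halves_coe] at h1
  have h2 := one_lt_two_pow_length hw
  have h3 : (y : ℝ) = wordVal w / (2 ^ w.length - 1) := by
    rw [eq_div_iff (by linarith)]
    field_simp at h1
    linarith
  apply hy
  refine ⟨(wordVal w : ℚ) / (2 ^ w.length - 1), ?_⟩
  rw [h3]; push_cast; rfl

lemma halves_inj_irrational {u v : List Bool} {y : I} (hy : Irrational (y : ℝ))
    (h : halves u y = halves v y) : u = v := by
  induction u generalizing v with
  | nil => exact (halves_fix_irrational hy h.symm).symm
  | cons b u ih =>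
    cases v with
    | nil => exact halves_fix_irrational hy h
    | cons c v =>
      obtain ⟨rfl, h2⟩ := half_inj (halves_irrational.2 hy) h
      rw [ih h2]

/-- A nonempty word has a fixed point: the point with periodic binary expansion. -/
lemma exists_halves_fix {w : List Bool} (hw : w ≠ []) : ∃ z, halves w z = z := by
  have h2 := one_lt_two_pow_length hw
  have h3 : (wordVal w : ℝ) + 1 ≤ 2 ^ w.length := by exact_mod_cast wordVal_lt w
  refine ⟨⟨wordVal w / (2 ^ w.length - 1), ?_, ?_⟩, ?_⟩
  · exact div_nonneg (by positivity) (by linarith)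
  · rw [div_le_one (by linarith)]; linarith
  · apply Subtype.ext
    rw [halves_coe]
    have : (2 : ℝ) ^ w.length - 1 ≠ 0 := by linarith
    simp only
    field_simp
    ring

lemma halves_sub (w : List Bool) (y z : I) :
    (halves w y : ℝ) - halves w z = (y - z) / 2 ^ w.length := by
  rw [halves_coe, halves_coe]; ring

lemma halves_contract_lt {w : List Bool} (hw : w ≠ []) {y z : I} (hz : halves w z = z)
    (h : z < y) : halves w y < y := by
  have h1 := halves_sub w y z
  rw [hz] at h1
  have h2 := one_lt_two_pow_length hw
  have h3 : (z : ℝ) < y := h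
  have h4 : ((y : ℝ) - z) / 2 ^ w.length < y - z := div_lt_self (by linarith) h2
  show (halves w y : ℝ) < y
  linarith

lemma halves_contract_gt {w : List Bool} (hw : w ≠ []) {y z : I} (hz : halves w z = z)
    (h : y < z) : y < halves w y := by
  have h1 := halves_sub w z y
  rw [hz] at h1
  have h2 := one_lt_two_pow_length hw
  have h3 : (y : ℝ) < z := h
  have h4 : ((z : ℝ) - y) / 2 ^ w.length < z - y := div_lt_self (by linarith) h2
  show (y : ℝ) < halves w y
  linarith

lemma half_true_one : half true 1 = 1 := Subtype.ext (by simp [half_coe])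

lemma half_false_zero : half false 0 = 0 := Subtype.ext (by simp [half_coe])

lemma half_false_one : half false 1 = half true 0 := Subtype.ext (by simp [half_coe])

lemma half_eq_one {b : Bool} {y : I} (h : half b y = 1) : b = true ∧ y = 1 := by
  have h1 := congrArg (fun z : I => (z : ℝ)) h
  simp only [half_coe] at h1
  have := y.2.2
  cases b
  · simp at h1; linarith
  · refine ⟨rfl, Subtype.ext ?_⟩
    rw [if_pos rfl, Set.Icc.coe_one] at h1
    rw [Set.Icc.coe_one]; linarith

lemma half_eq_zero {b : Bool} {y : I} (h : half b y = 0) : b = false ∧ y = 0 := by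
  have h1 := congrArg (fun z : I => (z : ℝ)) h
  simp only [half_coe] at h1
  have := y.2.1
  cases b
  · refine ⟨rfl, Subtype.ext ?_⟩
    rw [if_neg (by simp), Set.Icc.coe_zero] at h1
    rw [Set.Icc.coe_zero]; linarith
  · simp at h1; linarith

lemma halves_eq_one {w : List Bool} {y : I} (h : halves w y = 1) : (∀ b ∈ w, b = true) ∧ y = 1 := by
  induction w with
  | nil => simpa using h
  | cons b w ih =>
    obtain ⟨h1, h2⟩ := half_eq_one h
    obtain ⟨h3, h4⟩ := ih h2
    exact ⟨by simp [h1]; exact fun h => absurd (h3 _ h) (by simp), h4⟩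

lemma halves_eq_zero {w : List Bool} {y : I} (h : halves w y = 0) :
    (∀ b ∈ w, b = false) ∧ y = 0 := by
  induction w with
  | nil => simpa using h
  | cons b w ih =>
    obtain ⟨h1, h2⟩ := half_eq_zero h
    obtain ⟨h3, h4⟩ := ih h2
    exact ⟨by simp [h1]; exact fun h => absurd (h3 _ h) (by simp), h4⟩

lemma exists_irrational_between {a b : I} (h : a < b) :
    ∃ y : I, a < y ∧ y < b ∧ Irrational (y : ℝ) := by
  obtain ⟨r, hr, h1, h2⟩ := exists_irrational_btwn (show (a : ℝ) < b from h)
  exact ⟨⟨r, a.2.1.trans h1.le, h2.le.trans b.2.2⟩, h1, h2, hr⟩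

/-- Piecewise linear functions on the unit interval that are affine with slope a power of two and
a dyadic constant term on the intervals of a finite subdivision obtained by repeated halving. -/
inductive IsPL : (I → ℝ) → Prop
  | affine (g : I → ℝ) (k : ℤ) (d : ℝ) (hd : IsDyadic d) (h : ∀ y, g y = (2 : ℝ) ^ k * y + d) :
      IsPL g
  | glue (g : I → ℝ) (h0 : IsPL fun y => g (half false y)) (h1 : IsPL fun y => g (half true y)) :
      IsPL g

lemma IsDyadic.zero : IsDyadic 0 := ⟨0, 0, by simp⟩

lemma IsDyadic.one : IsDyadic 1 := ⟨1, 0, by simp⟩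

lemma IsDyadic.half {x : ℝ} (h : IsDyadic x) : IsDyadic (x / 2) := by
  have := h.zpow_mul (-1)
  convert this using 1
  rw [zpow_neg_one]; ring

lemma IsDyadic.sub {x y : ℝ} (hx : IsDyadic x) (hy : IsDyadic y) : IsDyadic (x - y) := by
  rw [sub_eq_add_neg]; exact hx.add hy.neg

lemma half_isDyadic {b : Bool} {y : I} (h : IsDyadic (y : ℝ)) : IsDyadic (half b y : ℝ) := by
  rw [half_coe]
  cases b
  · simpa using h.half
  · simpa using (h.add IsDyadic.one).half

namespace IsPL

lemma add_const {g : I → ℝ} (hg : IsPL g) {d : ℝ} (hd : IsDyadic d) : IsPL fun y => g y + d := by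
  induction hg with
  | affine g k e he h => exact .affine _ k (e + d) (he.add hd) fun y => by rw [h]; ring
  | glue g _ _ h0 h1 => exact .glue _ h0 h1

lemma comp_half {g : I → ℝ} (hg : IsPL g) (b : Bool) : IsPL fun y => g (half b y) := by
  cases hg with
  | affine _ k d hd h =>
    refine .affine _ (k - 1) (2 ^ k * (if b then 1 / 2 else 0) + d) ?_ fun y => ?_
    · refine IsDyadic.add (IsDyadic.zpow_mul ?_ k) hd
      cases b
      · simpa using IsDyadic.zero
      · simpa using IsDyadic.one.half
    · rw [h, half_coe, zpow_sub_one₀ (by norm_num)]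
      cases b <;> simp <;> ring
  | glue _ h0 h1 => cases b <;> assumption

protected lemma strictMono {g : I → ℝ} (hg : IsPL g) : StrictMono g := by
  induction hg with
  | affine g k d hd h =>
    intro x y hxy
    have hxy' : (x : ℝ) < y := hxy
    rw [h, h]
    have : (0 : ℝ) < 2 ^ k := by positivity
    nlinarith
  | glue g _ _ h0 h1 =>
    intro x y hxy
    obtain ⟨b, x, rfl⟩ := exists_half x
    obtain ⟨c, y, rfl⟩ := exists_half y
    have hxy' : (half b x : ℝ) < half c y := hxy
    rw [half_coe, half_coe] at hxy'
    have a1 := x.2.2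
    have a0 := x.2.1
    have c0 := y.2.1
    have c1 := y.2.2
    cases b <;> cases c
    · exact h0 ((half_strictMono false).lt_iff_lt.1 hxy)
    · have e0 : g (half false x) ≤ g (half false 1) := h0.monotone x.2.2
      have e1 : g (half true 0) ≤ g (half true y) := h1.monotone y.2.1
      rw [half_false_one] at e0
      rcases eq_or_lt_of_le (show x ≤ 1 from x.2.2) with rfl | hx
      · rw [half_false_one]
        refine h1 (lt_of_le_of_ne y.2.1 fun hy => ?_)
        rw [← hy] at hxy'
        simp at hxy'
      · have e2 : g (half false x) < g (half false 1) := h0 hx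
        rw [half_false_one] at e2
        exact e2.trans_le e1
    · simp at hxy'; linarith
    · exact h1 ((half_strictMono true).lt_iff_lt.1 hxy)

protected lemma continuous {g : I → ℝ} (hg : IsPL g) : Continuous g := by
  induction hg with
  | affine g k d hd h =>
    rw [funext h]; fun_prop
  | glue g _ _ h0 h1 =>
    have e : g = fun y : I => if (y : ℝ) ≤ 1 / 2
        then g (half false (Set.projIcc 0 1 zero_le_one (2 * (y : ℝ))))
        else g (half true (Set.projIcc 0 1 zero_le_one (2 * (y : ℝ) - 1))) := by
      funext y
      have a0 := y.2.1
      have a1 := y.2.2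
      split_ifs with h
      · congr 1; apply Subtype.ext
        rw [half_coe, Set.projIcc_of_mem _ (by constructor <;> linarith)]; simp
      · congr 1; apply Subtype.ext
        rw [half_coe, Set.projIcc_of_mem _ (by push Not at h; constructor <;> linarith)]; simp
    rw [e]
    refine Continuous.if_le ?_ ?_ (by fun_prop) (by fun_prop) ?_
    · exact h0.comp (continuous_projIcc.comp (by fun_prop))
    · exact h1.comp (continuous_projIcc.comp (by fun_prop))
    · intro y hy
      rw [hy]
      congr 1; apply Subtype.ext
      rw [half_coe, half_coe, Set.projIcc_of_mem _ (by norm_num),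
        Set.projIcc_of_mem _ (by norm_num)]
      norm_num

lemma isDyadic {g : I → ℝ} (hg : IsPL g) {y : I} (hy : IsDyadic (y : ℝ)) : IsDyadic (g y) := by
  induction hg generalizing y with
  | affine g k d hd h => rw [h]; exact (hy.zpow_mul k).add hd
  | glue g _ _ h0 h1 =>
    obtain ⟨b, z, rfl⟩ := exists_half y
    have hz : IsDyadic (z : ℝ) := by
      have : (z : ℝ) = 2 ^ (1 : ℤ) * (half b z : ℝ) - (if b then 1 else 0) := by
        rw [half_coe]; simp; ring
      rw [this]
      refine (hy.zpow_mul 1).sub ?_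
      cases b <;> simp [IsDyadic.zero, IsDyadic.one]
    cases b
    · exact h0 hz
    · exact h1 hz

lemma irrational {g : I → ℝ} (hg : IsPL g) {y : I} : Irrational (g y) ↔ Irrational (y : ℝ) := by
  induction hg generalizing y with
  | affine g k d hd h =>
    obtain ⟨m, n, rfl⟩ := hd
    have e : g y = ((2 ^ k : ℚ) : ℝ) * y + ((m / 2 ^ n : ℚ) : ℝ) := by rw [h]; push_cast; rfl
    rw [e, irrational_add_ratCast_iff, irrational_ratCast_mul_iff]
    have : (2 : ℚ) ^ k ≠ 0 := by positivity
    simp [this]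
  | glue g _ _ h0 h1 =>
    obtain ⟨b, z, rfl⟩ := exists_half y
    rw [half_irrational]
    cases b
    · exact h0
    · exact h1

/-- On sufficiently small dyadic intervals a piecewise linear function is affine. -/
lemma exists_affine {g : I → ℝ} (hg : IsPL g) : ∃ n : ℕ, ∀ w : List Bool, n ≤ w.length →
    ∃ (k : ℤ) (d : ℝ), IsDyadic d ∧ ∀ y, g (halves w y) = (2 : ℝ) ^ k * y + d := by
  induction hg with
  | affine g k d hd h =>
    refine ⟨0, fun w _ => ⟨k - w.length, 2 ^ (k - w.length) * wordVal w + d, ?_, fun y => ?_⟩⟩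
    · exact (IsDyadic.zpow_mul ⟨wordVal w, 0, by simp⟩ _).add hd
    · rw [h, halves_coe, zpow_sub₀ (by norm_num), zpow_natCast]
      field_simp; ring
  | glue g _ _ h0 h1 =>
    obtain ⟨n0, h0⟩ := h0
    obtain ⟨n1, h1⟩ := h1
    refine ⟨max n0 n1 + 1, fun w hw => ?_⟩
    cases w with
    | nil => simp at hw
    | cons b w =>
      simp only [List.length_cons, add_le_add_iff_right, max_le_iff] at hw
      cases b
      · exact h0 w hw.1
      · exact h1 w hw.2

lemma of_forall_affine {g : I → ℝ} (n : ℕ) (h : ∀ w : List Bool, w.length = n →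
    ∃ (k : ℤ) (d : ℝ), IsDyadic d ∧ ∀ y, g (halves w y) = (2 : ℝ) ^ k * y + d) : IsPL g := by
  induction n generalizing g with
  | zero =>
    obtain ⟨k, d, hd, h⟩ := h [] rfl
    exact .affine _ k d hd h
  | succ n ih =>
    exact .glue _ (ih fun w hw => h (false :: w) (by simp [hw]))
      (ih fun w hw => h (true :: w) (by simp [hw]))

end IsPL

lemma isDyadic_mem_grid {x : ℝ} (h : IsDyadic x) : ∃ n₀ : ℕ, ∀ n ≥ n₀, ∃ m : ℤ, x = m / 2 ^ n := by
  obtain ⟨m, n₀, rfl⟩ := h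
  refine ⟨n₀, fun n hn => ⟨m * 2 ^ (n - n₀), ?_⟩⟩
  obtain ⟨k, rfl⟩ := Nat.exists_eq_add_of_le hn
  push_cast
  rw [pow_add, Nat.add_sub_cancel_left]
  field_simp

/-- A dyadic piecewise linear homeomorphism maps piecewise linear functions to such functions:
the breakpoints are separated by a sufficiently fine dyadic subdivision. -/
lemma IsDyadicPL.comp_isPL {f : I ≃o I} (hf : IsDyadicPL f) {T : I → I}
    (hT : IsPL fun y => (T y : ℝ)) : IsPL fun y => (f (T y) : ℝ) := by
  generalize hg : (fun y => (T y : ℝ)) = g at hT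
  induction hT generalizing T with
  | glue g _ _ h0 h1 =>
    subst hg
    exact .glue _ (h0 rfl) (h1 rfl)
  | affine g k d hd h =>
    subst hg
    replace h : ∀ y, (T y : ℝ) = 2 ^ k * y + d := h
    have hfd := hf.isDyadic_iff
    obtain ⟨B, -, -, hB, haff⟩ := hf
    obtain ⟨n, hn⟩ := ((Filter.eventually_all_finset B).2 fun b hb => Filter.eventually_atTop.2
      (isDyadic_mem_grid (((hB b hb).1.sub hd).zpow_mul (-k)))).exists
    have h2k : (0 : ℝ) < 2 ^ k := by positivity
    have hmono : StrictMono T := by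
      intro x y hxy
      have hxy' : (x : ℝ) < y := hxy
      show (T x : ℝ) < T y
      rw [h, h]; nlinarith
    refine IsPL.of_forall_affine n fun w hw => ?_
    obtain ⟨j, hj⟩ := haff (T (halves w 0)) (T (halves w 1))
      (hmono.monotone ((halves_strictMono w).monotone zero_le_one)) (by
        rintro b hb ⟨h1, h2⟩
        obtain ⟨m, hm⟩ := hn b hb
        have h1' : (T (halves w 0) : ℝ) < b := h1
        have h2' : (b : ℝ) < T (halves w 1) := h2
        rw [h, halves_coe, hw] at h1' h2'
        have e : (b : ℝ) = 2 ^ k * (m / 2 ^ n) + d := by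
          rw [← hm, zpow_neg]; field_simp; ring
        rw [e] at h1' h2'
        have h3 : ((wordVal w : ℝ) + (0 : I)) / 2 ^ n < m / 2 ^ n := by nlinarith
        have h4 : (m : ℝ) / 2 ^ n < ((wordVal w : ℝ) + (1 : I)) / 2 ^ n := by nlinarith
        rw [div_lt_div_iff_of_pos_right (by positivity)] at h3 h4
        simp at h3 h4
        have h5 : (wordVal w : ℤ) < m := by exact_mod_cast h3
        have h6 : m < (wordVal w : ℤ) + 1 := by exact_mod_cast h4
        omega)
    have hdy : IsDyadic (T (halves w 0) : ℝ) := by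
      rw [h, halves_coe]
      exact (IsDyadic.zpow_mul ⟨wordVal w, w.length, by simp⟩ _).add hd
    refine ⟨j + k - n, f (T (halves w 0)), (hfd _).2 hdy, fun y => ?_⟩
    rw [hj _ (hmono.monotone ((halves_strictMono w).monotone y.2.1))
      (hmono.monotone ((halves_strictMono w).monotone y.2.2)), h, h, halves_coe, halves_coe, hw,
      zpow_sub₀ (by norm_num), zpow_add₀ (by norm_num), zpow_natCast]
    simp
    field_simp
    ring

lemma isPL_thompsonF (f : ThompsonF) {T : I → I} (hT : IsPL fun y => (T y : ℝ)) :
    IsPL fun y => (f.1 (T y) : ℝ) :=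
  IsDyadicPL.comp_isPL f.2 hT

lemma IsPL.id : IsPL fun y => (y : ℝ) :=
  .affine _ 0 0 IsDyadic.zero fun y => by simp

lemma IsPL.exists_breakpoints {g : I → ℝ} (hg : IsPL g) : ∃ B : Finset I, 0 ∈ B ∧ 1 ∈ B ∧
    (∀ b ∈ B, IsDyadic (b : ℝ)) ∧
    ∀ a b : I, a ≤ b → (∀ t ∈ B, ¬ (a < t ∧ t < b)) →
      ∃ k : ℤ, ∀ x : I, a ≤ x → x ≤ b → g x = g a + (2 : ℝ) ^ k * (x - a) := by
  classical
  induction hg with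
  | affine g k d hd h =>
    refine ⟨{0, 1}, by simp, by simp, ?_, fun a b _ _ => ⟨k, fun x _ _ => ?_⟩⟩
    · intro b hb
      simp only [Finset.mem_insert, Finset.mem_singleton] at hb
      rcases hb with rfl | rfl
      · exact IsDyadic.zero
      · exact IsDyadic.one
    · rw [h, h]; ring
  | glue g _ _ h0 h1 =>
    have ih : ∀ c, ∃ B : Finset I, 0 ∈ B ∧ 1 ∈ B ∧ (∀ b ∈ B, IsDyadic (b : ℝ)) ∧
        ∀ a b : I, a ≤ b → (∀ t ∈ B, ¬ (a < t ∧ t < b)) → ∃ k : ℤ, ∀ x, a ≤ x → x ≤ b →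
          g (half c x) = g (half c a) + (2 : ℝ) ^ k * (x - a) := fun c => by
      cases c
      exacts [h0, h1]
    choose B b0 b1 bd hB using ih
    have hm : ∀ c, ∀ t ∈ B c, half c t ∈ Finset.univ.biUnion fun c => (B c).image (half c) :=
      fun c t ht => Finset.mem_biUnion.2 ⟨c, mem_univ c, Finset.mem_image_of_mem _ ht⟩
    refine ⟨_, half_false_zero ▸ hm false 0 (b0 _), half_true_one ▸ hm true 1 (b1 _), ?_, ?_⟩
    · intro b hb
      simp only [Finset.mem_biUnion, Finset.mem_image] at hb
      obtain ⟨c, -, t, ht, rfl⟩ := hb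
      exact half_isDyadic (bd c t ht)
    · intro a b hab hfree
      -- an interval without breakpoints lies in one of the two halves
      obtain ⟨c, hc⟩ : ∃ c, ∀ x, a ≤ x → x ≤ b → ∃ z, x = half c z := by
        have hmid : ¬ ((a : ℝ) < half true 0 ∧ (half true 0 : ℝ) < b) := hfree _ (hm _ _ (b0 true))
        rw [half_true_coe] at hmid
        by_cases h2 : (b : ℝ) ≤ 1 / 2
        · refine ⟨false, fun x _ (hx : (x : ℝ) ≤ b) => ⟨⟨2 * x, ?_⟩, Subtype.ext ?_⟩⟩
          · have := x.2.1; constructor <;> linarith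
          · rw [half_false_coe]; simp
        · have h3 : (1 / 2 : ℝ) ≤ a := by
            by_contra h3
            exact hmid (by push Not at h2 h3; simp; constructor <;> linarith)
          refine ⟨true, fun x (hx : (a : ℝ) ≤ x) _ => ⟨⟨2 * x - 1, ?_⟩, Subtype.ext ?_⟩⟩
          · have := x.2.2; constructor <;> linarith
          · rw [half_true_coe]; simp
      have hle : ∀ {x y}, half c x ≤ half c y ↔ x ≤ y := (half_strictMono c).le_iff_le
      obtain ⟨a, rfl⟩ := hc a le_rfl hab
      obtain ⟨b, rfl⟩ := hc b hab le_rfl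
      obtain ⟨k, hk⟩ := hB c a b (hle.1 hab) fun t ht h =>
        hfree _ (hm c t ht) (h.imp (half_strictMono c ·) (half_strictMono c ·))
      refine ⟨k + 1, fun x hax hxb => ?_⟩
      obtain ⟨x, rfl⟩ := hc x hax hxb
      have := hk x (hle.1 hax) (hle.1 hxb)
      rw [half_coe, half_coe, zpow_add_one₀ two_ne_zero]
      cases c <;> rw [this] <;> simp <;> ring

/-- A piecewise linear map of the unit interval that fixes both end points is an element
of Thompson's group. -/
lemma exists_thompsonF_of_isPL {h : I → I} (hh : IsPL fun y => (h y : ℝ)) (h0 : h 0 = 0)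
    (h1 : h 1 = 1) : ∃ g : ThompsonF, ∀ y, g.1 y = h y := by
  have hmono : StrictMono h := fun x y hxy => hh.strictMono hxy
  have hcont : Continuous h := continuous_induced_rng.2 hh.continuous
  have hsurj : Function.Surjective h := by
    intro y
    have := intermediate_value_Icc (zero_le_one' I) hcont.continuousOn
    rw [h0, h1] at this
    obtain ⟨x, -, hx⟩ := this ⟨y.2.1, y.2.2⟩
    exact ⟨x, hx⟩
  refine ⟨⟨StrictMono.orderIsoOfSurjective h hmono hsurj, ?_⟩, fun y => rfl⟩
  obtain ⟨B, b0, b1, hB, haff⟩ := hh.exists_breakpoints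
  exact ⟨B, b0, b1, fun b hb => ⟨hB b hb, hh.isDyadic (hB b hb)⟩, haff⟩

/-! ### Powers of an order isomorphism -/

section zpow

variable (f : I ≃o I)

lemma orderIso_zpow_add (m n : ℤ) (x : I) : (f ^ (m + n)) x = (f ^ m) ((f ^ n) x) := by
  rw [zpow_add]; rfl

lemma orderIso_zpow_neg (m : ℤ) (x : I) : (f ^ (-m)) ((f ^ m) x) = x := by
  rw [← orderIso_zpow_add]; simp

lemma orderIso_zpow_neg' (m : ℤ) (x : I) : (f ^ m) ((f ^ (-m)) x) = x := by
  rw [← orderIso_zpow_add]; simp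

variable {f}

lemma zpow_eq_iff {m : ℤ} {x y : I} : (f ^ m) x = y ↔ x = (f ^ (-m)) y := by
  constructor
  · rintro rfl; rw [orderIso_zpow_neg]
  · rintro rfl; rw [orderIso_zpow_neg']

lemma orderIso_pow_apply (n : ℕ) (x : I) : (f ^ n) x = f^[n] x := by
  induction n with
  | zero => rfl
  | succ n ih => rw [Function.iterate_succ_apply', ← ih, pow_succ']; rfl

lemma pow_fix {x : I} (h : f x = x) (n : ℕ) : (f ^ n) x = x := by
  rw [orderIso_pow_apply, Function.iterate_fixed h]

lemma zpow_fix {x : I} (h : f x = x) (n : ℤ) : (f ^ n) x = x := by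
  obtain ⟨k, rfl | rfl⟩ := n.eq_nat_or_neg
  · rw [zpow_natCast]; exact pow_fix h k
  · rw [zpow_eq_iff, neg_neg, zpow_natCast]; exact (pow_fix h k).symm

lemma fix_of_pow_fix {x : I} {n : ℕ} (hn : 0 < n) (h : (f ^ n) x = x) : f x = x :=
  (Function.Commute.id_right.iterate_pos_eq_iff_map_eq f.monotone strictMono_id hn).1
    (by simpa [orderIso_pow_apply] using h)

lemma fix_of_zpow_fix {x : I} {n : ℤ} (hn : n ≠ 0) (h : (f ^ n) x = x) : f x = x := by
  obtain ⟨k, rfl | rfl⟩ := n.eq_nat_or_neg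
  · rw [zpow_natCast] at h; exact fix_of_pow_fix (by omega) h
  · rw [zpow_eq_iff, neg_neg, zpow_natCast] at h; exact fix_of_pow_fix (by omega) h.symm

lemma pow_lt_iff {x : I} {n : ℕ} (hn : 0 < n) : (f ^ n) x < x ↔ f x < x := by
  simpa [orderIso_pow_apply] using Function.Commute.id_right.iterate_pos_lt_iff_map_lt (x := x) f.monotone
    strictMono_id hn

lemma lt_pow_iff {x : I} {n : ℕ} (hn : 0 < n) : x < (f ^ n) x ↔ x < f x := by
  simpa [orderIso_pow_apply] using Function.Commute.id_left.iterate_pos_lt_iff_map_lt (x := x) monotone_id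
    f.strictMono hn

lemma zpow_injective_of_not_fix {x : I} (h : f x ≠ x) {m n : ℤ} (e : (f ^ m) x = (f ^ n) x) :
    m = n := by
  by_contra hmn
  rw [zpow_eq_iff, ← orderIso_zpow_add] at e
  exact h (fix_of_zpow_fix (by omega) e.symm)

lemma apply_zpow_fix_iff {x : I} (n : ℤ) : f ((f ^ n) x) = (f ^ n) x ↔ f x = x := by
  have h : f ((f ^ n) x) = (f ^ n) (f x) := by
    have h1 : (f ^ (1 + n)) x = f ((f ^ n) x) := by rw [orderIso_zpow_add]; simp
    have h2 : (f ^ (n + 1)) x = (f ^ n) (f x) := by rw [orderIso_zpow_add]; simp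
    rw [← h1, ← h2, add_comm]
  rw [h, (f ^ n).injective.eq_iff]

end zpow

lemma isPL_zpow (f : ThompsonF) (n : ℤ) {T : I → I} (hT : IsPL fun y => (T y : ℝ)) :
    IsPL fun y => ((f.1 ^ n) (T y) : ℝ) :=
  isPL_thompsonF (f ^ n) hT

/-! ### Chains, potentials and joints -/

section Indicator

open Classical in
/-- The integral indicator function of the point `a`. -/
def ind {α : Type} (a b : α) : ℤ := if a = b then 1 else 0

lemma ind_self {α : Type} (a : α) : ind a a = 1 := by simp [ind]

lemma ind_of_ne {α : Type} {a b : α} (h : a ≠ b) : ind a b = 0 := by simp [ind, h]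

lemma ind_nonneg {α : Type} (a b : α) : 0 ≤ ind a b := by unfold ind; split_ifs <;> simp

lemma sum_ind_mul {α : Type} [Fintype α] (a : α) (F : α → ℤ) : ∑ b, ind a b * F b = F a := by
  classical
  rw [Finset.sum_eq_single a (fun b _ hb => by rw [ind_of_ne hb.symm, zero_mul])
    (fun h => absurd (mem_univ a) h), ind_self, one_mul]

lemma sum_mul_ind_injective {α β : Type} [Fintype α] {g : α → β} (hg : Injective g)
    (φ : α → ℤ) (a : α) : ∑ b, φ b * ind (g b) (g a) = φ a := by
  classical
  rw [Finset.sum_eq_single a (fun b _ hb => by rw [ind_of_ne fun h => hb (hg h), mul_zero])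
    (fun h => absurd (mem_univ a) h), ind_self, mul_one]

lemma sum_mul_ind_ne {α β : Type} [Fintype α] {g : α → β} (φ : α → ℤ) {x : β}
    (h : ∀ b, g b ≠ x) : ∑ b, φ b * ind (g b) x = 0 :=
  Finset.sum_eq_zero fun b _ => by rw [ind_of_ne (h b), mul_zero]

end Indicator

namespace StrandGraph

variable (G : StrandGraph)

section Positions

variable {G} {s s' : G.S} {m m' : G.M}

lemma splitIn_injective : Injective G.splitIn := fun a b h => by
  simpa using @G.head_injective (.inl a) (.inl b) h

lemma mergeLeft_injective : Injective G.mergeLeft := fun a b h => by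
  simpa using @G.head_injective (.inr (.inl a)) (.inr (.inl b)) h

lemma mergeRight_injective : Injective G.mergeRight := fun a b h => by
  simpa using @G.head_injective (.inr (.inr a)) (.inr (.inr b)) h

lemma splitLeft_injective : Injective G.splitLeft := fun a b h => by
  simpa using @G.tail_injective (.inl a) (.inl b) h

lemma splitRight_injective : Injective G.splitRight := fun a b h => by
  simpa using @G.tail_injective (.inr (.inl a)) (.inr (.inl b)) h

lemma mergeOut_injective : Injective G.mergeOut := fun a b h => by
  simpa using @G.tail_injective (.inr (.inr a)) (.inr (.inr b)) h

lemma splitIn_ne_mergeLeft : G.splitIn s ≠ G.mergeLeft m := fun h => by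
  simpa using @G.head_injective (.inl s) (.inr (.inl m)) h

lemma splitIn_ne_mergeRight : G.splitIn s ≠ G.mergeRight m := fun h => by
  simpa using @G.head_injective (.inl s) (.inr (.inr m)) h

lemma mergeLeft_ne_mergeRight : G.mergeLeft m ≠ G.mergeRight m' := fun h => by
  simpa using @G.head_injective (.inr (.inl m)) (.inr (.inr m')) h

lemma splitLeft_ne_splitRight : G.splitLeft s ≠ G.splitRight s' := fun h => by
  simpa using @G.tail_injective (.inl s) (.inr (.inl s')) h

lemma splitLeft_ne_mergeOut : G.splitLeft s ≠ G.mergeOut m := fun h => by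
  simpa using @G.tail_injective (.inl s) (.inr (.inr m)) h

lemma splitRight_ne_mergeOut : G.splitRight s ≠ G.mergeOut m := fun h => by
  simpa using @G.tail_injective (.inr (.inl s)) (.inr (.inr m)) h

lemma splitIn_mem_heads : G.splitIn s ∈ G.heads := ⟨.inl s, rfl⟩

lemma mergeLeft_mem_heads : G.mergeLeft m ∈ G.heads := ⟨.inr (.inl m), rfl⟩

lemma mergeRight_mem_heads : G.mergeRight m ∈ G.heads := ⟨.inr (.inr m), rfl⟩

lemma splitLeft_mem_tails : G.splitLeft s ∈ G.tails := ⟨.inl s, rfl⟩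

lemma splitRight_mem_tails : G.splitRight s ∈ G.tails := ⟨.inr (.inl s), rfl⟩

lemma mergeOut_mem_tails : G.mergeOut m ∈ G.tails := ⟨.inr (.inr m), rfl⟩

lemma mem_heads {e : G.E} : e ∈ G.heads ↔
    (∃ s, e = G.splitIn s) ∨ (∃ m, e = G.mergeLeft m) ∨ ∃ m, e = G.mergeRight m := by
  constructor
  · rintro ⟨s | m | m, rfl⟩
    · exact .inl ⟨s, rfl⟩
    · exact .inr (.inl ⟨m, rfl⟩)
    · exact .inr (.inr ⟨m, rfl⟩)
  · rintro (⟨s, rfl⟩ | ⟨m, rfl⟩ | ⟨m, rfl⟩)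
    exacts [splitIn_mem_heads, mergeLeft_mem_heads, mergeRight_mem_heads]

lemma mem_tails {e : G.E} : e ∈ G.tails ↔
    (∃ s, e = G.splitLeft s) ∨ (∃ s, e = G.splitRight s) ∨ ∃ m, e = G.mergeOut m := by
  constructor
  · rintro ⟨s | s | m, rfl⟩
    · exact .inl ⟨s, rfl⟩
    · exact .inr (.inl ⟨s, rfl⟩)
    · exact .inr (.inr ⟨m, rfl⟩)
  · rintro (⟨s, rfl⟩ | ⟨s, rfl⟩ | ⟨m, rfl⟩)
    exacts [splitLeft_mem_tails, splitRight_mem_tails, mergeOut_mem_tails]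

end Positions

/-- The signed incidence of an edge with a region: `1` if the region is to its left, `-1` if it is
to its right (and `0` if it is on both sides). -/
def inc (e : G.E) (r : G.R) : ℤ := ind (G.left e) r - ind (G.right e) r

lemma dualBoundary_eq (c : G.E → ℤ) (r : G.R) : G.dualBoundary c r = ∑ e, c e * G.inc e r := by
  unfold dualBoundary inc ind
  rw [← sum_sub_distrib]
  refine sum_congr rfl fun e _ => ?_
  split_ifs <;> simp

lemma inc_split (s : G.S) (r : G.R) :
    G.inc (G.splitIn s) r = G.inc (G.splitLeft s) r + G.inc (G.splitRight s) r := by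
  obtain ⟨h1, h2, h3⟩ := G.split_corners s
  unfold inc
  rw [h1, h2, h3]; ring

lemma inc_merge (m : G.M) (r : G.R) :
    G.inc (G.mergeOut m) r = G.inc (G.mergeLeft m) r + G.inc (G.mergeRight m) r := by
  obtain ⟨h1, h2, h3⟩ := G.merge_corners m
  unfold inc
  rw [h1, h2, h3]; ring

/-- The value of a potential at the end point of an edge (`0` if there is none). -/
def headPot (φ : G.S → ℤ) (ψ : G.M → ℤ) (e : G.E) : ℤ :=
  ∑ s, φ s * ind (G.splitIn s) e +
    (∑ m, ψ m * ind (G.mergeLeft m) e + ∑ m, ψ m * ind (G.mergeRight m) e)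

/-- The value of a potential at the starting point of an edge (`0` if there is none). -/
def tailPot (φ : G.S → ℤ) (ψ : G.M → ℤ) (e : G.E) : ℤ :=
  (∑ s, φ s * ind (G.splitLeft s) e + ∑ s, φ s * ind (G.splitRight s) e) +
    ∑ m, ψ m * ind (G.mergeOut m) e

lemma coboundary_eq (φ : G.S → ℤ) (ψ : G.M → ℤ) (e : G.E) :
    G.coboundary φ ψ e = G.headPot φ ψ e - G.tailPot φ ψ e := by
  unfold coboundary headPot tailPot ind
  simp only [mul_sub, mul_add, sum_add_distrib, sum_sub_distrib]
  ring

section Evaluation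

variable {G} {φ : G.S → ℤ} {ψ : G.M → ℤ} {e : G.E}

lemma headPot_splitIn (s : G.S) : G.headPot φ ψ (G.splitIn s) = φ s := by
  rw [headPot, sum_mul_ind_injective splitIn_injective,
    sum_mul_ind_ne _ fun m h => splitIn_ne_mergeLeft h.symm,
    sum_mul_ind_ne _ fun m h => splitIn_ne_mergeRight h.symm]
  ring

lemma headPot_mergeLeft (m : G.M) : G.headPot φ ψ (G.mergeLeft m) = ψ m := by
  rw [headPot, sum_mul_ind_injective mergeLeft_injective,
    sum_mul_ind_ne _ fun m h => splitIn_ne_mergeLeft h,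
    sum_mul_ind_ne _ fun m h => mergeLeft_ne_mergeRight h.symm]
  ring

lemma headPot_mergeRight (m : G.M) : G.headPot φ ψ (G.mergeRight m) = ψ m := by
  rw [headPot, sum_mul_ind_injective mergeRight_injective,
    sum_mul_ind_ne _ fun m h => splitIn_ne_mergeRight h,
    sum_mul_ind_ne _ fun m h => mergeLeft_ne_mergeRight h]
  ring

lemma headPot_of_notMem (h : e ∉ G.heads) : G.headPot φ ψ e = 0 := by
  rw [headPot, sum_mul_ind_ne _ (g := G.splitIn) (by rintro s rfl; exact h splitIn_mem_heads),
    sum_mul_ind_ne _ (g := G.mergeLeft) (by rintro s rfl; exact h mergeLeft_mem_heads),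
    sum_mul_ind_ne _ (g := G.mergeRight) (by rintro s rfl; exact h mergeRight_mem_heads)]
  ring

lemma tailPot_splitLeft (s : G.S) : G.tailPot φ ψ (G.splitLeft s) = φ s := by
  rw [tailPot, sum_mul_ind_injective splitLeft_injective,
    sum_mul_ind_ne _ fun m h => splitLeft_ne_splitRight h.symm,
    sum_mul_ind_ne _ fun m h => splitLeft_ne_mergeOut h.symm]
  ring

lemma tailPot_splitRight (s : G.S) : G.tailPot φ ψ (G.splitRight s) = φ s := by
  rw [tailPot, sum_mul_ind_injective splitRight_injective,
    sum_mul_ind_ne _ fun m h => splitLeft_ne_splitRight h,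
    sum_mul_ind_ne _ fun m h => splitRight_ne_mergeOut h.symm]
  ring

lemma tailPot_mergeOut (m : G.M) : G.tailPot φ ψ (G.mergeOut m) = ψ m := by
  rw [tailPot, sum_mul_ind_injective mergeOut_injective,
    sum_mul_ind_ne _ fun m h => splitLeft_ne_mergeOut h,
    sum_mul_ind_ne _ fun m h => splitRight_ne_mergeOut h]
  ring

lemma tailPot_of_notMem (h : e ∉ G.tails) : G.tailPot φ ψ e = 0 := by
  rw [tailPot, sum_mul_ind_ne _ (g := G.splitLeft) (by rintro s rfl; exact h splitLeft_mem_tails),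
    sum_mul_ind_ne _ (g := G.splitRight) (by rintro s rfl; exact h splitRight_mem_tails),
    sum_mul_ind_ne _ (g := G.mergeOut) (by rintro s rfl; exact h mergeOut_mem_tails)]
  ring

end Evaluation

lemma sum_mul_ind_comm {α β : Type} [Fintype α] [Fintype β] (φ : α → ℤ) (g : α → β) (F : β → ℤ) :
    ∑ b, (∑ a, φ a * ind (g a) b) * F b = ∑ a, φ a * F (g a) := by
  simp only [Finset.sum_mul, mul_assoc]
  rw [Finset.sum_comm]
  refine sum_congr rfl fun a _ => ?_
  rw [← mul_sum, sum_ind_mul]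

lemma sum_headPot_mul (φ : G.S → ℤ) (ψ : G.M → ℤ) (F : G.E → ℤ) :
    ∑ e, G.headPot φ ψ e * F e =
      ∑ s, φ s * F (G.splitIn s) + ∑ m, ψ m * (F (G.mergeLeft m) + F (G.mergeRight m)) := by
  simp only [headPot, add_mul, sum_add_distrib, sum_mul_ind_comm, mul_add]

lemma sum_tailPot_mul (φ : G.S → ℤ) (ψ : G.M → ℤ) (F : G.E → ℤ) :
    ∑ e, G.tailPot φ ψ e * F e =
      ∑ s, φ s * (F (G.splitLeft s) + F (G.splitRight s)) + ∑ m, ψ m * F (G.mergeOut m) := by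
  simp only [tailPot, add_mul, sum_add_distrib, sum_mul_ind_comm, mul_add]

/-- The total boundary of a potential difference vanishes: a small loop around a vertex is a closed
curve. -/
lemma sum_headPot_sub_tailPot_mul_inc (φ : G.S → ℤ) (ψ : G.M → ℤ) (r : G.R) :
    ∑ e, (G.headPot φ ψ e - G.tailPot φ ψ e) * G.inc e r = 0 := by
  simp only [sub_mul, sum_sub_distrib, sum_headPot_mul, sum_tailPot_mul, inc_split,
    inc_merge]
  ring

/-- If all closed directed walks have positive weight, there is a potential which makes (a multiple
of) the weight positive on every edge. The potential is given by shortest walks. -/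
lemma exists_potential (c : G.E → ℤ)
    (hc : ∀ e l, G.IsClosedWalk e l → 0 < ((e :: l).map c).sum) :
    ∃ N : ℤ, 0 < N ∧ ∃ φ ψ, ∀ e ∈ G.tails, e ∈ G.heads →
      0 < N * c e + (G.headPot φ ψ e - G.tailPot φ ψ e) := by
  classical
  set N : ℤ := Fintype.card G.E + 1 with hN
  set w : G.E → ℤ := fun e => N * c e - 1 with hw
  have hsum : ∀ l : List G.E, (l.map w).sum = N * (l.map c).sum - l.length := by
    intro l
    induction l with
    | nil => simp
    | cons a l ih => rw [List.map_cons, List.sum_cons, ih, List.map_cons, List.sum_cons, List.length_cons, hw]; push_cast; ring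
  let C : G.E → Set (List G.E) := fun e =>
    {l | (e :: l).Nodup ∧ (e :: l).IsChain fun a b => G.Follows b a}
  have hfin : ∀ e, (C e).Finite := by
    intro e
    have : Set.Finite {l : List G.E | l.Nodup} :=
      Set.finite_coe_iff.1 (inferInstanceAs (Finite {l : List G.E // l.Nodup}))
    exact this.subset fun l hl => (List.nodup_cons.1 hl.1).2
  have hne : ∀ e, (C e).Nonempty := fun e => ⟨[], by simp [C]⟩
  have hmin : ∀ e, ∃ l ∈ C e, ∀ l' ∈ C e, ((e :: l).map w).sum ≤ ((e :: l').map w).sum := fun e =>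
    Set.exists_min_image (C e) (fun l => ((e :: l).map w).sum) (hfin e) (hne e)
  choose p hp hpmin using hmin
  set D : G.E → ℤ := fun e => ((e :: p e).map w).sum with hD
  have step : ∀ e e', G.Follows e e' → D e' ≤ D e + w e' := by
    intro e e' h
    by_cases hmem : e' ∈ e :: p e
    · obtain ⟨l1, l2, hl⟩ := List.append_of_mem hmem
      have hnd : (l1 ++ e' :: l2).Nodup := hl ▸ (hp e).1
      have hch : (l1 ++ e' :: l2).IsChain fun a b => G.Follows b a := hl ▸ (hp e).2
      have h1 : D e' ≤ ((e' :: l2).map w).sum :=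
        hpmin e' l2 ⟨(List.nodup_append.1 hnd).2.1, (List.isChain_append.1 hch).2.1⟩
      have hclosed : G.IsClosedWalk e' l1.reverse := by
        have h2 : (e' :: (l1 ++ [e'])).IsChain fun a b => G.Follows b a := by
          have h3 : (l1 ++ [e']).IsChain fun a b => G.Follows b a := by
            have h4 : (l1 ++ [e']) <+: (l1 ++ e' :: l2) := ⟨l2, by simp⟩
            exact hch.prefix h4
          refine List.IsChain.cons h3 ?_
          intro y hy
          cases l1 with
          | nil =>
            simp at hl hy
            subst hy
            rw [← hl.1]; rw [hl.1] at h ⊢; exact h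
          | cons a l1 =>
            simp at hl hy
            rw [← hy, ← hl.1]; exact h
        have h5 := List.isChain_reverse.2 h2
        unfold IsClosedWalk
        simpa using h5
      have hpos := hc _ _ hclosed
      have hlen : ((e' :: l1.reverse).length : ℤ) ≤ Fintype.card G.E := by
        have h6 : (e' :: l1.reverse).Nodup := by
          rw [List.nodup_append] at hnd
          rw [List.nodup_cons]
          refine ⟨fun h => ?_, by simpa using hnd.1⟩
          exact hnd.2.2 e' (by simpa using h) e' (by simp) rfl
        exact_mod_cast h6.length_le_card
      have h7 := hsum (e' :: l1.reverse)
      have h8 : 0 ≤ ((e' :: l1.reverse).map w).sum := by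
        rw [h7]
        have : N * 1 ≤ N * ((e' :: l1.reverse).map c).sum :=
          mul_le_mul_of_nonneg_left hpos (by omega)
        omega
      have h9 : D e = (l1.map w).sum + ((e' :: l2).map w).sum := by
        simp only [hD, hl, List.map_append, List.sum_append]
      have h10 : ((e' :: l1.reverse).map w).sum = w e' + (l1.map w).sum := by
        simp [List.sum_reverse]
      omega
    · have h1 : e :: p e ∈ C e' :=
        ⟨List.nodup_cons.2 ⟨hmem, (hp e).1⟩, List.IsChain.cons (hp e).2 (by simpa using h)⟩
      have h2 := hpmin e' _ h1
      simp only [hD, List.map_cons, List.sum_cons] at h2 ⊢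
      omega
  refine ⟨N, by omega, fun s => -D (G.splitIn s),
    fun m => -min (D (G.mergeLeft m)) (D (G.mergeRight m)), fun e ht hh => ?_⟩
  have hhead : -D e ≤ G.headPot (fun s => -D (G.splitIn s))
      (fun m => -min (D (G.mergeLeft m)) (D (G.mergeRight m))) e := by
    rcases mem_heads.1 hh with ⟨s, rfl⟩ | ⟨m, rfl⟩ | ⟨m, rfl⟩
    · rw [headPot_splitIn]
    · rw [headPot_mergeLeft]; exact neg_le_neg (min_le_left _ _)
    · rw [headPot_mergeRight]; exact neg_le_neg (min_le_right _ _)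
  have htail : G.tailPot (fun s => -D (G.splitIn s))
      (fun m => -min (D (G.mergeLeft m)) (D (G.mergeRight m))) e ≤ -(D e - w e) := by
    rcases mem_tails.1 ht with ⟨s, rfl⟩ | ⟨s, rfl⟩ | ⟨m, rfl⟩
    · rw [tailPot_splitLeft]
      have := step _ _ (show G.Follows (G.splitIn s) _ from .inl ⟨s, rfl, .inl rfl⟩)
      omega
    · rw [tailPot_splitRight]
      have := step _ _ (show G.Follows (G.splitIn s) _ from .inl ⟨s, rfl, .inr rfl⟩)
      omega
    · rw [tailPot_mergeOut]
      have h1 := step _ _ (show G.Follows (G.mergeLeft m) _ from .inr ⟨m, .inl rfl, rfl⟩)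
      have h2 := step _ _ (show G.Follows (G.mergeRight m) _ from .inr ⟨m, .inr rfl, rfl⟩)
      omega
  simp only [hw] at htail
  omega

end StrandGraph

section Sums

lemma sum_eq_sum_subtype {α M : Type} [AddCommMonoid M] [Fintype α] {P : α → Prop}
    [Fintype {a // P a}] {f : α → M} (h : ∀ a, ¬ P a → f a = 0) :
    ∑ a, f a = ∑ a : {a // P a}, f a := by
  symm
  refine Fintype.sum_of_injective Subtype.val Subtype.val_injective _ _ (fun a ha => h a ?_)
    fun _ => rfl
  intro hP
  exact ha ⟨⟨a, hP⟩, rfl⟩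

lemma sum_eq_add_sum_ne {α M : Type} [AddCommMonoid M] [Fintype α] (a : α)
    [Fintype {b // b ≠ a}] (f : α → M) : ∑ b, f b = f a + ∑ b : {b // b ≠ a}, f b := by
  classical
  rw [← Finset.add_sum_erase _ _ (mem_univ a)]
  congr 1
  refine Finset.sum_subtype _ (fun x => by simp) _

/-- The push-forward of a chain along a map. -/
def pushChain {α β : Type} [Fintype α] (π : α → β) (F : α → ℤ) (b : β) : ℤ :=
  ∑ a, F a * ind (π a) b

lemma sum_pushChain_mul {α β : Type} [Fintype α] [Fintype β] (π : α → β) (F : α → ℤ) (K : β → ℤ) :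
    ∑ b, pushChain π F b * K b = ∑ a, F a * K (π a) :=
  StrandGraph.sum_mul_ind_comm F π K

lemma pushChain_sum_ind {α β γ : Type} [Fintype α] [Fintype γ] (π : α → β) (φ : γ → ℤ)
    (g : γ → α) (b : β) :
    pushChain π (fun a => ∑ x, φ x * ind (g x) a) b = ∑ x, φ x * ind (π (g x)) b := by
  unfold pushChain
  exact StrandGraph.sum_mul_ind_comm φ g fun a => ind (π a) b

lemma pushChain_add {α β : Type} [Fintype α] (π : α → β) (F F' : α → ℤ) (b : β) :
    pushChain π (fun a => F a + F' a) b = pushChain π F b + pushChain π F' b := by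
  simp only [pushChain, add_mul, sum_add_distrib]

lemma pushChain_sub {α β : Type} [Fintype α] (π : α → β) (F F' : α → ℤ) (b : β) :
    pushChain π (fun a => F a - F' a) b = pushChain π F b - pushChain π F' b := by
  simp only [pushChain, sub_mul, sum_sub_distrib]

lemma pushChain_const_mul {α β : Type} [Fintype α] (π : α → β) (n : ℤ) (F : α → ℤ) (b : β) :
    pushChain π (fun a => n * F a) b = n * pushChain π F b := by
  simp only [pushChain, mul_assoc, mul_sum]

lemma pushChain_pos {α β : Type} [Fintype α] (π : α → β) {F : α → ℤ} (h : ∀ a, 0 < F a) (a : α) :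
    0 < pushChain π F (π a) := by
  refine Finset.sum_pos' (fun b _ => mul_nonneg (h b).le (ind_nonneg _ _))
    ⟨a, mem_univ a, ?_⟩
  rw [ind_self, mul_one]; exact h a

end Sums

section Glue

variable {α : Type}

lemma eq_of_eqvGen {β : Type*} {r : α → α → Prop} {F : α → β} (h : ∀ x y, r x y → F x = F y)
    {x y : α} (hxy : EqvGen r x y) : F x = F y :=
  congrArg (Quot.lift F h) (Quot.eqvGen_sound hxy)

/-- The type obtained from `α` by gluing the point `b` to the point `a`; the point `a` is kept as a
representative. -/
abbrev Glue (a b : α) : Type := {x : α // x = b → a = b}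

open Classical in
/-- The projection that glues `b` to `a`. -/
def glueProj (a b : α) (x : α) : Glue a b :=
  ⟨if x = b then a else x, by split_ifs with h <;> simp [h]⟩

variable {a b : α}

lemma glueProj_right : glueProj a b b = glueProj a b a := by
  apply Subtype.ext; simp [glueProj]

lemma glueProj_val_of_ne {x : α} (h : x ≠ b) : (glueProj a b x).1 = x := by
  simp [glueProj, h]

lemma glueProj_val (x : α) : (glueProj a b x).1 = x ∨ x = b ∧ (glueProj a b x).1 = a := by
  by_cases h : x = b
  · exact .inr ⟨h, by simp [glueProj, h]⟩
  · exact .inl (glueProj_val_of_ne h)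

lemma glueProj_coe (x : Glue a b) : glueProj a b x.1 = x := by
  apply Subtype.ext
  by_cases h : x.1 = b
  · simp only [glueProj, if_pos h, x.2 h]; exact h.symm
  · exact glueProj_val_of_ne h

lemma glueProj_eq_iff {x y : α} : glueProj a b x = glueProj a b y ↔
    x = y ∨ (x = a ∧ y = b) ∨ (x = b ∧ y = a) := by
  constructor
  · intro h
    have h' := congrArg Subtype.val h
    simp only [glueProj] at h'
    split_ifs at h' with h1 h2 h2
    · exact .inl (h1.trans h2.symm)
    · exact .inr (.inr ⟨h1, h'.symm⟩)
    · exact .inr (.inl ⟨h', h2⟩)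
    · exact .inl h'
  · rintro (rfl | ⟨rfl, rfl⟩ | ⟨rfl, rfl⟩)
    · rfl
    · rw [glueProj_right]
    · rw [glueProj_right]

lemma glueProj_eq_iff_eqvGen {x y : α} : glueProj a b x = glueProj a b y ↔
    EqvGen (fun x y => x = a ∧ y = b) x y := by
  constructor
  · intro h
    rcases glueProj_eq_iff.1 h with rfl | h | h
    · exact .refl _
    · exact .rel _ _ h
    · exact .symm _ _ (.rel _ _ h.symm)
  · exact eq_of_eqvGen fun x y h => by rw [h.1, h.2, glueProj_right]

/-- Composing with the gluing of two points enlarges the kernel of a map accordingly. -/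
lemma glueProj_comp_eq_iff_eqvGen {β : Type} {P : β → α}
    {r : β → β → Prop} (hr : ∀ x y, P x = P y ↔ EqvGen r x y) (u v x y : β) :
    glueProj (P u) (P v) (P x) = glueProj (P u) (P v) (P y) ↔
      EqvGen (fun x y => r x y ∨ x = u ∧ y = v) x y := by
  constructor
  · intro h
    have key : ∀ x y, P x = P y → EqvGen (fun x y => r x y ∨ x = u ∧ y = v) x y :=
      fun x y h => EqvGen.mono (fun _ _ h => .inl h) _ _ ((hr x y).1 h)
    have huv : EqvGen (fun x y => r x y ∨ x = u ∧ y = v) u v := .rel _ _ (.inr ⟨rfl, rfl⟩)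
    rcases glueProj_eq_iff.1 h with h | ⟨h1, h2⟩ | ⟨h1, h2⟩
    · exact key _ _ h
    · exact .trans _ _ _ (key _ _ h1) (.trans _ _ _ huv (.symm _ _ (key _ _ h2)))
    · exact .trans _ _ _ (key _ _ h1) (.trans _ _ _ (.symm _ _ huv) (.symm _ _ (key _ _ h2)))
  · refine eq_of_eqvGen (F := fun x => glueProj (P u) (P v) (P x)) fun x y h => ?_
    rcases h with h | ⟨rfl, rfl⟩
    · rw [(hr x y).2 (.rel _ _ h)]
    · rw [glueProj_right]

lemma eqvGen_map {α β : Type} {r : α → α → Prop} {r' : β → β → Prop} (g : α → β)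
    (h : ∀ x y, r x y → EqvGen r' (g x) (g y)) {x y : α} (hxy : EqvGen r x y) :
    EqvGen r' (g x) (g y) := by
  induction hxy with
  | rel x y hxy => exact h x y hxy
  | refl => exact .refl _
  | symm _ _ _ h => exact .symm _ _ h
  | trans _ _ _ _ _ h1 h2 => exact .trans _ _ _ h1 h2

lemma eqvGen_subtype_iff {P : α → Prop} {r : α → α → Prop} (hr : ∀ x y, r x y → P x ∧ P y)
    (x y : {x // P x}) : EqvGen (fun x y : {x // P x} => r x.1 y.1) x y ↔
      EqvGen r x.1 y.1 := by
  refine ⟨eqvGen_map _ fun _ _ => .rel _ _, fun h => ?_⟩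
  have key : ∀ a b, EqvGen r a b → (∃ (ha : P a) (hb : P b),
      EqvGen (fun x y : {x // P x} => r x.1 y.1) ⟨a, ha⟩ ⟨b, hb⟩) ∨ a = b := by
    intro a b h
    induction h with
    | rel x y h => exact .inl ⟨(hr x y h).1, (hr x y h).2, .rel _ _ h⟩
    | refl => exact .inr rfl
    | symm _ _ _ h =>
      rcases h with ⟨ha, hb, h⟩ | rfl
      exacts [.inl ⟨hb, ha, .symm _ _ h⟩, .inr rfl]
    | trans _ _ _ _ _ h1 h2 =>
      rcases h1 with ⟨ha, hb, h1⟩ | rfl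
      · rcases h2 with ⟨hb', hc, h2⟩ | rfl
        exacts [.inl ⟨ha, hc, .trans _ _ _ h1 h2⟩, .inl ⟨ha, hb, h1⟩]
      · exact h2
  rcases key _ _ h with ⟨_, _, h⟩ | h
  · exact h
  · rw [Subtype.ext h]; exact .refl _

end Glue

namespace StrandGraph

/-- The left (`false`) or right (`true`) edge leaving a split. -/
abbrev splitOut (G : StrandGraph) (s : G.S) (b : Bool) : G.E := bif b then G.splitRight s else G.splitLeft s

/-- The left (`false`) or right (`true`) edge entering a merge. -/
abbrev mergeIn (G : StrandGraph) (m : G.M) (b : Bool) : G.E :=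
  bif b then G.mergeRight m else G.mergeLeft m

variable {G : StrandGraph} {s s' : G.S} {m m' : G.M} {b b' : Bool}

lemma splitOut_inj : G.splitOut s b = G.splitOut s' b' ↔ s = s' ∧ b = b' := by
  refine ⟨fun h => ?_, fun h => by rw [h.1, h.2]⟩
  cases b <;> cases b'
  · exact ⟨splitLeft_injective h, rfl⟩
  · exact (splitLeft_ne_splitRight h).elim
  · exact (splitLeft_ne_splitRight h.symm).elim
  · exact ⟨splitRight_injective h, rfl⟩

lemma mergeIn_inj : G.mergeIn m b = G.mergeIn m' b' ↔ m = m' ∧ b = b' := by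
  refine ⟨fun h => ?_, fun h => by rw [h.1, h.2]⟩
  cases b <;> cases b'
  · exact ⟨mergeLeft_injective h, rfl⟩
  · exact (mergeLeft_ne_mergeRight h).elim
  · exact (mergeLeft_ne_mergeRight h.symm).elim
  · exact ⟨mergeRight_injective h, rfl⟩

lemma splitOut_ne_mergeOut : G.splitOut s b ≠ G.mergeOut m := by
  cases b
  exacts [splitLeft_ne_mergeOut, splitRight_ne_mergeOut]

lemma splitIn_ne_mergeIn : G.splitIn s ≠ G.mergeIn m b := by
  cases b
  exacts [splitIn_ne_mergeLeft, splitIn_ne_mergeRight]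

lemma splitOut_mem_tails : G.splitOut s b ∈ G.tails := by
  cases b
  exacts [splitLeft_mem_tails, splitRight_mem_tails]

lemma mergeIn_mem_heads : G.mergeIn m b ∈ G.heads := by
  cases b
  exacts [mergeLeft_mem_heads, mergeRight_mem_heads]

lemma mem_heads' {e : G.E} : e ∈ G.heads ↔ (∃ s, e = G.splitIn s) ∨ ∃ m b, e = G.mergeIn m b := by
  constructor
  · intro h
    rcases mem_heads.1 h with ⟨s, h⟩ | ⟨m, h⟩ | ⟨m, h⟩
    exacts [.inl ⟨s, h⟩, .inr ⟨m, false, h⟩, .inr ⟨m, true, h⟩]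
  · rintro (⟨s, rfl⟩ | ⟨m, b, rfl⟩)
    exacts [splitIn_mem_heads, mergeIn_mem_heads]

lemma mem_tails' {e : G.E} :
    e ∈ G.tails ↔ (∃ s b, e = G.splitOut s b) ∨ ∃ m, e = G.mergeOut m := by
  constructor
  · intro h
    rcases mem_tails.1 h with ⟨s, h⟩ | ⟨s, h⟩ | ⟨m, h⟩
    exacts [.inl ⟨s, false, h⟩, .inl ⟨s, true, h⟩, .inr ⟨m, h⟩]
  · rintro (⟨s, b, rfl⟩ | ⟨m, rfl⟩)
    exacts [splitOut_mem_tails, mergeOut_mem_tails]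

end StrandGraph

/-- A strand graph which may have additional bivalent vertices, called joints, and in which every
edge that begins at a vertex ends at a vertex. Two of its regions are marked. -/
structure JointedGraph extends StrandGraph where
  /-- joints -/
  J : Type
  [finJ : Fintype J]
  /-- the edge entering a joint -/
  jointIn : J → E
  /-- the edge leaving a joint -/
  jointOut : J → E
  inner : R
  outer : R
  jointIn_injective : Injective jointIn
  jointOut_injective : Injective jointOut
  jointIn_notMem : ∀ j, jointIn j ∉ toStrandGraph.heads
  jointOut_notMem : ∀ j, jointOut j ∉ toStrandGraph.tails
  joint_corners : ∀ j, left (jointIn j) = left (jointOut j) ∧ right (jointIn j) = right (jointOut j)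
  closed : ∀ e, (e ∈ toStrandGraph.tails ∨ ∃ j, jointOut j = e) ↔
    (e ∈ toStrandGraph.heads ∨ ∃ j, jointIn j = e)

open StrandGraph

namespace JointedGraph

attribute [instance] JointedGraph.finJ

variable (G : JointedGraph)

/-- The value of a potential at the end point of an edge, joints included. -/
def hpot (φ : G.S → ℤ) (ψ : G.M → ℤ) (χ : G.J → ℤ) (e : G.E) : ℤ :=
  G.headPot φ ψ e + ∑ j, χ j * ind (G.jointIn j) e

/-- The value of a potential at the starting point of an edge, joints included. -/
def tpot (φ : G.S → ℤ) (ψ : G.M → ℤ) (χ : G.J → ℤ) (e : G.E) : ℤ :=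
  G.tailPot φ ψ e + ∑ j, χ j * ind (G.jointOut j) e

/-- `c` is the chain of a dual curve from the inner to the outer region. -/
def IsCut (c : G.E → ℤ) : Prop :=
  ∀ r, ∑ e, c e * G.inc e r = ind G.outer r - ind G.inner r

/-- The conditions of planarity and positivity of an annular diagram, for graphs with joints. The
positivity of the winding numbers of cycles is expressed by a potential. -/
structure Good : Prop where
  connected : ∀ r r', EqvGen (fun p q => ∃ e, G.left e = p ∧ G.right e = q) r r'
  bounds : ∀ c : G.E → ℤ, (∀ r, ∑ e, c e * G.inc e r = 0) →
    ∃ φ ψ χ, ∀ e, c e = G.hpot φ ψ χ e - G.tpot φ ψ χ e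
  positive : ∃ c, G.IsCut c ∧ ∃ N : ℤ, 0 < N ∧ ∃ φ ψ χ, ∀ e,
    0 < N * c e + (G.hpot φ ψ χ e - G.tpot φ ψ χ e)

section Evaluation

variable {G} {φ : G.S → ℤ} {ψ : G.M → ℤ} {χ : G.J → ℤ} {e : G.E}

lemma hpot_of_mem_heads (h : e ∈ G.heads) : G.hpot φ ψ χ e = G.headPot φ ψ e := by
  rw [hpot, sum_mul_ind_ne _ (by rintro j rfl; exact G.jointIn_notMem j h), add_zero]

lemma tpot_of_mem_tails (h : e ∈ G.tails) : G.tpot φ ψ χ e = G.tailPot φ ψ e := by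
  rw [tpot, sum_mul_ind_ne _ (by rintro j rfl; exact G.jointOut_notMem j h), add_zero]

lemma hpot_splitIn (s : G.S) : G.hpot φ ψ χ (G.splitIn s) = φ s := by
  rw [hpot_of_mem_heads splitIn_mem_heads, headPot_splitIn]

lemma hpot_mergeLeft (m : G.M) : G.hpot φ ψ χ (G.mergeLeft m) = ψ m := by
  rw [hpot_of_mem_heads mergeLeft_mem_heads, headPot_mergeLeft]

lemma hpot_mergeRight (m : G.M) : G.hpot φ ψ χ (G.mergeRight m) = ψ m := by
  rw [hpot_of_mem_heads mergeRight_mem_heads, headPot_mergeRight]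

lemma hpot_jointIn (j : G.J) : G.hpot φ ψ χ (G.jointIn j) = χ j := by
  rw [hpot, headPot_of_notMem (G.jointIn_notMem j),
    sum_mul_ind_injective G.jointIn_injective, zero_add]

lemma tpot_splitLeft (s : G.S) : G.tpot φ ψ χ (G.splitLeft s) = φ s := by
  rw [tpot_of_mem_tails splitLeft_mem_tails, tailPot_splitLeft]

lemma tpot_splitRight (s : G.S) : G.tpot φ ψ χ (G.splitRight s) = φ s := by
  rw [tpot_of_mem_tails splitRight_mem_tails, tailPot_splitRight]

lemma tpot_mergeOut (m : G.M) : G.tpot φ ψ χ (G.mergeOut m) = ψ m := by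
  rw [tpot_of_mem_tails mergeOut_mem_tails, tailPot_mergeOut]

lemma tpot_jointOut (j : G.J) : G.tpot φ ψ χ (G.jointOut j) = χ j := by
  rw [tpot, tailPot_of_notMem (G.jointOut_notMem j),
    sum_mul_ind_injective G.jointOut_injective, zero_add]

lemma tpot_of_free (h : e ∉ G.tails) (h' : ∀ j, G.jointOut j ≠ e) : G.tpot φ ψ χ e = 0 := by
  rw [tpot, tailPot_of_notMem h, sum_mul_ind_ne _ h', zero_add]

lemma hpot_of_free (h : e ∉ G.tails) (h' : ∀ j, G.jointOut j ≠ e) : G.hpot φ ψ χ e = 0 := by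
  have h2 : ¬ (e ∈ G.heads ∨ ∃ j, G.jointIn j = e) := by
    rw [← G.closed]; rintro (h1 | ⟨j, h1⟩)
    exacts [h h1, h' j h1]
  push Not at h2
  rw [hpot, headPot_of_notMem h2.1, sum_mul_ind_ne _ h2.2, zero_add]

end Evaluation

lemma sum_pot_mul_inc (φ : G.S → ℤ) (ψ : G.M → ℤ) (χ : G.J → ℤ) (r : G.R) :
    ∑ e, (G.hpot φ ψ χ e - G.tpot φ ψ χ e) * G.inc e r = 0 := by
  have h1 := G.sum_headPot_sub_tailPot_mul_inc φ ψ r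
  have h2 : ∀ j, G.inc (G.jointIn j) r = G.inc (G.jointOut j) r := fun j => by
    unfold inc; rw [(G.joint_corners j).1, (G.joint_corners j).2]
  have h3 : ∑ e, ((∑ j, χ j * ind (G.jointIn j) e) - ∑ j, χ j * ind (G.jointOut j) e) *
      G.inc e r = 0 := by
    simp only [sub_mul, sum_sub_distrib, sum_mul_ind_comm, h2]
    ring
  have h4 : ∑ e, (G.hpot φ ψ χ e - G.tpot φ ψ χ e) * G.inc e r =
      ∑ e, (G.headPot φ ψ e - G.tailPot φ ψ e) * G.inc e r +
      ∑ e, ((∑ j, χ j * ind (G.jointIn j) e) - ∑ j, χ j * ind (G.jointOut j) e) *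
        G.inc e r := by
    rw [← sum_add_distrib]
    refine sum_congr rfl fun e _ => ?_
    unfold hpot tpot
    ring
  rw [h4, h1, h3, add_zero]

variable {G}

lemma IsCut.add_pot {c : G.E → ℤ} (hc : G.IsCut c) (φ : G.S → ℤ) (ψ : G.M → ℤ) (χ : G.J → ℤ) :
    G.IsCut fun e => c e + (G.hpot φ ψ χ e - G.tpot φ ψ χ e) := by
  intro r
  simp only [add_mul, sum_add_distrib]
  rw [hc r, G.sum_pot_mul_inc, add_zero]

/-- Any two cuts of a planar graph differ by a potential. -/
lemma Good.exists_pot (hG : G.Good) {c c' : G.E → ℤ} (hc : G.IsCut c) (hc' : G.IsCut c') :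
    ∃ φ ψ χ, ∀ e, c' e = c e + (G.hpot φ ψ χ e - G.tpot φ ψ χ e) := by
  obtain ⟨φ, ψ, χ, h⟩ := hG.bounds (fun e => c' e - c e) fun r => by
    simp only [sub_mul, sum_sub_distrib]
    rw [hc r, hc' r, sub_self]
  exact ⟨φ, ψ, χ, fun e => by have := h e; omega⟩

lemma hpot_add (φ φ' : G.S → ℤ) (ψ ψ' : G.M → ℤ) (χ χ' : G.J → ℤ) (e : G.E) :
    G.hpot (fun s => φ s + φ' s) (fun m => ψ m + ψ' m) (fun j => χ j + χ' j) e =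
      G.hpot φ ψ χ e + G.hpot φ' ψ' χ' e := by
  simp only [hpot, headPot, add_mul, sum_add_distrib]; ring

lemma tpot_add (φ φ' : G.S → ℤ) (ψ ψ' : G.M → ℤ) (χ χ' : G.J → ℤ) (e : G.E) :
    G.tpot (fun s => φ s + φ' s) (fun m => ψ m + ψ' m) (fun j => χ j + χ' j) e =
      G.tpot φ ψ χ e + G.tpot φ' ψ' χ' e := by
  simp only [tpot, tailPot, add_mul, sum_add_distrib]; ring

lemma hpot_mul (n : ℤ) (φ : G.S → ℤ) (ψ : G.M → ℤ) (χ : G.J → ℤ) (e : G.E) :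
    G.hpot (fun s => n * φ s) (fun m => n * ψ m) (fun j => n * χ j) e = n * G.hpot φ ψ χ e := by
  simp only [hpot, headPot, mul_assoc, ← mul_sum]; ring

lemma tpot_mul (n : ℤ) (φ : G.S → ℤ) (ψ : G.M → ℤ) (χ : G.J → ℤ) (e : G.E) :
    G.tpot (fun s => n * φ s) (fun m => n * ψ m) (fun j => n * χ j) e = n * G.tpot φ ψ χ e := by
  simp only [tpot, tailPot, mul_assoc, ← mul_sum]; ring

/-- Positivity does not depend on the choice of the cut. -/
lemma Good.positive_of_isCut (hG : G.Good) {c : G.E → ℤ} (hc : G.IsCut c) :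
    ∃ N : ℤ, 0 < N ∧ ∃ φ ψ χ, ∀ e, 0 < N * c e + (G.hpot φ ψ χ e - G.tpot φ ψ χ e) := by
  obtain ⟨c', hc', N, hN, φ, ψ, χ, h⟩ := hG.positive
  obtain ⟨φ', ψ', χ', h'⟩ := hG.exists_pot hc hc'
  refine ⟨N, hN, fun s => φ s + N * φ' s, fun s => ψ s + N * ψ' s, fun s => χ s + N * χ' s,
    fun e => ?_⟩
  have := h e
  rw [h' e] at this
  rw [hpot_add, tpot_add, hpot_mul, tpot_mul]
  linarith

/-! ### Smoothing a joint -/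

section Smooth

variable (G) (j : G.J)

/-- The edges after smoothing of the joint `j`: the edge leaving `j` is discarded, unless it is
also the edge entering `j`, which then becomes a free loop. -/
abbrev SmoothEdge : Type := Glue (G.jointIn j) (G.jointOut j)

/-- The edge of the smoothed graph containing a given edge. -/
abbrev proj (e : G.E) : G.SmoothEdge j := glueProj (G.jointIn j) (G.jointOut j) e

variable {G} {j}

lemma proj_jointOut : G.proj j (G.jointOut j) = G.proj j (G.jointIn j) :=
  glueProj_right

lemma proj_coe (e : G.SmoothEdge j) : G.proj j e.1 = e := glueProj_coe e

lemma left_proj (e : G.E) : G.left (G.proj j e).1 = G.left e := by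
  rcases glueProj_val (a := G.jointIn j) (b := G.jointOut j) e with h | ⟨h1, h2⟩
  · rw [h]
  · rw [h2, h1, (G.joint_corners j).1]

lemma right_proj (e : G.E) : G.right (G.proj j e).1 = G.right e := by
  rcases glueProj_val (a := G.jointIn j) (b := G.jointOut j) e with h | ⟨h1, h2⟩
  · rw [h]
  · rw [h2, h1, (G.joint_corners j).2]

lemma proj_head_inj {e e' : G.E} (h : e ≠ G.jointIn j) (h' : e' ≠ G.jointIn j)
    (he : G.proj j e = G.proj j e') : e = e' := by
  rcases glueProj_eq_iff.1 he with h1 | h1 | h1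
  exacts [h1, absurd h1.1 h, absurd h1.2 h']

lemma proj_tail_inj {e e' : G.E} (h : e ≠ G.jointOut j) (h' : e' ≠ G.jointOut j)
    (he : G.proj j e = G.proj j e') : e = e' := by
  rcases glueProj_eq_iff.1 he with h1 | h1 | h1
  exacts [h1, absurd h1.2 h', absurd h1.1 h]

lemma head_ne_jointIn (j : G.J) {e : G.E} (h : e ∈ G.heads) : e ≠ G.jointIn j := by
  rintro rfl; exact G.jointIn_notMem j h

lemma tail_ne_jointOut (j : G.J) {e : G.E} (h : e ∈ G.tails) : e ≠ G.jointOut j := by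
  rintro rfl; exact G.jointOut_notMem j h

variable (G) (j)

/-- The strand graph obtained by smoothing the joint `j`. -/
abbrev smoothGraph : StrandGraph where
  S := G.S
  M := G.M
  E := G.SmoothEdge j
  R := G.R
  finE := Fintype.ofFinite _
  splitIn s := G.proj j (G.splitIn s)
  splitLeft s := G.proj j (G.splitLeft s)
  splitRight s := G.proj j (G.splitRight s)
  mergeLeft m := G.proj j (G.mergeLeft m)
  mergeRight m := G.proj j (G.mergeRight m)
  mergeOut m := G.proj j (G.mergeOut m)
  left e := G.left e.1
  right e := G.right e.1
  tail_injective := by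
    have h : Sum.elim (fun s => G.proj j (G.splitLeft s))
        (Sum.elim (fun s => G.proj j (G.splitRight s))
          fun m => G.proj j (G.mergeOut m)) =
        G.proj j ∘ Sum.elim G.splitLeft (Sum.elim G.splitRight G.mergeOut) := by
      funext x; rcases x with x | x | x <;> rfl
    rw [h]
    intro x y hxy
    exact G.tail_injective (proj_tail_inj (tail_ne_jointOut j ⟨x, rfl⟩)
      (tail_ne_jointOut j ⟨y, rfl⟩) hxy)
  head_injective := by
    have h : Sum.elim (fun s => G.proj j (G.splitIn s))
        (Sum.elim (fun m => G.proj j (G.mergeLeft m))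
          fun m => G.proj j (G.mergeRight m)) =
        G.proj j ∘ Sum.elim G.splitIn (Sum.elim G.mergeLeft G.mergeRight) := by
      funext x; rcases x with x | x | x <;> rfl
    rw [h]
    intro x y hxy
    exact G.head_injective (proj_head_inj (head_ne_jointIn j ⟨x, rfl⟩)
      (head_ne_jointIn j ⟨y, rfl⟩) hxy)
  split_corners s := by simpa only [left_proj, right_proj] using G.split_corners s
  merge_corners m := by simpa only [left_proj, right_proj] using G.merge_corners m

variable {G} {j}

lemma mem_heads_smooth {e : G.SmoothEdge j} :
    e ∈ (G.smoothGraph j).heads ↔ ∃ a ∈ G.heads, G.proj j a = e := by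
  constructor
  · rintro ⟨s | m | m, rfl⟩
    exacts [⟨_, splitIn_mem_heads, rfl⟩, ⟨_, mergeLeft_mem_heads, rfl⟩,
      ⟨_, mergeRight_mem_heads, rfl⟩]
  · rintro ⟨a, ⟨s | m | m, rfl⟩, rfl⟩
    exacts [⟨.inl s, rfl⟩, ⟨.inr (.inl m), rfl⟩, ⟨.inr (.inr m), rfl⟩]

lemma mem_tails_smooth {e : G.SmoothEdge j} :
    e ∈ (G.smoothGraph j).tails ↔ ∃ a ∈ G.tails, G.proj j a = e := by
  constructor
  · rintro ⟨s | m | m, rfl⟩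
    exacts [⟨_, splitLeft_mem_tails, rfl⟩, ⟨_, splitRight_mem_tails, rfl⟩,
      ⟨_, mergeOut_mem_tails, rfl⟩]
  · rintro ⟨a, ⟨s | m | m, rfl⟩, rfl⟩
    exacts [⟨.inl s, rfl⟩, ⟨.inr (.inl m), rfl⟩, ⟨.inr (.inr m), rfl⟩]

variable (G) (j)

/-- The graph obtained by smoothing the joint `j`. -/
abbrev smooth : JointedGraph where
  toStrandGraph := G.smoothGraph j
  J := {k : G.J // k ≠ j}
  finJ := Fintype.ofFinite _
  jointIn k := G.proj j (G.jointIn k)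
  jointOut k := G.proj j (G.jointOut k)
  inner := G.inner
  outer := G.outer
  jointIn_injective := fun x y hxy => Subtype.ext (G.jointIn_injective
    (proj_head_inj (fun h => x.2 (G.jointIn_injective h))
      (fun h => y.2 (G.jointIn_injective h)) hxy))
  jointOut_injective := fun x y hxy => Subtype.ext (G.jointOut_injective
    (proj_tail_inj (fun h => x.2 (G.jointOut_injective h))
      (fun h => y.2 (G.jointOut_injective h)) hxy))
  jointIn_notMem := by
    intro k hk
    obtain ⟨a, ha, hak⟩ := mem_heads_smooth.1 hk
    have := proj_head_inj (head_ne_jointIn j ha)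
      (fun h => k.2 (G.jointIn_injective h)) hak
    exact G.jointIn_notMem k (this ▸ ha)
  jointOut_notMem := by
    intro k hk
    obtain ⟨a, ha, hak⟩ := mem_tails_smooth.1 hk
    have := proj_tail_inj (tail_ne_jointOut j ha)
      (fun h => k.2 (G.jointOut_injective h)) hak
    exact G.jointOut_notMem k (this ▸ ha)
  joint_corners := by
    intro k
    show G.left _ = G.left _ ∧ G.right _ = G.right _
    rw [left_proj, left_proj, right_proj, right_proj]
    exact G.joint_corners k
  closed := by
    intro e
    rw [mem_tails_smooth, mem_heads_smooth]
    have key1 : ((∃ a ∈ G.tails, G.proj j a = e) ∨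
        ∃ k : {k : G.J // k ≠ j}, G.proj j (G.jointOut k) = e) ↔
        ∃ a, (a ∈ G.tails ∨ ∃ k, G.jointOut k = a) ∧ a ≠ G.jointOut j ∧
          G.proj j a = e := by
      constructor
      · rintro (⟨a, h1, h2⟩ | ⟨k, h2⟩)
        · exact ⟨a, .inl h1, tail_ne_jointOut j h1, h2⟩
        · exact ⟨_, .inr ⟨k, rfl⟩, fun h => k.2 (G.jointOut_injective h), h2⟩
      · rintro ⟨a, h1 | ⟨k, rfl⟩, h2, h3⟩
        · exact .inl ⟨a, h1, h3⟩
        · exact .inr ⟨⟨k, fun h => h2 (h ▸ rfl)⟩, h3⟩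
    have key2 : ((∃ a ∈ G.heads, G.proj j a = e) ∨
        ∃ k : {k : G.J // k ≠ j}, G.proj j (G.jointIn k) = e) ↔
        ∃ a, (a ∈ G.heads ∨ ∃ k, G.jointIn k = a) ∧ a ≠ G.jointIn j ∧
          G.proj j a = e := by
      constructor
      · rintro (⟨a, h1, h2⟩ | ⟨k, h2⟩)
        · exact ⟨a, .inl h1, head_ne_jointIn j h1, h2⟩
        · exact ⟨_, .inr ⟨k, rfl⟩, fun h => k.2 (G.jointIn_injective h), h2⟩
      · rintro ⟨a, h1 | ⟨k, rfl⟩, h2, h3⟩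
        · exact .inl ⟨a, h1, h3⟩
        · exact .inr ⟨⟨k, fun h => h2 (h ▸ rfl)⟩, h3⟩
    rw [key1, key2]
    constructor
    · rintro ⟨a, h1, h2, h3⟩
      by_cases ha : a = G.jointIn j
      · subst ha
        exact ⟨G.jointOut j, (G.closed _).1 (.inr ⟨j, rfl⟩), fun h => h2 h.symm,
          proj_jointOut.trans h3⟩
      · exact ⟨a, (G.closed _).1 h1, ha, h3⟩
    · rintro ⟨a, h1, h2, h3⟩
      by_cases ha : a = G.jointOut j
      · subst ha
        exact ⟨G.jointIn j, (G.closed _).2 (.inr ⟨j, rfl⟩), fun h => h2 h.symm,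
          proj_jointOut.symm.trans h3⟩
      · exact ⟨a, (G.closed _).2 h1, ha, h3⟩

variable {G}

lemma inc_proj (e : G.E) (r : G.R) : (G.smooth j).inc (G.proj j e) r = G.inc e r := by
  show ind (G.left (G.proj j e).1) r - ind (G.right (G.proj j e).1) r = _
  rw [left_proj, right_proj]; rfl

lemma pushChain_hpot (φ : G.S → ℤ) (ψ : G.M → ℤ) (χ : G.J → ℤ) (e : G.SmoothEdge j) :
    pushChain (G.proj j) (G.hpot φ ψ χ) e =
      (G.smooth j).hpot φ ψ (fun k => χ k.1) e +
        χ j * ind (G.proj j (G.jointIn j)) e := by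
  have h : (G.smooth j).hpot φ ψ (fun k => χ k.1) e = (∑ s, φ s * ind (G.proj j (G.splitIn s)) e +
      (∑ m, ψ m * ind (G.proj j (G.mergeLeft m)) e +
        ∑ m, ψ m * ind (G.proj j (G.mergeRight m)) e)) +
      @Finset.sum _ _ _ (@Finset.univ _ (G.smooth j).finJ)
        fun k : {k : G.J // k ≠ j} => χ k.1 * ind (G.proj j (G.jointIn k.1)) e := rfl
  rw [h]
  unfold hpot headPot
  rw [pushChain_add, pushChain_add, pushChain_add, pushChain_sum_ind, pushChain_sum_ind,
    pushChain_sum_ind, pushChain_sum_ind, @sum_eq_add_sum_ne _ _ _ _ j (G.smooth j).finJ]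
  ring

lemma pushChain_tpot (φ : G.S → ℤ) (ψ : G.M → ℤ) (χ : G.J → ℤ) (e : G.SmoothEdge j) :
    pushChain (G.proj j) (G.tpot φ ψ χ) e =
      (G.smooth j).tpot φ ψ (fun k => χ k.1) e +
        χ j * ind (G.proj j (G.jointOut j)) e := by
  have h : (G.smooth j).tpot φ ψ (fun k => χ k.1) e = ((∑ s, φ s * ind (G.proj j (G.splitLeft s)) e +
      ∑ s, φ s * ind (G.proj j (G.splitRight s)) e) +
        ∑ m, ψ m * ind (G.proj j (G.mergeOut m)) e) +
      @Finset.sum _ _ _ (@Finset.univ _ (G.smooth j).finJ)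
        fun k : {k : G.J // k ≠ j} => χ k.1 * ind (G.proj j (G.jointOut k.1)) e := rfl
  rw [h]
  unfold tpot tailPot
  rw [pushChain_add, pushChain_add, pushChain_add, pushChain_sum_ind, pushChain_sum_ind,
    pushChain_sum_ind, pushChain_sum_ind, @sum_eq_add_sum_ne _ _ _ _ j (G.smooth j).finJ]
  ring

lemma pushChain_pot (φ : G.S → ℤ) (ψ : G.M → ℤ) (χ : G.J → ℤ) (e : G.SmoothEdge j) :
    pushChain (G.proj j) (fun e => G.hpot φ ψ χ e - G.tpot φ ψ χ e) e =
      (G.smooth j).hpot φ ψ (fun k => χ k.1) e - (G.smooth j).tpot φ ψ (fun k => χ k.1) e := by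
  rw [pushChain_sub, pushChain_hpot, pushChain_tpot, proj_jointOut]; ring

lemma isCut_pushChain {c : G.E → ℤ} (hc : G.IsCut c) :
    (G.smooth j).IsCut (pushChain (G.proj j) c) := by
  intro r
  have h := @sum_pushChain_mul _ _ _ (G.smooth j).finE (G.proj j) c
    fun e => (G.smooth j).inc e r
  rw [show ∑ e, c e * (G.smooth j).inc (G.proj j e) r = ∑ e, c e * G.inc e r from
    sum_congr rfl fun e _ => by rw [inc_proj]] at h
  exact h.trans (hc r)

open Classical in
/-- The chain on the original edges which is carried by the representatives of the edges of the
smoothed graph. -/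
def liftChain (c : G.SmoothEdge j → ℤ) (e : G.E) : ℤ :=
  if h : e = G.jointOut j → G.jointIn j = G.jointOut j then c ⟨e, h⟩ else 0

lemma sum_liftChain_mul (c : G.SmoothEdge j → ℤ) (F : G.E → ℤ) [Fintype (G.SmoothEdge j)] :
    ∑ e, liftChain j c e * F e = ∑ e, c e * F e.1 := by
  rw [sum_eq_sum_subtype (P := fun e => e = G.jointOut j → G.jointIn j = G.jointOut j)]
  · refine sum_congr rfl fun e _ => ?_
    rw [liftChain, dif_pos e.2]
  · intro e he; rw [liftChain, dif_neg he, zero_mul]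

lemma pushChain_liftChain (c : G.SmoothEdge j → ℤ) (e : G.SmoothEdge j) :
    pushChain (G.proj j) (liftChain j c) e = c e := by
  classical
  unfold pushChain
  rw [@sum_liftChain_mul _ _ _ _ (G.smooth j).finE]
  simp only [proj_coe]
  exact (@sum_mul_ind_injective _ _ (G.smooth j).finE id Function.injective_id c e :)

/-- Smoothing a joint preserves planarity and positivity: chains are lifted to representatives,
and potentials are pushed forward. -/
lemma Good.smooth {G : JointedGraph} (hG : G.Good) (j : G.J) : (G.smooth j).Good where
  connected r r' := by
    refine EqvGen.mono (fun p q h => ?_) _ _ (hG.connected r r')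
    obtain ⟨e, rfl, rfl⟩ := h
    exact ⟨G.proj j e, left_proj e, right_proj e⟩
  bounds c hc := by
    obtain ⟨φ, ψ, χ, h⟩ := hG.bounds (liftChain j c) fun r => by
      rw [@sum_liftChain_mul _ _ _ _ (G.smooth j).finE]; exact hc r
    refine ⟨φ, ψ, fun k => χ k.1, fun e => ?_⟩
    rw [← pushChain_pot, ← funext h, pushChain_liftChain]
  positive := by
    obtain ⟨c, hc, N, hN, φ, ψ, χ, h⟩ := hG.positive
    refine ⟨_, isCut_pushChain j hc, N, hN, φ, ψ, fun k => χ k.1, fun e => ?_⟩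
    rw [← pushChain_pot, ← pushChain_const_mul, ← pushChain_add]
    have := pushChain_pos (G.proj j) h e.1
    rwa [proj_coe] at this

end Smooth

end JointedGraph

open JointedGraph

/-! ### Annular diagrams as graphs with joints -/

lemma ind_subtype {α : Type} {P : α → Prop} (x y : {a // P a}) : ind x.1 y.1 = ind x y := by
  by_cases h : x = y
  · rw [h, ind_self, ind_self]
  · rw [ind_of_ne h, ind_of_ne fun h' => h (Subtype.ext h')]

open Classical in
lemma ind_eq_ite {α : Type} (a b : α) : ind a b = if b = a then 1 else 0 := by
  unfold ind; simp only [eq_comm]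

lemma pushChain_ind {α β : Type} [Fintype α] (π : α → β) (a : α) (b : β) :
    pushChain π (ind a) b = ind (π a) b :=
  sum_ind_mul a fun x => ind (π x) b

/-- A chain vanishes after gluing two points only if it is a multiple of their difference. -/
lemma eq_of_pushChain_glueProj_eq_zero {α : Type} [Fintype α] {a b : α} {F : α → ℤ}
    (h : ∀ r, pushChain (glueProj a b) F r = 0) (r : α) : F r = F a * (ind a r - ind b r) := by
  classical
  by_cases hab : a = b
  · subst hab
    have h1 := h (glueProj a a r)
    unfold pushChain at h1
    rw [Finset.sum_eq_single r] at h1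
    · rw [ind_self, mul_one] at h1; rw [h1]; ring
    · intro x _ hx
      rw [ind_of_ne, mul_zero]
      intro h2
      rcases glueProj_eq_iff.1 h2 with h3 | h3 | h3
      exacts [hx h3, hx (h3.1.trans h3.2.symm), hx (h3.1.trans h3.2.symm)]
    · exact fun h2 => absurd (mem_univ r) h2
  have key : F a + F b = 0 := by
    have h1 := h (glueProj a b a)
    unfold pushChain at h1
    rw [← Finset.sum_subset (Finset.subset_univ {a, b}), Finset.sum_pair hab, glueProj_right,
      ind_self, mul_one, mul_one] at h1
    · exact h1
    · intro x _ hx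
      rw [ind_of_ne, mul_zero]
      intro h2
      rcases glueProj_eq_iff.1 h2 with h3 | h3 | h3 <;> simp [h3] at hx
  by_cases hra : r = a
  · subst hra; rw [ind_self, ind_of_ne (Ne.symm hab)]; ring
  by_cases hrb : r = b
  · subst hrb; rw [ind_self, ind_of_ne hab]; linarith
  rw [ind_of_ne (Ne.symm hra), ind_of_ne (Ne.symm hrb)]
  have h1 := h (glueProj a b r)
  unfold pushChain at h1
  rw [Finset.sum_eq_single r] at h1
  · rw [ind_self, mul_one] at h1; rw [h1]; ring
  · intro x _ hx
    rw [ind_of_ne, mul_zero]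
    intro h2
    rcases glueProj_eq_iff.1 h2 with h3 | h3 | h3
    exacts [hx h3, hrb h3.2, hra h3.2]
  · exact fun h2 => absurd (mem_univ r) h2

namespace AnnularDiagram

variable (A : AnnularDiagram)

/-- An annular diagram as a graph without joints. -/
abbrev jointed : JointedGraph where
  toStrandGraph := A.toStrandGraph
  J := Empty
  jointIn := Empty.elim
  jointOut := Empty.elim
  inner := A.inner
  outer := A.outer
  jointIn_injective := fun x => x.elim
  jointOut_injective := fun x => x.elim
  jointIn_notMem := fun x => x.elim
  jointOut_notMem := fun x => x.elim
  joint_corners := fun x => x.elim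
  closed e := by simp [A.tails_eq_heads]

lemma hpot_jointed (φ : A.S → ℤ) (ψ : A.M → ℤ) (χ) (e : A.E) :
    A.jointed.hpot φ ψ χ e = A.headPot φ ψ e := by
  simp [hpot]

lemma tpot_jointed (φ : A.S → ℤ) (ψ : A.M → ℤ) (χ) (e : A.E) :
    A.jointed.tpot φ ψ χ e = A.tailPot φ ψ e := by
  simp [tpot]

lemma good_jointed : A.jointed.Good where
  connected := A.planar.1
  bounds c hc := by
    obtain ⟨φ, ψ, h⟩ := A.planar.2 c fun r => by rw [dualBoundary_eq]; exact hc r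
    refine ⟨φ, ψ, Empty.elim, fun e => ?_⟩
    rw [hpot_jointed, tpot_jointed, h, coboundary_eq]
  positive := by
    obtain ⟨c, h1, h2, h3⟩ := A.winding
    obtain ⟨N, hN, φ, ψ, h⟩ := A.exists_potential c h2
    refine ⟨c, fun r => ?_, N, hN, φ, ψ, Empty.elim, fun e => ?_⟩
    · rw [← dualBoundary_eq, h1]
      rw [ind_eq_ite, ind_eq_ite]
    · rw [hpot_jointed, tpot_jointed]
      by_cases he : e ∈ A.tails
      · exact h e he (A.tails_eq_heads ▸ he)
      · rw [headPot_of_notMem (A.tails_eq_heads ▸ he),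
          tailPot_of_notMem he]
        have := mul_pos hN (h3 e he)
        omega

lemma exists_coboundary {c : A.E → ℤ} (hc : ∀ r, ∑ e, c e * A.inc e r = 0) :
    ∃ φ ψ, ∀ e, c e = A.headPot φ ψ e - A.tailPot φ ψ e := by
  obtain ⟨φ, ψ, χ, h⟩ := A.good_jointed.bounds c hc
  exact ⟨φ, ψ, fun e => by rw [h, hpot_jointed, tpot_jointed]⟩

/-- A cut can be changed by a potential. -/
lemma exists_cut (φ₀ : (c : A.E → ℤ) → A.S → ℤ) (ψ₀ : (c : A.E → ℤ) → A.M → ℤ) :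
    ∃ c₀ c : A.E → ℤ, A.jointed.IsCut c₀ ∧ A.jointed.IsCut c ∧
      (∀ e, c e = c₀ e + (A.headPot (φ₀ c₀) (ψ₀ c₀) e - A.tailPot (φ₀ c₀) (ψ₀ c₀) e)) ∧
      ∃ N : ℤ, 0 < N ∧ ∃ φ ψ, ∀ e, 0 < N * c e + (A.headPot φ ψ e - A.tailPot φ ψ e) := by
  obtain ⟨c₀, hc₀, -⟩ := A.good_jointed.positive
  have hc := hc₀.add_pot (φ₀ c₀) (ψ₀ c₀) Empty.elim
  obtain ⟨N, hN, φ, ψ, χ, h⟩ := A.good_jointed.positive_of_isCut hc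
  simp only [hpot_jointed, tpot_jointed] at h hc
  exact ⟨c₀, _, hc₀, hc, fun e => rfl, N, hN, φ, ψ, h⟩

end AnnularDiagram

namespace JointedGraph

lemma hpot_eq_tpot_of_follows {G : JointedGraph} {φ : G.S → ℤ} {ψ : G.M → ℤ} {χ : G.J → ℤ}
    {e e' : G.E} (h : G.Follows e e') : G.hpot φ ψ χ e = G.tpot φ ψ χ e' := by
  rcases h with ⟨s, rfl, rfl | rfl⟩ | ⟨m, rfl | rfl, rfl⟩
  · rw [hpot_splitIn, tpot_splitLeft]
  · rw [hpot_splitIn, tpot_splitRight]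
  · rw [hpot_mergeLeft, tpot_mergeOut]
  · rw [hpot_mergeRight, tpot_mergeOut]

/-- A planar graph without joints, with positive winding numbers, is an annular diagram. -/
abbrev toAnnular (G : JointedGraph) [IsEmpty G.J] (hG : G.Good) : AnnularDiagram where
  toStrandGraph := G.toStrandGraph
  inner := G.inner
  outer := G.outer
  tails_eq_heads := by
    ext e; have := G.closed e; simpa using this
  planar := by
    refine ⟨hG.connected, fun c hc => ?_⟩
    obtain ⟨φ, ψ, χ, h⟩ := hG.bounds c fun r => by
      rw [← dualBoundary_eq]; exact hc r
    refine ⟨φ, ψ, funext fun e => ?_⟩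
    rw [h, coboundary_eq]
    simp [hpot, tpot]
  winding := by
    obtain ⟨c, hc, N, hN, φ, ψ, χ, h⟩ := hG.positive
    refine ⟨c, fun r => ?_, fun e l hl => ?_, fun e he => ?_⟩
    · rw [dualBoundary_eq, hc r]
      rw [ind_eq_ite, ind_eq_ite]
    · have key : ∀ (l : List G.E) (a b : G.E), List.IsChain G.Follows (a :: (l ++ [b])) →
          ((a :: l).map fun e => G.hpot φ ψ χ e - G.tpot φ ψ χ e).sum =
            G.tpot φ ψ χ b - G.tpot φ ψ χ a := by
        intro l
        induction l with
        | nil =>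
          intro a b hab
          simp at hab
          simp [hpot_eq_tpot_of_follows hab]
        | cons x l ih =>
          intro a b hab
          simp only [List.cons_append] at hab
          rw [List.isChain_cons_cons] at hab
          rw [List.map_cons, List.sum_cons, ih x b hab.2, hpot_eq_tpot_of_follows hab.1]
          ring
      have h1 := key l e e hl
      have h2 : ∀ l : List G.E, N * (l.map c).sum +
          (l.map fun e => G.hpot φ ψ χ e - G.tpot φ ψ χ e).sum =
          (l.map fun e => N * c e + (G.hpot φ ψ χ e - G.tpot φ ψ χ e)).sum := by
        intro l
        induction l with
        | nil => simp
        | cons a l ih => simp only [List.map_cons, List.sum_cons, ← ih]; ring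
      have h3 := h2 (e :: l)
      rw [h1, sub_self, add_zero] at h3
      have h4 : 0 < ((e :: l).map fun e => N * c e + (G.hpot φ ψ χ e - G.tpot φ ψ χ e)).sum := by
        rw [List.map_cons, List.sum_cons]
        exact add_pos_of_pos_of_nonneg (h e) (List.sum_nonneg (by
          intro x hx
          obtain ⟨y, -, rfl⟩ := List.mem_map.1 hx
          exact (h y).le))
      rw [← h3] at h4
      exact pos_of_mul_pos_right h4 hN.le
    · have h1 := h e
      rw [hpot_of_free he (fun j => isEmptyElim j), tpot_of_free he (fun j => isEmptyElim j)] at h1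
      exact pos_of_mul_pos_right (by simpa using h1) hN.le

end JointedGraph

namespace AnnularDiagram

variable (A : AnnularDiagram) {m : A.M} {s : A.S}

/-! ### Cutting a merge followed by a split -/

section CutI

lemma injective_elim_subtype {X Y Z E : Type} {p : X → Prop} {q : Y → Prop} {r : Z → Prop}
    {w : E → Prop} {a : X → E} {b : Y → E} {c : Z → E} (h : Injective (Sum.elim a (Sum.elim b c)))
    {a' : Subtype p → Subtype w} {b' : Subtype q → Subtype w} {c' : Subtype r → Subtype w}
    (ha : ∀ x, (a' x).1 = a x.1) (hb : ∀ x, (b' x).1 = b x.1) (hc : ∀ x, (c' x).1 = c x.1) :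
    Injective (Sum.elim a' (Sum.elim b' c')) := by
  refine Injective.of_comp (f := Subtype.val) ?_
  convert h.comp (Subtype.val_injective.sumMap
    (Subtype.val_injective.sumMap Subtype.val_injective)) using 1
  funext x; rcases x with x | x | x
  exacts [ha x, hb x, hc x]

lemma splitIn_ne_mergeOut (h : A.mergeOut m = A.splitIn s) {t : A.S} (ht : t ≠ s) :
    A.splitIn t ≠ A.mergeOut m := by
  rw [h]; exact fun h' => ht (splitIn_injective h')

lemma mergeIn_ne_mergeOut (h : A.mergeOut m = A.splitIn s) (n : A.M) (b : Bool) :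
    A.mergeIn n b ≠ A.mergeOut m := by
  rw [h]; cases b
  exacts [splitIn_ne_mergeLeft.symm, splitIn_ne_mergeRight.symm]

/-- The graph obtained by cutting out a merge followed by a split. -/
abbrev cutIGraph (h : A.mergeOut m = A.splitIn s) : StrandGraph where
  S := {t : A.S // t ≠ s}
  M := {n : A.M // n ≠ m}
  E := {e : A.E // e ≠ A.mergeOut m}
  R := Glue (A.right (A.mergeLeft m)) (A.right (A.splitLeft s))
  finS := Fintype.ofFinite _
  finM := Fintype.ofFinite _
  finE := Fintype.ofFinite _
  finR := Fintype.ofFinite _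
  splitIn t := ⟨A.splitIn t, A.splitIn_ne_mergeOut h t.2⟩
  splitLeft t := ⟨A.splitLeft t, splitLeft_ne_mergeOut⟩
  splitRight t := ⟨A.splitRight t, splitRight_ne_mergeOut⟩
  mergeLeft n := ⟨A.mergeLeft n, A.mergeIn_ne_mergeOut h n false⟩
  mergeRight n := ⟨A.mergeRight n, A.mergeIn_ne_mergeOut h n true⟩
  mergeOut n := ⟨A.mergeOut n, fun h' => n.2 (mergeOut_injective h')⟩
  left e := glueProj _ _ (A.left e.1)
  right e := glueProj _ _ (A.right e.1)
  tail_injective := injective_elim_subtype A.tail_injective (fun _ => rfl) (fun _ => rfl) fun _ => rfl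
  head_injective := injective_elim_subtype A.head_injective (fun _ => rfl) (fun _ => rfl) fun _ => rfl
  split_corners t := by
    obtain ⟨h1, h2, h3⟩ := A.split_corners t
    simp only [h1, h2, h3, and_self]
  merge_corners n := by
    obtain ⟨h1, h2, h3⟩ := A.merge_corners n
    simp only [h1, h2, h3, and_self]

lemma mem_tails_cutI (h : A.mergeOut m = A.splitIn s) (e : (A.cutIGraph h).E) :
    (e ∈ (A.cutIGraph h).tails ∨ ∃ b, A.splitOut s b = e.1) ↔ e.1 ∈ A.tails := by
  constructor
  · rintro (⟨x | x | x, rfl⟩ | ⟨b, hb⟩)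
    exacts [splitLeft_mem_tails, splitRight_mem_tails, mergeOut_mem_tails, hb ▸ splitOut_mem_tails]
  · intro he
    rcases mem_tails'.1 he with ⟨t, b, ht⟩ | ⟨n, hn⟩
    · by_cases hts : t = s
      · exact .inr ⟨b, by rw [ht, hts]⟩
      · cases b
        exacts [.inl ⟨.inl ⟨t, hts⟩, Subtype.ext ht.symm⟩,
          .inl ⟨.inr (.inl ⟨t, hts⟩), Subtype.ext ht.symm⟩]
    · exact .inl ⟨.inr (.inr ⟨n, fun hnm => e.2 (by rw [hn, hnm])⟩), Subtype.ext hn.symm⟩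

lemma mem_heads_cutI (h : A.mergeOut m = A.splitIn s) (e : (A.cutIGraph h).E) :
    (e ∈ (A.cutIGraph h).heads ∨ ∃ b, A.mergeIn m b = e.1) ↔ e.1 ∈ A.heads := by
  constructor
  · rintro (⟨x | x | x, rfl⟩ | ⟨b, hb⟩)
    exacts [splitIn_mem_heads, mergeLeft_mem_heads, mergeRight_mem_heads, hb ▸ mergeIn_mem_heads]
  · intro he
    rcases mem_heads'.1 he with ⟨t, ht⟩ | ⟨n, b, hn⟩
    · exact .inl ⟨.inl ⟨t, fun hts => e.2 (by rw [ht, hts, h])⟩, Subtype.ext ht.symm⟩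
    · by_cases hnm : n = m
      · exact .inr ⟨b, by rw [hn, hnm]⟩
      · cases b
        exacts [.inl ⟨.inr (.inl ⟨n, hnm⟩), Subtype.ext hn.symm⟩,
          .inl ⟨.inr (.inr ⟨n, hnm⟩), Subtype.ext hn.symm⟩]

/-- The graph obtained by cutting out a merge followed by a split; the loose ends are connected by
two joints, a left one and a right one. -/
abbrev cutI (h : A.mergeOut m = A.splitIn s) : JointedGraph where
  toStrandGraph := A.cutIGraph h
  J := Bool
  jointIn b := ⟨A.mergeIn m b, A.mergeIn_ne_mergeOut h m b⟩
  jointOut b := ⟨A.splitOut s b, splitOut_ne_mergeOut⟩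
  inner := glueProj _ _ A.inner
  outer := glueProj _ _ A.outer
  jointIn_injective _ _ hxy := (mergeIn_inj.1 (congrArg Subtype.val hxy)).2
  jointOut_injective _ _ hxy := (splitOut_inj.1 (congrArg Subtype.val hxy)).2
  jointIn_notMem := by
    rintro b ⟨x | x | x, hx⟩ <;> have hx := congrArg Subtype.val hx
    exacts [splitIn_ne_mergeIn hx, x.2 (mergeIn_inj (b := false).1 hx).1,
      x.2 (mergeIn_inj (b := true).1 hx).1]
  jointOut_notMem := by
    rintro b ⟨x | x | x, hx⟩ <;> have hx := congrArg Subtype.val hx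
    exacts [x.2 (splitOut_inj (b := false).1 hx).1, x.2 (splitOut_inj (b := true).1 hx).1,
      splitOut_ne_mergeOut hx.symm]
  joint_corners := by
    obtain ⟨h1, h2, h3⟩ := A.split_corners s
    obtain ⟨h4, h5, h6⟩ := A.merge_corners m
    have h7 : A.left (A.mergeLeft m) = A.left (A.splitLeft s) := by rw [← h4, ← h1, h]
    have h8 : A.right (A.mergeRight m) = A.right (A.splitRight s) := by rw [h6, h3, h]
    rintro (_ | _)
    · exact ⟨congrArg (glueProj _ _) h7, glueProj_right.symm⟩
    · refine ⟨?_, congrArg (glueProj _ _) h8⟩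
      show glueProj _ _ (A.left (A.mergeRight m)) = glueProj _ _ (A.left (A.splitRight s))
      rw [← h5, ← h2, glueProj_right]
  closed e := by
    simp only [Subtype.ext_iff]
    rw [mem_tails_cutI, mem_heads_cutI, A.tails_eq_heads]

variable {A} {h : A.mergeOut m = A.splitIn s}

lemma hpot_cutI (φ : A.S → ℤ) (ψ : A.M → ℤ) (χ : Bool → ℤ) (e : (A.cutI h).E) :
    (A.cutI h).hpot (fun t => φ t.1) (fun n => ψ n.1) χ e = A.headPot φ ψ e.1 +
      ((χ false - ψ m) * ind (A.mergeLeft m) e.1 + (χ true - ψ m) * ind (A.mergeRight m) e.1) := by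
  have h1 : ind (A.splitIn s) e.1 = 0 := ind_of_ne (by rw [← h]; exact e.2.symm)
  unfold hpot headPot
  rw [@sum_eq_add_sum_ne _ _ _ _ s (A.cutI h).finS (fun t => φ t * ind (A.splitIn t) e.1),
    @sum_eq_add_sum_ne _ _ _ _ m (A.cutI h).finM (fun n => ψ n * ind (A.mergeLeft n) e.1),
    @sum_eq_add_sum_ne _ _ _ _ m (A.cutI h).finM (fun n => ψ n * ind (A.mergeRight n) e.1), h1,
    Fintype.sum_bool]
  simp only [← ind_subtype, mergeIn, cond_true, cond_false]
  ring

lemma tpot_cutI (φ : A.S → ℤ) (ψ : A.M → ℤ) (χ : Bool → ℤ) (e : (A.cutI h).E) :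
    (A.cutI h).tpot (fun t => φ t.1) (fun n => ψ n.1) χ e = A.tailPot φ ψ e.1 +
      ((χ false - φ s) * ind (A.splitLeft s) e.1 + (χ true - φ s) * ind (A.splitRight s) e.1) := by
  have h1 : ind (A.mergeOut m) e.1 = 0 := ind_of_ne e.2.symm
  unfold tpot tailPot
  rw [@sum_eq_add_sum_ne _ _ _ _ s (A.cutI h).finS (fun t => φ t * ind (A.splitLeft t) e.1),
    @sum_eq_add_sum_ne _ _ _ _ s (A.cutI h).finS (fun t => φ t * ind (A.splitRight t) e.1),
    @sum_eq_add_sum_ne _ _ _ _ m (A.cutI h).finM (fun n => ψ n * ind (A.mergeOut n) e.1), h1,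
    Fintype.sum_bool]
  simp only [← ind_subtype, splitOut, cond_true, cond_false]
  ring

/-- The boundary in the cut graph is obtained from the boundary in the original graph by gluing two
regions. -/
lemma sum_mul_inc_cutI {c : A.E → ℤ} (hc : c (A.mergeOut m) = 0) (r : (A.cutI h).R) :
    (A.cutI h).dualBoundary (fun e => c e.1) r =
      pushChain (glueProj (A.right (A.mergeLeft m)) (A.right (A.splitLeft s)))
        (fun r => ∑ e, c e * A.inc e r) r := by
  have h1 : ∀ e, pushChain (glueProj (A.right (A.mergeLeft m)) (A.right (A.splitLeft s)))
      (A.inc e) r = ind (glueProj _ _ (A.left e)) r - ind (glueProj _ _ (A.right e)) r := fun e => by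
    show pushChain _ (fun r => ind (A.left e) r - ind (A.right e) r) r = _
    rw [pushChain_sub, pushChain_ind, pushChain_ind]
  have h2 : pushChain (glueProj (A.right (A.mergeLeft m)) (A.right (A.splitLeft s)))
      (fun r => ∑ e, c e * A.inc e r) r =
      ∑ e, c e * (ind (glueProj _ _ (A.left e)) r - ind (glueProj _ _ (A.right e)) r) := by
    simp only [← h1]
    unfold pushChain
    simp only [Finset.sum_mul, mul_sum, mul_assoc]
    exact Finset.sum_comm
  rw [dualBoundary_eq, h2, @sum_eq_add_sum_ne _ _ _ _ (A.mergeOut m) (A.cutI h).finE, hc, zero_mul, zero_add]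
  rfl

lemma isCut_cutI {c : A.E → ℤ} (hc : A.jointed.IsCut c) (h0 : c (A.mergeOut m) = 0) :
    (A.cutI h).IsCut fun e => c e.1 := by
  intro r
  rw [← dualBoundary_eq, sum_mul_inc_cutI h0, funext hc, pushChain_sub, pushChain_ind, pushChain_ind]

open Classical in
/-- Extension of a chain by zero. -/
def extendChain {α : Type} {P : α → Prop} (c : {a // P a} → ℤ) (a : α) : ℤ :=
  if h : P a then c ⟨a, h⟩ else 0

lemma extendChain_coe {α : Type} {P : α → Prop} (c : {a // P a} → ℤ) (a : {a // P a}) :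
    extendChain c a.1 = c a := dif_pos a.2

lemma extendChain_of_not {α : Type} {P : α → Prop} (c : {a // P a} → ℤ) {a : α} (h : ¬ P a) :
    extendChain c a = 0 := dif_neg h

lemma good_cutI : (A.cutI h).Good where
  connected r r' := by
    rw [← glueProj_coe r, ← glueProj_coe r']
    refine eqvGen_map (glueProj _ _) (fun p q hpq => ?_) (A.planar.1 r.1 r'.1)
    obtain ⟨e, rfl, rfl⟩ := hpq
    by_cases he : e = A.mergeOut m
    · obtain ⟨h4, h5, h6⟩ := A.merge_corners m
      subst he
      refine .trans _ (glueProj _ _ (A.right (A.mergeLeft m))) _ (.rel _ _ ?_) (.rel _ _ ?_)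
      · exact ⟨⟨A.mergeLeft m, A.mergeIn_ne_mergeOut h m false⟩, congrArg (glueProj _ _) h4.symm, rfl⟩
      · exact ⟨⟨A.mergeRight m, A.mergeIn_ne_mergeOut h m true⟩, congrArg (glueProj _ _) h5.symm,
          congrArg (glueProj _ _) h6⟩
    · exact .rel _ _ ⟨⟨e, he⟩, rfl, rfl⟩
  bounds c hc := by
    set r1 := A.right (A.mergeLeft m) with hr1
    set r2 := A.right (A.splitLeft s) with hr2
    have hx : extendChain c (A.mergeOut m) = 0 := extendChain_of_not c (by simp)
    set k := ∑ e, extendChain c e * A.inc e r1 with hk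
    have h1 : ∀ r, ∑ e, extendChain c e * A.inc e r = k * (ind r1 r - ind r2 r) := by
      refine eq_of_pushChain_glueProj_eq_zero fun r => ?_
      rw [← sum_mul_inc_cutI (h := h) hx, dualBoundary_eq]
      simp only [extendChain_coe]
      exact hc r
    have hl : A.left (A.mergeLeft m) = A.left (A.splitLeft s) := by
      rw [← (A.merge_corners m).1, h, (A.split_corners s).1]
    obtain ⟨φ, ψ, hφ⟩ := A.exists_coboundary
      (c := fun e => extendChain c e + k * (ind (A.mergeLeft m) e - ind (A.splitLeft s) e))
      fun r => by
        simp only [add_mul, sum_add_distrib, h1, mul_assoc, sub_mul, sum_sub_distrib,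
          ← mul_sum, sum_ind_mul]
        unfold inc
        rw [hl]; ring
    have hs : φ s = ψ m := by
      have h2 := hφ (A.mergeOut m)
      have h3 : A.headPot φ ψ (A.mergeOut m) = φ s := by rw [h, headPot_splitIn]
      rw [tailPot_mergeOut, h3, hx,
        ind_of_ne (show A.mergeLeft m ≠ _ from A.mergeIn_ne_mergeOut h m false),
        ind_of_ne splitLeft_ne_mergeOut] at h2
      linarith
    refine ⟨fun t => φ t.1, fun n => ψ n.1, fun b => bif b then ψ m else ψ m - k, fun e => ?_⟩
    have h2 := hφ e.1
    rw [extendChain_coe] at h2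
    rw [hpot_cutI, tpot_cutI, hs]
    simp only [cond_true, cond_false]
    linarith
  positive := by
    obtain ⟨c₀, c, -, hc, hc0, N, hN, φ, ψ, hφ⟩ :=
      A.exists_cut (fun c t => -c (A.mergeOut m) * ind s t) fun _ _ => 0
    have hx : c (A.mergeOut m) = 0 := by
      rw [hc0, tailPot_mergeOut, h, headPot_splitIn, ind_self]; ring
    refine ⟨_, isCut_cutI hc hx, N, hN, fun t => φ t.1, fun n => ψ n.1, fun _ => φ s, fun e => ?_⟩
    rw [hpot_cutI, tpot_cutI]
    have h2 := hφ e.1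
    have h3 := hφ (A.mergeOut m)
    rw [hx, tailPot_mergeOut, h, headPot_splitIn] at h3
    have h4 := mul_nonneg (show 0 ≤ φ s - ψ m by linarith) (ind_nonneg (A.mergeLeft m) e.1)
    have h5 := mul_nonneg (show 0 ≤ φ s - ψ m by linarith) (ind_nonneg (A.mergeRight m) e.1)
    linarith

end CutI

end AnnularDiagram

namespace AnnularDiagram

variable (A : AnnularDiagram) {m : A.M} {s : A.S}

/-! ### Cutting out a bigon -/

section CutII

/-- The left and right edges of the split `s` are the left and right edges of the merge `m`, and
they bound a disc. -/
structure IsBigon (s : A.S) (m : A.M) : Prop where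
  left_eq : A.splitLeft s = A.mergeLeft m
  right_eq : A.splitRight s = A.mergeRight m
  isBetween : A.IsBetween (A.right (A.splitLeft s)) (A.splitLeft s) (A.splitRight s)

variable {A}

lemma IsBigon.left_ne (h : A.IsBigon s m) {e : A.E}
    (he : e ≠ A.splitLeft s ∧ e ≠ A.splitRight s) : A.left e ≠ A.right (A.splitLeft s) :=
  fun h' => he.2 ((h.isBetween.2.2.2 e).1 h')

lemma IsBigon.right_ne (h : A.IsBigon s m) {e : A.E}
    (he : e ≠ A.splitLeft s ∧ e ≠ A.splitRight s) : A.right e ≠ A.right (A.splitLeft s) :=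
  fun h' => he.1 ((h.isBetween.2.2.1 e).1 h')

lemma IsBigon.splitIn_ne (h : A.IsBigon s m) (t : A.S) :
    A.splitIn t ≠ A.splitLeft s ∧ A.splitIn t ≠ A.splitRight s := by
  rw [h.left_eq, h.right_eq]
  exact ⟨splitIn_ne_mergeLeft, splitIn_ne_mergeRight⟩

lemma splitLeft_ne_of_ne {t : A.S} (h : t ≠ s) :
    A.splitLeft t ≠ A.splitLeft s ∧ A.splitLeft t ≠ A.splitRight s :=
  ⟨fun h' => h (splitLeft_injective h'), splitLeft_ne_splitRight⟩

lemma splitRight_ne_of_ne {t : A.S} (h : t ≠ s) :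
    A.splitRight t ≠ A.splitLeft s ∧ A.splitRight t ≠ A.splitRight s :=
  ⟨splitLeft_ne_splitRight.symm, fun h' => h (splitRight_injective h')⟩

lemma mergeOut_ne_splitOut (n : A.M) :
    A.mergeOut n ≠ A.splitLeft s ∧ A.mergeOut n ≠ A.splitRight s :=
  ⟨splitLeft_ne_mergeOut.symm, splitRight_ne_mergeOut.symm⟩

lemma IsBigon.mergeLeft_ne (h : A.IsBigon s m) {n : A.M} (hn : n ≠ m) :
    A.mergeLeft n ≠ A.splitLeft s ∧ A.mergeLeft n ≠ A.splitRight s := by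
  rw [h.left_eq, h.right_eq]
  exact ⟨fun h' => hn (mergeLeft_injective h'), mergeLeft_ne_mergeRight⟩

lemma IsBigon.mergeRight_ne (h : A.IsBigon s m) {n : A.M} (hn : n ≠ m) :
    A.mergeRight n ≠ A.splitLeft s ∧ A.mergeRight n ≠ A.splitRight s := by
  rw [h.left_eq, h.right_eq]
  exact ⟨mergeLeft_ne_mergeRight.symm,
    fun h' => hn (mergeRight_injective h')⟩

lemma IsBigon.left_splitIn (h : A.IsBigon s m) : A.left (A.splitIn s) = A.left (A.mergeOut m) := by
  rw [(A.split_corners s).1, h.left_eq, (A.merge_corners m).1]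

lemma IsBigon.right_splitIn (h : A.IsBigon s m) :
    A.right (A.splitIn s) = A.right (A.mergeOut m) := by
  rw [← (A.split_corners s).2.2, h.right_eq, (A.merge_corners m).2.2]

/-- The graph obtained by cutting out a bigon. -/
abbrev cutIIGraph (h : A.IsBigon s m) : StrandGraph where
  S := {t : A.S // t ≠ s}
  M := {n : A.M // n ≠ m}
  E := {e : A.E // e ≠ A.splitLeft s ∧ e ≠ A.splitRight s}
  R := {r : A.R // r ≠ A.right (A.splitLeft s)}
  finS := Fintype.ofFinite _
  finM := Fintype.ofFinite _
  finE := Fintype.ofFinite _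
  finR := Fintype.ofFinite _
  splitIn t := ⟨A.splitIn t, h.splitIn_ne t⟩
  splitLeft t := ⟨A.splitLeft t, splitLeft_ne_of_ne t.2⟩
  splitRight t := ⟨A.splitRight t, splitRight_ne_of_ne t.2⟩
  mergeLeft n := ⟨A.mergeLeft n, h.mergeLeft_ne n.2⟩
  mergeRight n := ⟨A.mergeRight n, h.mergeRight_ne n.2⟩
  mergeOut n := ⟨A.mergeOut n, mergeOut_ne_splitOut n.1⟩
  left e := ⟨A.left e.1, h.left_ne e.2⟩
  right e := ⟨A.right e.1, h.right_ne e.2⟩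
  tail_injective := injective_elim_subtype A.tail_injective (fun _ => rfl) (fun _ => rfl) fun _ => rfl
  head_injective := injective_elim_subtype A.head_injective (fun _ => rfl) (fun _ => rfl) fun _ => rfl
  split_corners t := by
    obtain ⟨h1, h2, h3⟩ := A.split_corners t
    exact ⟨Subtype.ext h1, Subtype.ext h2, Subtype.ext h3⟩
  merge_corners n := by
    obtain ⟨h1, h2, h3⟩ := A.merge_corners n
    exact ⟨Subtype.ext h1, Subtype.ext h2, Subtype.ext h3⟩

lemma mem_tails_cutII (h : A.IsBigon s m) (e : (cutIIGraph h).E) :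
    (e ∈ (cutIIGraph h).tails ∨ A.mergeOut m = e.1) ↔ e.1 ∈ A.tails := by
  constructor
  · rintro (⟨x | x | x, rfl⟩ | h1)
    exacts [splitLeft_mem_tails, splitRight_mem_tails, mergeOut_mem_tails, h1 ▸ mergeOut_mem_tails]
  · intro he
    rcases mem_tails.1 he with ⟨t, ht⟩ | ⟨t, ht⟩ | ⟨n, hn⟩
    · exact .inl ⟨.inl ⟨t, fun hts => e.2.1 (by rw [ht, hts])⟩, Subtype.ext ht.symm⟩
    · exact .inl ⟨.inr (.inl ⟨t, fun hts => e.2.2 (by rw [ht, hts])⟩), Subtype.ext ht.symm⟩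
    · by_cases hnm : n = m
      · exact .inr (by rw [hn, hnm])
      · exact .inl ⟨.inr (.inr ⟨n, hnm⟩), Subtype.ext hn.symm⟩

lemma mem_heads_cutII (h : A.IsBigon s m) (e : (cutIIGraph h).E) :
    (e ∈ (cutIIGraph h).heads ∨ A.splitIn s = e.1) ↔ e.1 ∈ A.heads := by
  constructor
  · rintro (⟨x | x | x, rfl⟩ | h1)
    exacts [splitIn_mem_heads, mergeLeft_mem_heads, mergeRight_mem_heads, h1 ▸ splitIn_mem_heads]
  · intro he
    rcases mem_heads.1 he with ⟨t, ht⟩ | ⟨n, hn⟩ | ⟨n, hn⟩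
    · by_cases hts : t = s
      · exact .inr (by rw [ht, hts])
      · exact .inl ⟨.inl ⟨t, hts⟩, Subtype.ext ht.symm⟩
    · refine .inl ⟨.inr (.inl ⟨n, fun hnm => e.2.1 ?_⟩), Subtype.ext hn.symm⟩
      rw [hn, hnm, h.left_eq]
    · refine .inl ⟨.inr (.inr ⟨n, fun hnm => e.2.2 ?_⟩), Subtype.ext hn.symm⟩
      rw [hn, hnm, h.right_eq]

/-- The graph obtained by cutting out a bigon; the loose ends are connected by a joint. -/
abbrev cutII (h : A.IsBigon s m) : JointedGraph where
  toStrandGraph := cutIIGraph h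
  J := Unit
  jointIn _ := ⟨A.splitIn s, h.splitIn_ne s⟩
  jointOut _ := ⟨A.mergeOut m, mergeOut_ne_splitOut m⟩
  inner := ⟨A.inner, h.isBetween.1.symm⟩
  outer := ⟨A.outer, h.isBetween.2.1.symm⟩
  jointIn_injective := fun _ _ _ => rfl
  jointOut_injective := fun _ _ _ => rfl
  jointIn_notMem := by
    rintro - ⟨x | x | x, hx⟩ <;> have hx := congrArg Subtype.val hx
    · exact x.2 (splitIn_injective hx)
    · exact splitIn_ne_mergeLeft hx.symm
    · exact splitIn_ne_mergeRight hx.symm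
  jointOut_notMem := by
    rintro - ⟨x | x | x, hx⟩ <;> have hx := congrArg Subtype.val hx
    · exact splitLeft_ne_mergeOut hx
    · exact splitRight_ne_mergeOut hx
    · exact x.2 (mergeOut_injective hx)
  joint_corners _ := ⟨Subtype.ext h.left_splitIn, Subtype.ext h.right_splitIn⟩
  closed e := by
    simp only [Subtype.ext_iff, exists_const]
    rw [mem_tails_cutII, mem_heads_cutII, A.tails_eq_heads]

variable {h : A.IsBigon s m}

lemma hpot_cutII (φ : A.S → ℤ) (ψ : A.M → ℤ) (χ : Unit → ℤ) (e : (cutII h).E) :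
    (cutII h).hpot (fun t => φ t.1) (fun n => ψ n.1) χ e = A.headPot φ ψ e.1 +
      (χ () - φ s) * ind (A.splitIn s) e.1 := by
  have h1 : ind (A.mergeLeft m) e.1 = 0 := ind_of_ne (by rw [← h.left_eq]; exact e.2.1.symm)
  have h2 : ind (A.mergeRight m) e.1 = 0 := ind_of_ne (by rw [← h.right_eq]; exact e.2.2.symm)
  unfold hpot headPot
  rw [@sum_eq_add_sum_ne _ _ _ _ s (cutII h).finS (fun t => φ t * ind (A.splitIn t) e.1),
    @sum_eq_add_sum_ne _ _ _ _ m (cutII h).finM (fun n => ψ n * ind (A.mergeLeft n) e.1),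
    @sum_eq_add_sum_ne _ _ _ _ m (cutII h).finM (fun n => ψ n * ind (A.mergeRight n) e.1), h1, h2,
    Fintype.sum_unique (fun j : Unit => χ j * _)]
  simp only [← ind_subtype]
  ring

lemma tpot_cutII (φ : A.S → ℤ) (ψ : A.M → ℤ) (χ : Unit → ℤ) (e : (cutII h).E) :
    (cutII h).tpot (fun t => φ t.1) (fun n => ψ n.1) χ e = A.tailPot φ ψ e.1 +
      (χ () - ψ m) * ind (A.mergeOut m) e.1 := by
  have h1 : ind (A.splitLeft s) e.1 = 0 := ind_of_ne e.2.1.symm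
  have h2 : ind (A.splitRight s) e.1 = 0 := ind_of_ne e.2.2.symm
  unfold tpot tailPot
  rw [@sum_eq_add_sum_ne _ _ _ _ s (cutII h).finS (fun t => φ t * ind (A.splitLeft t) e.1),
    @sum_eq_add_sum_ne _ _ _ _ s (cutII h).finS (fun t => φ t * ind (A.splitRight t) e.1),
    @sum_eq_add_sum_ne _ _ _ _ m (cutII h).finM (fun n => ψ n * ind (A.mergeOut n) e.1), h1, h2,
    Fintype.sum_unique (fun j : Unit => χ j * _)]
  simp only [← ind_subtype]
  ring

lemma dualBoundary_cutII {c : A.E → ℤ} (hl : c (A.splitLeft s) = 0) (hr : c (A.splitRight s) = 0)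
    (r : (cutII h).R) :
    (cutII h).dualBoundary (fun e => c e.1) r = ∑ e, c e * A.inc e r.1 := by
  rw [dualBoundary_eq, @sum_eq_sum_subtype _ _ _ _
    (fun e => e ≠ A.splitLeft s ∧ e ≠ A.splitRight s) (cutII h).finE]
  · unfold inc
    simp only [← ind_subtype]
  · intro e he
    rw [not_and_or, not_not, not_not] at he
    rcases he with rfl | rfl
    · rw [hl, zero_mul]
    · rw [hr, zero_mul]

/-- The edge to the left of a region bounded by exactly two edges is crossed as often as the edge
to its right. -/
lemma sum_mul_inc_isBetween (c : A.E → ℤ) {r : A.R} {a b : A.E} (hab : A.IsBetween r a b) :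
    ∑ e, c e * A.inc e r = c b - c a := by
  have h1 : ∀ e, c e * A.inc e r = c e * ind e b - c e * ind e a := by
    intro e
    have h2 : ind (A.left e) r = ind e b := by
      by_cases hl : A.left e = r
      · rw [hl, ind_self, (hab.2.2.2 e).1 hl, ind_self]
      · rw [ind_of_ne hl, ind_of_ne fun h' => hl ((hab.2.2.2 e).2 h')]
    have h3 : ind (A.right e) r = ind e a := by
      by_cases hl : A.right e = r
      · rw [hl, ind_self, (hab.2.2.1 e).1 hl, ind_self]
      · rw [ind_of_ne hl, ind_of_ne fun h' => hl ((hab.2.2.1 e).2 h')]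
    rw [inc, h2, h3, mul_sub]
  simp only [h1, sum_sub_distrib]
  rw [sum_mul_ind_injective (g := fun e : A.E => e) Function.injective_id,
    sum_mul_ind_injective (g := fun e : A.E => e) Function.injective_id]

lemma eq_of_isCut {c : A.E → ℤ} (hc : A.jointed.IsCut c) {r : A.R} {a b : A.E}
    (hab : A.IsBetween r a b) : c a = c b := by
  have h1 := hc r
  rw [ind_of_ne hab.1.symm, ind_of_ne hab.2.1.symm] at h1
  have h2 := sum_mul_inc_isBetween c hab
  exact (sub_eq_zero.1 (h2.symm.trans h1)).symm

lemma isCut_cutII {c : A.E → ℤ} (hc : A.jointed.IsCut c) (hl : c (A.splitLeft s) = 0) :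
    (cutII h).IsCut fun e => c e.1 := by
  intro r
  rw [← dualBoundary_eq,
    dualBoundary_cutII hl ((eq_of_isCut hc h.isBetween).symm.trans hl), ← ind_subtype,
    ← ind_subtype]
  exact hc r.1

lemma good_cutII : (cutII h).Good where
  connected := by
    classical
    let g : A.R → (cutII h).R := fun r => if hr : r = A.right (A.splitLeft s) then
      (cutII h).left ⟨A.splitIn s, h.splitIn_ne s⟩ else ⟨r, hr⟩
    have hg : ∀ r : (cutII h).R, g r.1 = r := fun r => dif_neg r.2
    have hd : g (A.right (A.splitLeft s)) = (cutII h).left ⟨A.splitIn s, h.splitIn_ne s⟩ :=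
      dif_pos rfl
    intro r r'
    rw [← hg r, ← hg r']
    refine eqvGen_map g (fun p q hpq => ?_) (A.planar.1 r.1 r'.1)
    obtain ⟨e, rfl, rfl⟩ := hpq
    by_cases he : e ≠ A.splitLeft s ∧ e ≠ A.splitRight s
    · exact .rel _ _ ⟨⟨e, he⟩, (hg ⟨_, h.left_ne he⟩).symm, (hg ⟨_, h.right_ne he⟩).symm⟩
    · obtain ⟨h1, h2, h3⟩ := A.split_corners s
      rw [not_and_or, not_not, not_not] at he
      rcases he with rfl | rfl
      · rw [hd, ← h1, hg ((cutII h).left ⟨A.splitIn s, h.splitIn_ne s⟩)]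
        exact .refl _
      · rw [← h2, hd, h3, hg ((cutII h).right ⟨A.splitIn s, h.splitIn_ne s⟩)]
        exact .rel _ _ ⟨_, rfl, rfl⟩
  bounds c hc := by
    have hl : extendChain c (A.splitLeft s) = 0 := extendChain_of_not c (by simp)
    have hr : extendChain c (A.splitRight s) = 0 := extendChain_of_not c (by simp)
    obtain ⟨φ, ψ, hφ⟩ := A.exists_coboundary (c := extendChain c) fun r => by
      by_cases hd : r = A.right (A.splitLeft s)
      · rw [hd, sum_mul_inc_isBetween _ h.isBetween, hl, hr, sub_self]
      · rw [← dualBoundary_cutII (h := h) hl hr ⟨r, hd⟩, dualBoundary_eq]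
        simp only [extendChain_coe]
        exact hc ⟨r, hd⟩
    have hs : φ s = ψ m := by
      have h1 := hφ (A.splitLeft s)
      have h3 : A.headPot φ ψ (A.splitLeft s) = ψ m := by
        rw [h.left_eq, headPot_mergeLeft]
      rw [tailPot_splitLeft, h3, hl] at h1
      linarith
    refine ⟨fun t => φ t.1, fun n => ψ n.1, fun _ => φ s, fun e => ?_⟩
    have h2 := hφ e.1
    rw [extendChain_coe] at h2
    rw [hpot_cutII, tpot_cutII, h2, hs]
    ring
  positive := by
    obtain ⟨c₀, c, -, hc, hc0, N, hN, φ, ψ, hφ⟩ :=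
      A.exists_cut (fun _ _ => 0) fun c n => -c (A.splitLeft s) * ind m n
    have h3 : ∀ φ ψ, A.headPot φ ψ (A.splitLeft s) = ψ m := fun φ ψ => by
      rw [h.left_eq, headPot_mergeLeft]
    have hx : c (A.splitLeft s) = 0 := by
      rw [hc0, tailPot_splitLeft, h3, ind_self]; ring
    refine ⟨_, isCut_cutII hc hx, N, hN, fun t => φ t.1, fun n => ψ n.1, fun _ => ψ m, fun e => ?_⟩
    rw [hpot_cutII, tpot_cutII]
    have h2 := hφ e.1
    have h4 := hφ (A.splitLeft s)
    rw [hx, h3, tailPot_splitLeft] at h4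
    have h5 := mul_nonneg (show 0 ≤ ψ m - φ s by linarith) (ind_nonneg (A.splitIn s) e.1)
    linarith

end CutII

/-! ### Combining two parallel free loops -/

section CutIII

/-- Two free loops that bound an annulus. -/
structure IsParallel (a b : A.E) : Prop where
  ne : a ≠ b
  left_free : a ∉ A.tails
  right_free : b ∉ A.tails
  isBetween : A.IsBetween (A.right a) a b

variable {A} {a b : A.E}

open Classical in
/-- The region to the right of an edge after two parallel free loops have been combined. -/
def rightIII (a b e : A.E) : A.R := if e = a then A.right b else A.right e

lemma rightIII_of_mem_tails (h : A.IsParallel a b) {e : A.E} (he : e ∈ A.tails) :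
    rightIII a b e = A.right e := by
  rw [rightIII, if_neg]; rintro rfl; exact h.left_free he

lemma IsParallel.rightIII_ne (h : A.IsParallel a b) (e : A.E) : rightIII a b e ≠ A.right a := by
  unfold rightIII
  split_ifs with h1
  · exact fun h' => h.ne ((h.isBetween.2.2.1 b).1 h').symm
  · exact fun h' => h1 ((h.isBetween.2.2.1 e).1 h')

lemma IsParallel.left_ne (h : A.IsParallel a b) {e : A.E} (he : e ≠ b) : A.left e ≠ A.right a :=
  fun h' => he ((h.isBetween.2.2.2 e).1 h')

lemma IsParallel.tail_ne (h : A.IsParallel a b) {e : A.E} (he : e ∈ A.tails) : e ≠ b := by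
  rintro rfl; exact h.right_free he

lemma IsParallel.head_ne (h : A.IsParallel a b) {e : A.E} (he : e ∈ A.heads) : e ≠ b :=
  h.tail_ne (A.tails_eq_heads ▸ he)

/-- The strand graph obtained by combining two parallel free loops. -/
abbrev cutIIIGraph (h : A.IsParallel a b) : StrandGraph where
  S := A.S
  M := A.M
  E := {e : A.E // e ≠ b}
  R := {r : A.R // r ≠ A.right a}
  finE := Fintype.ofFinite _
  finR := Fintype.ofFinite _
  splitIn t := ⟨A.splitIn t, h.head_ne splitIn_mem_heads⟩
  splitLeft t := ⟨A.splitLeft t, h.tail_ne splitLeft_mem_tails⟩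
  splitRight t := ⟨A.splitRight t, h.tail_ne splitRight_mem_tails⟩
  mergeLeft n := ⟨A.mergeLeft n, h.head_ne mergeLeft_mem_heads⟩
  mergeRight n := ⟨A.mergeRight n, h.head_ne mergeRight_mem_heads⟩
  mergeOut n := ⟨A.mergeOut n, h.tail_ne mergeOut_mem_tails⟩
  left e := ⟨A.left e.1, h.left_ne e.2⟩
  right e := ⟨rightIII a b e.1, h.rightIII_ne e.1⟩
  tail_injective := by
    refine Injective.of_comp (f := Subtype.val) ?_
    convert A.tail_injective using 1
    funext x; rcases x with x | x | x <;> rfl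
  head_injective := by
    refine Injective.of_comp (f := Subtype.val) ?_
    convert A.head_injective using 1
    funext x; rcases x with x | x | x <;> rfl
  split_corners t := by
    obtain ⟨h1, h2, h3⟩ := A.split_corners t
    refine ⟨Subtype.ext h1, Subtype.ext ?_, Subtype.ext ?_⟩
    · exact (rightIII_of_mem_tails h splitLeft_mem_tails).trans h2
    · show rightIII a b _ = rightIII a b _
      rw [rightIII_of_mem_tails h splitRight_mem_tails,
        rightIII_of_mem_tails h (A.tails_eq_heads ▸ splitIn_mem_heads), h3]
  merge_corners n := by
    obtain ⟨h1, h2, h3⟩ := A.merge_corners n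
    refine ⟨Subtype.ext h1, Subtype.ext ?_, Subtype.ext ?_⟩
    · exact (rightIII_of_mem_tails h (A.tails_eq_heads ▸ mergeLeft_mem_heads)).trans h2
    · show rightIII a b _ = rightIII a b _
      rw [rightIII_of_mem_tails h mergeOut_mem_tails,
        rightIII_of_mem_tails h (A.tails_eq_heads ▸ mergeRight_mem_heads), h3]

/-- The graph obtained by combining two parallel free loops. -/
abbrev cutIII (h : A.IsParallel a b) : JointedGraph where
  toStrandGraph := cutIIIGraph h
  J := Empty
  jointIn := Empty.elim
  jointOut := Empty.elim
  inner := ⟨A.inner, h.isBetween.1.symm⟩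
  outer := ⟨A.outer, h.isBetween.2.1.symm⟩
  jointIn_injective := fun x => x.elim
  jointOut_injective := fun x => x.elim
  jointIn_notMem := fun x => x.elim
  jointOut_notMem := fun x => x.elim
  joint_corners := fun x => x.elim
  closed e := by
    have h1 : e ∈ (cutIIIGraph h).tails ↔ e.1 ∈ A.tails := by
      constructor
      · rintro ⟨x | x | x, rfl⟩
        exacts [⟨.inl x, rfl⟩, ⟨.inr (.inl x), rfl⟩, ⟨.inr (.inr x), rfl⟩]
      · rintro ⟨x | x | x, hx⟩
        exacts [⟨.inl x, Subtype.ext hx⟩, ⟨.inr (.inl x), Subtype.ext hx⟩,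
          ⟨.inr (.inr x), Subtype.ext hx⟩]
    have h2 : e ∈ (cutIIIGraph h).heads ↔ e.1 ∈ A.heads := by
      constructor
      · rintro ⟨x | x | x, rfl⟩
        exacts [⟨.inl x, rfl⟩, ⟨.inr (.inl x), rfl⟩, ⟨.inr (.inr x), rfl⟩]
      · rintro ⟨x | x | x, hx⟩
        exacts [⟨.inl x, Subtype.ext hx⟩, ⟨.inr (.inl x), Subtype.ext hx⟩,
          ⟨.inr (.inr x), Subtype.ext hx⟩]
    simp [h1, h2, A.tails_eq_heads]

variable {h : A.IsParallel a b}

lemma hpot_cutIII (φ : A.S → ℤ) (ψ : A.M → ℤ) (χ : Empty → ℤ) (e : (cutIII h).E) :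
    (cutIII h).hpot φ ψ χ e = A.headPot φ ψ e.1 := by
  unfold hpot headPot
  simp only [← ind_subtype, Finset.univ_eq_empty, Finset.sum_empty, add_zero]

lemma tpot_cutIII (φ : A.S → ℤ) (ψ : A.M → ℤ) (χ : Empty → ℤ) (e : (cutIII h).E) :
    (cutIII h).tpot φ ψ χ e = A.tailPot φ ψ e.1 := by
  unfold tpot tailPot
  simp only [← ind_subtype, Finset.univ_eq_empty, Finset.sum_empty, add_zero]

lemma dualBoundary_cutIII {c : A.E → ℤ} (hc : c a = c b) (r : (cutIII h).R) :
    (cutIII h).dualBoundary (fun e => c e.1) r = ∑ e, c e * A.inc e r.1 := by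
  have hd : A.left b = A.right a := (h.isBetween.2.2.2 b).2 rfl
  have h1 : ∀ e : (cutIII h).E, (cutIII h).inc e r = A.inc e.1 r.1 + ind a e.1 * A.inc b r.1 := by
    intro e
    show ind _ r - ind _ r = _
    rw [← ind_subtype, ← ind_subtype]
    show ind (A.left e.1) r.1 - ind (rightIII a b e.1) r.1 = _
    unfold inc rightIII
    split_ifs with h2
    · rw [h2, ind_self, hd]; ring
    · rw [ind_of_ne (Ne.symm h2)]; ring
  rw [dualBoundary_eq, @sum_eq_add_sum_ne _ _ _ _ b (cutIII h).finE]
  simp only [h1, mul_add, sum_add_distrib]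
  rw [add_comm]
  congr 1
  have h2 : ∀ e : (cutIII h).E, c e.1 * (ind a e.1 * A.inc b r.1) =
      ind (⟨a, h.ne⟩ : (cutIII h).E) e * (c e.1 * A.inc b r.1) := by
    intro e; rw [← ind_subtype]; ring
  simp only [h2]
  rw [@sum_ind_mul _ (cutIII h).finE, hc]

lemma isCut_cutIII {c : A.E → ℤ} (hc : A.jointed.IsCut c) : (cutIII h).IsCut fun e => c e.1 := by
  intro r
  rw [← dualBoundary_eq, dualBoundary_cutIII (eq_of_isCut hc h.isBetween),
    ← ind_subtype, ← ind_subtype]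
  exact hc r.1

open Classical in
/-- The map from the edges of a diagram to those of the diagram in which two parallel free
loops have been combined. -/
def projIII (h : A.IsParallel a b) (e : A.E) : (cutIII h).E :=
  if he : e = b then ⟨a, h.ne⟩ else ⟨e, he⟩

lemma projIII_coe (e : (cutIII h).E) : projIII h e.1 = e := dif_neg e.2

lemma projIII_right : projIII h b = ⟨a, h.ne⟩ := dif_pos rfl

lemma projIII_of_ne {e : A.E} (he : e ≠ b) : projIII h e = ⟨e, he⟩ := dif_neg he

lemma good_cutIII : (cutIII h).Good where
  connected := by
    classical
    let g : A.R → (cutIII h).R := fun r => if hr : r = A.right a then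
      (cutIII h).left ⟨a, h.ne⟩ else ⟨r, hr⟩
    have hg : ∀ r : (cutIII h).R, g r.1 = r := fun r => dif_neg r.2
    have hd : g (A.right a) = (cutIII h).left ⟨a, h.ne⟩ := dif_pos rfl
    intro r r'
    rw [← hg r, ← hg r']
    refine eqvGen_map g (fun p q hpq => ?_) (A.planar.1 r.1 r'.1)
    obtain ⟨e, rfl, rfl⟩ := hpq
    by_cases hea : e = a
    · rw [hea, hd, hg ((cutIII h).left ⟨a, h.ne⟩)]; exact .refl _
    have h1 : rightIII a b a = A.right b := if_pos rfl
    have h2 : rightIII a b e = A.right e := if_neg hea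
    by_cases heb : e = b
    · rw [heb, (h.isBetween.2.2.2 b).2 rfl, hd, ← h1, hg ((cutIII h).right ⟨a, h.ne⟩)]
      exact .rel _ _ ⟨_, rfl, rfl⟩
    · rw [← h2, hg ((cutIII h).right ⟨e, heb⟩), hg ((cutIII h).left ⟨e, heb⟩)]
      exact .rel _ _ ⟨_, rfl, rfl⟩
  bounds c hc := by
    have h1 : c (projIII h a) = c (projIII h b) := by
      rw [projIII_right, projIII_of_ne h.ne]
    obtain ⟨φ, ψ, hφ⟩ := A.exists_coboundary (c := fun e => c (projIII h e)) fun r => by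
      by_cases hd : r = A.right a
      · rw [hd, sum_mul_inc_isBetween _ h.isBetween, h1, sub_self]
      · rw [← dualBoundary_cutIII (h := h) h1 ⟨r, hd⟩, dualBoundary_eq]
        simp only [projIII_coe]
        exact hc ⟨r, hd⟩
    refine ⟨φ, ψ, Empty.elim, fun e => ?_⟩
    rw [hpot_cutIII, tpot_cutIII, ← hφ e.1, projIII_coe]
  positive := by
    obtain ⟨c₀, c, -, hc, -, N, hN, φ, ψ, hφ⟩ := A.exists_cut (fun _ _ => 0) fun _ _ => 0
    refine ⟨_, isCut_cutIII hc, N, hN, φ, ψ, Empty.elim, fun e => ?_⟩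
    rw [hpot_cutIII, tpot_cutIII]
    exact hφ e.1

end CutIII

end AnnularDiagram

lemma eqvGen_false_iff {α : Type} {x y : α} : EqvGen (fun _ _ => False) x y ↔ x = y := by
  refine ⟨eq_of_eqvGen (F := id) fun _ _ h => h.elim, ?_⟩
  rintro rfl; exact .refl _

namespace AnnularDiagram

variable {A : AnnularDiagram} {m : A.M} {s : A.S} {a b : A.E}

/-! ### The reductions exist -/

instance : IsEmpty {k : {k : Bool // k ≠ false} // k ≠ ⟨true, Bool.noConfusion⟩} :=
  ⟨fun ⟨⟨k, hk⟩, hk'⟩ => by cases k <;> simp at hk hk'⟩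

instance : IsEmpty {k : Unit // k ≠ ()} := ⟨fun k => k.2 rfl⟩

/-- The graph obtained by a reduction of type I. -/
abbrev reductI (h : A.mergeOut m = A.splitIn s) : JointedGraph :=
  ((A.cutI h).smooth false).smooth ⟨true, Bool.noConfusion⟩

/-- The graph obtained by a reduction of type II. -/
abbrev reductII (h : A.IsBigon s m) : JointedGraph := (cutII h).smooth ()

open Classical in
/-- The correspondence of edges in a reduction of type I. -/
def projI (h : A.mergeOut m = A.splitIn s) (e : A.E) : (reductI h).E :=
  proj _ _ (proj _ _
    (if he : e ≠ A.mergeOut m then ⟨e, he⟩ else (A.cutI h).jointIn false : (A.cutI h).E))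

lemma projI_of_ne {h : A.mergeOut m = A.splitIn s} {e : A.E} (he : e ≠ A.mergeOut m) :
    projI h e = proj _ _ (proj _ _
      (⟨e, he⟩ : (A.cutI h).E)) := by
  rw [projI, dif_pos he]

lemma good_reductI (h : A.mergeOut m = A.splitIn s) : (reductI h).Good :=
  (good_cutI.smooth false).smooth _

lemma good_reductII (h : A.IsBigon s m) : (reductII h).Good := good_cutII.smooth ()

lemma collapseI (h : A.mergeOut m = A.splitIn s) :
    Collapse A.toStrandGraph (reductI h).toStrandGraph {s} {m} {A.mergeOut m} ∅
      (fun e e' => (e = A.mergeLeft m ∧ e' = A.splitLeft s) ∨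
        (e = A.mergeRight m ∧ e' = A.splitRight s))
      (fun r r' => r = A.right (A.mergeLeft m) ∧ r' = A.right (A.splitLeft s))
      (fun t => t.1) (fun n => n.1) (projI h) (glueProj _ _) :=
  { split_injective := Subtype.val_injective
    split_range := by ext t; simp
    merge_injective := Subtype.val_injective
    merge_range := by ext t; simp
    edge_surj := fun e => by
      refine ⟨e.1.1.1, e.1.1.2, ?_⟩
      rw [projI_of_ne e.1.1.2]
      exact (congrArg _ (glueProj_coe e.1)).trans (glueProj_coe e)
    edge_ker := fun e e' he he' => by
      rw [projI_of_ne he, projI_of_ne he']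
      refine (glueProj_comp_eq_iff_eqvGen (P := proj (A.cutI h) false)
        (r := fun x y => x = (A.cutI h).jointIn false ∧ y = (A.cutI h).jointOut false)
        (fun _ _ => glueProj_eq_iff_eqvGen) ((A.cutI h).jointIn true)
        ((A.cutI h).jointOut true) _ _).trans ?_
      rw [← eqvGen_subtype_iff (P := fun e => e ≠ A.mergeOut m) (x := ⟨e, he⟩) (y := ⟨e', he'⟩)]
      · simp only [Subtype.ext_iff, cond_true, cond_false]
      · rintro x y (⟨rfl, rfl⟩ | ⟨rfl, rfl⟩)
        exacts [⟨A.mergeIn_ne_mergeOut h m false, splitLeft_ne_mergeOut⟩,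
          ⟨A.mergeIn_ne_mergeOut h m true, splitRight_ne_mergeOut⟩]
    region_surj := fun r => ⟨r.1, id, glueProj_coe r⟩
    region_ker := fun r r' _ _ => glueProj_eq_iff_eqvGen
    splitIn := fun t => (projI_of_ne _).symm
    splitLeft := fun t => (projI_of_ne _).symm
    splitRight := fun t => (projI_of_ne _).symm
    mergeLeft := fun t => (projI_of_ne _).symm
    mergeRight := fun t => (projI_of_ne _).symm
    mergeOut := fun t => (projI_of_ne _).symm
    left := fun e he _ => by
      rw [projI_of_ne he]
      exact (left_proj (G := (A.cutI h).smooth false) _).trans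
        (left_proj (G := A.cutI h) _)
    right := fun e he _ => by
      rw [projI_of_ne he]
      exact (right_proj (G := (A.cutI h).smooth false) _).trans
        (right_proj (G := A.cutI h) _) }

lemma reducesI_reductI (h : A.mergeOut m = A.splitIn s) :
    A.ReducesI ((reductI h).toAnnular (good_reductI h)) :=
  ⟨m, s, h, _, _, _, _, collapseI h, rfl, rfl⟩

open Classical in
/-- The correspondence of edges in a reduction of type II. -/
def projII (h : A.IsBigon s m) (e : A.E) : (reductII h).E :=
  proj _ _ (if he : e ≠ A.splitLeft s ∧ e ≠ A.splitRight s then ⟨e, he⟩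
    else (cutII h).jointIn () : (cutII h).E)

lemma projII_of_ne {h : A.IsBigon s m} {e : A.E} (he : e ≠ A.splitLeft s ∧ e ≠ A.splitRight s) :
    projII h e = proj _ _ (⟨e, he⟩ : (cutII h).E) := by
  rw [projII, dif_pos he]

open Classical in
/-- The correspondence of regions when a region is deleted. -/
def removeRegion {α : Type} {d : α} (r₀ : {r : α // r ≠ d}) (r : α) :
    {r : α // r ≠ d} := if hr : r = d then r₀ else ⟨r, hr⟩

lemma removeRegion_of_ne {α : Type} {d : α} (r₀ : {r : α // r ≠ d}) {r : α} (h : r ≠ d) :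
    removeRegion r₀ r = ⟨r, h⟩ := dif_neg h

lemma removeRegion_eq_iff {α : Type} {d : α} (r₀ : {r : α // r ≠ d}) {r r' : α} (h : r ≠ d)
    (h' : r' ≠ d) :
    removeRegion r₀ r = removeRegion r₀ r' ↔ EqvGen (fun _ _ => False) r r' := by
  rw [removeRegion_of_ne _ h, removeRegion_of_ne _ h', eqvGen_false_iff, Subtype.mk.injEq]

lemma collapseII (h : A.IsBigon s m) :
    Collapse A.toStrandGraph (reductII h).toStrandGraph {s} {m}
      {A.splitLeft s, A.splitRight s} {A.right (A.splitLeft s)}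
      (fun e e' => e = A.splitIn s ∧ e' = A.mergeOut m) (fun _ _ => False)
      (fun t => t.1) (fun n => n.1) (projII h) (removeRegion (cutII h).inner) :=
  { split_injective := Subtype.val_injective
    split_range := by ext t; simp
    merge_injective := Subtype.val_injective
    merge_range := by ext t; simp
    edge_surj := fun e => by
      refine ⟨e.1.1, by simpa using e.1.2, ?_⟩
      rw [projII_of_ne e.1.2]
      exact glueProj_coe e
    edge_ker := fun e e' he he' => by
      have he : e ≠ A.splitLeft s ∧ e ≠ A.splitRight s := by simpa using he
      have he' : e' ≠ A.splitLeft s ∧ e' ≠ A.splitRight s := by simpa using he'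
      rw [projII_of_ne he, projII_of_ne he']
      refine glueProj_eq_iff_eqvGen.trans ?_
      rw [← eqvGen_subtype_iff (P := fun e => e ≠ A.splitLeft s ∧ e ≠ A.splitRight s)
        (x := ⟨e, he⟩) (y := ⟨e', he'⟩)]
      · simp only [Subtype.ext_iff]
      · rintro x y ⟨rfl, rfl⟩
        exact ⟨h.splitIn_ne s, mergeOut_ne_splitOut m⟩
    region_surj := fun r => ⟨r.1, r.2, removeRegion_of_ne _ r.2⟩
    region_ker := fun r r' h1 h2 => removeRegion_eq_iff _ h1 h2
    splitIn := fun t => (projII_of_ne _).symm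
    splitLeft := fun t => (projII_of_ne _).symm
    splitRight := fun t => (projII_of_ne _).symm
    mergeLeft := fun t => (projII_of_ne _).symm
    mergeRight := fun t => (projII_of_ne _).symm
    mergeOut := fun t => (projII_of_ne _).symm
    left := fun e he h1 => by
      have he : e ≠ A.splitLeft s ∧ e ≠ A.splitRight s := by simpa using he
      rw [projII_of_ne he, removeRegion_of_ne _ h1]
      exact left_proj (G := cutII h) _
    right := fun e he h1 => by
      have he : e ≠ A.splitLeft s ∧ e ≠ A.splitRight s := by simpa using he
      rw [projII_of_ne he, removeRegion_of_ne _ h1]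
      exact right_proj (G := cutII h) _ }

lemma reducesII_reductII (h : A.IsBigon s m) :
    A.ReducesII ((reductII h).toAnnular (good_reductII h)) :=
  ⟨s, m, h.left_eq, h.right_eq, h.isBetween, _, _, _, _, collapseII h,
    (removeRegion_of_ne _ h.isBetween.1.symm).symm,
    (removeRegion_of_ne _ h.isBetween.2.1.symm).symm⟩

lemma projIII_eq_iff (h : A.IsParallel a b) {e e' : A.E} :
    projIII h e = projIII h e' ↔ EqvGen (fun e e' => e = a ∧ e' = b) e e' := by
  rw [← glueProj_eq_iff_eqvGen, Subtype.ext_iff, Subtype.ext_iff]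
  have : ∀ e, (projIII h e).1 = (glueProj a b e).1 := fun e => by
    by_cases he : e = b
    · simp [projIII, glueProj, he]
    · simp [projIII, glueProj, he]
  rw [this, this]

lemma collapseIII (h : A.IsParallel a b) :
    Collapse A.toStrandGraph (cutIII h).toStrandGraph ∅ ∅ ∅ {A.right a}
      (fun e e' => e = a ∧ e' = b) (fun _ _ => False) id id (projIII h)
      (removeRegion (cutIII h).inner) :=
  { split_injective := Function.injective_id
    split_range := by simp
    merge_injective := Function.injective_id
    merge_range := by simp
    edge_surj := fun e => ⟨e.1, id, projIII_coe e⟩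
    edge_ker := fun e e' _ _ => projIII_eq_iff h
    region_surj := fun r => ⟨r.1, r.2, removeRegion_of_ne _ r.2⟩
    region_ker := fun r r' h1 h2 => removeRegion_eq_iff _ h1 h2
    splitIn := fun t => (projIII_of_ne _).symm
    splitLeft := fun t => (projIII_of_ne _).symm
    splitRight := fun t => (projIII_of_ne _).symm
    mergeLeft := fun t => (projIII_of_ne _).symm
    mergeRight := fun t => (projIII_of_ne _).symm
    mergeOut := fun t => (projIII_of_ne _).symm
    left := fun e _ h1 => by
      have he : e ≠ b := by rintro rfl; exact h1 ((h.isBetween.2.2.2 e).2 rfl)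
      rw [projIII_of_ne he, removeRegion_of_ne _ h1]
    right := fun e _ h1 => by
      have hea : e ≠ a := by rintro rfl; exact h1 rfl
      rw [removeRegion_of_ne _ h1]
      by_cases he : e = b
      · subst he
        rw [projIII_right]
        exact Subtype.ext (if_pos rfl)
      · rw [projIII_of_ne he]
        exact Subtype.ext (if_neg hea) }

lemma reducesIII_cutIII (h : A.IsParallel a b) :
    A.ReducesIII ((cutIII h).toAnnular good_cutIII) :=
  ⟨a, b, h.ne, h.left_free, h.right_free, h.isBetween, _, _, _, _, collapseIII h,
    (removeRegion_of_ne _ h.isBetween.1.symm).symm,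
    (removeRegion_of_ne _ h.isBetween.2.1.symm).symm⟩

/-- In a reduced diagram no merge is followed by a split. -/
lemma IsReduced.mergeOut_ne_splitIn (hA : A.IsReduced) (m : A.M) (s : A.S) :
    A.mergeOut m ≠ A.splitIn s :=
  fun h => hA _ (.inl (reducesI_reductI h))

lemma IsReduced.not_isBigon (hA : A.IsReduced) : ¬ A.IsBigon s m :=
  fun h => hA _ (.inr (.inl (reducesII_reductII h)))

lemma IsReduced.not_isParallel (hA : A.IsReduced) : ¬ A.IsParallel a b :=
  fun h => hA _ (.inr (.inr (reducesIII_cutIII h)))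

end AnnularDiagram

/-! ### Collapses are determined by their data -/

namespace StrandGraph.Collapse

variable {G H K : StrandGraph} {kS : Set G.S} {kM : Set G.M} {kE : Set G.E} {kR : Set G.R}
  {gE : G.E → G.E → Prop} {gR : G.R → G.R → Prop} {τ : H.S → G.S} {μ : H.M → G.M} {π : G.E → H.E}
  {ρ : G.R → H.R} {τ' : K.S → G.S} {μ' : K.M → G.M} {π' : G.E → K.E} {ρ' : G.R → K.R}

/-- Two diagrams that arise by the same collapse are isomorphic. -/
lemma unique (h : Collapse G H kS kM kE kR gE gR τ μ π ρ)
    (h' : Collapse G K kS kM kE kR gE gR τ' μ' π' ρ')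
    (hl : ∀ e ∉ kE, ∃ e₁ ∉ kE, π e₁ = π e ∧ G.left e₁ ∉ kR)
    (hr : ∀ e ∉ kE, ∃ e₁ ∉ kE, π e₁ = π e ∧ G.right e₁ ∉ kR)
    (hS : ∀ s ∉ kS, G.splitIn s ∉ kE ∧ G.splitLeft s ∉ kE ∧ G.splitRight s ∉ kE)
    (hM : ∀ m ∉ kM, G.mergeLeft m ∉ kE ∧ G.mergeRight m ∉ kE ∧ G.mergeOut m ∉ kE) :
    ∃ (τ₀ : K.S → H.S) (μ₀ : K.M → H.M) (π₀ : H.E → K.E) (ρ₀ : H.R → K.R),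
      Collapse H K ∅ ∅ ∅ ∅ (fun _ _ => False) (fun _ _ => False) τ₀ μ₀ π₀ ρ₀ ∧
      ∀ r ∉ kR, ρ₀ (ρ r) = ρ' r := by
  have lift : ∀ {X Y Z : Type} {κ : X → Z} {κ' : Y → Z}, Set.range κ = Set.range κ' →
      ∀ t, ∃ t₀, κ t₀ = κ' t := fun h t => (h ▸ ⟨t, rfl⟩ : _ ∈ Set.range _)
  choose τ₀ hτ₀ using lift (h.split_range.trans h'.split_range.symm)
  choose μ₀ hμ₀ using lift (h.merge_range.trans h'.merge_range.symm)
  choose ε hεk hε using h.edge_surj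
  choose δ hδk hδ using h.region_surj
  have hπ : ∀ e ∉ kE, π' (ε (π e)) = π' e := fun e he =>
    (h'.edge_ker _ _ (hεk _) he).2 ((h.edge_ker _ _ (hεk _) he).1 (hε _))
  have hρ : ∀ r ∉ kR, ρ' (δ (ρ r)) = ρ' r := fun r hr =>
    (h'.region_ker _ _ (hδk _) hr).2 ((h.region_ker _ _ (hδk _) hr).1 (hδ _))
  have hπ' : ∀ e e', e ∉ kE → e' ∉ kE → π e = π e' → π' e = π' e' := fun e e' he he' h1 =>
    (h'.edge_ker _ _ he he').2 ((h.edge_ker _ _ he he').1 h1)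
  have kS' : ∀ t, τ' t ∉ kS := fun t => (h'.split_range ▸ ⟨t, rfl⟩ : τ' t ∈ kSᶜ)
  have kM' : ∀ t, μ' t ∉ kM := fun t => (h'.merge_range ▸ ⟨t, rfl⟩ : μ' t ∈ kMᶜ)
  refine ⟨τ₀, μ₀, fun e => π' (ε e), fun r => ρ' (δ r), ?_, hρ⟩
  exact
  { split_injective := fun x y hxy => h'.split_injective (by rw [← hτ₀, ← hτ₀, hxy])
    split_range := by
      rw [Set.compl_empty, Set.range_eq_univ]
      intro t
      obtain ⟨t₀, ht₀⟩ := lift (h'.split_range.trans h.split_range.symm) t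
      exact ⟨t₀, h.split_injective (by rw [hτ₀, ht₀])⟩
    merge_injective := fun x y hxy => h'.merge_injective (by rw [← hμ₀, ← hμ₀, hxy])
    merge_range := by
      rw [Set.compl_empty, Set.range_eq_univ]
      intro t
      obtain ⟨t₀, ht₀⟩ := lift (h'.merge_range.trans h.merge_range.symm) t
      exact ⟨t₀, h.merge_injective (by rw [hμ₀, ht₀])⟩
    edge_surj := fun e' => by
      obtain ⟨e, he, rfl⟩ := h'.edge_surj e'
      exact ⟨π e, id, hπ e he⟩
    edge_ker := fun e e' _ _ => by
      rw [eqvGen_false_iff, h'.edge_ker _ _ (hεk _) (hεk _), ← h.edge_ker _ _ (hεk _) (hεk _), hε,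
        hε]
    region_surj := fun r' => by
      obtain ⟨r, hr, rfl⟩ := h'.region_surj r'
      exact ⟨ρ r, id, hρ r hr⟩
    region_ker := fun r r' _ _ => by
      rw [eqvGen_false_iff, h'.region_ker _ _ (hδk _) (hδk _),
        ← h.region_ker _ _ (hδk _) (hδk _), hδ, hδ]
    splitIn := fun t => by
      rw [h'.splitIn, h.splitIn, hτ₀, hπ _ (hS _ (kS' t)).1]
    splitLeft := fun t => by
      rw [h'.splitLeft, h.splitLeft, hτ₀, hπ _ (hS _ (kS' t)).2.1]
    splitRight := fun t => by
      rw [h'.splitRight, h.splitRight, hτ₀, hπ _ (hS _ (kS' t)).2.2]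
    mergeLeft := fun t => by
      rw [h'.mergeLeft, h.mergeLeft, hμ₀, hπ _ (hM _ (kM' t)).1]
    mergeRight := fun t => by
      rw [h'.mergeRight, h.mergeRight, hμ₀, hπ _ (hM _ (kM' t)).2.1]
    mergeOut := fun t => by
      rw [h'.mergeOut, h.mergeOut, hμ₀, hπ _ (hM _ (kM' t)).2.2]
    left := fun e _ _ => by
      obtain ⟨e₁, he₁, h1, h2⟩ := hl (ε e) (hεk e)
      rw [hε] at h1
      rw [← h1, h.left _ he₁ h2, hρ _ h2, hπ _ he₁, h'.left _ he₁ h2]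
    right := fun e _ _ => by
      obtain ⟨e₁, he₁, h1, h2⟩ := hr (ε e) (hεk e)
      rw [hε] at h1
      rw [← h1, h.right _ he₁ h2, hρ _ h2, hπ _ he₁, h'.right _ he₁ h2] }

end StrandGraph.Collapse

namespace AnnularDiagram

variable {A B : AnnularDiagram}

lemma isotopic_of_collapse {C : AnnularDiagram} {kS : Set A.S} {kM : Set A.M} {kE : Set A.E}
    {kR : Set A.R} {gE : A.E → A.E → Prop} {gR : A.R → A.R → Prop} {τ : B.S → A.S}
    {μ : B.M → A.M} {π : A.E → B.E} {ρ : A.R → B.R} {τ' : C.S → A.S} {μ' : C.M → A.M}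
    {π' : A.E → C.E} {ρ' : A.R → C.R}
    (h : Collapse A.toStrandGraph B.toStrandGraph kS kM kE kR gE gR τ μ π ρ)
    (h' : Collapse A.toStrandGraph C.toStrandGraph kS kM kE kR gE gR τ' μ' π' ρ')
    (hl : ∀ e ∉ kE, ∃ e₁ ∉ kE, π e₁ = π e ∧ A.left e₁ ∉ kR)
    (hr : ∀ e ∉ kE, ∃ e₁ ∉ kE, π e₁ = π e ∧ A.right e₁ ∉ kR)
    (hS : ∀ s ∉ kS, A.splitIn s ∉ kE ∧ A.splitLeft s ∉ kE ∧ A.splitRight s ∉ kE)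
    (hM : ∀ m ∉ kM, A.mergeLeft m ∉ kE ∧ A.mergeRight m ∉ kE ∧ A.mergeOut m ∉ kE)
    (hi : B.inner = ρ A.inner ∧ B.outer = ρ A.outer)
    (hi' : C.inner = ρ' A.inner ∧ C.outer = ρ' A.outer)
    (hk : A.inner ∉ kR ∧ A.outer ∉ kR) : B.Isotopic C := by
  obtain ⟨τ₀, μ₀, π₀, ρ₀, h1, h2⟩ := h.unique h' hl hr hS hM
  exact ⟨τ₀, μ₀, π₀, ρ₀, h1, by rw [hi'.1, hi.1, h2 _ hk.1], by rw [hi'.2, hi.2, h2 _ hk.2]⟩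

/-- Every reduction is one of the three constructions, up to isotopy. -/
lemma Reduces.cases {P : AnnularDiagram → Prop} (hAB : A.Reduces B)
    (hP : ∀ C, C.Isotopic B → P C → P B)
    (hI : ∀ m s (h : A.mergeOut m = A.splitIn s),
      P ((reductI h).toAnnular (good_reductI h)))
    (hII : ∀ s m (h : A.IsBigon s m), P ((reductII h).toAnnular (good_reductII h)))
    (hIII : ∀ a b (h : A.IsParallel a b), P ((cutIII h).toAnnular good_cutIII)) : P B := by
  rcases hAB with ⟨m, s, h, τ, μ, π, ρ, hc, hi⟩ | ⟨s, m, h1, h2, h3, τ, μ, π, ρ, hc, hi⟩ |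
    ⟨a, b, h1, h2, h3, h4, τ, μ, π, ρ, hc, hi⟩
  · refine hP _ (isotopic_of_collapse (collapseI h) hc (fun e he => ⟨e, he, rfl, id⟩)
      (fun e he => ⟨e, he, rfl, id⟩) (fun t ht => ⟨A.splitIn_ne_mergeOut h ht,
      splitLeft_ne_mergeOut, splitRight_ne_mergeOut⟩)
      (fun n hn => ⟨A.mergeIn_ne_mergeOut h n false, A.mergeIn_ne_mergeOut h n true,
      fun h' => hn (mergeOut_injective h')⟩) ⟨rfl, rfl⟩ hi ⟨id, id⟩) (hI m s h)
  · have h : A.IsBigon s m := ⟨h1, h2, h3⟩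
    refine hP _ (isotopic_of_collapse (collapseII h) hc
      (fun e he => ⟨e, he, rfl, h.left_ne (by simpa using he)⟩)
      (fun e he => ⟨e, he, rfl, h.right_ne (by simpa using he)⟩)
      (fun t ht => ?_) (fun n hn => ?_) ⟨(removeRegion_of_ne _ h.isBetween.1.symm).symm,
      (removeRegion_of_ne _ h.isBetween.2.1.symm).symm⟩ hi ⟨h3.1.symm, h3.2.1.symm⟩) (hII s m h)
    · have := And.intro (h.splitIn_ne t)
        (And.intro (splitLeft_ne_of_ne (A := A) ht) (splitRight_ne_of_ne (A := A) ht))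
      simpa using this
    · have := And.intro (h.mergeLeft_ne hn)
        (And.intro (h.mergeRight_ne hn) (mergeOut_ne_splitOut (s := s) n))
      simpa using this
  · have h : A.IsParallel a b := ⟨h1, h2, h3, h4⟩
    have hab : projIII h a = projIII h b := (projIII_eq_iff h).2 (.rel _ _ ⟨rfl, rfl⟩)
    refine hP _ (isotopic_of_collapse (collapseIII h) hc (fun e _ => ?_) (fun e _ => ?_)
      (fun t _ => ⟨id, id, id⟩) (fun n _ => ⟨id, id, id⟩)
      ⟨(removeRegion_of_ne _ h.isBetween.1.symm).symm,
      (removeRegion_of_ne _ h.isBetween.2.1.symm).symm⟩ hi ⟨h4.1.symm, h4.2.1.symm⟩) (hIII a b h)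
    · by_cases he : e = b
      · exact ⟨a, id, by rw [he, hab], h.left_ne h1⟩
      · exact ⟨e, id, rfl, h.left_ne he⟩
    · by_cases he : e = a
      · exact ⟨b, id, by rw [he, hab], fun h' => h1 ((h4.2.2.1 b).1 h').symm⟩
      · exact ⟨e, id, rfl, fun h' => he ((h4.2.2.1 e).1 h')⟩

/-- Reductions decrease the number of edges. -/
lemma Reduces.card_lt (hAB : A.Reduces B) : Fintype.card B.E < Fintype.card A.E := by
  have key : ∀ (π : A.E → B.E), Function.Surjective π → ¬ Injective π →
      Fintype.card B.E < Fintype.card A.E := by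
    intro π h1 h2
    refine lt_of_le_of_ne (Fintype.card_le_of_surjective π h1) fun h3 => h2 ?_
    exact ((Fintype.bijective_iff_surjective_and_card π).2 ⟨h1, h3.symm⟩).1
  have key' : ∀ (π : A.E → B.E) (kE : Set A.E) (x : A.E), x ∈ kE →
      (∀ e', ∃ e, e ∉ kE ∧ π e = e') → Fintype.card B.E < Fintype.card A.E := by
    intro π kE x hx h
    refine key π (fun e' => (h e').imp fun e he => he.2) fun hi => ?_
    obtain ⟨e, he, hex⟩ := h (π x)
    exact he (hi hex ▸ hx)
  rcases hAB with ⟨m, s, h, τ, μ, π, ρ, hc, hi⟩ | ⟨s, m, h1, h2, h3, τ, μ, π, ρ, hc, hi⟩ |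
    ⟨a, b, h1, h2, h3, h4, τ, μ, π, ρ, hc, hi⟩
  · exact key' π _ (A.mergeOut m) (Set.mem_singleton _) hc.edge_surj
  · exact key' π _ _ (.inl rfl) hc.edge_surj
  · refine key π (fun e' => (hc.edge_surj e').imp fun e he => he.2) fun hi => h1 (hi ?_)
    exact (hc.edge_ker a b id id).2 (.rel _ _ ⟨rfl, rfl⟩)

/-- Every annular diagram can be reduced. -/
lemma exists_isReduced (A : AnnularDiagram) : ∃ B, B.IsReduced ∧ A.Equivalent B := by
  induction hn : Fintype.card A.E using Nat.strong_induction_on generalizing A with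
  | _ n ih =>
    by_cases hA : A.IsReduced
    · exact ⟨A, hA, .refl _⟩
    · unfold IsReduced at hA
      push Not at hA
      obtain ⟨B, hB⟩ := hA
      obtain ⟨C, hC, hBC⟩ := ih _ (hn ▸ hB.card_lt) B rfl
      exact ⟨C, hC, .trans _ _ _ (.rel _ _ (.inr hB)) hBC⟩

end AnnularDiagram

namespace StrandDiagram

/-! ### Closing a strand diagram -/

variable (D : StrandDiagram)

/-- A strand diagram whose sink is joined to its source. -/
abbrev jointed : JointedGraph where
  toStrandGraph := D.toStrandGraph
  J := Unit
  jointIn _ := D.sink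
  jointOut _ := D.source
  inner := D.right D.source
  outer := D.left D.source
  jointIn_injective := fun _ _ _ => rfl
  jointOut_injective := fun _ _ _ => rfl
  jointIn_notMem _ := by rw [D.heads_eq]; simp
  jointOut_notMem _ := by rw [D.tails_eq]; simp
  joint_corners _ := ⟨D.left_side.symm, D.right_side.symm⟩
  closed e := by
    rw [D.heads_eq, D.tails_eq]
    simp only [Set.mem_compl_iff, Set.mem_singleton_iff, exists_const, @eq_comm _ e]
    constructor <;> intro _ <;> exact (em _).symm

lemma isCut_ind_sink : D.jointed.IsCut fun e => ind D.sink e := by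
  intro r
  rw [sum_ind_mul]
  show ind (D.left D.sink) r - ind (D.right D.sink) r = _
  rw [← D.left_side, ← D.right_side]

lemma good_jointed : D.jointed.Good where
  connected := D.planar.1
  bounds c hc := by
    obtain ⟨φ, ψ, h⟩ := D.planar.2 c fun r => by rw [dualBoundary_eq]; exact hc r
    refine ⟨φ, ψ, fun _ => 0, fun e => ?_⟩
    rw [h, coboundary_eq]
    simp [hpot, tpot]
  positive := by
    obtain ⟨N, hN, φ, ψ, h⟩ := D.exists_potential (fun _ => 0) fun e l hl => (D.acyclic e l hl).elim
    -- a large weight at the sink compensates for the joint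
    obtain ⟨K, hK, hK1, hK2⟩ : ∃ K : ℤ, 0 < K ∧ -K < D.headPot φ ψ D.source ∧
        D.tailPot φ ψ D.sink < K := by
      refine ⟨|D.headPot φ ψ D.source| + |D.tailPot φ ψ D.sink| + 1, by positivity, ?_, ?_⟩
      · have := neg_abs_le (D.headPot φ ψ D.source)
        have := abs_nonneg (D.tailPot φ ψ D.sink)
        omega
      · have := le_abs_self (D.tailPot φ ψ D.sink)
        have := abs_nonneg (D.headPot φ ψ D.source)
        omega
    refine ⟨_, D.isCut_ind_sink, 2 * K, by omega, φ, ψ, fun _ => -K, fun e => ?_⟩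
    simp only [hpot, tpot, Fintype.sum_unique]
    by_cases h1 : e = D.sink
    · have h2 : e ∉ D.heads := by rw [D.heads_eq, h1]; simp
      rw [headPot_of_notMem h2, h1, ind_self]
      by_cases h3 : D.source = D.sink
      · have h4 : D.sink ∉ D.tails := by rw [D.tails_eq, h3]; simp
        rw [h3, ind_self, tailPot_of_notMem h4]; linarith
      · rw [ind_of_ne h3]; linarith
    · have h2 : e ∈ D.heads := by rw [D.heads_eq]; exact h1
      rw [ind_of_ne (Ne.symm h1)]
      by_cases h3 : e = D.source
      · have h4 : e ∉ D.tails := by rw [D.tails_eq, h3]; simp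
        rw [tailPot_of_notMem h4, h3, ind_self]; linarith
      · have h4 : e ∈ D.tails := by rw [D.tails_eq]; exact h3
        rw [ind_of_ne (Ne.symm h3)]
        have := h e h4 h2
        linarith

instance : IsEmpty {k : D.jointed.J // k ≠ ()} := ⟨fun k => k.2 rfl⟩

/-- The closure of a strand diagram. -/
abbrev closure : AnnularDiagram :=
  (D.jointed.smooth ()).toAnnular (D.good_jointed.smooth ())

lemma isClosure_closure : D.IsClosure D.closure := by
  refine ⟨id, id, fun e => D.jointed.proj () e, id, ?_, rfl, rfl⟩
  exact
  { split_injective := Function.injective_id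
    split_range := by simp
    merge_injective := Function.injective_id
    merge_range := by simp
    edge_surj := fun e => ⟨e.1, id, glueProj_coe e⟩
    edge_ker := fun e e' _ _ => by
      refine glueProj_eq_iff_eqvGen.trans ⟨fun h => ?_, fun h => ?_⟩
      · refine eqvGen_map id (fun x y h => ?_) h
        exact .symm _ _ (.rel _ _ h.symm)
      · refine eqvGen_map id (fun x y h => ?_) h
        exact .symm _ _ (.rel _ _ h.symm)
    region_surj := fun r => ⟨r, id, rfl⟩
    region_ker := fun r r' _ _ => eqvGen_false_iff.symm
    splitIn := fun _ => rfl
    splitLeft := fun _ => rfl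
    splitRight := fun _ => rfl
    mergeLeft := fun _ => rfl
    mergeRight := fun _ => rfl
    mergeOut := fun _ => rfl
    left := fun e _ _ => left_proj _
    right := fun e _ _ => right_proj _ }

lemma IsClosure.isotopic {D : StrandDiagram} {A : AnnularDiagram} (h : D.IsClosure A) :
    D.closure.Isotopic A := by
  obtain ⟨τ, μ, π, ρ, h1, h2⟩ := h
  obtain ⟨τ', μ', π', ρ', h1', h2'⟩ := D.isClosure_closure
  obtain ⟨τ₀, μ₀, π₀, ρ₀, h3, h4⟩ := h1'.unique h1 (fun e he => ⟨e, he, rfl, id⟩)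
    (fun e he => ⟨e, he, rfl, id⟩) (fun _ _ => ⟨id, id, id⟩) (fun _ _ => ⟨id, id, id⟩)
  exact ⟨τ₀, μ₀, π₀, ρ₀, h3, by rw [h2.1, h2'.1, h4 _ id], by rw [h2.2, h2'.2, h4 _ id]⟩

end StrandDiagram

variable {f : ThompsonF}

/-- An irrational point of the unit interval. -/
abbrev Irr (y : I) : Prop := Irrational (y : ℝ)

lemma exists_irr : ∃ y, Irr y :=
  (exists_irrational_between one_pos).imp fun _ h => h.2.2

/-! ### Orbits -/

/-- `x` and `y` lie in the same orbit of `f`. -/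
def Orb (f : ThompsonF) (x y : I) : Prop := ∃ k : ℤ, x = (f.1 ^ k) y

namespace Orb

variable {x y z : I}

lemma refl (f : ThompsonF) (x : I) : Orb f x x := ⟨0, by simp⟩

lemma of_eq (h : x = y) : Orb f x y := h ▸ refl f x

lemma symm (h : Orb f x y) : Orb f y x := by
  obtain ⟨k, rfl⟩ := h; exact ⟨-k, by rw [orderIso_zpow_neg]⟩

lemma trans (h : Orb f x y) (h' : Orb f y z) : Orb f x z := by
  obtain ⟨k, rfl⟩ := h; obtain ⟨l, rfl⟩ := h'
  exact ⟨k + l, by rw [orderIso_zpow_add]⟩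

lemma zpow (f : ThompsonF) (k : ℤ) (x : I) : Orb f ((f.1 ^ k) x) x := ⟨k, rfl⟩

lemma fix (h : Orb f x y) (hy : f.1 y = y) : f.1 x = x := by
  obtain ⟨k, rfl⟩ := h; rw [zpow_fix hy, hy]

lemma eq_of_fix (h : Orb f x y) (hy : f.1 y = y) : x = y := by
  obtain ⟨k, rfl⟩ := h; exact zpow_fix hy k

lemma map_one (f : ThompsonF) : f.1 1 = 1 := f.1.map_top

lemma map_zero (f : ThompsonF) : f.1 0 = 0 := f.1.map_bot

lemma eq_one (h : Orb f x 1) : x = 1 := h.eq_of_fix (map_one f)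

lemma eq_zero (h : Orb f x 0) : x = 0 := h.eq_of_fix (map_zero f)

end Orb

lemma irrational_zpow {k : ℤ} {x : I} :
    Irr ((f.1 ^ k) x) ↔ Irr x :=
  (isPL_zpow f k IsPL.id).irrational

/-- A piecewise linear map attains all values between two of its values. -/
lemma IsPL.exists_eq {T : I → I} (hT : IsPL fun y => (T y : ℝ)) {a b x : I} (h1 : T a ≤ x)
    (h2 : x ≤ T b) : ∃ y, T y = x := by
  have hc : Continuous T := continuous_induced_rng.2 hT.continuous
  exact mem_range_of_exists_le_of_exists_ge hc ⟨a, h1⟩ ⟨b, h2⟩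

/-- If the images of two piecewise linear maps overlap, they have an irrational value in common. -/
lemma IsPL.exists_common {T U : I → I} (hT : IsPL fun y => (T y : ℝ))
    (hU : IsPL fun y => (U y : ℝ)) {a b u v u' v' : I} (hab : a < b) (h1 : T u ≤ a) (h2 : b ≤ T v)
    (h3 : U u' ≤ a) (h4 : b ≤ U v') : ∃ y z : I, Irr y ∧ Irr z ∧
      T y = U z ∧ a < T y ∧ T y < b := by
  obtain ⟨x, hax, hxb, hx⟩ := exists_irrational_between hab
  obtain ⟨y, hy⟩ := hT.exists_eq (h1.trans hax.le) (hxb.le.trans h2)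
  obtain ⟨z, hz⟩ := hU.exists_eq (h3.trans hax.le) (hxb.le.trans h4)
  refine ⟨y, z, hT.irrational.1 ?_, hU.irrational.1 ?_, hy.trans hz.symm, hy ▸ hax, hy ▸ hxb⟩
  · show Irr (T y); rwa [hy]
  · show Irr (U z); rwa [hz]

/-- Intervals with the same right end overlap. -/
lemma IsPL.exists_common_right {T U : I → I} (hT : IsPL fun y => (T y : ℝ))
    (hU : IsPL fun y => (U y : ℝ)) (h : T 1 = U 1) : ∃ y z : I, Irr y ∧ Irr z ∧ T y = U z := by
  obtain ⟨y, z, hy, hz, h2, -⟩ := hT.exists_common hU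
    (max_lt (hT.strictMono one_pos) (h ▸ hU.strictMono one_pos) : max (T 0) (U 0) < T 1)
    (le_max_left _ _) le_rfl (le_max_right _ _) h.le
  exact ⟨y, z, hy, hz, h2⟩

lemma IsPL.exists_common_left {T U : I → I} (hT : IsPL fun y => (T y : ℝ))
    (hU : IsPL fun y => (U y : ℝ)) (h : T 0 = U 0) : ∃ y z : I, Irr y ∧ Irr z ∧ T y = U z := by
  obtain ⟨y, z, hy, hz, h2, -⟩ := hT.exists_common hU
    (lt_min (hT.strictMono one_pos) (h ▸ hU.strictMono one_pos) : T 0 < min (T 1) (U 1))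
    le_rfl (min_le_left _ _) h.ge (min_le_right _ _)
  exact ⟨y, z, hy, hz, h2⟩

lemma IsPL.strictMono' {T : I → I} (hT : IsPL fun y => (T y : ℝ)) : StrictMono T :=
  fun _ _ h => hT.strictMono h

/-- Two maps that fit together can be glued. -/
lemma exists_glue {g h : I → I} (hgh : g 1 = h 0) :
    ∃ k : I → I, (∀ y, k (half false y) = g y) ∧ ∀ y, k (half true y) = h y := by
  classical
  choose b z hz using exists_half
  have key : ∀ b b' y y', half b y = half b' y' →
      (bif b then h y else g y) = bif b' then h y' else g y' := by
    intro b b' y y' hyy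
    have h1 := congrArg (fun t : I => (t : ℝ)) hyy
    simp only [half_coe] at h1
    have l0 := y.2.1
    have l1 := y.2.2
    have l2 := y'.2.1
    have l3 := y'.2.2
    cases b <;> cases b' <;> simp only [cond_true, cond_false] <;>
      simp only [if_true, if_false, Bool.false_eq_true] at h1
    · congr 1; exact Subtype.ext (by linarith)
    · have e1 : y = 1 := Subtype.ext (show (y : ℝ) = 1 by linarith)
      have e2 : y' = 0 := Subtype.ext (show (y' : ℝ) = 0 by linarith)
      rw [e1, e2, hgh]
    · have e1 : y' = 1 := Subtype.ext (show (y' : ℝ) = 1 by linarith)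
      have e2 : y = 0 := Subtype.ext (show (y : ℝ) = 0 by linarith)
      rw [e1, e2, hgh]
    · congr 1; exact Subtype.ext (by linarith)
  exact ⟨fun y => bif b y then h (z y) else g (z y), fun y => key _ false _ _ (hz _).symm,
    fun y => key _ true _ _ (hz _).symm⟩

namespace JointedGraph

variable (G : JointedGraph)

/-! ### Colorings -/

/-- The elementary transitions in a graph: `Trans e u e' v` means that the point `u y` of the edge
`e` continues as the point `v y` of the edge `e'`. A free loop continues as itself. -/
inductive Trans : G.E → (I → I) → G.E → (I → I) → Prop
  | split (s : G.S) (b : Bool) : Trans (G.splitIn s) (half b) (G.splitOut s b) id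
  | merge (m : G.M) (b : Bool) : Trans (G.mergeIn m b) id (G.mergeOut m) (half b)
  | joint (j : G.J) : Trans (G.jointIn j) id (G.jointOut j) id
  | free (e : G.E) (he : e ∉ G.tails) (hj : ∀ j, G.jointOut j ≠ e) : Trans e id e id

/-- An irrational point on an edge continues, across a vertex, as a point on the next edge. -/
def Step (a b : G.E × I) : Prop :=
  ∃ (e : G.E) (u : I → I) (e' : G.E) (v : I → I) (y : I), G.Trans e u e' v ∧ Irr y ∧
    a = (e, u y) ∧ b = (e', v y)

/-- Two points lie on the same trajectory. -/
def Flow : G.E × I → G.E × I → Prop := EqvGen G.Step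

/-- A coloring of a graph by `f`: every edge `e` carries a piecewise linear map `T e` to the unit
interval, such that following a strand across the edge `e` amounts to applying `f` as often as the
cut `c` is crossed. Every region `r` carries a point `p r`, and the ends of the intervals at the
left and right of an edge are, up to the action of `f`, the points of the adjacent regions. The
orbits of `f` on irrational points correspond exactly to the trajectories. -/
structure IsColoring (f : ThompsonF) (c : G.E → ℤ) (T : G.E → I → I) (p : G.R → I) : Prop where
  cut : G.IsCut c
  pl : ∀ e, IsPL fun y => (T e y : ℝ)
  eq : ∀ {e u e' v}, G.Trans e u e' v → ∀ y, (f.1 ^ c e) (T e (u y)) = T e' (v y)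
  left : ∀ e, Orb f (T e 0) (p (G.left e))
  right : ∀ e, Orb f (T e 1) (p (G.right e))
  inner : p G.inner = 1
  outer : p G.outer = 0
  inj : ∀ (e e') (y y' : I), Irr y → Irr y' → Orb f (T e y) (T e' y') →
    G.Flow (e, y) (e', y')
  cov : ∀ x : I, Irr x → ∃ e y, Orb f x (T e y)

/-- The graph has a coloring by `f`. -/
def Colored (f : ThompsonF) : Prop := ∃ c T p, G.IsColoring f c T p

variable {G}

lemma Trans.hpot_eq_tpot {e e' : G.E} {u v : I → I} (h : G.Trans e u e' v) (φ : G.S → ℤ)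
    (ψ : G.M → ℤ) (χ : G.J → ℤ) : G.hpot φ ψ χ e = G.tpot φ ψ χ e' := by
  cases h with
  | split s b => cases b <;> simp [hpot_splitIn, tpot_splitLeft, tpot_splitRight]
  | merge m b => cases b <;> simp [hpot_mergeLeft, hpot_mergeRight, tpot_mergeOut]
  | joint j => rw [hpot_jointIn, tpot_jointOut]
  | free _ he hj => rw [hpot_of_free he hj, tpot_of_free he hj]

lemma Trans.step {e e' : G.E} {u v : I → I} (h : G.Trans e u e' v) {y : I}
    (hy : Irr y) : G.Flow (e, u y) (e', v y) :=
  .rel _ _ ⟨_, _, _, _, _, h, hy, rfl, rfl⟩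

/-- To prove a relation for all steps, free loops may be disregarded. -/
lemma Step.cases {P : G.E × I → G.E × I → Prop} {a b : G.E × I} (h : G.Step a b)
    (h1 : ∀ s b (y : I), Irr y → P (G.splitIn s, half b y) (G.splitOut s b, y))
    (h2 : ∀ m b (y : I), Irr y → P (G.mergeIn m b, y) (G.mergeOut m, half b y))
    (h3 : ∀ j (y : I), Irr y → P (G.jointIn j, y) (G.jointOut j, y))
    (h4 : ∀ e y, P (e, y) (e, y)) : P a b := by
  obtain ⟨e, u, e', v, y, ht, hy, rfl, rfl⟩ := h
  cases ht with
  | split s b => exact h1 s b y hy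
  | merge m b => exact h2 m b y hy
  | joint j => exact h3 j y hy
  | free => exact h4 _ _

namespace IsColoring

variable {c : G.E → ℤ} {T : G.E → I → I} {p : G.R → I}

/-- The change of a coloring by a potential. -/
lemma gauge (h : G.IsColoring f c T p) (φ : G.S → ℤ) (ψ : G.M → ℤ) (χ : G.J → ℤ) :
    G.IsColoring f (fun e => c e + (G.hpot φ ψ χ e - G.tpot φ ψ χ e))
      (fun e y => (f.1 ^ G.tpot φ ψ χ e) (T e y)) p where
  cut := h.cut.add_pot φ ψ χ
  pl e := isPL_zpow f _ (h.pl e)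
  eq := by
    intro e u e' v ht y
    rw [← orderIso_zpow_add, ← h.eq ht y, ← orderIso_zpow_add, ← ht.hpot_eq_tpot φ ψ χ]
    congr 2; ring
  left e := (Orb.zpow f _ _).trans (h.left e)
  right e := (Orb.zpow f _ _).trans (h.right e)
  inner := h.inner
  outer := h.outer
  inj e e' y y' hy hy' ho :=
    h.inj e e' y y' hy hy' (((Orb.zpow f _ _).symm.trans ho).trans (Orb.zpow f _ _))
  cov x hx := by
    obtain ⟨e, y, hxy⟩ := h.cov x hx
    exact ⟨e, y, hxy.trans (Orb.zpow f _ _).symm⟩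

/-- Every cut is part of a coloring. -/
lemma exists_of_isCut (h : G.IsColoring f c T p) (hG : G.Good) {c' : G.E → ℤ} (hc' : G.IsCut c') :
    ∃ T', G.IsColoring f c' T' p := by
  obtain ⟨φ, ψ, χ, hφ⟩ := hG.exists_pot h.cut hc'
  have h1 := h.gauge φ ψ χ
  rw [← funext hφ] at h1
  exact ⟨_, h1⟩

lemma strictMono (h : G.IsColoring f c T p) (e : G.E) : StrictMono (T e) := (h.pl e).strictMono'

lemma orb_of_trans (h : G.IsColoring f c T p) {e u e' v} (ht : G.Trans e u e' v) (y : I) :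
    Orb f (T e (u y)) (T e' (v y)) := by
  rw [← h.eq ht y]; exact (Orb.zpow f _ _).symm

lemma orb_of_flow (h : G.IsColoring f c T p) {a b : G.E × I} (hab : G.Flow a b) :
    Orb f (T a.1 a.2) (T b.1 b.2) := by
  induction hab with
  | rel a b hab =>
    obtain ⟨e, u, e', v, y, ht, hy, rfl, rfl⟩ := hab
    exact h.orb_of_trans ht y
  | refl => exact Orb.refl f _
  | symm _ _ _ h => exact h.symm
  | trans _ _ _ _ _ h1 h2 => exact h1.trans h2

/-- The crossing number of a free loop is positive, so its interval consists of fixed points. -/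
lemma fix_of_free (h : G.IsColoring f c T p) (hG : G.Good) {e : G.E} (he : e ∉ G.tails)
    (hj : ∀ j, G.jointOut j ≠ e) (y : I) : f.1 (T e y) = T e y := by
  obtain ⟨N, hN, φ, ψ, χ, hφ⟩ := hG.positive_of_isCut h.cut
  have h1 := hφ e
  rw [hpot_of_free he hj, tpot_of_free he hj, sub_self, add_zero] at h1
  exact fix_of_zpow_fix (pos_of_mul_pos_right h1 hN.le).ne' (h.eq (.free e he hj) y)

lemma tail_cases (e : G.E) : (∃ s, e = G.splitLeft s) ∨ (∃ s, e = G.splitRight s) ∨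
    (∃ m, e = G.mergeOut m) ∨ (∃ j, e = G.jointOut j) ∨
    e ∉ G.tails ∧ ∀ j, G.jointOut j ≠ e := by
  by_cases he : e ∈ G.tails
  · rcases mem_tails.1 he with h | h | h
    exacts [.inl h, .inr (.inl h), .inr (.inr (.inl h))]
  · by_cases hj : ∃ j, G.jointOut j = e
    · obtain ⟨j, hj⟩ := hj; exact .inr (.inr (.inr (.inl ⟨j, hj.symm⟩)))
    · push Not at hj; exact .inr (.inr (.inr (.inr ⟨he, hj⟩)))

/-- Going up along the right side of an edge whose right end is not a fixed point, one arrives at a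
split, in the middle of which the end point lies: otherwise one would turn around forever, and the
heights of the end points over a fixed point of their orbit would decrease forever. -/
lemma exists_split (h : G.IsColoring f c T p) (hG : G.Good) {e : G.E} (he : f.1 (T e 1) ≠ T e 1) :
    ∃ s, G.right (G.splitLeft s) = G.right e ∧ Orb f (T e 1) (T (G.splitIn s) (half false 1)) := by
  classical
  obtain ⟨N, hN, φ, ψ, χ, hφ⟩ := hG.positive_of_isCut h.cut
  set q := T e 1 with hq
  let P : G.E × ℤ → Prop := fun a => T a.1 1 = (f.1 ^ a.2) q ∧ G.right a.1 = G.right e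
  have hPinj : ∀ a b, P a → P b → a.1 = b.1 → a.2 = b.2 := by
    rintro ⟨a, k⟩ ⟨b, l⟩ h1 h2 rfl
    exact zpow_injective_of_not_fix he (h1.1.symm.trans h2.1)
  have hfin : {a | P a}.Finite :=
    Set.Finite.of_injOn (f := Prod.fst) (t := Set.univ) (fun _ _ => Set.mem_univ _)
      (fun a ha b hb hab => Prod.ext hab (hPinj a b ha hb hab)) Set.finite_univ
  obtain ⟨⟨a, k⟩, ⟨h1, h2⟩, hmin⟩ := Set.exists_min_image {a | P a}
    (fun a => N * a.2 + G.tpot φ ψ χ a.1) hfin ⟨(e, 0), by simp [q], rfl⟩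
  have down : ∀ b u v, G.Trans b u a v → u 1 = 1 → v 1 = 1 → G.right b = G.right a → False := by
    intro b u v ht hu hv hr
    have h3 := h.eq ht 1
    rw [hu, hv, h1, zpow_eq_iff, ← orderIso_zpow_add] at h3
    have h4 : N * k + _ ≤ N * (-c b + k) + _ := hmin (b, -c b + k) ⟨h3, hr.trans h2⟩
    have h5 := hφ b
    rw [ht.hpot_eq_tpot φ ψ χ] at h5
    dsimp only at h4
    linarith
  rcases tail_cases a with ⟨s, rfl⟩ | ⟨s, rfl⟩ | ⟨m, rfl⟩ | ⟨j, rfl⟩ | ⟨h3, h4⟩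
  · refine ⟨s, h2, ?_⟩
    have h3 := h.orb_of_trans (.split s false) 1
    exact (Orb.symm ⟨k, h1⟩).trans h3.symm
  · exact (down _ _ _ (.split s true) half_true_one rfl (G.split_corners s).2.2.symm).elim
  · exact (down _ _ _ (.merge m true) rfl half_true_one (G.merge_corners m).2.2).elim
  · exact (down _ _ _ (.joint j) rfl rfl (G.joint_corners j).2).elim
  · have h5 := h.fix_of_free hG h3 h4 1
    rw [h1, apply_zpow_fix_iff] at h5
    exact absurd h5 he

end IsColoring

/-! ### Flow equivalences -/

/-- A correspondence between the points of two graphs that respects trajectories. -/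
structure FlowEquiv (G H : JointedGraph) where
  map : G.E × I → H.E × I
  inv : H.E × I → G.E × I
  map_irr : ∀ a : G.E × I, Irr a.2 → Irr (map a).2
  inv_irr : ∀ a : H.E × I, Irr a.2 → Irr (inv a).2
  map_step : ∀ {a b}, G.Step a b → H.Flow (map a) (map b)
  inv_step : ∀ {a b}, H.Step a b → G.Flow (inv a) (inv b)
  inv_map : ∀ a : G.E × I, Irr a.2 → G.Flow (inv (map a)) a
  map_inv : ∀ a : H.E × I, Irr a.2 → H.Flow (map (inv a)) a

namespace FlowEquiv

variable {G H : JointedGraph}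

/-- The inverse correspondence. -/
def symm (F : FlowEquiv G H) : FlowEquiv H G :=
  ⟨F.inv, F.map, F.inv_irr, F.map_irr, F.inv_step, F.map_step, F.map_inv, F.inv_map⟩

lemma map_flow (F : FlowEquiv G H) {a b : G.E × I} (h : G.Flow a b) : H.Flow (F.map a) (F.map b) :=
  eqvGen_map F.map (fun _ _ h => F.map_step h) h

/-- The correspondence of trajectories and orbits is transferred along a flow equivalence. -/
lemma inj (F : FlowEquiv G H) {c : G.E → ℤ} {T : G.E → I → I} {p : G.R → I}
    (h : G.IsColoring f c T p) {T' : H.E → I → I}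
    (hT : ∀ a : H.E × I, Irr a.2 → Orb f (T' a.1 a.2) (T (F.inv a).1 (F.inv a).2)) :
    ∀ (e e') (y y' : I), Irr y → Irr y' → Orb f (T' e y) (T' e' y') →
      H.Flow (e, y) (e', y') := by
  intro e e' y y' hy hy' ho
  have h1 := h.inj _ _ _ _ (F.inv_irr (e, y) hy) (F.inv_irr (e', y') hy')
    (((hT (e, y) hy).symm.trans ho).trans (hT (e', y') hy'))
  exact .trans _ _ _ (.symm _ _ (F.map_inv _ hy)) (.trans _ _ _ (F.map_flow h1) (F.map_inv _ hy'))

lemma cov (F : FlowEquiv G H) {c : G.E → ℤ} {T : G.E → I → I} {p : G.R → I}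
    (h : G.IsColoring f c T p) {T' : H.E → I → I}
    (hT : ∀ a : H.E × I, Irr a.2 → Orb f (T' a.1 a.2) (T (F.inv a).1 (F.inv a).2)) :
    ∀ x : I, Irr x → ∃ e y, Orb f x (T' e y) := by
  intro x hx
  obtain ⟨e, y, hxy⟩ := h.cov x hx
  have hy : Irr y := by
    obtain ⟨k, rfl⟩ := hxy
    exact (h.pl e).irrational.1 (irrational_zpow.1 hx)
  refine ⟨_, _, hxy.trans ((hT (F.map (e, y)) (F.map_irr (e, y) hy)).trans ?_).symm⟩
  exact h.orb_of_flow (F.inv_map (e, y) hy)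

end FlowEquiv

end JointedGraph

namespace JointedGraph

/-! ### Colorings and the smoothing of joints -/

section Smooth

variable {G : JointedGraph} {j : G.J}

lemma flow_proj (e : G.E) {y : I} (hy : Irr y) :
    G.Flow ((G.proj j e).1, y) (e, y) := by
  rcases glueProj_val (a := G.jointIn j) (b := G.jointOut j) e with h | ⟨h1, h2⟩
  · rw [h]; exact .refl _
  · rw [h2, h1]; exact (Trans.joint j).step hy

/-- Smoothing a joint does not change the trajectories. -/
def flowEquivSmooth (G : JointedGraph) (j : G.J) : FlowEquiv G (G.smooth j) where
  map a := (G.proj j a.1, a.2)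
  inv b := (b.1.1, b.2)
  map_irr _ h := h
  inv_irr _ h := h
  map_step h := by
    classical
    refine h.cases (P := fun a b => (G.smooth j).Flow (G.proj j a.1, a.2)
      (G.proj j b.1, b.2)) (fun s b y hy => ?_) (fun m b y hy => ?_) (fun k y hy => ?_)
      (fun e y => .refl _)
    · have := Trans.step (.split (G := G.smooth j) s b) hy
      cases b <;> exact this
    · have := Trans.step (.merge (G := G.smooth j) m b) hy
      cases b <;> exact this
    · by_cases hk : k = j
      · subst hk; rw [proj_jointOut]; exact .refl _
      · exact Trans.step (.joint (G := G.smooth j) ⟨k, hk⟩) hy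
  inv_step h := by
    refine h.cases (P := fun a b : G.SmoothEdge j × I => G.Flow (a.1.1, a.2) (b.1.1, b.2)) (fun s b y hy => ?_)
      (fun m b y hy => ?_) (fun k y hy => ?_) (fun e y => .refl _)
    · have h1 := Trans.step (.split (G := G) s b) hy
      refine .trans _ _ _ (flow_proj _ (half_irrational.2 hy))
        (.trans _ _ _ h1 (.symm _ _ ?_))
      cases b <;> exact flow_proj _ hy
    · have h1 := Trans.step (.merge (G := G) m b) hy
      refine .trans _ _ _ ?_
        (.trans _ _ _ h1 (.symm _ _ (flow_proj _ (half_irrational.2 hy))))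
      cases b <;> exact flow_proj _ hy
    · exact .trans _ _ _ (flow_proj _ hy) (.trans _ _ _ (Trans.step (.joint k.1) hy)
        (.symm _ _ (flow_proj _ hy)))
  inv_map a ha := flow_proj a.1 ha
  map_inv b _ := by rw [proj_coe]; exact .refl _

/-- The value of a push-forward, if the chain vanishes on the edge entering the joint. -/
lemma pushChain_proj {c : G.E → ℤ} (hc : G.jointIn j ≠ G.jointOut j → c (G.jointIn j) = 0)
    {e : G.E} (he : e = G.jointIn j → G.jointIn j = G.jointOut j) :
    pushChain (G.proj j) c (G.proj j e) = c e := by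
  unfold pushChain
  rw [Finset.sum_eq_single e, ind_self, mul_one]
  · intro x _ hx
    by_cases hxe : G.proj j x = G.proj j e
    · rcases glueProj_eq_iff.1 hxe with h | h | h
      · exact absurd h hx
      · have : c x = 0 := by
          rw [h.1]; refine hc fun h' => hx ?_
          rw [h.1, h.2, h']
        rw [this, zero_mul]
      · exact absurd (h.1.trans ((he h.2).symm.trans h.2.symm)) hx
    · rw [ind_of_ne hxe, mul_zero]
  · exact fun h => absurd (mem_univ e) h

lemma smooth_free {e : G.SmoothEdge j} (he : e ∉ (G.smooth j).tails)
    (hj : ∀ k, (G.smooth j).jointOut k ≠ e) :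
    (e.1 ∉ G.tails ∧ ∀ k, G.jointOut k ≠ e.1) ∨ (e.1 = G.jointOut j ∧ G.jointIn j = G.jointOut j) := by
  by_cases h1 : e.1 ∈ G.tails
  · exact absurd (mem_tails_smooth.2 ⟨_, h1, proj_coe e⟩) he
  · by_cases h2 : ∃ k, G.jointOut k = e.1
    · obtain ⟨k, hk⟩ := h2
      by_cases hkj : k = j
      · subst hkj; exact .inr ⟨hk.symm, e.2 hk.symm⟩
      · exact absurd (show G.proj j (G.jointOut k) = e by rw [hk, proj_coe])
          (hj ⟨k, hkj⟩)
    · push Not at h2; exact .inl ⟨h1, h2⟩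

lemma Colored.smooth (h : G.Colored f) (j : G.J) : (G.smooth j).Colored f := by
  classical
  -- make the cut vanish on the edge entering the joint, so that both edges carry the same map
  obtain ⟨c, T, p, h, hc⟩ : ∃ c T p, G.IsColoring f c T p ∧
      (G.jointIn j ≠ G.jointOut j → c (G.jointIn j) = 0) := by
    obtain ⟨c, T, p, h⟩ := h
    refine ⟨_, _, p, h.gauge (fun _ => 0) (fun _ => 0) (fun k => -c (G.jointIn j) * ind j k), ?_⟩
    intro hne
    have h1 : G.tpot (fun _ => 0) (fun _ => 0) (fun k => -c (G.jointIn j) * ind j k)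
        (G.jointIn j) = 0 := by
      rcases IsColoring.tail_cases (G.jointIn j) with ⟨s, h1⟩ | ⟨s, h1⟩ | ⟨s, h1⟩ | ⟨k, h1⟩ | ⟨h1, h2⟩
      · rw [h1, tpot_splitLeft]
      · rw [h1, tpot_splitRight]
      · rw [h1, tpot_mergeOut]
      · rw [h1, tpot_jointOut, ind_of_ne, mul_zero]; rintro rfl; exact hne h1
      · rw [tpot_of_free h1 h2]
    show c (G.jointIn j) + (G.hpot _ _ _ (G.jointIn j) - G.tpot _ _ _ (G.jointIn j)) = 0
    rw [h1, hpot_jointIn, ind_self]; ring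
  have hT : ∀ e, T (G.proj j e).1 = T e := by
    intro e
    rcases glueProj_val (a := G.jointIn j) (b := G.jointOut j) e with h1 | ⟨h1, h2⟩
    · rw [h1]
    · rw [h2, h1]
      by_cases hne : G.jointIn j = G.jointOut j
      · rw [hne]
      · funext y
        have := h.eq (.joint j) y
        rwa [hc hne, zpow_zero] at this
  have hv : ∀ e, (e = G.jointIn j → G.jointIn j = G.jointOut j) →
      pushChain (G.proj j) c (G.proj j e) = c e := fun e => pushChain_proj hc
  have hin : ∀ e ∈ G.heads, pushChain (G.proj j) c (G.proj j e) = c e := fun e he =>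
    hv e fun h' => absurd h' (head_ne_jointIn j he)
  have F := flowEquivSmooth G j
  refine ⟨pushChain (G.proj j) c, fun e => T e.1, p, ?_⟩
  exact
  { cut := isCut_pushChain j h.cut
    pl := fun e => h.pl e.1
    eq := fun {e u e' v} ht y => by
      cases ht with
      | split s b =>
        have h1 := h.eq (.split (G := G) s b) y
        rw [← hin _ splitIn_mem_heads, ← hT (G.splitIn s), ← hT (G.splitOut s b)] at h1
        cases b <;> exact h1
      | merge m b =>
        have h1 := h.eq (.merge (G := G) m b) y
        rw [← hin _ mergeIn_mem_heads, ← hT (G.mergeIn m b), ← hT (G.mergeOut m)] at h1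
        cases b <;> exact h1
      | joint k =>
        have h1 := h.eq (.joint k.1) y
        rw [← hv _ fun h' => absurd (G.jointIn_injective h') k.2, ← hT (G.jointIn k),
          ← hT (G.jointOut k)] at h1
        exact h1
      | free e he hj =>
        rcases smooth_free he hj with ⟨h1, h2⟩ | ⟨h1, h2⟩
        · have h3 := h.eq (.free e.1 h1 h2) y
          rw [← hv _ (by
            intro h'
            exfalso
            have h4 := (G.closed e.1).2 (.inr ⟨j, h'.symm⟩)
            rcases h4 with h4 | ⟨k, h4⟩
            exacts [h1 h4, h2 k h4]), proj_coe] at h3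
          exact h3
        · have h3 := h.eq (.joint j) y
          rw [← hv _ fun _ => h2, h2, ← h1, proj_coe] at h3
          exact h3
    left := fun e => h.left e.1
    right := fun e => h.right e.1
    inner := h.inner
    outer := h.outer
    inj := (flowEquivSmooth G j).inj h fun a _ => .refl f _
    cov := (flowEquivSmooth G j).cov h fun a _ => .refl f _ }

lemma Colored.of_smooth (h : (G.smooth j).Colored f) : G.Colored f := by
  classical
  obtain ⟨c', T', p, h⟩ := h
  set c : G.E → ℤ := fun e => if e = G.jointIn j ∧ G.jointIn j ≠ G.jointOut j then 0 else
    c' (G.proj j e) with hcdef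
  have hc : G.jointIn j ≠ G.jointOut j → c (G.jointIn j) = 0 := fun h1 => if_pos ⟨rfl, h1⟩
  have hc' : ∀ e, (e = G.jointIn j → G.jointIn j = G.jointOut j) → c e = c' (G.proj j e) :=
    fun e he => if_neg fun h1 => h1.2 (he h1.1)
  have hpush : pushChain (G.proj j) c = c' := by
    funext e
    by_cases he : e.1 = G.jointIn j → G.jointIn j = G.jointOut j
    · rw [← proj_coe e, pushChain_proj hc he, hc' _ he]
    · push Not at he
      rw [← proj_coe e, he.1, ← proj_jointOut, pushChain_proj hc fun h => h.symm,
        hc' _ fun h => h.symm]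
  have hin : ∀ e ∈ G.heads, c e = c' (G.proj j e) := fun e he =>
    hc' e fun h' => absurd h' (head_ne_jointIn j he)
  refine ⟨c, fun e => T' (G.proj j e), p, ?_⟩
  exact
  { cut := fun r => by
      have h1 := h.cut r
      have h2 := @sum_pushChain_mul _ _ _ (G.smooth j).finE (G.proj j) c
        fun e => (G.smooth j).inc e r
      rw [hpush, h1] at h2
      rw [show ∑ e, c e * G.inc e r = ∑ e, c e * (G.smooth j).inc (G.proj j e) r from
        sum_congr rfl fun e _ => by rw [inc_proj]]
      exact h2.symm
    pl := fun e => h.pl _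
    eq := fun {e u e' v} ht y => by
      cases ht with
      | split s b =>
        have h1 := h.eq (.split (G := G.smooth j) s b) y
        rw [hin _ splitIn_mem_heads]
        cases b <;> exact h1
      | merge m b =>
        have h1 := h.eq (.merge (G := G.smooth j) m b) y
        rw [hin _ mergeIn_mem_heads]
        cases b <;> exact h1
      | joint k =>
        by_cases hkj : k = j
        · subst hkj
          by_cases hne : G.jointIn k = G.jointOut k
          · have h1 : G.proj k (G.jointIn k) ∉ (G.smooth k).tails := by
              intro h2
              obtain ⟨a, ha, h3⟩ := mem_tails_smooth.1 h2
              rcases glueProj_eq_iff.1 h3 with h4 | h4 | h4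
              · exact G.jointOut_notMem k (hne ▸ h4 ▸ ha)
              · exact G.jointOut_notMem k (hne ▸ h4.1 ▸ ha)
              · exact G.jointOut_notMem k (h4.1 ▸ ha)
            have h2 : ∀ l, (G.smooth k).jointOut l ≠ G.proj k (G.jointIn k) := by
              intro l h3
              rcases glueProj_eq_iff.1 h3 with h4 | h4 | h4
              · exact l.2 (G.jointOut_injective (h4.trans hne))
              · exact l.2 (G.jointOut_injective (h4.1.trans hne))
              · exact l.2 (G.jointOut_injective h4.1)
            have h3 := h.eq (.free _ h1 h2) y
            rw [hc' _ fun _ => hne, proj_jointOut]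
            exact h3
          · rw [hc hne, proj_jointOut, zpow_zero]; rfl
        · have h1 := h.eq (.joint (G := G.smooth j) ⟨k, hkj⟩) y
          rw [hc' _ fun h' => absurd (G.jointIn_injective h') hkj]
          exact h1
      | free e he hj =>
        have he' : ∀ x, G.proj j x = G.proj j e → x = e ∨ x = G.jointOut j := by
          intro x hx
          rcases glueProj_eq_iff.1 hx with h4 | h4 | h4
          exacts [.inl h4, absurd h4.2.symm (hj j), .inr h4.1]
        have h1 : G.proj j e ∉ (G.smooth j).tails := by
          intro h2
          obtain ⟨a, ha, h3⟩ := mem_tails_smooth.1 h2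
          rcases he' a h3 with rfl | rfl
          exacts [he ha, G.jointOut_notMem j ha]
        have h2 : ∀ l, (G.smooth j).jointOut l ≠ G.proj j e := by
          intro l h3
          rcases he' _ h3 with h4 | h4
          exacts [hj _ h4, l.2 (G.jointOut_injective h4)]
        have h3 := h.eq (.free _ h1 h2) y
        rw [hc' e]
        · exact h3
        · intro h4
          exfalso
          rcases (G.closed e).2 (.inr ⟨j, h4.symm⟩) with h5 | ⟨k, h5⟩
          exacts [he h5, hj k h5]
    left := fun e => by
      rw [← left_proj (j := j)]; exact h.left _
    right := fun e => by
      rw [← right_proj (j := j)]; exact h.right _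
    inner := h.inner
    outer := h.outer
    inj := (flowEquivSmooth G j).symm.inj h fun a _ => .refl f _
    cov := (flowEquivSmooth G j).symm.cov h fun a _ => .refl f _ }

end Smooth

end JointedGraph

namespace AnnularDiagram

/-- The coloring of an annular diagram. -/
abbrev Colored (A : AnnularDiagram) (f : ThompsonF) : Prop := A.jointed.Colored f

/-- Without joints, the two notions of coloring agree. -/
lemma colored_toAnnular {G : JointedGraph} [IsEmpty G.J] (hG : G.Good) :
    (G.toAnnular hG).Colored f ↔ G.Colored f := by
  have h1 : ∀ {e : G.E} {u} {e' : G.E} {v}, G.Trans e u e' v →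
      (G.toAnnular hG).jointed.Trans e u e' v := by
    intro e u e' v h
    cases h with
    | split s b => exact .split (G := (G.toAnnular hG).jointed) s b
    | merge m b => exact .merge (G := (G.toAnnular hG).jointed) m b
    | joint j => exact isEmptyElim j
    | free _ he hj => exact .free (G := (G.toAnnular hG).jointed) _ he fun j => j.elim
  have h2 : ∀ {e u e' v}, (G.toAnnular hG).jointed.Trans e u e' v → G.Trans e u e' v := by
    intro e u e' v h
    cases h with
    | split s b => exact .split (G := G) s b
    | merge m b => exact .merge (G := G) m b
    | joint j => exact j.elim
    | free _ he hj => exact .free (G := G) _ he fun j => isEmptyElim j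
  have ht : ∀ {e u e' v}, (G.toAnnular hG).jointed.Trans e u e' v ↔ G.Trans e u e' v :=
    ⟨h2, h1⟩
  have hs : (G.toAnnular hG).jointed.Flow = G.Flow := by
    unfold JointedGraph.Flow
    congr 1
    funext a b
    unfold Step
    simp only [ht]
  constructor
  · rintro ⟨c, T, p, h⟩
    exact ⟨c, T, p, ⟨h.cut, h.pl, fun h' => h.eq (ht.2 h'), h.left, h.right, h.inner, h.outer,
      hs ▸ h.inj, h.cov⟩⟩
  · rintro ⟨c, T, p, h⟩
    exact ⟨c, T, p, ⟨h.cut, h.pl, fun h' => h.eq (ht.1 h'), h.left, h.right, h.inner, h.outer,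
      hs ▸ h.inj, h.cov⟩⟩

end AnnularDiagram

/-- The first binary digit of a number in the unit interval. -/
def digit (y : I) : Bool := (exists_half y).choose

/-- A number in the unit interval without its first binary digit. -/
def shift (y : I) : I := (exists_half y).choose_spec.choose

lemma half_digit_shift (y : I) : half (digit y) (shift y) = y :=
  (exists_half y).choose_spec.choose_spec.symm

lemma digit_half {b : Bool} {y : I} (hy : Irr y) : digit (half b y) = b :=
  (half_inj hy (half_digit_shift (half b y)).symm).1.symm

lemma shift_half {b : Bool} {y : I} (hy : Irr y) : shift (half b y) = y :=
  (half_inj hy (half_digit_shift (half b y)).symm).2.symm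

lemma shift_irr {y : I} (hy : Irr y) : Irr (shift y) := by
  rw [← half_digit_shift y] at hy; exact half_irrational.1 hy

namespace JointedGraph.IsColoring

variable {G : JointedGraph} {f : ThompsonF} {c : G.E → ℤ} {T : G.E → I → I} {p : G.R → I}

/-- Trajectories that meet just below a common point of two edges. -/
lemma exists_flow_below (h : G.IsColoring f c T p) {e e' : G.E} {y y' : I} (hy : 0 < y)
    (hy' : 0 < y') (ho : Orb f (T e y) (T e' y')) :
    ∃ z z' : I, Irr z ∧ Irr z' ∧ z < y ∧ z' < y' ∧ G.Flow (e, z) (e', z') := by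
  obtain ⟨k, hk⟩ := ho
  have h1 := isPL_zpow f k (h.pl e')
  obtain ⟨z, z', hz, hz', hzz, h2, h3⟩ := (h.pl e).exists_common h1
    (max_lt (h.strictMono e hy) (hk ▸ h1.strictMono' hy')) (le_max_left _ _) le_rfl
    (le_max_right _ _) hk.le
  exact ⟨z, z', hz, hz', (h.strictMono e).lt_iff_lt.1 h3,
    h1.strictMono'.lt_iff_lt.1 (hzz ▸ hk ▸ h3), h.inj _ _ _ _ hz hz' ⟨k, hzz⟩⟩

/-- Trajectories that meet just above a common point of two edges. -/
lemma exists_flow_above (h : G.IsColoring f c T p) {e e' : G.E} {y y' : I} (hy : y < 1)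
    (hy' : y' < 1) (ho : Orb f (T e y) (T e' y')) :
    ∃ z z' : I, Irr z ∧ Irr z' ∧ y < z ∧ y' < z' ∧ G.Flow (e, z) (e', z') := by
  obtain ⟨k, hk⟩ := ho
  have h1 := isPL_zpow f k (h.pl e')
  obtain ⟨z, z', hz, hz', hzz, h2, h3⟩ := (h.pl e).exists_common h1
    (lt_min (h.strictMono e hy) (hk ▸ h1.strictMono' hy')) le_rfl (min_le_left _ _) hk.ge
    (min_le_right _ _)
  exact ⟨z, z', hz, hz', (h.strictMono e).lt_iff_lt.1 h2,
    h1.strictMono'.lt_iff_lt.1 (hzz ▸ hk ▸ h2), h.inj _ _ _ _ hz hz' ⟨k, hzz⟩⟩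

end JointedGraph.IsColoring

lemma half_false_one_pos : (0 : I) < half false 1 := by
  show (0 : ℝ) < half false 1
  rw [half_false_coe]; norm_num

lemma half_false_one_lt : half false 1 < (1 : I) := by
  show (half false 1 : ℝ) < 1
  rw [half_false_coe]; norm_num

namespace AnnularDiagram

variable {A : AnnularDiagram} {m : A.M} {s : A.S} {h : A.mergeOut m = A.splitIn s}

/-! ### Colorings and reductions of type I -/

section CutI

open Classical in
/-- Cutting out a merge followed by a split does not change the trajectories. -/
def flowEquivCutI {A : AnnularDiagram} {m : A.M} {s : A.S}
    (h : A.mergeOut m = A.splitIn s) :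
    FlowEquiv A.jointed (A.cutI h) where
  map a := if ha : a.1 ≠ A.mergeOut m then (⟨a.1, ha⟩, a.2) else
    ((A.cutI h).jointOut (digit a.2), shift a.2)
  inv b := (b.1.1, b.2)
  map_irr a ha := by
    dsimp only
    split_ifs
    exacts [ha, shift_irr ha]
  inv_irr _ h := h
  map_step hab := by
    have hn : ∀ (e : A.E) (he : e ≠ A.mergeOut m) (y : I),
        (if ha : e ≠ A.mergeOut m then ((⟨e, ha⟩ : (A.cutI h).E), y) else
          ((A.cutI h).jointOut (digit y), shift y)) = ((⟨e, he⟩ : (A.cutI h).E), y) :=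
      fun e he y => dif_pos he
    have hx : ∀ (e : A.E) (he : e = A.mergeOut m) (b : Bool) (y : I), Irr y →
        (if ha : e ≠ A.mergeOut m then ((⟨e, ha⟩ : (A.cutI h).E), half b y) else
          ((A.cutI h).jointOut (digit (half b y)), shift (half b y))) =
          ((A.cutI h).jointOut b, y) := by
      intro e he b y hy
      rw [dif_neg (not_not.2 he), digit_half hy, shift_half hy]
    refine hab.cases (P := fun a b : A.E × I => (A.cutI h).Flow
      (if ha : a.1 ≠ A.mergeOut m then (⟨a.1, ha⟩, a.2) else
        ((A.cutI h).jointOut (digit a.2), shift a.2))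
      (if ha : b.1 ≠ A.mergeOut m then (⟨b.1, ha⟩, b.2) else
        ((A.cutI h).jointOut (digit b.2), shift b.2))) (fun t b y hy => ?_) (fun n b y hy => ?_)
      (fun j => j.elim) (fun e y => .refl _)
    · dsimp only
      rw [hn _ (splitOut_ne_mergeOut)]
      by_cases hts : t = s
      · subst hts; rw [hx _ h.symm _ _ hy]; exact .refl _
      · rw [hn _ (A.splitIn_ne_mergeOut h hts)]
        have := Trans.step (.split (G := A.cutI h) ⟨t, hts⟩ b) hy
        cases b <;> exact this
    · dsimp only
      rw [hn _ (A.mergeIn_ne_mergeOut h n b)]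
      by_cases hnm : n = m
      · subst hnm
        rw [hx _ rfl _ _ hy]
        exact Trans.step (.joint (G := A.cutI h) b) hy
      · rw [hn _ fun h' => hnm (mergeOut_injective h')]
        have := Trans.step (.merge (G := A.cutI h) ⟨n, hnm⟩ b) hy
        cases b <;> exact this
  inv_step hab := by
    refine hab.cases (P := fun a b : (A.cutI h).E × I => A.jointed.Flow (a.1.1, a.2) (b.1.1, b.2))
      (fun t b y hy => ?_) (fun n b y hy => ?_) (fun b y hy => ?_) (fun e y => .refl _)
    · have := Trans.step (.split (G := A.jointed) t.1 b) hy
      cases b <;> exact this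
    · have := Trans.step (.merge (G := A.jointed) n.1 b) hy
      cases b <;> exact this
    · have h1 := Trans.step (.merge (G := A.jointed) m b) hy
      have h2 := Trans.step (.split (G := A.jointed) s b) hy
      rw [← show A.jointed.mergeOut m = A.jointed.splitIn s from h] at h2
      exact .trans _ _ _ h1 h2
  inv_map a ha := by
    by_cases hx : a.1 = A.mergeOut m
    · rw [dif_neg (not_not.2 hx)]
      have h2 := Trans.step (.split (G := A.jointed) s (digit a.2)) (shift_irr ha)
      rw [half_digit_shift, ← show A.jointed.mergeOut m = A.jointed.splitIn s from h, ← hx] at h2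
      exact .symm _ _ h2
    · rw [dif_pos hx]; exact .refl _
  map_inv b _ := by
    rw [dif_pos b.1.2]; exact .refl _

lemma exists_isCut_mergeOut (h : A.mergeOut m = A.splitIn s) :
    ∃ c, A.jointed.IsCut c ∧ c (A.mergeOut m) = 0 := by
  obtain ⟨c₀, c, -, hc, hc0, -⟩ :=
    A.exists_cut (fun c t => -c (A.mergeOut m) * ind s t) fun _ _ => 0
  refine ⟨c, hc, ?_⟩
  rw [hc0, tailPot_mergeOut, h, headPot_splitIn, ind_self]; ring

lemma free_cutI {e : (A.cutI h).E} :
    (e ∉ (A.cutI h).tails ∧ ∀ j, (A.cutI h).jointOut j ≠ e) ↔ e.1 ∉ A.tails := by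
  rw [← mem_tails_cutI A h e, not_or, not_exists]
  simp only [Subtype.ext_iff, ne_eq]

lemma Colored.cutI (hA : A.Colored f) (h : A.mergeOut m = A.splitIn s) :
    (A.cutI h).Colored f := by
  obtain ⟨c, hc, hx⟩ := exists_isCut_mergeOut h
  obtain ⟨c', T', p, h'⟩ := hA
  obtain ⟨T, hT⟩ := h'.exists_of_isCut A.good_jointed hc
  have hx' : c (A.splitIn s) = 0 := h ▸ hx
  have hsp : ∀ b y, T (A.mergeOut m) (half b y) = T (A.splitOut s b) y := fun b y => by
    have h1 := hT.eq (.split (G := A.jointed) s b) y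
    rw [show c (A.jointed.splitIn s) = 0 from hx', zpow_zero] at h1
    rw [h]; exact h1
  have hpp : ∀ r, Orb f (p (glueProj (A.right (A.mergeLeft m)) (A.right (A.splitLeft s)) r).1)
      (p r) := by
    intro r
    rcases glueProj_val (a := A.right (A.mergeLeft m)) (b := A.right (A.splitLeft s)) r with
      h1 | ⟨h1, h2⟩
    · rw [h1]; exact Orb.refl f _
    · rw [h2, h1]
      have h3 := hT.orb_of_trans (.merge (G := A.jointed) m false) 1
      have h4 : Orb f (T (A.mergeOut m) (half false 1)) (T (A.splitLeft s) 1) :=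
        Orb.of_eq (hsp false 1)
      exact ((hT.right (A.mergeLeft m)).symm.trans h3).trans (h4.trans (hT.right (A.splitLeft s)))
  refine ⟨fun e => c e.1, fun e => T e.1, fun r => p r.1, ?_⟩
  exact
  { cut := isCut_cutI hc hx
    pl := fun e => hT.pl e.1
    eq := fun {e u e' v} ht y => by
      cases ht with
      | split t b =>
        have h1 := hT.eq (.split (G := A.jointed) t.1 b) y
        cases b <;> exact h1
      | merge n b =>
        have h1 := hT.eq (.merge (G := A.jointed) n.1 b) y
        cases b <;> exact h1
      | joint b =>
        have h1 := hT.eq (.merge (G := A.jointed) m b) y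
        exact h1.trans (hsp b y)
      | free e he hj =>
        exact hT.eq (.free (G := A.jointed) e.1 (free_cutI.1 ⟨he, hj⟩) fun j => j.elim) y
    left := fun e => (hT.left e.1).trans (hpp _).symm
    right := fun e => (hT.right e.1).trans (hpp _).symm
    inner := Orb.eq_one ((hpp _).trans (Orb.of_eq hT.inner))
    outer := Orb.eq_zero ((hpp _).trans (Orb.of_eq hT.outer))
    inj := (flowEquivCutI h).inj hT fun a _ => .refl f _
    cov := (flowEquivCutI h).cov hT fun a _ => .refl f _ }

/-- The intervals carried by the two strands of a cut-out merge and split are adjacent, if the region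
above the merge and the region below the split are the same: otherwise the
strand between the merge and the split would separate the trajectories just below and just
above the end point of the left interval. -/
lemma adjacent_of_right_eq {c : (A.cutI h).E → ℤ} {T : (A.cutI h).E → I → I}
    {p : (A.cutI h).R → I} (hT : (A.cutI h).IsColoring f c T p)
    (hr : A.right (A.mergeLeft m) = A.right (A.splitLeft s))
    (hO : Orb f (T ((A.cutI h).jointOut true) 0) (T ((A.cutI h).jointOut false) 1))
    (hfix : f.1 (T ((A.cutI h).jointOut false) 1) ≠ T ((A.cutI h).jointOut false) 1) : False := by
  have hl : A.left (A.mergeLeft m) = A.left (A.splitLeft s) := by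
    rw [← (A.merge_corners m).1, h, (A.split_corners s).1]
  -- the curve crossing the left strand above the merge and below the split bounds a disc
  obtain ⟨φ, ψ, hφ⟩ := A.exists_coboundary
    (c := fun e => ind (A.mergeLeft m) e - ind (A.splitLeft s) e) fun r => by
      simp only [sub_mul, sum_sub_distrib, sum_ind_mul]
      unfold inc
      rw [hl, hr]; ring
  have hs : φ s = ψ m := by
    have h2 := hφ (A.mergeOut m)
    have h3 : A.headPot φ ψ (A.mergeOut m) = φ s := by rw [h, headPot_splitIn]
    rw [tailPot_mergeOut, h3,
      ind_of_ne (show A.mergeLeft m ≠ _ from A.mergeIn_ne_mergeOut h m false),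
      ind_of_ne splitLeft_ne_mergeOut] at h2
    linarith
  have hin : ∀ n b, A.headPot φ ψ (A.mergeIn n b) = ψ n := fun n b => by
    cases b
    exacts [headPot_mergeLeft n, headPot_mergeRight n]
  have hout : ∀ t b, A.tailPot φ ψ (A.splitOut t b) = φ t := fun t b => by
    cases b
    exacts [tailPot_splitLeft t, tailPot_splitRight t]
  -- the label of a point is the winding number of this curve; it is constant on trajectories
  set lab : A.E → ℤ := fun e => A.tailPot φ ψ e - ind (A.splitLeft s) e with hlab
  have hlab' : ∀ e, lab e = A.headPot φ ψ e - ind (A.mergeLeft m) e := fun e => by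
    have := hφ e
    simp only [hlab]; linarith
  have hinv : ∀ a b, (A.cutI h).Flow a b → lab a.1.1 = lab b.1.1 := fun _ _ hab => by
    refine eq_of_eqvGen (r := (A.cutI h).Step) (F := fun a => lab a.1.1) (fun a b hab => ?_) hab
    refine hab.cases (G := A.cutI h) (P := fun a b => lab a.1.1 = lab b.1.1) (fun t b y hy => ?_)
      (fun n b y hy => ?_) (fun b y hy => ?_) (fun e y => rfl)
    · have h2 : A.splitLeft s ≠ A.splitOut t.1 b := fun h' => t.2 (splitOut_inj (b := false).1 h').1.symm
      have e1 : ((A.cutI h).splitOut t b).1 = A.splitOut t.1 b := by cases b <;> rfl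
      show lab (A.splitIn t.1) = lab ((A.cutI h).splitOut t b).1
      rw [hlab', e1, headPot_splitIn, hlab]
      beta_reduce
      rw [hout, ind_of_ne splitIn_ne_mergeLeft.symm, ind_of_ne h2]
    · have h1 : A.mergeLeft m ≠ A.mergeIn n.1 b := fun h' => n.2 (mergeIn_inj (b := false).1 h').1.symm
      have e1 : ((A.cutI h).mergeIn n b).1 = A.mergeIn n.1 b := by cases b <;> rfl
      show lab ((A.cutI h).mergeIn n b).1 = lab (A.mergeOut n.1)
      rw [hlab', e1, hin, hlab]
      beta_reduce
      rw [tailPot_mergeOut, ind_of_ne h1, ind_of_ne splitLeft_ne_mergeOut]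
    · show lab (A.mergeIn m b) = lab (A.splitOut s b)
      rw [hlab', hin, hlab]
      beta_reduce
      rw [hout, hs]
      cases b
      · exact congrArg _ ((ind_self _).trans (ind_self _).symm)
      · exact congrArg _ ((ind_of_ne mergeLeft_ne_mergeRight).trans
          (ind_of_ne splitLeft_ne_splitRight).symm)
  obtain ⟨t, -, ht⟩ := hT.exists_split good_cutI hfix
  obtain ⟨z₁, z₁', -, -, -, -, h1⟩ := hT.exists_flow_below one_pos half_false_one_pos ht
  obtain ⟨z₂, z₂', -, -, -, -, h2⟩ := hT.exists_flow_above one_pos half_false_one_lt (hO.trans ht)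
  have h3 : A.tailPot φ ψ (A.splitOut s false) - ind (A.splitLeft s) (A.splitOut s false) =
      A.tailPot φ ψ (A.splitOut s true) - ind (A.splitLeft s) (A.splitOut s true) :=
    (hinv _ _ h1).trans (hinv _ _ h2).symm
  rw [hout, hout, show A.splitOut s false = A.splitLeft s from rfl,
    show A.splitOut s true = A.splitRight s from rfl, ind_self,
    ind_of_ne splitLeft_ne_splitRight] at h3
  omega

end CutI

end AnnularDiagram

namespace StrandGraph

/-- Summing the heights of the two ends of the edges around a region: if heights are respected in
all corners except possibly the lower corners above a merge, the total defect in these corners is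
the number of times that the region is wound around by the chain `c`. Here `h0 e` and `h1 e` are the
heights of the left and the right of the starting point of the edge `e`. -/
lemma sum_mul_inc_eq_sum_defect (G : StrandGraph) (hth : G.tails = G.heads) (r : G.R)
    (c h0 h1 : G.E → ℤ)
    (hsl : ∀ s, G.left (G.splitIn s) = r → h0 (G.splitIn s) + c (G.splitIn s) = h0 (G.splitLeft s))
    (hsr : ∀ s, G.right (G.splitIn s) = r →
      h1 (G.splitIn s) + c (G.splitIn s) = h1 (G.splitRight s))
    (hsm : ∀ s, G.right (G.splitLeft s) = r → h1 (G.splitLeft s) = h0 (G.splitRight s))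
    (hml : ∀ m, G.left (G.mergeOut m) = r →
      h0 (G.mergeLeft m) + c (G.mergeLeft m) = h0 (G.mergeOut m))
    (hmr : ∀ m, G.right (G.mergeOut m) = r →
      h1 (G.mergeRight m) + c (G.mergeRight m) = h1 (G.mergeOut m))
    (hfree : ∀ e, e ∉ G.tails → G.left e ≠ r ∧ G.right e ≠ r) :
    ∑ e, c e * G.inc e r = ∑ m, ind (G.right (G.mergeLeft m)) r *
      (h0 (G.mergeRight m) + c (G.mergeRight m) - (h1 (G.mergeLeft m) + c (G.mergeLeft m))) := by
  have hmul : ∀ {r' : G.R} {x y : ℤ}, (r' = r → x = y) → ind r' r * x = ind r' r * y := by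
    intro r' x y hxy
    by_cases hr : r' = r
    · rw [hxy hr]
    · rw [ind_of_ne hr, zero_mul, zero_mul]
  set B : G.E → ℤ := fun e => ind (G.left e) r * (h0 e + c e) - ind (G.right e) r * (h1 e + c e)
    with hB
  set U : G.E → ℤ := fun e => ind (G.left e) r * h0 e - ind (G.right e) r * h1 e with hU
  have e0 : ∑ e, c e * G.inc e r = ∑ e, B e - ∑ e, U e := by
    rw [← sum_sub_distrib]
    refine sum_congr rfl fun e _ => ?_
    simp only [hB, hU, inc]; ring
  have e1 : ∑ e, B e = ∑ e, G.headPot (fun _ => 1) (fun _ => 1) e * B e := by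
    refine sum_congr rfl fun e _ => ?_
    by_cases he : e ∈ G.heads
    · rcases mem_heads.1 he with ⟨s, rfl⟩ | ⟨s, rfl⟩ | ⟨s, rfl⟩ <;>
        simp [headPot_splitIn, headPot_mergeLeft, headPot_mergeRight]
    · obtain ⟨h2, h3⟩ := hfree e (hth ▸ he)
      simp [hB, ind_of_ne h2, ind_of_ne h3]
  have e2 : ∑ e, U e = ∑ e, G.tailPot (fun _ => 1) (fun _ => 1) e * U e := by
    refine sum_congr rfl fun e _ => ?_
    by_cases he : e ∈ G.tails
    · rcases mem_tails.1 he with ⟨s, rfl⟩ | ⟨s, rfl⟩ | ⟨s, rfl⟩ <;>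
        simp [tailPot_splitLeft, tailPot_splitRight, tailPot_mergeOut]
    · obtain ⟨h2, h3⟩ := hfree e he
      simp [hU, ind_of_ne h2, ind_of_ne h3]
  have e3 : ∀ s, B (G.splitIn s) = U (G.splitLeft s) + U (G.splitRight s) := by
    intro s
    obtain ⟨c1, c2, c3⟩ := G.split_corners s
    simp only [hB, hU]
    rw [hmul (hsl s), hmul (hsr s), hmul (hsm s), c1, c2, c3]; ring
  have e4 : ∀ m, B (G.mergeLeft m) + B (G.mergeRight m) = U (G.mergeOut m) +
      ind (G.right (G.mergeLeft m)) r * (h0 (G.mergeRight m) + c (G.mergeRight m) -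
        (h1 (G.mergeLeft m) + c (G.mergeLeft m))) := by
    intro m
    obtain ⟨c1, c2, c3⟩ := G.merge_corners m
    simp only [hB, hU]
    rw [← hmul (hml m), ← hmul (hmr m), c1, c2, ← c3]; ring
  rw [e0, e1, e2, sum_headPot_mul, sum_tailPot_mul]
  simp only [one_mul, e3, e4, sum_add_distrib]
  ring

end StrandGraph

namespace AnnularDiagram

variable {A : AnnularDiagram} {m : A.M} {s : A.S}

/-- The intervals carried by the two strands of a cut-out merge and split are adjacent. -/
lemma adjacent_cutI {h : A.mergeOut m = A.splitIn s} {c : A.E → ℤ}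
    {T : (A.cutI h).E → I → I}
    {p : (A.cutI h).R → I} (hc : A.jointed.IsCut c) (h0 : c (A.mergeOut m) = 0)
    (hT : (A.cutI h).IsColoring f (fun e => c e.1) T p) :
    T ((A.cutI h).jointOut false) 1 = T ((A.cutI h).jointOut true) 0 := by
  classical
  set q := T ((A.cutI h).jointOut false) 1 with hq
  set r1 := A.right (A.mergeLeft m) with hr1
  set r2 := A.right (A.splitLeft s) with hr2
  have hq2 : r2 = A.left (A.splitRight s) := (A.split_corners s).2.1
  have ho1 : Orb f q (p (glueProj r1 r2 r1)) := by
    have h1 := hT.right ((A.cutI h).jointOut false)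
    rwa [show (A.cutI h).right ((A.cutI h).jointOut false) = glueProj r1 r2 r1 from
      glueProj_right] at h1
  have ho2 : Orb f (T ((A.cutI h).jointOut true) 0) (p (glueProj r1 r2 r1)) := by
    have h1 := hT.left ((A.cutI h).jointOut true)
    rwa [show (A.cutI h).left ((A.cutI h).jointOut true) = glueProj r1 r2 r1 from
      (congrArg (glueProj r1 r2) hq2.symm).trans glueProj_right] at h1
  by_cases hfix : f.1 q = q
  · exact ((ho2.trans ho1.symm).eq_of_fix hfix).symm
  by_cases hr : r1 = r2
  · exact (adjacent_of_right_eq hT hr (ho2.trans ho1.symm) hfix).elim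
  by_contra hne
  have hnf : f.1 (p (glueProj r1 r2 r1)) ≠ p (glueProj r1 r2 r1) := fun h' => hfix (ho1.fix h')
  -- the heights of the points of the orbit of `q`
  set ht : I → ℤ := fun z => if hz : Orb f z q then hz.choose else 0 with hht
  have htq : ∀ z, Orb f z q → z = (f.1 ^ ht z) q := fun z hz => by
    simp only [hht, dif_pos hz]; exact hz.choose_spec
  have ht1 : ∀ (k : ℤ) (z z' : I), Orb f z q → (f.1 ^ k) z = z' → ht z + k = ht z' := by
    intro k z z' hz hzz
    have hz' : Orb f z' q := (show Orb f z' z from ⟨k, hzz.symm⟩).trans hz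
    refine zpow_injective_of_not_fix hfix ?_
    rw [← htq z' hz', ← hzz, add_comm, orderIso_zpow_add, ← htq z hz]
  -- the intervals at the top of the edges
  set z0 : A.E → I := fun e => if he : e ≠ A.mergeOut m then T ⟨e, he⟩ 0 else
    T ((A.cutI h).jointOut false) 0 with hz0
  set z1 : A.E → I := fun e => if he : e ≠ A.mergeOut m then T ⟨e, he⟩ 1 else
    T ((A.cutI h).jointOut true) 1 with hz1
  have z0e : ∀ (e : A.E) (he : e ≠ A.mergeOut m), z0 e = T ⟨e, he⟩ 0 := fun e he => dif_pos he
  have z1e : ∀ (e : A.E) (he : e ≠ A.mergeOut m), z1 e = T ⟨e, he⟩ 1 := fun e he => dif_pos he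
  have z0x : z0 (A.mergeOut m) = T ((A.cutI h).jointOut false) 0 := dif_neg (not_not.2 rfl)
  have z1x : z1 (A.mergeOut m) = T ((A.cutI h).jointOut true) 1 := dif_neg (not_not.2 rfl)
  have horb : ∀ {z : I} {r : A.R}, Orb f z (p (glueProj r1 r2 r)) → r = r1 → Orb f z q := by
    rintro z _ h1 rfl; exact h1.trans ho1.symm
  have o0 : ∀ e, A.left e = r1 → Orb f (z0 e) q := by
    intro e
    by_cases he : e = A.mergeOut m
    · rw [he, z0x, (A.merge_corners m).1]
      refine horb ((hT.left _).trans (Orb.of_eq ?_))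
      rw [← (A.merge_corners m).1, h, (A.split_corners s).1]; rfl
    · rw [z0e e he]
      exact horb (hT.left ⟨e, he⟩)
  have o1 : ∀ e, A.right e = r1 → Orb f (z1 e) q := by
    intro e
    by_cases he : e = A.mergeOut m
    · rw [he, z1x, h, ← (A.split_corners s).2.2]
      exact horb (hT.right ((A.cutI h).jointOut true))
    · rw [z1e e he]
      exact horb (hT.right ⟨e, he⟩)
  have hin : r1 ≠ A.inner := by
    intro h1
    refine hnf ?_
    rw [(congrArg (fun r => p (glueProj r1 r2 r)) h1).trans hT.inner, Orb.map_one]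
  have hout : r1 ≠ A.outer := by
    intro h1
    refine hnf ?_
    rw [(congrArg (fun r => p (glueProj r1 r2 r)) h1).trans hT.outer, Orb.map_zero]
  have hsplit : ∀ t b, A.splitOut t b ≠ A.mergeOut m := fun _ _ => splitOut_ne_mergeOut
  have hmerge : ∀ n b, A.mergeIn n b ≠ A.mergeOut m := A.mergeIn_ne_mergeOut h
  have hjoint : ∀ b y, (f.1 ^ c (A.mergeIn m b)) (T ⟨A.mergeIn m b, hmerge m b⟩ y) =
      T ((A.cutI h).jointOut b) y := fun b y => hT.eq (.joint (G := A.cutI h) b) y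
  have hsp : ∀ t (hts : t ≠ s) b y, (f.1 ^ c (A.splitIn t))
      (T ⟨A.splitIn t, A.splitIn_ne_mergeOut h hts⟩ (half b y)) =
      T ⟨A.splitOut t b, hsplit t b⟩ y := by
    intro t hts b y
    have := hT.eq (.split (G := A.cutI h) ⟨t, hts⟩ b) y
    cases b <;> exact this
  have hme : ∀ n (hnm : n ≠ m) b y, (f.1 ^ c (A.mergeIn n b))
      (T ⟨A.mergeIn n b, hmerge n b⟩ y) =
      T ⟨A.mergeOut n, fun h' => hnm (mergeOut_injective h')⟩ (half b y) := by
    intro n hnm b y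
    have := hT.eq (.merge (G := A.cutI h) ⟨n, hnm⟩ b) y
    cases b <;> exact this
  have key := A.sum_mul_inc_eq_sum_defect A.tails_eq_heads r1 c (fun e => ht (z0 e))
    (fun e => ht (z1 e)) ?_ ?_ ?_ ?_ ?_ ?_
  · have h1 : ∑ e, c e * A.inc e r1 = 0 := by
      rw [show ∑ e, c e * A.inc e r1 = ind A.outer r1 - ind A.inner r1 from hc r1,
        ind_of_ne hin.symm, ind_of_ne hout.symm, sub_self]
    rw [h1, Finset.sum_eq_single_of_mem m (mem_univ _)] at key
    · have e1 : z1 (A.mergeLeft m) = T ⟨A.mergeLeft m, hmerge m false⟩ 1 := z1e _ _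
      have e2 : z0 (A.mergeRight m) = T ⟨A.mergeRight m, hmerge m true⟩ 0 := z0e _ _
      rw [ind_self, one_mul, ht1 (c (A.mergeLeft m)) _ _ (o1 _ rfl) ((congrArg _ e1).trans (hjoint false 1)),
        ht1 (c (A.mergeRight m)) _ _ (o0 _ (A.merge_corners m).2.1.symm)
          ((congrArg _ e2).trans (hjoint true 0))] at key
      rw [htq q (Orb.refl f q), htq _ (ho2.trans ho1.symm)] at hne
      exact hne (by rw [show ht q = ht (T ((A.cutI h).jointOut true) 0) by linarith])
    · intro n _ hnm
      by_cases hrn : A.right (A.mergeLeft n) = r1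
      · have e1 : z1 (A.mergeLeft n) = T ⟨A.mergeLeft n, hmerge n false⟩ 1 := z1e _ _
        have e2 : z0 (A.mergeRight n) = T ⟨A.mergeRight n, hmerge n true⟩ 0 := z0e _ _
        rw [ht1 (c (A.mergeLeft n)) _ _ (o1 _ hrn) ((congrArg _ e1).trans (hme n hnm false 1)),
          ht1 (c (A.mergeRight n)) _ _ (o0 _ ((A.merge_corners n).2.1 ▸ hrn))
            ((congrArg _ e2).trans (hme n hnm true 0)),
          half_false_one, sub_self, mul_zero]
      · rw [ind_of_ne hrn, zero_mul]
  · intro t htr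
    refine ht1 _ _ _ (o0 _ htr) ?_
    rw [z0e (A.splitLeft t) (hsplit t false)]
    by_cases hts : t = s
    · subst hts
      rw [← h, h0, z0x]; rfl
    · rw [z0e _ (A.splitIn_ne_mergeOut h hts)]
      have h1 := hsp t hts false 0
      rw [half_false_zero] at h1
      exact h1
  · intro t htr
    refine ht1 _ _ _ (o1 _ htr) ?_
    rw [z1e (A.splitRight t) (hsplit t true)]
    by_cases hts : t = s
    · subst hts
      rw [← h, h0, z1x]; rfl
    · rw [z1e _ (A.splitIn_ne_mergeOut h hts)]
      have h1 := hsp t hts true 1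
      rw [half_true_one] at h1
      exact h1
  · intro t htr
    by_cases hts : t = s
    · subst hts
      exact absurd htr.symm hr
    · have h1 := hsp t hts false 1
      rw [half_false_one] at h1
      have h2 := h1.symm.trans (hsp t hts true 0)
      show ht _ = ht _
      rw [z1e (A.splitLeft t) (hsplit t false), z0e (A.splitRight t) (hsplit t true)]
      exact congrArg ht h2
  · intro n hnr
    refine ht1 _ _ _ (o0 _ ((A.merge_corners n).1 ▸ hnr)) ?_
    rw [z0e (A.mergeLeft n) (hmerge n false)]
    by_cases hnm : n = m
    · subst hnm
      rw [z0x]; exact hjoint false 0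
    · rw [z0e _ fun h' => hnm (mergeOut_injective h')]
      have h1 := hme n hnm false 0
      rw [half_false_zero] at h1
      exact h1
  · intro n hnr
    refine ht1 _ _ _ (o1 _ ((A.merge_corners n).2.2.symm ▸ hnr)) ?_
    rw [z1e (A.mergeRight n) (hmerge n true)]
    by_cases hnm : n = m
    · subst hnm
      rw [z1x]; exact hjoint true 1
    · rw [z1e _ fun h' => hnm (mergeOut_injective h')]
      have h1 := hme n hnm true 1
      rw [half_true_one] at h1
      exact h1
  · intro e he
    have hex : e ≠ A.mergeOut m := by rintro rfl; exact he mergeOut_mem_tails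
    have h1 := (free_cutI (h := h) (e := ⟨e, hex⟩)).2 he
    have h2 := hT.fix_of_free good_cutI h1.1 h1.2
    refine ⟨fun h3 => hfix ?_, fun h3 => hfix ?_⟩
    · have h4 := o0 e h3
      rw [z0e e hex] at h4
      exact h4.symm.fix (h2 0)
    · have h4 := o1 e h3
      rw [z1e e hex] at h4
      exact h4.symm.fix (h2 1)

open Classical in
lemma Colored.of_cutI {h : A.mergeOut m = A.splitIn s}
    (hA : (A.cutI h).Colored f) : A.Colored f := by
  obtain ⟨c, hc, h0⟩ := exists_isCut_mergeOut h
  obtain ⟨c', T', p, h'⟩ := hA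
  obtain ⟨T, hT⟩ := h'.exists_of_isCut good_cutI (isCut_cutI hc h0)
  obtain ⟨k, hk0, hk1⟩ := exists_glue (adjacent_cutI hc h0 hT)
  set U : A.E → I → I := fun e y => if he : e ≠ A.mergeOut m then T ⟨e, he⟩ y else k y with hU
  have hUe : ∀ (e : A.E) (he : e ≠ A.mergeOut m), U e = T ⟨e, he⟩ := fun e he =>
    funext fun y => dif_pos he
  have hUx : U (A.mergeOut m) = k := funext fun y => dif_neg (not_not.2 rfl)
  have hk : ∀ b y, k (half b y) = T ((A.cutI h).jointOut b) y := fun b y => by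
    cases b; exacts [hk0 y, hk1 y]
  have h0' : c (A.splitIn s) = 0 := h ▸ h0
  have horb : ∀ a : A.E × I, U a.1 a.2 =
      T ((flowEquivCutI h).map a).1 ((flowEquivCutI h).map a).2 := fun a => by
    by_cases ha : a.1 = A.mergeOut m
    · rw [show (flowEquivCutI h).map a = ((A.cutI h).jointOut (digit a.2), shift a.2) from
        dif_neg (not_not.2 ha), ha, hUx]
      conv_lhs => rw [← half_digit_shift a.2]
      exact hk _ _
    · rw [show (flowEquivCutI h).map a = (⟨a.1, ha⟩, a.2) from dif_pos ha, hUe _ ha]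
  refine ⟨c, U, fun r => p (glueProj _ _ r), ?_⟩
  exact
  { cut := hc
    pl := fun e => by
      by_cases he : e = A.mergeOut m
      · rw [he, hUx]
        refine .glue _ ?_ ?_
        · simp only [hk]; exact hT.pl _
        · simp only [hk]; exact hT.pl _
      · rw [hUe e he]; exact hT.pl _
    eq := fun {e u e' v} ht y => by
      cases ht with
      | split t b =>
        show (f.1 ^ c (A.splitIn t)) (U (A.splitIn t) (half b y)) = U (A.splitOut t b) y
        rw [hUe _ (splitOut_ne_mergeOut)]
        by_cases hts : t = s
        · subst hts
          rw [h0', ← h, hUx, hk]; rfl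
        · rw [hUe _ (A.splitIn_ne_mergeOut h hts)]
          have := hT.eq (.split (G := A.cutI h) ⟨t, hts⟩ b) y
          cases b <;> exact this
      | merge n b =>
        show (f.1 ^ c (A.mergeIn n b)) (U (A.mergeIn n b) y) = U (A.mergeOut n) (half b y)
        rw [hUe _ (A.mergeIn_ne_mergeOut h n b)]
        by_cases hnm : n = m
        · subst hnm
          rw [hUx, hk]
          exact hT.eq (.joint (G := A.cutI h) b) y
        · rw [hUe _ fun h' => hnm (mergeOut_injective h')]
          have := hT.eq (.merge (G := A.cutI h) ⟨n, hnm⟩ b) y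
          cases b <;> exact this
      | joint j => exact j.elim
      | free e he hj =>
        have hex : e ≠ A.mergeOut m := by rintro rfl; exact he mergeOut_mem_tails
        have h1 := (free_cutI (h := h) (e := ⟨e, hex⟩)).2 he
        show (f.1 ^ c e) (U e y) = U e y
        rw [hUe e hex]
        exact hT.eq (.free (G := A.cutI h) ⟨e, hex⟩ h1.1 h1.2) y
    left := fun e => by
      by_cases he : e = A.mergeOut m
      · subst he
        rw [hUx, ← half_false_zero, hk]
        refine (hT.left _).trans (Orb.of_eq (congrArg p (congrArg (glueProj _ _) ?_)))
        exact (A.split_corners s).1.symm.trans (congrArg A.left h.symm)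
      · rw [hUe e he]; exact hT.left ⟨e, he⟩
    right := fun e => by
      by_cases he : e = A.mergeOut m
      · subst he
        rw [hUx, ← half_true_one, hk]
        refine (hT.right _).trans (Orb.of_eq (congrArg p (congrArg (glueProj _ _) ?_)))
        exact (A.split_corners s).2.2.trans (congrArg A.right h.symm)
      · rw [hUe e he]; exact hT.right ⟨e, he⟩
    inner := hT.inner
    outer := hT.outer
    inj := (flowEquivCutI h).symm.inj hT fun a _ => Orb.of_eq (horb a)
    cov := (flowEquivCutI h).symm.cov hT fun a _ => Orb.of_eq (horb a) }

/-! ### Colorings and reductions of type II -/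

section CutII

lemma IsBigon.splitOut_eq (h : A.IsBigon s m) (b : Bool) : A.splitOut s b = A.mergeIn m b := by
  cases b
  exacts [h.left_eq, h.right_eq]

lemma splitOut_eq_iff {e : A.E} : ¬(e ≠ A.splitLeft s ∧ e ≠ A.splitRight s) ↔
    ∃ b, e = A.splitOut s b := by
  rw [not_and_or, not_not, not_not, Bool.exists_bool]; rfl

open Classical in
/-- The point of the cut graph corresponding to a point of the original graph: points on the
bigon are moved up. -/
def mapCutII (h : A.IsBigon s m) (a : A.E × I) : (A.cutII h).E × I :=
  if ha : a.1 ≠ A.splitLeft s ∧ a.1 ≠ A.splitRight s then (⟨a.1, ha⟩, a.2) else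
    ((A.cutII h).jointIn (), half (decide (a.1 = A.splitRight s)) a.2)

lemma mapCutII_of_ne (h : A.IsBigon s m) {e : A.E} (he : e ≠ A.splitLeft s ∧ e ≠ A.splitRight s)
    (y : I) : mapCutII h (e, y) = (⟨e, he⟩, y) := dif_pos he

open Classical in
lemma mapCutII_splitOut (h : A.IsBigon s m) (b : Bool) (y : I) :
    mapCutII h (A.splitOut s b, y) = ((A.cutII h).jointIn (), half b y) := by
  unfold mapCutII
  rw [dif_neg (splitOut_eq_iff.2 ⟨b, rfl⟩)]
  cases b
  · rw [decide_eq_false (show (A.splitOut s false, y).1 ≠ A.splitRight s from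
      splitLeft_ne_splitRight)]
  · rw [decide_eq_true (show (A.splitOut s true, y).1 = A.splitRight s from rfl)]

/-- Cutting out a bigon does not change the trajectories. -/
def flowEquivCutII (h : A.IsBigon s m) :
    FlowEquiv A.jointed (A.cutII h) where
  map := mapCutII h
  inv b := (b.1.1, b.2)
  map_irr a ha := by
    unfold mapCutII
    split_ifs
    exacts [ha, half_irrational.2 ha]
  inv_irr _ h := h
  map_step hab := by
    refine hab.cases (P := fun a b : A.E × I => (A.cutII h).Flow (mapCutII h a) (mapCutII h b))
      (fun t b y hy => ?_) (fun n b y hy => ?_) (fun j => j.elim) (fun e y => .refl _)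
    · dsimp only
      rw [mapCutII_of_ne h (h.splitIn_ne t)]
      by_cases hts : t = s
      · subst hts
        exact (mapCutII_splitOut h b y).symm ▸ .refl _
      · have h1 := Trans.step (.split (G := A.cutII h) ⟨t, hts⟩ b) hy
        have h2 : A.splitOut t b ≠ A.splitLeft s ∧ A.splitOut t b ≠ A.splitRight s := by
          cases b
          exacts [splitLeft_ne_of_ne hts, splitRight_ne_of_ne hts]
        have h3 := mapCutII_of_ne h h2 y
        cases b <;> exact h3.symm ▸ h1
    · dsimp only
      rw [mapCutII_of_ne h (mergeOut_ne_splitOut n)]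
      by_cases hnm : n = m
      · subst hnm
        have h1 := mapCutII_splitOut h b y
        rw [h.splitOut_eq] at h1
        exact h1.symm ▸ Trans.step (.joint (G := A.cutII h) ()) (half_irrational.2 hy)
      · have h1 := Trans.step (.merge (G := A.cutII h) ⟨n, hnm⟩ b) hy
        have h2 : A.mergeIn n b ≠ A.splitLeft s ∧ A.mergeIn n b ≠ A.splitRight s := by
          cases b
          exacts [h.mergeLeft_ne hnm, h.mergeRight_ne hnm]
        have h3 := mapCutII_of_ne h h2 y
        cases b <;> exact h3.symm ▸ h1
  inv_step hab := by
    refine hab.cases (P := fun a b : (A.cutII h).E × I => A.jointed.Flow (a.1.1, a.2) (b.1.1, b.2))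
      (fun t b y hy => ?_) (fun n b y hy => ?_) (fun _ y hy => ?_) (fun e y => .refl _)
    · have := Trans.step (.split (G := A.jointed) t.1 b) hy
      cases b <;> exact this
    · have := Trans.step (.merge (G := A.jointed) n.1 b) hy
      cases b <;> exact this
    · have h1 := Trans.step (.split (G := A.jointed) s (digit y)) (shift_irr hy)
      have h2 := Trans.step (.merge (G := A.jointed) m (digit y)) (shift_irr hy)
      rw [half_digit_shift] at h1 h2
      rw [show A.jointed.splitOut s (digit y) = _ from h.splitOut_eq (digit y)] at h1
      exact .trans _ _ _ h1 h2
  inv_map a ha := by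
    obtain ⟨e, y⟩ := a
    by_cases he : e ≠ A.splitLeft s ∧ e ≠ A.splitRight s
    · rw [mapCutII_of_ne h he]; exact .refl _
    · obtain ⟨b, rfl⟩ := splitOut_eq_iff.1 he
      rw [mapCutII_splitOut]
      exact Trans.step (.split (G := A.jointed) s b) ha
  map_inv b _ := by
    rw [mapCutII_of_ne h b.1.2]; exact .refl _

lemma exists_isCut_splitLeft (h : A.IsBigon s m) :
    ∃ c, A.jointed.IsCut c ∧ ∀ b, c (A.splitOut s b) = 0 := by
  obtain ⟨c₀, c, -, hc, hc0, -⟩ :=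
    A.exists_cut (fun _ _ => 0) fun c n => -c (A.splitLeft s) * ind m n
  have h3 : ∀ φ ψ, A.headPot φ ψ (A.splitLeft s) = ψ m := fun φ ψ => by
    rw [h.left_eq, headPot_mergeLeft]
  have hx : c (A.splitLeft s) = 0 := by
    rw [hc0, tailPot_splitLeft, h3, ind_self]; ring
  refine ⟨c, hc, fun b => ?_⟩
  cases b
  exacts [hx, (eq_of_isCut hc h.isBetween).symm.trans hx]

lemma free_cutII {h : A.IsBigon s m} {e : (A.cutII h).E} :
    (e ∉ (A.cutII h).tails ∧ ∀ j, (A.cutII h).jointOut j ≠ e) ↔ e.1 ∉ A.tails := by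
  rw [← mem_tails_cutII h e, not_or]
  simp only [Subtype.ext_iff, ne_eq, forall_const]

lemma Colored.cutII (hA : A.Colored f) (h : A.IsBigon s m) :
    (A.cutII h).Colored f := by
  obtain ⟨c, hc, hx⟩ := exists_isCut_splitLeft h
  obtain ⟨c', T', p, h'⟩ := hA
  obtain ⟨T, hT⟩ := h'.exists_of_isCut A.good_jointed hc
  refine ⟨fun e => c e.1, fun e => T e.1, fun r => p r.1, ?_⟩
  exact
  { cut := isCut_cutII hc (hx false)
    pl := fun e => hT.pl e.1
    eq := fun {e u e' v} ht y => by
      cases ht with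
      | split t b =>
        have h1 := hT.eq (.split (G := A.jointed) t.1 b) y
        cases b <;> exact h1
      | merge n b =>
        have h1 := hT.eq (.merge (G := A.jointed) n.1 b) y
        cases b <;> exact h1
      | joint _ =>
        have h1 := hT.eq (.split (G := A.jointed) s (digit y)) (shift y)
        have h2 := hT.eq (.merge (G := A.jointed) m (digit y)) (shift y)
        have h3 := h.splitOut_eq (digit y)
        rw [half_digit_shift] at h1 h2
        refine h1.trans ?_
        rw [show c (A.jointed.mergeIn m (digit y)) = 0 from h3 ▸ hx _, zpow_zero] at h2
        rw [show A.jointed.splitOut s (digit y) = _ from h3]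
        exact h2
      | free e he hj =>
        exact hT.eq (.free (G := A.jointed) e.1 (free_cutII.1 ⟨he, hj⟩) fun j => j.elim) y
    left := fun e => hT.left e.1
    right := fun e => hT.right e.1
    inner := hT.inner
    outer := hT.outer
    inj := (flowEquivCutII h).inj hT fun a _ => .refl f _
    cov := (flowEquivCutII h).cov hT fun a _ => .refl f _ }

open Classical in
lemma Colored.of_cutII {h : A.IsBigon s m}
    (hA : (A.cutII h).Colored f) : A.Colored f := by
  obtain ⟨c, hc, hx⟩ := exists_isCut_splitLeft h
  obtain ⟨c', T', p', h'⟩ := hA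
  obtain ⟨T, hT⟩ := h'.exists_of_isCut good_cutII (isCut_cutII (h := h) hc (hx false))
  set U : A.E → I → I := fun e y => if he : e ≠ A.splitLeft s ∧ e ≠ A.splitRight s then T ⟨e, he⟩ y
    else (f.1 ^ c (A.splitIn s))
      (T ((A.cutII h).jointIn ()) (half (decide (e = A.splitRight s)) y)) with hU
  have hUe : ∀ (e : A.E) (he : e ≠ A.splitLeft s ∧ e ≠ A.splitRight s), U e = T ⟨e, he⟩ :=
    fun e he => funext fun y => dif_pos he
  have hUs : ∀ b y, U (A.splitOut s b) y =
      (f.1 ^ c (A.splitIn s)) (T ((A.cutII h).jointIn ()) (half b y)) := fun b y => by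
    simp only [hU, dif_neg (splitOut_eq_iff.2 ⟨b, rfl⟩)]
    congr 3
    cases b
    · exact decide_eq_false splitLeft_ne_splitRight
    · exact decide_eq_true rfl
  have hUj : ∀ b y, U (A.splitOut s b) y = T ((A.cutII h).jointOut ()) (half b y) := fun b y => by
    rw [hUs]; exact hT.eq (.joint (G := A.cutII h) ()) _
  set p : A.R → I := fun r => if hr : r ≠ A.right (A.splitLeft s) then p' ⟨r, hr⟩ else
    U (A.splitLeft s) 1 with hp
  have hpe : ∀ (r : A.R) (hr : r ≠ A.right (A.splitLeft s)), p r = p' ⟨r, hr⟩ :=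
    fun r hr => dif_pos hr
  have hpd : p (A.right (A.splitLeft s)) = U (A.splitLeft s) 1 := dif_neg (not_not.2 rfl)
  have horb : ∀ a : A.E × I, Orb f (U a.1 a.2)
      (T (mapCutII h a).1 (mapCutII h a).2) := by
    rintro ⟨e, y⟩
    by_cases he : e ≠ A.splitLeft s ∧ e ≠ A.splitRight s
    · rw [mapCutII_of_ne h he, hUe e he]; exact Orb.refl f _
    · obtain ⟨b, rfl⟩ := splitOut_eq_iff.1 he
      rw [mapCutII_splitOut, hUs]; exact Orb.zpow f _ _
  refine ⟨c, U, p, ?_⟩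
  exact
  { cut := hc
    pl := fun e => by
      by_cases he : e ≠ A.splitLeft s ∧ e ≠ A.splitRight s
      · rw [hUe e he]; exact hT.pl _
      · obtain ⟨b, rfl⟩ := splitOut_eq_iff.1 he
        simp only [hUj]
        exact (hT.pl _).comp_half b
    eq := fun {e u e' v} ht y => by
      cases ht with
      | split t b =>
        show (f.1 ^ c (A.splitIn t)) (U (A.splitIn t) (half b y)) = U (A.splitOut t b) y
        rw [hUe _ (h.splitIn_ne t)]
        by_cases hts : t = s
        · subst hts
          exact (hUs b y).symm
        · have h1 := hT.eq (.split (G := A.cutII h) ⟨t, hts⟩ b) y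
          cases b
          · exact (hUe _ (splitLeft_ne_of_ne hts)).symm ▸ h1
          · exact (hUe _ (splitRight_ne_of_ne hts)).symm ▸ h1
      | merge n b =>
        show (f.1 ^ c (A.mergeIn n b)) (U (A.mergeIn n b) y) = U (A.mergeOut n) (half b y)
        rw [hUe _ (mergeOut_ne_splitOut n)]
        by_cases hnm : n = m
        · subst hnm
          rw [← h.splitOut_eq, hx, zpow_zero]
          exact hUj b y
        · have h1 := hT.eq (.merge (G := A.cutII h) ⟨n, hnm⟩ b) y
          cases b
          · exact (hUe _ (h.mergeLeft_ne hnm)).symm ▸ h1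
          · exact (hUe _ (h.mergeRight_ne hnm)).symm ▸ h1
      | joint j => exact j.elim
      | free e he hj =>
        have hex : e ≠ A.splitLeft s ∧ e ≠ A.splitRight s :=
          ⟨fun h' => he (h' ▸ splitLeft_mem_tails),
            fun h' => he (h' ▸ splitRight_mem_tails)⟩
        have h1 := (free_cutII (h := h) (e := ⟨e, hex⟩)).2 he
        show (f.1 ^ c e) (U e y) = U e y
        rw [hUe e hex]
        exact hT.eq (.free (G := A.cutII h) ⟨e, hex⟩ h1.1 h1.2) y
    left := fun e => by
      by_cases he : e ≠ A.splitLeft s ∧ e ≠ A.splitRight s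
      · rw [hUe e he]
        refine (hT.left ⟨e, he⟩).trans (Orb.of_eq ?_)
        exact (hpe _ (h.left_ne he)).symm
      · obtain ⟨b, rfl⟩ := splitOut_eq_iff.1 he
        cases b
        · rw [hUs, half_false_zero]
          refine (Orb.zpow f _ _).trans ((hT.left _).trans (Orb.of_eq ?_))
          refine (hpe _ (h.left_ne (h.splitIn_ne s))).symm.trans ?_
          rw [(A.split_corners s).1]; rfl
        · refine Orb.of_eq ?_
          show U (A.splitOut s true) 0 = p (A.left (A.splitRight s))
          rw [← (A.split_corners s).2.1, hpd, hUs, ← half_false_one]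
          exact (hUs false 1).symm
    right := fun e => by
      by_cases he : e ≠ A.splitLeft s ∧ e ≠ A.splitRight s
      · rw [hUe e he]
        refine (hT.right ⟨e, he⟩).trans (Orb.of_eq ?_)
        exact (hpe _ (h.right_ne he)).symm
      · obtain ⟨b, rfl⟩ := splitOut_eq_iff.1 he
        cases b
        · exact Orb.of_eq hpd.symm
        · rw [hUs, half_true_one]
          refine (Orb.zpow f _ _).trans ((hT.right _).trans (Orb.of_eq ?_))
          refine (hpe _ (h.right_ne (h.splitIn_ne s))).symm.trans ?_
          rw [← (A.split_corners s).2.2]; rfl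
    inner := (hpe _ h.isBetween.1.symm).trans hT.inner
    outer := (hpe _ h.isBetween.2.1.symm).trans hT.outer
    inj := (flowEquivCutII h).symm.inj hT fun a _ => horb a
    cov := (flowEquivCutII h).symm.cov hT fun a _ => horb a }

end CutII

/-! ### Colorings and reductions of type III -/

section CutIII

variable {a b : A.E}

lemma IsParallel.ne_of_mem_tails (h : A.IsParallel a b) {e : A.E} (he : e ∈ A.tails) :
    e ≠ a ∧ e ≠ b :=
  ⟨fun h' => h.left_free (h' ▸ he), h.tail_ne he⟩

lemma IsParallel.ne_of_mem_heads (h : A.IsParallel a b) {e : A.E} (he : e ∈ A.heads) :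
    e ≠ a ∧ e ≠ b :=
  h.ne_of_mem_tails (A.tails_eq_heads ▸ he)

open Classical in
/-- The intervals on two parallel free loops become the halves of the interval on the combined
loop. -/
def mapIII (h : A.IsParallel a b) (x : A.E × I) : (A.cutIII h).E × I :=
  (projIII h x.1, if x.1 = a then half false x.2 else if x.1 = b then half true x.2 else x.2)

open Classical in
/-- The intervals on two parallel free loops are the halves of the interval on the combined
loop. -/
def invIII (h : A.IsParallel a b) (x : (A.cutIII h).E × I) : A.E × I :=
  if x.1.1 = a then (bif digit x.2 then b else a, shift x.2) else (x.1.1, x.2)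

lemma mapIII_left (h : A.IsParallel a b) (y : I) : mapIII h (a, y) = (⟨a, h.ne⟩, half false y) := by
  rw [mapIII, projIII_of_ne h.ne, if_pos rfl]

lemma mapIII_right (h : A.IsParallel a b) (y : I) : mapIII h (b, y) = (⟨a, h.ne⟩, half true y) := by
  rw [mapIII, projIII_right, if_neg h.ne.symm, if_pos rfl]

lemma mapIII_of_ne (h : A.IsParallel a b) {e : A.E} (he : e ≠ a ∧ e ≠ b) (y : I) :
    mapIII h (e, y) = (⟨e, he.2⟩, y) := by
  rw [mapIII, projIII_of_ne he.2, if_neg he.1, if_neg he.2]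

lemma invIII_left (h : A.IsParallel a b) (y : I) :
    invIII h (⟨a, h.ne⟩, y) = (bif digit y then b else a, shift y) := if_pos rfl

lemma invIII_of_ne (h : A.IsParallel a b) {e : A.E} (he : e ≠ a ∧ e ≠ b) (y : I) :
    invIII h (⟨e, he.2⟩, y) = (e, y) := if_neg he.1

lemma mapIII_invIII (h : A.IsParallel a b) (x : (A.cutIII h).E × I) :
    mapIII h (invIII h x) = x := by
  obtain ⟨⟨e, he⟩, y⟩ := x
  by_cases hea : e = a
  · subst hea
    rw [invIII_left]
    conv_rhs => rw [← half_digit_shift y]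
    cases digit y
    exacts [mapIII_left h _, mapIII_right h _]
  · rw [invIII_of_ne h ⟨hea, he⟩, mapIII_of_ne h ⟨hea, he⟩]

lemma mapIII_splitOut (h : A.IsParallel a b) (t : A.S) (b' : Bool) (y : I) :
    mapIII h (A.splitOut t b', y) = ((A.cutIII h).splitOut t b', y) := by
  cases b' <;> exact mapIII_of_ne h (h.ne_of_mem_tails splitOut_mem_tails) y

lemma mapIII_mergeIn (h : A.IsParallel a b) (n : A.M) (b' : Bool) (y : I) :
    mapIII h (A.mergeIn n b', y) = ((A.cutIII h).mergeIn n b', y) := by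
  cases b' <;> exact mapIII_of_ne h (h.ne_of_mem_heads mergeIn_mem_heads) y

lemma mapIII_splitIn (h : A.IsParallel a b) (t : A.S) (y : I) :
    mapIII h (A.splitIn t, y) = ((A.cutIII h).splitIn t, y) :=
  mapIII_of_ne h (h.ne_of_mem_heads splitIn_mem_heads) y

lemma mapIII_mergeOut (h : A.IsParallel a b) (n : A.M) (y : I) :
    mapIII h (A.mergeOut n, y) = ((A.cutIII h).mergeOut n, y) :=
  mapIII_of_ne h (h.ne_of_mem_tails mergeOut_mem_tails) y

lemma invIII_mapIII (h : A.IsParallel a b) (x : A.E × I) (hx : Irr x.2) :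
    invIII h (mapIII h x) = x := by
  obtain ⟨e, y⟩ := x
  by_cases hea : e = a
  · subst hea
    rw [mapIII_left, invIII_left, digit_half hx, shift_half hx]; rfl
  by_cases heb : e = b
  · subst heb
    rw [mapIII_right, invIII_left, digit_half hx, shift_half hx]; rfl
  · rw [mapIII_of_ne h ⟨hea, heb⟩, invIII_of_ne h ⟨hea, heb⟩]

/-- Combining parallel loops does not change the trajectories. -/
def flowEquivCutIII (h : A.IsParallel a b) :
    FlowEquiv A.jointed (A.cutIII h) where
  map := mapIII h
  inv := invIII h
  map_irr x hx := by
    unfold mapIII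
    dsimp only
    split_ifs
    exacts [half_irrational.2 hx, half_irrational.2 hx, hx]
  inv_irr x hx := by
    unfold invIII
    split_ifs
    exacts [shift_irr hx, hx]
  map_step hab := by
    refine hab.cases (P := fun x y : A.E × I => (A.cutIII h).Flow (mapIII h x) (mapIII h y))
      (fun t b' y hy => ?_) (fun n b' y hy => ?_) (fun j => j.elim) (fun e y => .refl _)
    · rw [show mapIII h (A.jointed.splitIn t, half b' y) = _ from mapIII_splitIn h t _,
        show mapIII h (A.jointed.splitOut t b', y) = _ from mapIII_splitOut h t b' y]
      exact Trans.step (.split (G := A.cutIII h) t b') hy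
    · rw [show mapIII h (A.jointed.mergeIn n b', y) = _ from mapIII_mergeIn h n b' _,
        show mapIII h (A.jointed.mergeOut n, half b' y) = _ from mapIII_mergeOut h n _]
      exact Trans.step (.merge (G := A.cutIII h) n b') hy
  inv_step hab := by
    refine hab.cases (P := fun x y : (A.cutIII h).E × I => A.jointed.Flow (invIII h x)
      (invIII h y)) (fun t b' y hy => ?_) (fun n b' y hy => ?_) (fun j => j.elim)
      (fun e y => .refl _)
    · rw [← mapIII_splitIn h t, ← mapIII_splitOut h t b' y,
        invIII_mapIII h _ (half_irrational.2 hy), invIII_mapIII h _ hy]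
      exact Trans.step (.split (G := A.jointed) t b') hy
    · rw [← mapIII_mergeOut h n, ← mapIII_mergeIn h n b' y,
        invIII_mapIII h _ hy, invIII_mapIII h _ (half_irrational.2 hy)]
      exact Trans.step (.merge (G := A.jointed) n b') hy
  inv_map x hx := by rw [invIII_mapIII h x hx]; exact .refl _
  map_inv x _ := by rw [mapIII_invIII h x]; exact .refl _

lemma free_cutIII {h : A.IsParallel a b} {e : (A.cutIII h).E} :
    (e ∉ (A.cutIII h).tails ∧ ∀ j, (A.cutIII h).jointOut j ≠ e) ↔ e.1 ∉ A.tails := by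
  have h1 : e ∈ (cutIIIGraph h).tails ↔ e.1 ∈ A.tails := by
    constructor
    · rintro ⟨x | x | x, rfl⟩
      exacts [⟨.inl x, rfl⟩, ⟨.inr (.inl x), rfl⟩, ⟨.inr (.inr x), rfl⟩]
    · rintro ⟨x | x | x, hx⟩
      exacts [⟨.inl x, Subtype.ext hx⟩, ⟨.inr (.inl x), Subtype.ext hx⟩,
        ⟨.inr (.inr x), Subtype.ext hx⟩]
  rw [← h1]
  exact and_iff_left fun j => j.elim

open Classical in
lemma Colored.cutIII (hA : A.Colored f) (h : A.IsParallel a b) :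
    (A.cutIII h).Colored f := by
  obtain ⟨c, T, p, hT⟩ := hA
  have hfa : ∀ y, f.1 (T a y) = T a y :=
    hT.fix_of_free A.good_jointed h.left_free fun j => j.elim
  have hfb : ∀ y, f.1 (T b y) = T b y :=
    hT.fix_of_free A.good_jointed h.right_free fun j => j.elim
  have hab : T a 1 = T b 0 := by
    have h1 := hT.right a
    have h2 := hT.left b
    rw [show A.jointed.left b = A.jointed.right a from (h.isBetween.2.2.2 b).2 rfl] at h2
    exact ((h2.trans h1.symm).eq_of_fix (hfa 1)).symm
  obtain ⟨k, hk0, hk1⟩ := exists_glue hab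
  have hk : ∀ y, f.1 (k y) = k y := fun y => by
    rw [← half_digit_shift y]
    cases digit y
    · rw [hk0, hfa]
    · rw [hk1, hfb]
  set U : (A.cutIII h).E → I → I := fun e => if e.1 = a then k else T e.1 with hU
  have hUa : U ⟨a, h.ne⟩ = k := if_pos rfl
  have hUe : ∀ (e : A.E) (he : e ≠ a ∧ e ≠ b), U ⟨e, he.2⟩ = T e := fun e he => if_neg he.1
  have horb : ∀ x : (A.cutIII h).E × I, U x.1 x.2 = T (invIII h x).1 (invIII h x).2 := by
    rintro ⟨⟨e, he⟩, y⟩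
    by_cases hea : e = a
    · subst hea
      rw [invIII_left, hUa]
      conv_lhs => rw [← half_digit_shift y]
      cases digit y
      exacts [hk0 _, hk1 _]
    · rw [invIII_of_ne h ⟨hea, he⟩, hUe e ⟨hea, he⟩]
  refine ⟨fun e => c e.1, U, fun r => p r.1, ?_⟩
  have hsplit : ∀ t b', U ((A.cutIII h).splitOut t b') = T (A.splitOut t b') := by
    rintro t (_ | _)
    exacts [hUe _ (h.ne_of_mem_tails splitLeft_mem_tails),
      hUe _ (h.ne_of_mem_tails splitRight_mem_tails)]
  have hmerge : ∀ n b', U ((A.cutIII h).mergeIn n b') = T (A.mergeIn n b') := by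
    rintro n (_ | _)
    exacts [hUe _ (h.ne_of_mem_heads mergeLeft_mem_heads),
      hUe _ (h.ne_of_mem_heads mergeRight_mem_heads)]
  exact
  { cut := isCut_cutIII hT.cut
    pl := fun e => by
      by_cases hea : e.1 = a
      · rw [show U e = k from if_pos hea]
        refine .glue _ ?_ ?_
        · simp only [hk0]; exact hT.pl _
        · simp only [hk1]; exact hT.pl _
      · rw [show U e = T e.1 from if_neg hea]; exact hT.pl _
    eq := fun {e u e' v} ht y => by
      cases ht with
      | split t b' =>
        rw [hsplit]
        refine Eq.trans ?_ (hT.eq (.split (G := A.jointed) t b') y)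
        exact congrArg (f.1 ^ c (A.splitIn t))
          (congrFun (hUe _ (h.ne_of_mem_heads splitIn_mem_heads)) _)
      | merge n b' =>
        rw [hmerge]
        refine Eq.trans ?_ ((hT.eq (.merge (G := A.jointed) n b') y).trans ?_)
        · cases b' <;> rfl
        · exact (congrFun (hUe _ (h.ne_of_mem_tails mergeOut_mem_tails)) _).symm
      | joint j => exact j.elim
      | free e he hj =>
        by_cases hea : e.1 = a
        · rw [show U e = k from if_pos hea]
          exact zpow_fix (hk y) _
        · rw [show U e = T e.1 from if_neg hea]
          exact hT.eq (.free (G := A.jointed) e.1 (free_cutIII.1 ⟨he, hj⟩) fun j => j.elim) y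
    left := fun e => by
      by_cases hea : e.1 = a
      · rw [show U e = k from if_pos hea, ← half_false_zero, hk0]
        refine (Orb.of_eq ?_).trans (hT.left e.1)
        rw [hea]
      · rw [show U e = T e.1 from if_neg hea]; exact hT.left e.1
    right := fun e => by
      by_cases hea : e.1 = a
      · rw [show U e = k from if_pos hea, ← half_true_one, hk1]
        refine (hT.right b).trans (Orb.of_eq (congrArg p ?_))
        exact (if_pos hea).symm
      · rw [show U e = T e.1 from if_neg hea]
        refine (hT.right e.1).trans (Orb.of_eq (congrArg p ?_))
        exact (if_neg hea).symm
    inner := hT.inner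
    outer := hT.outer
    inj := (flowEquivCutIII h).inj hT fun x _ => Orb.of_eq (horb x)
    cov := (flowEquivCutIII h).cov hT fun x _ => Orb.of_eq (horb x) }

open Classical in
lemma Colored.of_cutIII {h : A.IsParallel a b}
    (hA : (A.cutIII h).Colored f) : A.Colored f := by
  obtain ⟨c, hc, -⟩ := A.good_jointed.positive
  obtain ⟨c', T', p', h'⟩ := hA
  obtain ⟨T, hT⟩ := h'.exists_of_isCut good_cutIII (isCut_cutIII (h := h) hc)
  have hfa : ∀ y, f.1 (T ⟨a, h.ne⟩ y) = T ⟨a, h.ne⟩ y :=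
    hT.fix_of_free good_cutIII (free_cutIII.2 h.left_free).1 fun j => j.elim
  set U : A.E → I → I := fun e y => T (mapIII h (e, y)).1 (mapIII h (e, y)).2 with hU
  have hUa : ∀ y, U a y = T ⟨a, h.ne⟩ (half false y) := fun y => by
    simp only [hU, mapIII_left]
  have hUb : ∀ y, U b y = T ⟨a, h.ne⟩ (half true y) := fun y => by
    simp only [hU, mapIII_right]
  have hUe : ∀ (e : A.E) (he : e ≠ a ∧ e ≠ b), U e = T ⟨e, he.2⟩ := fun e he => by
    funext y; simp only [hU, mapIII_of_ne h he]
  set p : A.R → I := fun r => if hr : r ≠ A.right a then p' ⟨r, hr⟩ else U a 1 with hp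
  have hpe : ∀ (r : A.R) (hr : r ≠ A.right a), p r = p' ⟨r, hr⟩ := fun r hr => dif_pos hr
  have hpd : p (A.right a) = U a 1 := dif_neg (not_not.2 rfl)
  refine ⟨c, U, p, ?_⟩
  exact
  { cut := hc
    pl := fun e => by
      by_cases hea : e = a
      · subst hea; simp only [hUa]; exact (hT.pl _).comp_half false
      by_cases heb : e = b
      · subst heb; simp only [hUb]; exact (hT.pl _).comp_half true
      rw [hUe e ⟨hea, heb⟩]; exact hT.pl _
    eq := fun {e u e' v} ht y => by
      cases ht with
      | split t b' =>
        refine Eq.trans ?_ ((hT.eq (.split (G := A.cutIII h) t b') y).trans ?_)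
        · simp only [hU]
          rw [show mapIII h (A.jointed.splitIn t, half b' y) = _ from mapIII_splitIn h t _]
        · simp only [hU]
          rw [show mapIII h (A.jointed.splitOut t b', id y) = _ from mapIII_splitOut h t b' y]
          rfl
      | merge n b' =>
        refine Eq.trans ?_ ((hT.eq (.merge (G := A.cutIII h) n b') y).trans ?_)
        · simp only [hU]
          rw [show mapIII h (A.jointed.mergeIn n b', id y) = _ from mapIII_mergeIn h n b' y]
          cases b' <;> rfl
        · simp only [hU]
          rw [show mapIII h (A.jointed.mergeOut n, half b' y) = _ from mapIII_mergeOut h n _]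
      | joint j => exact j.elim
      | free e he hj =>
        refine zpow_fix ?_ _
        by_cases hea : e = a
        · subst hea; rw [hUa]; exact hfa _
        by_cases heb : e = b
        · subst heb; rw [hUb]; exact hfa _
        rw [hUe e ⟨hea, heb⟩]
        exact hT.fix_of_free good_cutIII
          ((free_cutIII (h := h) (e := ⟨e, heb⟩)).2 he).1 (fun j => j.elim) y
    left := fun e => by
      by_cases heb : e = b
      · subst heb
        rw [show A.jointed.left e = A.right a from (h.isBetween.2.2.2 e).2 rfl, hpd, hUa, hUb,
          half_false_one]
        exact Orb.refl f _
      · rw [show p (A.jointed.left e) = p' ((A.cutIII h).left ⟨e, heb⟩) from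
          hpe _ (h.left_ne heb)]
        by_cases hea : e = a
        · subst hea; rw [hUa, half_false_zero]; exact hT.left _
        · rw [hUe e ⟨hea, heb⟩]; exact hT.left _
    right := fun e => by
      by_cases hea : e = a
      · subst hea
        exact Orb.of_eq hpd.symm
      · have h1 : A.right e ≠ A.right a := fun h' => hea ((h.isBetween.2.2.1 e).1 h')
        rw [show p (A.jointed.right e) = p' ⟨A.right e, h1⟩ from hpe _ h1]
        by_cases heb : e = b
        · subst heb
          rw [hUb, half_true_one]
          refine (hT.right _).trans (Orb.of_eq (congrArg p' (Subtype.ext ?_)))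
          exact if_pos rfl
        · rw [hUe e ⟨hea, heb⟩]
          refine (hT.right _).trans (Orb.of_eq (congrArg p' (Subtype.ext ?_)))
          exact if_neg hea
    inner := (hpe _ h.isBetween.1.symm).trans hT.inner
    outer := (hpe _ h.isBetween.2.1.symm).trans hT.outer
    inj := (flowEquivCutIII h).symm.inj hT fun x _ => .refl f _
    cov := (flowEquivCutIII h).symm.cov hT fun x _ => .refl f _ }

end CutIII

end AnnularDiagram

namespace AnnularDiagram

variable {A B C : AnnularDiagram}

/-! ### Invariance of colorings -/

lemma isotopic_refl (A : AnnularDiagram) : ∃ τ μ π ρ, StrandGraph.Collapse A.toStrandGraph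
    A.toStrandGraph ∅ ∅ ∅ ∅ (fun _ _ => False) (fun _ _ => False) τ μ π ρ ∧
      A.inner = ρ A.inner ∧ A.outer = ρ A.outer :=
  ⟨id, id, id, id,
    { split_injective := Function.injective_id
      split_range := by simp
      merge_injective := Function.injective_id
      merge_range := by simp
      edge_surj := fun e => ⟨e, id, rfl⟩
      edge_ker := fun e e' _ _ => by rw [eqvGen_false_iff]; rfl
      region_surj := fun e => ⟨e, id, rfl⟩
      region_ker := fun e e' _ _ => by rw [eqvGen_false_iff]; rfl
      splitIn := fun _ => rfl
      splitLeft := fun _ => rfl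
      splitRight := fun _ => rfl
      mergeLeft := fun _ => rfl
      mergeRight := fun _ => rfl
      mergeOut := fun _ => rfl
      left := fun _ _ _ => rfl
      right := fun _ _ _ => rfl }, rfl, rfl⟩

lemma Isotopic.symm (h : A.Isotopic B) : B.Isotopic A := by
  obtain ⟨τ, μ, π, ρ, h1, h2⟩ := h
  obtain ⟨τ', μ', π', ρ', h1', h2'⟩ := isotopic_refl A
  exact isotopic_of_collapse h1 h1' (fun e _ => ⟨e, id, rfl, id⟩) (fun e _ => ⟨e, id, rfl, id⟩)
    (fun _ _ => ⟨id, id, id⟩) (fun _ _ => ⟨id, id, id⟩) h2 h2' ⟨id, id⟩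

lemma Isotopic.colored (h : A.Isotopic B) (hB : B.Colored f) : A.Colored f := by
  obtain ⟨τ, μ, π, ρ, h, hin, hout⟩ := h
  obtain ⟨c, T, p, hT⟩ := hB
  have hπ : Function.Bijective π := by
    refine ⟨fun e e' hee => ?_, fun e' => ?_⟩
    · exact eqvGen_false_iff.1 ((h.edge_ker e e' id id).1 hee)
    · obtain ⟨e, -, he⟩ := h.edge_surj e'; exact ⟨e, he⟩
  have hρ : Injective ρ := fun r r' hrr =>
    eqvGen_false_iff.1 ((h.region_ker r r' id id).1 hrr)
  have hl : ∀ e, B.left (π e) = ρ (A.left e) := fun e => h.left e id id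
  have hr : ∀ e, B.right (π e) = ρ (A.right e) := fun e => h.right e id id
  have hind : ∀ r r', ind (ρ r) (ρ r') = ind r r' := fun r r' => by
    by_cases hr : r = r'
    · rw [hr, ind_self, ind_self]
    · rw [ind_of_ne hr, ind_of_ne fun h' => hr (hρ h')]
  have hsplit : ∀ s, s ∈ Set.range τ := fun s => by rw [h.split_range]; exact id
  have hmerge : ∀ m, m ∈ Set.range μ := fun m => by rw [h.merge_range]; exact id
  have hso : ∀ s b, B.splitOut s b = π (A.splitOut (τ s) b) := fun s b => by
    cases b
    exacts [h.splitLeft s, h.splitRight s]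
  have hmi : ∀ m b, B.mergeIn m b = π (A.mergeIn (μ m) b) := fun m b => by
    cases b
    exacts [h.mergeLeft m, h.mergeRight m]
  have htails : ∀ e, e ∉ A.tails → π e ∉ B.tails := by
    intro e he h1
    rcases mem_tails'.1 h1 with ⟨s, b, h2⟩ | ⟨m, h2⟩
    · exact he (hπ.1 (h2.trans (hso s b)) ▸ splitOut_mem_tails)
    · exact he (hπ.1 (h2.trans (h.mergeOut m)) ▸ mergeOut_mem_tails)
  have htrans : ∀ {e u e' v}, A.jointed.Trans e u e' v →
      B.jointed.Trans (π e) u (π e') v := by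
    intro e u e' v ht
    cases ht with
    | split s b =>
      obtain ⟨s, rfl⟩ := hsplit s
      have := Trans.split (G := B.jointed) s b
      rw [show B.jointed.splitIn s = _ from h.splitIn s,
        show B.jointed.splitOut s b = _ from hso s b] at this
      exact this
    | merge m b =>
      obtain ⟨m, rfl⟩ := hmerge m
      have := Trans.merge (G := B.jointed) m b
      rw [show B.jointed.mergeOut m = _ from h.mergeOut m,
        show B.jointed.mergeIn m b = _ from hmi m b] at this
      exact this
    | joint j => exact j.elim
    | free e he hj => exact .free _ (htails e he) fun j => j.elim
  set E := Equiv.ofBijective π hπ with hE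
  have hEπ : ∀ e, E.symm (π e) = e := fun e => E.symm_apply_apply e
  let F : FlowEquiv B.jointed A.jointed :=
    { map := fun a => (E.symm a.1, a.2)
      inv := fun a => (π a.1, a.2)
      map_irr := fun _ ha => ha
      inv_irr := fun _ ha => ha
      map_step := fun {a b} hab => by
        refine hab.cases (P := fun a b : B.E × I =>
          A.jointed.Flow (E.symm a.1, a.2) (E.symm b.1, b.2)) (fun s b y hy => ?_)
          (fun m b y hy => ?_) (fun j => j.elim) (fun e y => .refl _)
        · dsimp only
          rw [show B.jointed.splitIn s = _ from h.splitIn s,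
            show B.jointed.splitOut s b = _ from hso s b, hEπ, hEπ]
          exact Trans.step (.split (G := A.jointed) (τ s) b) hy
        · dsimp only
          rw [show B.jointed.mergeOut m = _ from h.mergeOut m,
            show B.jointed.mergeIn m b = _ from hmi m b, hEπ, hEπ]
          exact Trans.step (.merge (G := A.jointed) (μ m) b) hy
      inv_step := fun {a b} hab => by
        obtain ⟨e, u, e', v, y, ht, hy, rfl, rfl⟩ := hab
        exact (htrans ht).step hy
      inv_map := fun a _ => by
        rw [show π (E.symm a.1) = a.1 from E.apply_symm_apply a.1]; exact .refl _
      map_inv := fun a _ => by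
        rw [hEπ]; exact .refl _ }
  refine ⟨fun e => c (π e), fun e => T (π e), fun r => p (ρ r), ?_⟩
  exact
  { cut := fun r => by
      have h1 := hT.cut (ρ r)
      rw [show B.jointed.outer = _ from hout, show B.jointed.inner = _ from hin, hind,
        hind] at h1
      refine Eq.trans ?_ h1
      refine Fintype.sum_equiv E _ _ fun e => ?_
      show c (π e) * (ind _ _ - ind _ _) = c (π e) * (ind (B.left (π e)) _ - ind (B.right (π e)) _)
      rw [hl, hr, hind, hind]
    pl := fun e => hT.pl (π e)
    eq := fun ht y => hT.eq (htrans ht) y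
    left := fun e => by
      have h1 := hT.left (π e)
      rwa [show B.jointed.left (π e) = _ from hl e] at h1
    right := fun e => by
      have h1 := hT.right (π e)
      rwa [show B.jointed.right (π e) = _ from hr e] at h1
    inner := by
      rw [← hT.inner]; exact congrArg p hin.symm
    outer := by
      rw [← hT.outer]; exact congrArg p hout.symm
    inj := F.inj hT fun a _ => .refl f _
    cov := F.cov hT fun a _ => .refl f _ }

lemma Reduces.colored_iff (h : A.Reduces B) : A.Colored f ↔ B.Colored f := by
  refine h.cases (P := fun B => A.Colored f ↔ B.Colored f)
    (fun C hC hA => hA.trans ⟨hC.symm.colored, hC.colored⟩) (fun m s h => ?_) (fun s m h => ?_)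
    (fun a b h => ?_)
  · rw [colored_toAnnular (good_reductI h)]
    exact ⟨fun hA => ((hA.cutI h).smooth _).smooth _,
      fun hA => Colored.of_cutI hA.of_smooth.of_smooth⟩
  · rw [colored_toAnnular (good_reductII h)]
    exact ⟨fun hA => (hA.cutII h).smooth _, fun hA => Colored.of_cutII hA.of_smooth⟩
  · rw [colored_toAnnular (good_cutIII (h := h))]
    exact ⟨fun hA => hA.cutIII h, Colored.of_cutIII⟩

/-- Colorings are invariant under equivalence. -/
lemma Equivalent.colored_iff (h : A.Equivalent B) : A.Colored f ↔ B.Colored f := by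
  induction h with
  | rel A B h =>
    rcases h with h | h
    · exact ⟨h.symm.colored, h.colored⟩
    · exact h.colored_iff
  | refl => rfl
  | symm _ _ _ h => exact h.symm
  | trans _ _ _ _ _ h1 h2 => exact h1.trans h2

end AnnularDiagram

/-- A coloring by `f` can be transported to a coloring by a conjugate of `f`. -/
lemma JointedGraph.Colored.conj {G : JointedGraph} (hG : G.Colored f)
    (h : ThompsonF) : G.Colored (h * f * h⁻¹) := by
  obtain ⟨c, T, p, hT⟩ := hG
  have hz : ∀ (k : ℤ) (x : I), ((h * f * h⁻¹).1 ^ k) (h.1 x) = h.1 ((f.1 ^ k) x) := by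
    intro k x
    have : (h * f * h⁻¹).1 ^ k = h.1 * f.1 ^ k * h.1⁻¹ := by
      rw [← conj_zpow]; rfl
    rw [this]
    show h.1 ((f.1 ^ k) (h.1⁻¹ (h.1 x))) = _
    rw [show h.1⁻¹ (h.1 x) = x from h.1.symm_apply_apply x]
  have ho : ∀ {x y : I}, Orb f x y → Orb (h * f * h⁻¹) (h.1 x) (h.1 y) := by
    rintro x y ⟨k, rfl⟩
    exact ⟨k, (hz k y).symm⟩
  have ho' : ∀ {x y : I}, Orb (h * f * h⁻¹) (h.1 x) (h.1 y) → Orb f x y := by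
    rintro x y ⟨k, hk⟩
    rw [hz] at hk
    exact ⟨k, h.1.injective hk⟩
  have hpl := fun e => isPL_zpow h 1 (hT.pl e)
  simp only [zpow_one] at hpl
  refine ⟨c, fun e y => h.1 (T e y), fun r => h.1 (p r), ?_⟩
  exact
  { cut := hT.cut
    pl := hpl
    eq := fun ht y => by rw [hz, hT.eq ht]
    left := fun e => ho (hT.left e)
    right := fun e => ho (hT.right e)
    inner := by rw [hT.inner, Orb.map_one]
    outer := by rw [hT.outer, Orb.map_zero]
    inj := fun e e' y y' hy hy' hyy => hT.inj e e' y y' hy hy' (ho' hyy)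
    cov := fun x hx => by
      have h1 : Irr (h.1.symm x) := by
        rw [← irrational_zpow (f := h) (k := 1), zpow_one, h.1.apply_symm_apply]; exact hx
      obtain ⟨e, y, hy⟩ := hT.cov _ h1
      have := ho hy
      rw [h.1.apply_symm_apply] at this
      exact ⟨e, y, this⟩ }

/-! ### Forests of nested intervals -/

/-- `Desc C e u x` means that `x` is reached from `e` by descending along the word `u`. -/
inductive Desc {E : Type} (C : E → Bool → E → Prop) : E → List Bool → E → Prop
  | nil (e : E) : Desc C e [] e
  | cons {e x y : E} {b : Bool} {u : List Bool} (h : C e b x) (h' : Desc C x u y) :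
      Desc C e (b :: u) y

namespace Desc

variable {E : Type} {C : E → Bool → E → Prop} {e x y : E} {u v : List Bool}

lemma append (h : Desc C e u x) (h' : Desc C x v y) : Desc C e (u ++ v) y := by
  induction h with
  | nil => exact h'
  | cons h _ ih => exact .cons h (ih h')

lemma snoc {b : Bool} (h : Desc C e u x) (h' : C x b y) : Desc C e (u ++ [b]) y :=
  h.append (.cons h' (.nil y))

lemma of_append (h : Desc C e (u ++ v) y) : ∃ x, Desc C e u x ∧ Desc C x v y := by
  induction u generalizing e with
  | nil => exact ⟨e, .nil e, h⟩
  | cons b u ih =>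
    cases h with
    | cons h h' =>
      obtain ⟨x, h1, h2⟩ := ih h'
      exact ⟨x, .cons h h1, h2⟩

lemma eq_of_nil (h : Desc C e [] y) : e = y := by cases h; rfl

/-- A nonempty descent has a last step. -/
lemma exists_last (h : Desc C e u y) (hu : u ≠ []) :
    ∃ v b x, u = v ++ [b] ∧ Desc C e v x ∧ C x b y := by
  obtain ⟨v, b, rfl⟩ := List.eq_nil_or_concat u |>.resolve_left hu
  rw [List.concat_eq_append] at h ⊢
  obtain ⟨x, h1, h2⟩ := h.of_append
  cases h2 with
  | cons h3 h4 => exact ⟨v, b, x, rfl, h1, h4.eq_of_nil ▸ h3⟩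

/-- A loop can be run through repeatedly. -/
lemma flatten_replicate (h : Desc C e u e) (n : ℕ) : Desc C e (List.replicate n u).flatten e := by
  induction n with
  | zero => exact .nil e
  | succ n ih => exact h.append ih

end Desc

/-- A forest of intervals: the interval of an edge is divided into the intervals of its two
children, up to powers of a homeomorphism `f`. Every edge in the forest has a parent, and the
weights imply that along closed descents a positive power of `f` is applied. The points of two edges
of the forest which lie in the same orbit are related by a descent. -/
structure Forest (f : ThompsonF) {E : Type} (T : E → I → I) where
  Child : E → Bool → E → Prop
  child_unique : ∀ {e b x y}, Child e b x → Child e b y → x = y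
  parent_unique : ∀ {e b x e' b'}, Child e b x → Child e' b' x → e = e' ∧ b = b'
  exists_child : ∀ {e b x}, Child e b x → ∀ b', ∃ y, Child e b' y
  exists_parent : ∀ {e b x}, Child e b x → ∃ e' b', Child e' b' e
  N : ℤ
  N_pos : 0 < N
  wt : E → ℤ
  shift : ∀ {e b x}, Child e b x → ∃ n : ℤ, (∀ y, T e (half b y) = (f.1 ^ n) (T x y)) ∧
    0 < N * n + wt x - wt e
  comp : ∀ {e e' b b' x x'}, Child e b x → Child e' b' x' → ∀ y y' : I, Irr y → Irr y' →
    Orb f (T x y) (T x' y') →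
    ∃ u, Desc Child x u x' ∧ y = halves u y' ∨ Desc Child x' u x ∧ y' = halves u y

namespace Forest

variable {E : Type} {T : E → I → I} (F : Forest f T)

/-- The edges of the forest. -/
def Mem (x : E) : Prop := ∃ e b, F.Child e b x

/-- The edges with children. -/
def Node (e : E) : Prop := ∃ b x, F.Child e b x

variable {F} {e e' x x' y : E} {u v w : List Bool}

lemma Node.mem (h : F.Node e) : F.Mem e := by
  obtain ⟨b, x, h⟩ := h; exact F.exists_parent h

lemma desc_unique (h : Desc F.Child e u x) (h' : Desc F.Child e u y) : x = y := by
  induction h with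
  | nil => exact h'.eq_of_nil
  | cons h1 _ ih =>
    cases h' with
    | cons h2 h3 => exact ih (F.child_unique h2 h1 ▸ h3)

/-- Two descents to the same edge of the same length agree. -/
lemma desc_unique_left (h : Desc F.Child e u x) (h' : Desc F.Child e' v x)
    (huv : u.length = v.length) : e = e' ∧ u = v := by
  induction h generalizing e' v with
  | nil =>
    obtain rfl := List.length_eq_zero_iff.1 huv.symm
    exact ⟨h'.eq_of_nil.symm, rfl⟩
  | cons h1 _ ih =>
    cases h' with
    | nil => simp at huv
    | cons h2 h3 =>
      obtain ⟨rfl, rfl⟩ := ih h3 (by simpa using huv)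
      obtain ⟨rfl, rfl⟩ := F.parent_unique h1 h2
      exact ⟨rfl, rfl⟩

lemma mem_of_desc (h : Desc F.Child e u x) (he : F.Mem e) : F.Mem x := by
  induction h with
  | nil => exact he
  | cons h1 _ ih => exact ih ⟨_, _, h1⟩

lemma node_of_desc (h : Desc F.Child e u x) (hu : u ≠ []) : F.Node e := by
  cases h with
  | nil => exact absurd rfl hu
  | cons h1 _ => exact ⟨_, _, h1⟩

lemma desc_shift (h : Desc F.Child e u x) : ∃ n : ℤ,
    (∀ y, T e (halves u y) = (f.1 ^ n) (T x y)) ∧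
      0 ≤ F.N * n + F.wt x - F.wt e ∧ (u ≠ [] → 0 < F.N * n + F.wt x - F.wt e) := by
  induction h with
  | nil => exact ⟨0, fun y => by simp, by simp, fun h => absurd rfl h⟩
  | cons h1 _ ih =>
    obtain ⟨n, h2, h3, -⟩ := ih
    obtain ⟨m, h4, h5⟩ := F.shift h1
    have h6 := mul_add F.N m n
    refine ⟨m + n, fun y => ?_, by linarith, fun _ => by linarith⟩
    rw [orderIso_zpow_add, ← h2, ← h4]; rfl

variable (F) in
/-- A loop: an edge that is its own descendant. -/
def Loop (e : E) : Prop := ∃ w, w ≠ [] ∧ Desc F.Child e w e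

lemma Loop.mem (h : F.Loop e) : F.Mem e := by
  obtain ⟨w, hw, h⟩ := h; exact (node_of_desc h hw).mem

/-- The interval of a loop is contracted by `f`. -/
lemma loop_shift (h : Desc F.Child e w e) (hw : w ≠ []) : ∃ n : ℕ, 0 < n ∧
    ∀ y, T e (halves w y) = (f.1 ^ n) (T e y) := by
  obtain ⟨n, h1, -, h2⟩ := desc_shift h
  have h3 := h2 hw
  have h4 : 0 < n := pos_of_mul_pos_right (by linarith) F.N_pos.le
  refine ⟨n.toNat, by omega, fun y => ?_⟩
  rw [h1, ← zpow_natCast, Int.toNat_of_nonneg h4.le]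

variable [Finite E]

/-- Long descents begin in loops. -/
lemma exists_short_loop (h : Desc F.Child e u x) (hu : Nat.card E ≤ u.length) :
    ∃ w, w ≠ [] ∧ w.length ≤ u.length ∧ Desc F.Child e w e := by
  classical
  have := Fintype.ofFinite E
  rw [Nat.card_eq_fintype_card] at hu
  have h1 : ∀ i : Fin (u.length + 1), ∃ z, Desc F.Child e (u.take i) z := fun i => by
    rw [← List.take_append_drop i u] at h
    exact h.of_append.imp fun _ => And.left
  choose z hz using h1
  obtain ⟨i, j, hij, hzz⟩ := Fintype.exists_ne_map_eq_of_card_lt z (by rw [Fintype.card_fin]; omega)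
  wlog hlt : i < j generalizing i j
  · exact this j i hij.symm hzz.symm (lt_of_le_of_ne (not_lt.1 hlt) hij.symm)
  -- the edges `i` steps above the repeated edge agree
  have h2 := hz j
  rw [← List.take_append_drop (j - i) (u.take j)] at h2
  obtain ⟨z', h6, h7⟩ := h2.of_append
  obtain ⟨rfl, -⟩ := desc_unique_left h7 (hzz ▸ hz i) (by
    have := j.2
    have hlt : (i : ℕ) < j := hlt
    simp only [List.length_drop, List.length_take]; omega)
  refine ⟨_, fun h8 => ?_, by simp, h6⟩
  have h9 := congrArg List.length h8
  have := j.2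
  have hlt : (i : ℕ) < j := hlt
  simp only [List.length_take, List.length_nil] at h9
  omega

lemma loop_of_desc (h : Desc F.Child e u x) (hu : Nat.card E ≤ u.length) : F.Loop e := by
  obtain ⟨w, hw, -, h1⟩ := exists_short_loop h hu
  exact ⟨w, hw, h1⟩

/-- All loops have a common period. -/
lemma Loop.exists_period (h : F.Loop e) :
    ∃ w, w.length = (Nat.card E).factorial ∧ Desc F.Child e w e := by
  obtain ⟨w, hw, h1⟩ := h
  have h2 := h1.flatten_replicate (Nat.card E)
  rw [← List.take_append_drop (Nat.card E) (List.replicate (Nat.card E) w).flatten] at h2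
  obtain ⟨x, h3, -⟩ := h2.of_append
  have h4 : ((List.replicate (Nat.card E) w).flatten.take (Nat.card E)).length = Nat.card E := by
    rw [List.length_take, min_eq_left]
    rw [List.length_flatten, List.map_replicate, List.sum_replicate, smul_eq_mul]
    exact Nat.le_mul_of_pos_right _ (List.length_pos_iff.2 hw)
  obtain ⟨v, hv, hvl, h5⟩ := exists_short_loop h3 h4.ge
  rw [h4] at hvl
  obtain ⟨k, hk⟩ := Nat.dvd_factorial (List.length_pos_iff.2 hv) hvl
  refine ⟨_, ?_, h5.flatten_replicate k⟩
  rw [List.length_flatten, List.map_replicate, List.sum_replicate, smul_eq_mul, hk, mul_comm]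

omit [Finite E] in
/-- Every edge has ancestors of any order. -/
lemma exists_ancestor (he : F.Mem e) (n : ℕ) : ∃ r u, F.Mem r ∧ Desc F.Child r u e ∧
    u.length = n := by
  induction n with
  | zero => exact ⟨e, [], he, .nil e, rfl⟩
  | succ n ih =>
    obtain ⟨r, u, ⟨r', b, h⟩, h1, h2⟩ := ih
    exact ⟨r', b :: u, F.exists_parent h, .cons h h1, by simp [h2]⟩

/-- Every edge of the forest is a descendant of a loop. -/
lemma exists_loop (he : F.Mem e) : ∃ r u, F.Loop r ∧ Desc F.Child r u e := by
  obtain ⟨r, u, -, h1, h2⟩ := exists_ancestor he (Nat.card E)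
  exact ⟨r, u, loop_of_desc h1 h2.ge, h1⟩

end Forest

/-- Descending along the digits of an irrational number one leaves the forest: otherwise one runs
through loops periodically, so that the number is rational. -/
lemma Forest.exists_leaf {E : Type} {T : E → I → I} {F : Forest f T} [Finite E]
    {e : E} {y : I} (hy : Irr y) :
    ∃ u x y', Desc F.Child e u x ∧ y = halves u y' ∧ ¬ F.Node x := by
  classical
  by_contra hcon
  let P : E → I → Prop := fun e y => ∀ u x y', Desc F.Child e u x → y = halves u y' → F.Node x
  have hP : P e y := fun u x y' h1 h2 => by
    by_contra h3; exact hcon ⟨u, x, y', h1, h2, h3⟩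
  have hlong : ∀ (n : ℕ) e y, P e y → ∃ u x y', u.length = n ∧ Desc F.Child e u x ∧
      y = halves u y' ∧ P x y' := by
    intro n
    induction n with
    | zero => exact fun e y h => ⟨[], e, y, rfl, .nil e, rfl, h⟩
    | succ n ih =>
      intro e y h
      obtain ⟨u, x, y', h1, h2, h3, h4⟩ := ih e y h
      obtain ⟨b, z, h5⟩ := exists_half y'
      obtain ⟨_, _, h6⟩ := h4 [] x y' (.nil x) rfl
      obtain ⟨x', h7⟩ := F.exists_child h6 b
      have h8 := h2.snoc h7
      have h9 : y = halves (u ++ [b]) z := by rw [halves_append, h3, h5]; rfl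
      refine ⟨u ++ [b], x', z, by simp [h1], h8, h9, fun v x'' y'' h10 h11 => ?_⟩
      exact h _ _ y'' (h8.append h10) (by rw [halves_append, h9, h11])
  have hloop : ∀ e y, P e y → F.Loop e := fun e y h => by
    obtain ⟨u, x, y', h1, h2, -⟩ := hlong (Nat.card E) e y h
    exact loop_of_desc h2 h1.ge
  obtain ⟨w, hwl, hw⟩ := (hloop e y hP).exists_period
  have hstep : ∀ y, P e y → ∃ y', y = halves w y' ∧ P e y' := by
    intro y h
    obtain ⟨u, x, y', h1, h2, h3, h4⟩ := hlong _ e y h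
    obtain ⟨w', hw'l, hw'⟩ := (hloop x y' h4).exists_period
    obtain ⟨rfl, -⟩ := desc_unique_left h2 hw' (h1.trans hw'l.symm)
    obtain ⟨-, rfl⟩ := desc_unique_left h2 hw (h1.trans hwl.symm)
    exact ⟨y', h3, h4⟩
  have hw0 : w ≠ [] := by
    rintro rfl
    exact (Nat.factorial_pos _).ne hwl
  obtain ⟨z, hz⟩ := exists_halves_fix hw0
  have hpow : (2 : ℝ) ≤ 2 ^ w.length := by
    calc (2 : ℝ) = 2 ^ 1 := (pow_one 2).symm
      _ ≤ _ := pow_le_pow_right₀ (by norm_num) (List.length_pos_iff.2 hw0)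
  have hdist : ∀ (n : ℕ) y, P e y → |(y : ℝ) - z| ≤ (1 / 2) ^ n := by
    intro n
    induction n with
    | zero =>
      intro y _
      have := y.2.1; have := y.2.2; have := z.2.1; have := z.2.2
      rw [pow_zero, abs_le]; constructor <;> linarith
    | succ n ih =>
      intro y h
      obtain ⟨y', rfl, h1⟩ := hstep y h
      have h2 := halves_sub w y' z
      rw [hz] at h2
      rw [h2, abs_div, abs_of_pos (two_pow_length_pos w), pow_succ]
      have h3 := ih y' h1
      calc |(y' : ℝ) - z| / 2 ^ w.length ≤ |(y' : ℝ) - z| / 2 :=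
            div_le_div_of_nonneg_left (abs_nonneg _) two_pos hpow
        _ ≤ _ := by linarith
  have hyz : (y : ℝ) - z = 0 := by
    by_contra h
    obtain ⟨n, hn⟩ := exists_pow_lt_of_lt_one (abs_pos.2 h) (show (1 / 2 : ℝ) < 1 by norm_num)
    exact absurd (hdist n y hP) (not_le.2 hn)
  have : y = z := Subtype.ext (sub_eq_zero.1 hyz)
  exact hw0 (halves_fix_irrational hy (this ▸ hz))

/-! ### Contracted intervals -/

/-- `ψ` conjugates the contraction `halves w` to the `n`-th power of `f`. -/
structure Contracts (f : ThompsonF) (ψ : I → I) (w : List Bool) (n : ℕ) : Prop where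
  pl : IsPL fun y => (ψ y : ℝ)
  ne : w ≠ []
  pos : 0 < n
  eq : ∀ y, ψ (halves w y) = (f.1 ^ n) (ψ y)

namespace Contracts

variable {ψ χ : I → I} {w w' : List Bool} {n n' : ℕ}

lemma fix (h : Contracts f ψ w n) {z : I} (hz : halves w z = z) : f.1 (ψ z) = ψ z := by
  refine fix_of_pow_fix h.pos ?_
  rw [← h.eq, hz]

lemma lt (h : Contracts f ψ w n) {z y : I} (hz : halves w z = z) (hy : z < y) :
    f.1 (ψ y) < ψ y := by
  rw [← pow_lt_iff h.pos, ← h.eq]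
  exact h.pl.strictMono' (halves_contract_lt h.ne hz hy)

lemma gt (h : Contracts f ψ w n) {z y : I} (hz : halves w z = z) (hy : y < z) :
    ψ y < f.1 (ψ y) := by
  rw [← lt_pow_iff h.pos, ← h.eq]
  exact h.pl.strictMono' (halves_contract_gt h.ne hz hy)

lemma eq_of_fix (h : Contracts f ψ w n) {z y : I} (hz : halves w z = z) (hy : f.1 (ψ y) = ψ y) :
    y = z := by
  rcases lt_trichotomy y z with h1 | h1 | h1
  · exact absurd hy (h.gt hz h1).ne'
  · exact h1
  · exact absurd hy (h.lt hz h1).ne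

lemma zpow (h : Contracts f ψ w n) (k : ℤ) : Contracts f (fun y => (f.1 ^ k) (ψ y)) w n where
  pl := isPL_zpow f k h.pl
  ne := h.ne
  pos := h.pos
  eq y := by
    rw [h.eq, ← zpow_natCast, ← orderIso_zpow_add, ← orderIso_zpow_add, add_comm]

lemma replicate (h : Contracts f ψ w n) {k : ℕ} (hk : 0 < k) :
    Contracts f ψ (List.replicate k w).flatten (k * n) where
  pl := h.pl
  ne := by
    obtain ⟨k, rfl⟩ : ∃ l, k = l + 1 := ⟨k - 1, by omega⟩
    rw [List.replicate_succ, List.flatten_cons]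
    simp [h.ne]
  pos := Nat.mul_pos hk h.pos
  eq y := by
    clear hk
    induction k with
    | zero => simp
    | succ k ih =>
      rw [List.replicate_succ, List.flatten_cons, halves_append, h.eq, ih, add_mul, one_mul,
        add_comm, pow_add]
      rfl

/-- Two contracted intervals that meet in a point that is not fixed have the same fixed point and
lie on the same side of it. -/
lemma fix_eq (h : Contracts f ψ w n) (h' : Contracts f χ w' n') {z z' y y' : I}
    (hz : halves w z = z) (hz' : halves w' z' = z') (hy : ψ y = χ y')
    (hne : f.1 (ψ y) ≠ ψ y) : ψ z = χ z' ∧ (z < y ∧ z' < y' ∨ y < z ∧ y' < z') := by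
  have aux : ∀ {ψ χ : I → I} {w w' : List Bool} {n n' : ℕ} {z z' a b : I},
      Contracts f ψ w n → Contracts f χ w' n' → halves w z = z → halves w' z' = z' →
      χ a ≤ ψ z → ψ z ≤ χ b → χ z' = ψ z := by
    intro ψ χ w w' n n' z z' a b h h' hz hz' h1 h2
    obtain ⟨t, ht⟩ := h'.pl.exists_eq h1 h2
    rw [← ht, h'.eq_of_fix hz' (y := t) (by rw [ht]; exact h.fix hz)]
  have hne' : f.1 (χ y') ≠ χ y' := hy ▸ hne
  rcases lt_trichotomy y z with h1 | rfl | h1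
  · rcases lt_trichotomy y' z' with h2 | rfl | h2
    · have h3 := (h.pl.strictMono' h1).le
      have h4 := (h'.pl.strictMono' h2).le
      refine ⟨?_, .inr ⟨h1, h2⟩⟩
      rcases le_total (ψ z) (χ z') with h5 | h5
      exacts [(aux h h' hz hz' (hy ▸ h3) h5).symm, aux h' h hz' hz (hy ▸ h4) h5]
    · exact absurd (h'.fix hz') hne'
    · exact absurd ((h.gt hz h1).trans (hy ▸ h'.lt hz' h2)) (lt_irrefl _)
  · exact absurd (h.fix hz) hne
  · rcases lt_trichotomy y' z' with h2 | rfl | h2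
    · exact absurd ((h'.gt hz' h2).trans (hy ▸ h.lt hz h1)) (lt_irrefl _)
    · exact absurd (h'.fix hz') hne'
    · have h3 := (h.pl.strictMono' h1).le
      have h4 := (h'.pl.strictMono' h2).le
      refine ⟨?_, .inl ⟨h1, h2⟩⟩
      rcases le_total (ψ z) (χ z') with h5 | h5
      exacts [aux h' h hz' hz h5 (hy ▸ h4), (aux h h' hz hz' h5 (hy ▸ h3)).symm]

end Contracts

namespace Forest

variable {E : Type} {T : E → I → I} {F : Forest f T} [Finite E] {e e' : E}

/-- The points of an edge lie in the interval of a loop, so they move towards the fixed point. -/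
lemma exists_contracts (hT : ∀ e, IsPL fun y => (T e y : ℝ)) (he : F.Mem e) :
    ∃ r w n u k, F.Loop r ∧ Desc F.Child r w r ∧ Contracts f (T r) w n ∧ Desc F.Child r u e ∧
      ∀ y, T e y = (f.1 ^ (k : ℤ)) (T r (halves u y)) := by
  obtain ⟨r, u, ⟨w, hw, h1⟩, h2⟩ := exists_loop he
  obtain ⟨n, hn, h3⟩ := loop_shift h1 hw
  obtain ⟨k, h4, -⟩ := desc_shift h2
  refine ⟨r, w, n, u, -k, ⟨w, hw, h1⟩, h1, ⟨hT r, hw, hn, h3⟩, h2, fun y => ?_⟩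
  rw [h4, orderIso_zpow_neg]

lemma not_fix_of_irr (hT : ∀ e, IsPL fun y => (T e y : ℝ)) (he : F.Mem e) {y : I} (hy : Irr y) :
    f.1 (T e y) ≠ T e y := by
  obtain ⟨r, w, n, u, k, -, -, hc, -, h⟩ := exists_contracts hT he
  intro h1
  rw [h, apply_zpow_fix_iff] at h1
  obtain ⟨z, hz⟩ := exists_halves_fix hc.ne
  have h2 := hc.eq_of_fix hz h1
  exact hc.ne (halves_fix_irrational (h2 ▸ halves_irrational.2 hy) hz)

/-- The points of an edge move towards a fixed point on this edge. -/
lemma lt_of_fix (hT : ∀ e, IsPL fun y => (T e y : ℝ)) (he : F.Mem e) {y₀ y : I}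
    (h0 : f.1 (T e y₀) = T e y₀) : (y₀ < y → f.1 (T e y) < T e y) ∧
      (y < y₀ → T e y < f.1 (T e y)) := by
  obtain ⟨r, w, n, u, k, -, -, hc, -, h⟩ := exists_contracts hT he
  have hc' := hc.zpow k
  obtain ⟨z, hz⟩ := exists_halves_fix hc.ne
  rw [h] at h0 ⊢
  obtain rfl := hc'.eq_of_fix hz h0
  exact ⟨fun hy => hc'.lt hz (halves_strictMono u hy), fun hy => hc'.gt hz (halves_strictMono u hy)⟩

omit [Finite E] in
lemma eq_halves_of_desc (hT : ∀ e, IsPL fun y => (T e y : ℝ)) {k : ℤ} {u : List Bool}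
    {y y' z z' : I} (hfix : f.1 (T e' z') ≠ T e' z') (hzz : T e z = (f.1 ^ k) (T e' z'))
    (h : T e y = (f.1 ^ k) (T e' y')) (h1 : Desc F.Child e u e') (h2 : z = halves u z') :
    y = halves u y' := by
  refine (hT e).strictMono'.injective ?_
  obtain ⟨n, h3, -⟩ := desc_shift h1
  rw [h2, h3] at hzz
  rw [h, h3, zpow_injective_of_not_fix hfix hzz]

lemma comp_of_irr (hT : ∀ e, IsPL fun y => (T e y : ℝ)) (he : F.Mem e) (he' : F.Mem e')
    {k : ℤ} {y y' z z' : I} (hz : Irr z) (hz' : Irr z') (hzz : T e z = (f.1 ^ k) (T e' z'))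
    (h : T e y = (f.1 ^ k) (T e' y')) :
    ∃ u, Desc F.Child e u e' ∧ y = halves u y' ∨ Desc F.Child e' u e ∧ y' = halves u y := by
  obtain ⟨_, _, hm⟩ := id he
  obtain ⟨_, _, hm'⟩ := id he'
  obtain ⟨u, ⟨h1, h2⟩ | ⟨h1, h2⟩⟩ := F.comp hm hm' z z' hz hz' ⟨k, hzz⟩
  · exact ⟨u, .inl ⟨h1, eq_halves_of_desc hT (not_fix_of_irr hT he' hz') hzz h h1 h2⟩⟩
  · rw [eq_comm, zpow_eq_iff] at hzz h
    exact ⟨u, .inr ⟨h1, eq_halves_of_desc hT (not_fix_of_irr hT he hz) hzz h h1 h2⟩⟩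

/-- If two edges take the same value at points that are not left end points, then one descends
from the other, along a word taking one of the points to the other one. -/
lemma comp_below (hT : ∀ e, IsPL fun y => (T e y : ℝ)) (he : F.Mem e) (he' : F.Mem e') {k : ℤ}
    {y y' : I} (hy : 0 < y) (hy' : 0 < y') (h : T e y = (f.1 ^ k) (T e' y')) :
    ∃ u, Desc F.Child e u e' ∧ y = halves u y' ∨ Desc F.Child e' u e ∧ y' = halves u y := by
  have h1 := isPL_zpow f k (hT e')
  obtain ⟨z, z', hz, hz', hzz, -, -⟩ := (hT e).exists_common h1
    (max_lt ((hT e).strictMono' hy) (h ▸ h1.strictMono' hy')) (le_max_left _ _) le_rfl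
    (le_max_right _ _) h.le
  exact comp_of_irr hT he he' hz hz' hzz h

lemma comp_above (hT : ∀ e, IsPL fun y => (T e y : ℝ)) (he : F.Mem e) (he' : F.Mem e') {k : ℤ}
    {y y' : I} (hy : y < 1) (hy' : y' < 1) (h : T e y = (f.1 ^ k) (T e' y')) :
    ∃ u, Desc F.Child e u e' ∧ y = halves u y' ∨ Desc F.Child e' u e ∧ y' = halves u y := by
  have h1 := isPL_zpow f k (hT e')
  obtain ⟨z, z', hz, hz', hzz, -, -⟩ := (hT e).exists_common h1
    (lt_min ((hT e).strictMono' hy) (h ▸ h1.strictMono' hy')) le_rfl (min_le_left _ _) h.ge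
    (min_le_right _ _)
  exact comp_of_irr hT he he' hz hz' hzz h

end Forest

/-! ### Comparison of contracted intervals -/

lemma halves_one_of_forall {u : List Bool} (h : ∀ b ∈ u, b = true) : halves u 1 = 1 := by
  induction u with
  | nil => rfl
  | cons b u ih =>
    show half b (halves u 1) = 1
    rw [ih fun b hb => h b (List.mem_cons_of_mem _ hb), h b List.mem_cons_self, half_true_one]

lemma halves_zero_of_forall {u : List Bool} (h : ∀ b ∈ u, b = false) : halves u 0 = 0 := by
  induction u with
  | nil => rfl
  | cons b u ih =>
    show half b (halves u 0) = 0
    rw [ih fun b hb => h b (List.mem_cons_of_mem _ hb), h b List.mem_cons_self, half_false_zero]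

lemma halves_flatten_replicate_fix {w : List Bool} {z : I} (hz : halves w z = z) (t : ℕ) :
    halves (List.replicate t w).flatten z = z := by
  induction t with
  | zero => rfl
  | succ t ih => rw [List.replicate_succ, List.flatten_cons, halves_append, ih, hz]

/-- An affine map restricted to a dyadic interval. -/
lemma affine_halves (k : ℤ) {d : ℝ} (hd : IsDyadic d) (u : List Bool) : ∃ d', IsDyadic d' ∧
    ∀ x : I, (2 : ℝ) ^ k * halves u x + d = (2 : ℝ) ^ (k - u.length) * x + d' := by
  have h1 : IsDyadic (wordVal u : ℝ) := ⟨wordVal u, 0, by simp⟩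
  refine ⟨_, (h1.zpow_mul (k - u.length)).add hd, fun x => ?_⟩
  rw [halves_coe, zpow_sub₀ two_ne_zero, zpow_natCast]
  ring

/-- The fixed points of two contractions by the same factor differ by a dyadic number only if they
are equal or the two end points of the unit interval. -/
lemma eq_of_isDyadic_sub {u v : List Bool} (huv : u.length = v.length) (hu : u ≠ []) {x y : I}
    (hx : halves u x = x) (hy : halves v y = y) (h : IsDyadic ((x : ℝ) - y)) :
    x = y ∨ x = 1 ∧ y = 0 ∨ x = 0 ∧ y = 1 := by
  have h1 := congrArg (fun z : I => (z : ℝ)) hx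
  have h2 := congrArg (fun z : I => (z : ℝ)) hy
  simp only [halves_coe] at h1 h2
  rw [div_eq_iff (two_pow_length_pos _).ne'] at h1 h2
  obtain ⟨m, s, hm⟩ := h
  have h3 : ((2 ^ u.length - 1 : ℤ) : ℝ) * m = ((wordVal u - wordVal v : ℤ) : ℝ) * 2 ^ s := by
    rw [← huv] at h2
    rw [eq_div_iff (by positivity)] at hm
    rw [← hm]
    push_cast
    linear_combination (-(2 : ℝ) ^ s) * (h1 - h2)
  have h4 : (2 ^ u.length - 1) * m = (wordVal u - wordVal v : ℤ) * 2 ^ s := by exact_mod_cast h3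
  have h5 : IsCoprime ((2 : ℤ) ^ s) (2 ^ u.length - 1) := by
    refine IsCoprime.pow_left ?_
    obtain ⟨l, hl⟩ : ∃ l, u.length = l + 1 :=
      ⟨u.length - 1, by have := List.length_pos_iff.2 hu; omega⟩
    exact ⟨2 ^ l, -1, by rw [hl, pow_succ]; ring⟩
  obtain ⟨a, rfl⟩ := h5.dvd_of_dvd_mul_left ⟨_, h4.trans (mul_comm _ _)⟩
  have h6 : (x : ℝ) - y = a := by
    rw [hm]; push_cast; field_simp
  have x0 := x.2.1
  have x1 := x.2.2
  have y0 := y.2.1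
  have y1 := y.2.2
  have h7 : (a : ℝ) < 2 := by linarith
  have h8 : (-2 : ℝ) < a := by linarith
  have h9 : a < 2 := by exact_mod_cast h7
  have h10 : -2 < a := by exact_mod_cast h8
  obtain rfl | rfl | rfl := (by omega : a = -1 ∨ a = 0 ∨ a = 1) <;> push_cast at h6
  · exact .inr (.inr ⟨Subtype.ext (by push_cast; linarith), Subtype.ext (by push_cast; linarith)⟩)
  · exact .inl (Subtype.ext (by linarith))
  · exact .inr (.inl ⟨Subtype.ext (by push_cast; linarith), Subtype.ext (by push_cast; linarith)⟩)

lemma length_flatten_replicate (t : ℕ) (w : List Bool) :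
    (List.replicate t w).flatten.length = t * w.length := by
  simp

lemma flatten_replicate_add (s t : ℕ) (w : List Bool) :
    (List.replicate (s + t) w).flatten =
      (List.replicate s w).flatten ++ (List.replicate t w).flatten := by
  rw [List.replicate_add, List.flatten_append]

namespace Contracts

variable {ψ χ : I → I} {w w' : List Bool} {n n' : ℕ}

lemma eq_replicate (h : Contracts f ψ w n) (j : ℕ) (x : I) :
    ψ (halves (List.replicate j w).flatten x) = (f.1 ^ (j * n)) (ψ x) := by
  rcases j.eq_zero_or_pos with rfl | hj
  · simp
  · exact (h.replicate hj).eq x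

/-- Two intervals contracted by the same power of `f` towards a common point, which meet in a point
that is not fixed, agree up to the powers of `f` and the contraction. -/
lemma exists_prefix_aux (h : Contracts f ψ w n) (h' : Contracts f χ w' n) {y y' : I}
    (hy : ψ y = χ y') (hne : f.1 (ψ y) ≠ ψ y) : ∃ (i : ℤ) (t : ℕ) (u v : List Bool),
    (List.replicate t w).flatten = u ++ v ∧ ∀ x, ψ (halves u x) = (f.1 ^ i) (χ x) := by
  obtain ⟨z, hz⟩ := exists_halves_fix h.ne
  obtain ⟨z', hz'⟩ := exists_halves_fix h'.ne
  obtain ⟨hp, hside⟩ := h.fix_eq h' hz hz' hy hne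
  have hw : 0 < w.length := List.length_pos_iff.2 h.ne
  have hw' : 0 < w'.length := List.length_pos_iff.2 h'.ne
  -- restricted to a small interval around the fixed points, the maps are affine
  obtain ⟨N₁, h1⟩ := h.pl.exists_affine
  obtain ⟨N₂, h2⟩ := h'.pl.exists_affine
  set j := max N₁ N₂ with hj
  have hjw : N₁ ≤ (List.replicate j w).flatten.length := by
    rw [length_flatten_replicate]
    exact (le_max_left N₁ N₂).trans (Nat.le_mul_of_pos_right j hw)
  have hjw' : N₂ ≤ (List.replicate j w').flatten.length := by
    rw [length_flatten_replicate]
    exact (le_max_right N₁ N₂).trans (Nat.le_mul_of_pos_right j hw')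
  obtain ⟨k, d, hd, hA⟩ := h1 _ hjw
  obtain ⟨k', d', hd', hB⟩ := h2 _ hjw'
  have pk : ∀ k : ℤ, (0 : ℝ) < 2 ^ k := fun k => by positivity
  have hAz : (2 : ℝ) ^ k * z + d = ψ z := by
    rw [← hA, halves_flatten_replicate_fix hz]
  have hBz : (2 : ℝ) ^ k' * z' + d' = ψ z := by
    rw [← hB, halves_flatten_replicate_fix hz', hp]
  have hAB : (2 : ℝ) ^ k * y + d = (2 : ℝ) ^ k' * y' + d' := by
    rw [← hA, ← hB, h.eq_replicate, h'.eq_replicate, hy]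
  have hAB' : (2 : ℝ) ^ k * halves w y + d = (2 : ℝ) ^ k' * halves w' y' + d' := by
    rw [← hA, ← hB, h.eq_replicate, h'.eq_replicate, h.eq, h'.eq, hy]
  -- the contraction factors agree
  have hlen : w.length = w'.length := by
    have e1 := halves_sub w y z
    have e2 := halves_sub w' y' z'
    rw [hz] at e1
    rw [hz'] at e2
    have e3 : (2 : ℝ) ^ k * (y - z) = 2 ^ k' * (y' - z') := by linarith
    have e4 : (2 : ℝ) ^ k * ((y - z) / 2 ^ w.length) = 2 ^ k' * ((y' - z') / 2 ^ w'.length) := by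
      rw [← e1, ← e2]; linarith
    have e5 : (2 : ℝ) ^ k * (y - z) ≠ 0 := by
      refine mul_ne_zero (pk k).ne' (sub_ne_zero.2 ?_)
      rcases hside with h3 | h3
      · exact (show (z : ℝ) < y from h3.1).ne'
      · exact (show (y : ℝ) < z from h3.1).ne
    rw [← mul_div_assoc, ← mul_div_assoc, ← e3, div_eq_div_iff (by positivity) (by positivity)]
      at e4
    have e6 := mul_left_cancel₀ e5 e4
    exact (Nat.pow_right_injective le_rfl (by exact_mod_cast e6)).symm
  -- by further contraction, the second map can be given the smaller slope
  set i := (k' - k).toNat with hi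
  obtain ⟨d₂, hd₂, hB₂⟩ := affine_halves k' hd' (List.replicate i w').flatten
  rw [length_flatten_replicate] at hB₂
  set k₂ : ℤ := k' - ((i * w'.length : ℕ) : ℤ) with hk₂
  have hk : k₂ ≤ k := by
    have e1 : k' - k ≤ i := Int.self_le_toNat _
    have e2 : (i : ℤ) ≤ ((i * w'.length : ℕ) : ℤ) := by
      exact_mod_cast Nat.le_mul_of_pos_right i hw'
    omega
  -- the prefix of the periodic word which makes the slopes equal
  set t := (k - k₂).toNat + 1 with ht
  set V := (List.replicate t w).flatten with hV
  have hVl : V.length = t * w.length := length_flatten_replicate t w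
  have hVt : t ≤ V.length := hVl ▸ Nat.le_mul_of_pos_right t hw
  set u := V.take (k - k₂).toNat with hu
  set v := V.drop (k - k₂).toNat with hv
  have huv : u ++ v = V := List.take_append_drop _ _
  have hul : (u.length : ℤ) = k - k₂ := by
    rw [hu, List.length_take, min_eq_left (by omega)]; omega
  obtain ⟨d₁, hd₁, hA₁⟩ := affine_halves k hd u
  rw [hul, sub_sub_cancel] at hA₁
  -- the fixed points of the rotated words
  have hzV : halves V z = z := halves_flatten_replicate_fix hz t
  set zu := halves v z with hzu
  have hzu1 : halves u zu = z := by rw [hzu, ← halves_append, huv, hzV]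
  have hzu2 : halves (v ++ u) zu = zu := by rw [halves_append, hzu1]
  have hne' : v ++ u ≠ [] := by
    intro h3
    have := congrArg List.length huv
    have h4 := congrArg List.length h3
    simp only [List.length_append, List.length_nil] at this h4
    omega
  have hl : (v ++ u).length = (List.replicate t w').flatten.length := by
    rw [length_flatten_replicate, ← hlen, ← hVl, ← huv, List.length_append, List.length_append,
      add_comm]
  have e1 : (2 : ℝ) ^ k₂ * zu + d₁ = ψ z := by rw [← hA₁, hzu1, hAz]
  have e2 : (2 : ℝ) ^ k₂ * z' + d₂ = ψ z := by
    rw [← hB₂, halves_flatten_replicate_fix hz', hBz]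
  have e3 : IsDyadic ((zu : ℝ) - z') := by
    have e4 : (zu : ℝ) - z' = 2 ^ (-k₂) * (d₂ - d₁) := by
      rw [show d₂ - d₁ = 2 ^ k₂ * ((zu : ℝ) - z') by linarith, ← mul_assoc,
        ← zpow_add₀ two_ne_zero]
      simp
    rw [e4]
    exact (hd₂.sub hd₁).zpow_mul _
  rcases eq_of_isDyadic_sub hl hne' hzu2 (halves_flatten_replicate_fix hz' t) e3 with h3 | h3 | h3
  · refine ⟨((i + j) * n : ℕ), j + t, (List.replicate j w).flatten ++ u, v, ?_, fun x => ?_⟩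
    · rw [flatten_replicate_add, List.append_assoc, huv]
    · have e5 : d₁ = d₂ := by rw [h3] at e1; linarith
      rw [zpow_natCast, ← h'.eq_replicate, add_comm i j, flatten_replicate_add, halves_append,
        halves_append]
      exact Subtype.ext (by rw [hA, hB, hA₁, hB₂, e5])
  · have h4 := halves_eq_one (h3.1 ▸ hzu2)
    have h5 : z = 1 := by
      rw [← hzu1, h3.1]
      exact halves_one_of_forall fun b hb => h4.1 b (List.mem_append_right _ hb)
    rcases hside with h6 | h6
    · exact absurd (h5 ▸ h6.1) (not_lt.2 le_top)
    · exact absurd (h3.2 ▸ h6.2) (not_lt.2 bot_le)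
  · have h4 := halves_eq_zero (h3.1 ▸ hzu2)
    have h5 : z = 0 := by
      rw [← hzu1, h3.1]
      exact halves_zero_of_forall fun b hb => h4.1 b (List.mem_append_right _ hb)
    rcases hside with h6 | h6
    · exact absurd (h3.2 ▸ h6.2) (not_lt.2 le_top)
    · exact absurd (h5 ▸ h6.1) (not_lt.2 bot_le)

/-- Two contracted intervals which meet in a point that is not fixed agree up to the powers of `f`
and the contraction. -/
lemma exists_prefix (h : Contracts f ψ w n) (h' : Contracts f χ w' n') {y y' : I}
    (hy : ψ y = χ y') (hne : f.1 (ψ y) ≠ ψ y) : ∃ (i : ℤ) (t : ℕ) (u v : List Bool),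
    (List.replicate t w).flatten = u ++ v ∧ ∀ x, ψ (halves u x) = (f.1 ^ i) (χ x) := by
  have h1 := h.replicate h'.pos
  have h2 := h'.replicate h.pos
  rw [mul_comm] at h2
  obtain ⟨i, t, u, v, h3, h4⟩ := h1.exists_prefix_aux h2 hy hne
  refine ⟨i, t * n', u, v, ?_, h4⟩
  rw [← h3]
  clear h3
  induction t with
  | zero => simp
  | succ t ih => rw [List.replicate_succ, List.flatten_cons, ← ih, add_mul, one_mul, add_comm,
      flatten_replicate_add]

end Contracts

/-! ### Pairs of forests -/

/-- Two maps to the unit interval agree up to a power of `f`. -/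
def Sim (f : ThompsonF) (ψ χ : I → I) : Prop := ∃ k : ℤ, ∀ y, ψ y = (f.1 ^ k) (χ y)

lemma zpow_inv_apply (f : ThompsonF) (k : ℤ) (x : I) : ((f⁻¹).1 ^ k) x = (f.1 ^ (-k)) x := by
  have : (f⁻¹).1 ^ k = f.1 ^ (-k) := by
    rw [zpow_neg, ← inv_zpow]; rfl
  rw [this]

lemma Orb.inv {x y : I} (h : Orb f x y) : Orb f⁻¹ x y := by
  obtain ⟨k, rfl⟩ := h
  exact ⟨-k, by rw [zpow_inv_apply, neg_neg]⟩

lemma inv_lt_iff {x : I} : (f⁻¹).1 x < x ↔ x < f.1 x := f.1.symm_apply_lt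

lemma lt_inv_iff {x : I} : x < (f⁻¹).1 x ↔ f.1 x < x := f.1.lt_symm_apply

namespace Sim

variable {ψ χ ω : I → I}

lemma symm (h : Sim f ψ χ) : Sim f χ ψ := by
  obtain ⟨k, h⟩ := h; exact ⟨-k, fun y => by rw [h, orderIso_zpow_neg]⟩

lemma trans (h : Sim f ψ χ) (h' : Sim f χ ω) : Sim f ψ ω := by
  obtain ⟨k, h⟩ := h; obtain ⟨l, h'⟩ := h'
  exact ⟨k + l, fun y => by rw [orderIso_zpow_add, h, h']⟩

lemma comp (h : Sim f ψ χ) (u : List Bool) :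
    Sim f (fun y => ψ (halves u y)) fun y => χ (halves u y) := by
  obtain ⟨k, h⟩ := h; exact ⟨k, fun y => h _⟩

lemma inv (h : Sim f ψ χ) : Sim f⁻¹ ψ χ := by
  obtain ⟨k, h⟩ := h
  exact ⟨-k, fun y => by rw [zpow_inv_apply, neg_neg, h]⟩

lemma orb (h : Sim f ψ χ) (y : I) : Orb f (ψ y) (χ y) := by
  obtain ⟨k, h⟩ := h; exact ⟨k, h y⟩

end Sim

namespace Forest

variable {E : Type} {T : E → I → I} {F : Forest f T} {e e' x r : E}
  {u : List Bool}

lemma sim_desc (h : Desc F.Child e u x) : Sim f (fun y => T e (halves u y)) (T x) := by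
  obtain ⟨n, h, -⟩ := desc_shift h
  exact ⟨n, h⟩

lemma sim_child {b : Bool} (h : F.Child e b x) : Sim f (fun y => T e (half b y)) (T x) := by
  obtain ⟨n, h, -⟩ := F.shift h
  exact ⟨n, h⟩

/-- An edge whose interval is the interval of a dyadic part of a second edge is a
descendant of the second edge, unless the second edge is its proper descendant. -/
lemma desc_of_sim (he : F.Mem e) (hx : F.Mem x) (h : Sim f (fun y => T e (halves u y)) (T x)) :
    Desc F.Child e u x ∨ ∃ v, v ≠ [] ∧ Desc F.Child x v e := by
  obtain ⟨y, hy⟩ := exists_irr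
  obtain ⟨_, _, he⟩ := he
  obtain ⟨_, _, hx⟩ := hx
  obtain ⟨v, ⟨h1, h2⟩ | ⟨h1, h2⟩⟩ := F.comp he hx _ y (halves_irrational.2 hy) hy (h.orb y)
  · exact .inl (halves_inj_irrational hy h2 ▸ h1)
  · by_cases hv : v = []
    · subst hv
      refine .inl ?_
      have h3 : u = [] := halves_fix_irrational hy h2.symm
      rw [h3, h1.eq_of_nil]
      exact .nil e
    · exact .inr ⟨v, hv, h1⟩

lemma eq_of_sim (he : F.Mem e) (hx : F.Mem x) (h : Sim f (T e) (T x)) : e = x := by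
  obtain ⟨y, hy⟩ := exists_irr
  obtain ⟨_, _, he⟩ := he
  obtain ⟨_, _, hx⟩ := hx
  obtain ⟨v, ⟨h1, h2⟩ | ⟨h1, h2⟩⟩ := F.comp he hx y y hy hy (h.orb y) <;>
    obtain rfl := halves_fix_irrational hy h2.symm
  exacts [h1.eq_of_nil, h1.eq_of_nil.symm]

end Forest

/-- The structure on the edges of a reduced diagram colored by `f`: there is a forest of intervals
contracted by `f` and another one of intervals contracted by its inverse `g`. The leaves of each
forest belong to the other one, and edges outside of both carry fixed points. Two leaves which are
siblings in one forest are not siblings in the other. -/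
structure BiForest (f g : ThompsonF) {E : Type} (T : E → I → I) where
  inv : g = f⁻¹
  fst : Forest f T
  snd : Forest g T
  pl : ∀ e, IsPL fun y => (T e y : ℝ)
  cov : ∀ x : I, Irr x → ∃ e y, Orb f x (T e y)
  free : ∀ e, ¬ fst.Mem e → ¬ snd.Mem e → ∀ y, f.1 (T e y) = T e y
  mem_snd : ∀ {e}, fst.Mem e → ¬ fst.Node e → snd.Mem e
  mem_fst : ∀ {e}, snd.Mem e → ¬ snd.Node e → fst.Mem e
  not_node_snd : ∀ {e}, fst.Mem e → ¬ snd.Node e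
  not_node_fst : ∀ {e}, snd.Mem e → ¬ fst.Node e
  noSib : ∀ {e e' x₀ x₁}, fst.Child e false x₀ → fst.Child e true x₁ → snd.Child e' false x₀ →
    snd.Child e' true x₁ → False

namespace BiForest

variable {f g : ThompsonF} {E : Type} {T : E → I → I} {e e' r : E}

/-- Exchanging the two forests. -/
def swap (A : BiForest f g T) : BiForest g f T where
  inv := by rw [A.inv, inv_inv]
  fst := A.snd
  snd := A.fst
  pl := A.pl
  cov x hx := by
    obtain ⟨e, y, h⟩ := A.cov x hx
    exact ⟨e, y, A.inv ▸ h.inv⟩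
  free e h h' y := by
    have h1 := A.free e h' h y
    rw [A.inv]
    exact (f.1.symm_apply_eq).2 h1.symm
  mem_snd := A.mem_fst
  mem_fst := A.mem_snd
  not_node_snd := A.not_node_fst
  not_node_fst := A.not_node_snd
  noSib h1 h2 h3 h4 := A.noSib h3 h4 h1 h2

variable (A : BiForest f g T) {A}

lemma sim_inv (A : BiForest f g T) {ψ χ : I → I} (h : Sim f ψ χ) : Sim g ψ χ := A.inv ▸ h.inv

variable [Finite E]

/-- The points which are not fixed are covered by the first forest. -/
lemma cov_fst (A : BiForest f g T) {x : I} (hx : Irr x) (hfix : f.1 x ≠ x) :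
    ∃ e y, A.fst.Mem e ∧ Orb f x (T e y) := by
  obtain ⟨e, y, h⟩ := A.cov x hx
  by_cases h1 : A.fst.Mem e
  · exact ⟨e, y, h1, h⟩
  by_cases h2 : A.snd.Mem e
  · have hy : Irr y := by
      obtain ⟨k, rfl⟩ := h
      exact (A.pl e).irrational.1 (irrational_zpow.1 hx)
    obtain ⟨u, z, y', h3, rfl, h4⟩ := Forest.exists_leaf (F := A.snd) (e := e) hy
    refine ⟨z, y', A.mem_fst (Forest.mem_of_desc h3 h2) h4, h.trans ?_⟩
    exact (A.swap.sim_inv (Forest.sim_desc h3)).orb y'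
  · exact absurd (h.fix (A.free e h1 h2 y)) hfix

/-- The intervals of the two forests do not overlap near a fixed point, since it attracts on
one of them and repels on the other. -/
lemma eq_of_fix_overlap (A : BiForest f g T) (he : A.fst.Mem e) (he' : A.snd.Mem e') {k : ℤ}
    {y₀ y₀' y y' : I} (hfix : f.1 (T e y₀) = T e y₀) (h0 : T e y₀ = (f.1 ^ k) (T e' y₀'))
    (h : T e y = (f.1 ^ k) (T e' y')) : y = y₀ := by
  have hg : ∀ x, ((f.1 ^ k) : I ≃o I) (g.1 x) = g.1 ((f.1 ^ k) x) := fun x => by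
    have h1 := zpow_inv_apply f 1
    simp only [zpow_one] at h1
    rw [A.inv, h1, h1, ← orderIso_zpow_add, ← orderIso_zpow_add, add_comm]
  have hfix' : g.1 (T e' y₀') = T e' y₀' := by
    rw [h0, apply_zpow_fix_iff] at hfix
    rw [A.inv]
    exact (f.1.symm_apply_eq).2 hfix.symm
  have h1 := Forest.lt_of_fix (y := y) A.pl he hfix
  have h2 := Forest.lt_of_fix (y := y') A.pl he' hfix'
  have h3 : ∀ {x x' t t'}, T e x = (f.1 ^ k) (T e' t) → T e x' = (f.1 ^ k) (T e' t') →
      (t < t' ↔ x < x') := fun h h' => by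
    rw [← (A.pl e').strictMono'.lt_iff_lt, ← (f.1 ^ k).lt_iff_lt, ← h, ← h',
      (A.pl e).strictMono'.lt_iff_lt]
  rw [h3 h0 h, h3 h h0, ← (f.1 ^ k).lt_iff_lt (x := g.1 _), ← (f.1 ^ k).lt_iff_lt (y := g.1 _), hg,
    ← h, A.inv, inv_lt_iff, lt_inv_iff] at h2
  rcases lt_trichotomy y y₀ with h4 | h4 | h4
  · exact absurd (h1.2 h4) (h2.2 h4).not_gt
  · exact h4
  · exact absurd (h1.1 h4) (h2.1 h4).not_gt

/-- The interval of an inner edge of the first forest is not contained in an interval of the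
second forest. The deepest inner edge below it would be divided in the same way in
the two forests. -/
lemma not_sim_loop (A : BiForest f g T) (he : A.fst.Node e) (hr : A.snd.Loop r) (v : List Bool) :
    ¬ Sim f (T e) fun y => T r (halves v y) := by
  intro hsim
  by_cases hloop : A.fst.Loop e
  · obtain ⟨w, hw, h1⟩ := hloop
    obtain ⟨n, hn, h2⟩ := Forest.loop_shift h1 hw
    obtain ⟨z, hz⟩ := exists_halves_fix hw
    have h3 : Contracts f (T e) w n := ⟨A.pl e, hw, hn, h2⟩
    obtain ⟨k, hk⟩ := hsim
    obtain ⟨y, hy⟩ := exists_irr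
    have h4 := A.eq_of_fix_overlap he.mem hr.mem (h3.fix hz) (hk z) (hk y)
    exact hw (halves_fix_irrational (h4 ▸ hy) hz)
  obtain ⟨u, x, h1, h2, h3⟩ : ∃ u x, Desc A.fst.Child e u x ∧ A.fst.Node x ∧
      ∀ b x', A.fst.Child x b x' → ¬ A.fst.Node x' := by
    by_contra hcon
    push Not at hcon
    have h4 : ∀ n : ℕ, ∃ u x, Desc A.fst.Child e u x ∧ A.fst.Node x ∧ u.length = n := by
      intro n
      induction n with
      | zero => exact ⟨[], e, .nil e, he, rfl⟩
      | succ n ih =>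
        obtain ⟨u, x, h5, h6, h7⟩ := ih
        obtain ⟨b, x', h8, h9⟩ := hcon u x h5 h6
        exact ⟨u ++ [b], x', h5.snoc h8, h9, by simp [h7]⟩
    obtain ⟨u, x, h5, -, h6⟩ := h4 (Nat.card E)
    exact hloop (Forest.loop_of_desc h5 h6.ge)
  obtain ⟨b₀, x₀, h4⟩ := id h2
  have key : ∀ b, ∃ x', A.fst.Child x b x' ∧ Desc A.snd.Child r (v ++ u ++ [b]) x' := by
    intro b
    obtain ⟨x', h5⟩ := A.fst.exists_child h4 b
    refine ⟨x', h5, ?_⟩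
    have h6 : A.snd.Mem x' := A.mem_snd ⟨_, _, h5⟩ (h3 b x' h5)
    have h7 : Sim f (fun y => T r (halves (v ++ u ++ [b]) y)) (T x') := by
      have h8 := (hsim.comp (u ++ [b])).symm
      simp only [← halves_append, ← List.append_assoc] at h8
      exact h8.trans (Forest.sim_desc (h1.snoc h5))
    rcases Forest.desc_of_sim hr.mem h6 (A.sim_inv h7) with h8 | ⟨w, hw, h8⟩
    · exact h8
    · exact absurd (Forest.node_of_desc h8 hw) (A.not_node_snd ⟨_, _, h5⟩)
  obtain ⟨x₀, c₀, d₀⟩ := key false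
  obtain ⟨x₁, c₁, d₁⟩ := key true
  obtain ⟨z₀, p₀, q₀⟩ := d₀.of_append
  obtain ⟨z₁, p₁, q₁⟩ := d₁.of_append
  obtain rfl := Forest.desc_unique p₀ p₁
  refine A.noSib c₀ c₁ (e' := z₀) ?_ ?_
  · cases q₀ with
    | cons h h' => exact h'.eq_of_nil ▸ h
  · cases q₁ with
    | cons h h' => exact h'.eq_of_nil ▸ h

/-- An edge is determined by its interval up to the action of `f`. -/
lemma eq_of_sim (A : BiForest f g T) (he : A.fst.Mem e ∨ A.snd.Mem e)
    (he' : A.fst.Mem e' ∨ A.snd.Mem e') (h : Sim f (T e) (T e')) : e = e' := by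
  have key : ∀ {f g : ThompsonF} (A : BiForest f g T) {e e' : E}, A.fst.Mem e → A.snd.Mem e' →
      Sim f (T e) (T e') → e = e' := by
    intro f g A e e' he he' h
    by_cases h1 : A.fst.Node e
    · obtain ⟨r, u, hr, h2⟩ := Forest.exists_loop he'
      exact absurd (h.trans (A.swap.sim_inv (Forest.sim_desc h2).symm)) (A.not_sim_loop h1 hr u)
    · exact Forest.eq_of_sim (A.mem_snd he h1) he' (A.sim_inv h)
  rcases he with he | he <;> rcases he' with he' | he'
  · exact Forest.eq_of_sim he he' h
  · exact key A he he' h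
  · exact key A.swap he he' (A.sim_inv h)
  · exact Forest.eq_of_sim he he' (A.sim_inv h)

section Match

variable {E' : Type} {T' : E' → I → I} [Finite E']

/-- The loops of a forest only depend on `f`. -/
lemma exists_loop_sim (A : BiForest f g T) (B : BiForest f g T') {r : E'} (hr : B.fst.Loop r) :
    ∃ r', A.fst.Loop r' ∧ Sim f (T r') (T' r) := by
  obtain ⟨y, hy⟩ := exists_irr
  have h1 := Forest.not_fix_of_irr B.pl hr.mem hy
  obtain ⟨e, y', he, k, h2⟩ := A.cov_fst ((B.pl r).irrational.2 hy) h1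
  obtain ⟨r', w, n, u, l, hr', hw, hc, -, h3⟩ := Forest.exists_contracts A.pl he
  obtain ⟨w', hw', h4⟩ := id hr
  obtain ⟨n', hn', h5⟩ := Forest.loop_shift h4 hw'
  have hc' : Contracts f (T' r) w' n' := ⟨B.pl r, hw', hn', h5⟩
  have h6 : (f.1 ^ (k + l)) (T r' (halves u y')) = T' r y := by
    rw [h2, h3, orderIso_zpow_add]
  obtain ⟨i, t, u', v, h7, h8⟩ := (hc.zpow (k + l)).exists_prefix hc' h6 (by rwa [h6])
  have h9 := hw.flatten_replicate t
  rw [h7] at h9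
  obtain ⟨r₁, h10, h11⟩ := h9.of_append
  refine ⟨r₁, ?_, ?_⟩
  · by_cases hu : u' = []
    · subst hu
      exact h10.eq_of_nil ▸ hr'
    · exact ⟨v ++ u', by simp [hu], h11.append h10⟩
  · refine (Forest.sim_desc h10).symm.trans (Sim.trans ?_ ⟨i, h8⟩)
    exact ⟨-(k + l), fun y => by rw [orderIso_zpow_neg]⟩

/-- Inner edges correspond to inner edges. -/
lemma node_of_sim (A : BiForest f g T) (B : BiForest f g T') {e' : E'} (he : A.fst.Node e)
    (he' : B.fst.Mem e') (h : Sim f (T e) (T' e')) : B.fst.Node e' := by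
  by_contra h1
  obtain ⟨r', u, hr', h2⟩ := Forest.exists_loop (B.mem_snd he' h1)
  obtain ⟨r, hr, h3⟩ := exists_loop_sim A.swap B.swap hr'
  have h4 : Sim f (T' e') fun y => T r (halves u y) :=
    (B.swap.sim_inv (Forest.sim_desc h2).symm).trans (A.swap.sim_inv (h3.symm.comp u))
  exact A.not_sim_loop he hr u (h.trans h4)

/-- The edges of a forest only depend on `f`, up to the action of `f`. -/
lemma exists_sim (A : BiForest f g T) (B : BiForest f g T') (he : A.fst.Mem e) :
    ∃ e', B.fst.Mem e' ∧ Sim f (T e) (T' e') := by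
  obtain ⟨r, u, hr, h⟩ := Forest.exists_loop he
  obtain ⟨r', hr', h1⟩ := exists_loop_sim B A hr
  have key : ∀ {x e : E} {u : List Bool}, Desc A.fst.Child x u e →
      (∃ x', B.fst.Mem x' ∧ Sim f (T x) (T' x')) → ∃ e', B.fst.Mem e' ∧ Sim f (T e) (T' e') := by
    intro x e u h
    induction h with
    | nil => exact id
    | @cons x x₁ e b u h2 _ ih =>
      rintro ⟨x', hx', h3⟩
      obtain ⟨_, _, h4⟩ := node_of_sim A B ⟨_, _, h2⟩ hx' h3
      obtain ⟨x₁', h5⟩ := B.fst.exists_child h4 b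
      refine ih ⟨x₁', ⟨_, _, h5⟩, ?_⟩
      exact (Forest.sim_child h2).symm.trans ((h3.comp [b]).trans (Forest.sim_child h5))
  exact key h ⟨r', hr'.mem, h1.symm⟩

end Match

end BiForest

/-! ### The two forests of a reduced diagram -/

/-- For a relation which is deterministic in both directions, two equivalent points are
connected by a directed path. -/
lemma reflTransGen_of_eqvGen {α : Type} {r : α → α → Prop} (h1 : ∀ {a b c}, r a b → r a c → b = c)
    (h2 : ∀ {a b c}, r a c → r b c → a = b) {a b : α} (h : EqvGen r a b) :
    ReflTransGen r a b ∨ ReflTransGen r b a := by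
  induction h with
  | rel a b h => exact .inl (.single h)
  | refl a => exact .inl .refl
  | symm _ _ _ h => exact h.symm
  | trans a b c _ _ h h' =>
    rcases h with h | h <;> rcases h' with h' | h'
    · exact .inl (h.trans h')
    · have h3 := ReflTransGen.total_of_right_unique (r := Function.swap r)
        (fun _ _ _ h h' => h2 h h') (Relation.reflTransGen_swap.2 h)
        (Relation.reflTransGen_swap.2 h')
      exact h3.symm.imp Relation.reflTransGen_swap.1 Relation.reflTransGen_swap.1
    · exact ReflTransGen.total_of_right_unique (fun _ _ _ h h' => h1 h h') h h'
    · exact .inr (h'.trans h)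

namespace Forest

variable {E : Type} [Finite E] {T : E → I → I} {F : Forest f T} {e x z : E}

omit [Finite E] in
lemma eq_of_desc {b : Bool} {y y' : I} (hz : F.Child e b z) (hn : ¬ F.Node z)
    (h : ∃ u, Desc F.Child x u z ∧ y = halves u y' ∨ Desc F.Child z u x ∧ y' = halves u y)
    (hy : ∀ u, y = halves u y' → b ∉ u) : x = z := by
  obtain ⟨u, ⟨h1, h2⟩ | ⟨h1, -⟩⟩ := h <;> by_cases hu : u = []
  · subst hu; exact h1.eq_of_nil
  · obtain ⟨v, b, w, rfl, -, h3⟩ := h1.exists_last hu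
    obtain ⟨-, rfl⟩ := F.parent_unique h3 hz
    exact absurd (by simp) (hy _ h2)
  · subst hu; exact h1.eq_of_nil.symm
  · exact absurd (node_of_desc h1 hu) hn

/-- An edge whose interval ends, up to the action of `f`, where that of a left leaf ends, is that
leaf. -/
lemma eq_of_right_end (hT : ∀ e, IsPL fun y => (T e y : ℝ)) (hz : F.Child e false z)
    (hn : ¬ F.Node z) (hx : F.Mem x) (h : Orb f (T x 1) (T z 1)) : x = z := by
  obtain ⟨k, h⟩ := h
  exact eq_of_desc hz hn (comp_below hT hx ⟨_, _, hz⟩ one_pos one_pos h) fun u h2 h3 => by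
    simpa using (halves_eq_one h2.symm).1 false h3

lemma eq_of_left_end (hT : ∀ e, IsPL fun y => (T e y : ℝ)) (hz : F.Child e true z)
    (hn : ¬ F.Node z) (hx : F.Mem x) (h : Orb f (T x 0) (T z 0)) : x = z := by
  obtain ⟨k, h⟩ := h
  exact eq_of_desc hz hn (comp_above hT hx ⟨_, _, hz⟩ one_pos one_pos h) fun u h2 h3 => by
    simpa using (halves_eq_zero h2.symm).1 true h3

end Forest

lemma JointedGraph.Trans.cases {G : JointedGraph} {e e' : G.E} {u v : I → I} (h : G.Trans e u e' v) :
    (∃ s b, e = G.splitIn s ∧ u = half b ∧ e' = G.splitOut s b ∧ v = id) ∨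
    (∃ m b, e = G.mergeIn m b ∧ u = id ∧ e' = G.mergeOut m ∧ v = half b) ∨
    (∃ j, e = G.jointIn j ∧ e' = G.jointOut j) ∨ e' = e ∧ u = id ∧ v = id ∧ e ∉ G.tails := by
  cases h with
  | split s b => exact .inl ⟨s, b, rfl, rfl, rfl, rfl⟩
  | merge m b => exact .inr (.inl ⟨m, b, rfl, rfl, rfl, rfl⟩)
  | joint j => exact .inr (.inr (.inl ⟨j, rfl, rfl⟩))
  | free _ he _ => exact .inr (.inr (.inr ⟨rfl, rfl, rfl, he⟩))

namespace AnnularDiagram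

variable {A : AnnularDiagram} {f : ThompsonF} {c : A.E → ℤ} {T : A.E → I → I} {p : A.R → I}

/-- Descending through merges, against the direction of the strands. -/
def MergeChild (A : AnnularDiagram) (e : A.E) (b : Bool) (x : A.E) : Prop :=
  ∃ m, e = A.mergeOut m ∧ x = A.mergeIn m b

/-- Descending through splits. -/
def SplitChild (A : AnnularDiagram) (e : A.E) (b : Bool) (x : A.E) : Prop :=
  ∃ s, e = A.splitIn s ∧ x = A.splitOut s b

lemma trans_cases {e e' : A.E} {u v : I → I} (h : A.jointed.Trans e u e' v) :
    (∃ s b, e = A.splitIn s ∧ u = half b ∧ e' = A.splitOut s b ∧ v = id) ∨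
    (∃ m b, e = A.mergeIn m b ∧ u = id ∧ e' = A.mergeOut m ∧ v = half b) ∨
    e' = e ∧ u = id ∧ v = id ∧ e ∉ A.tails := by
  rcases h.cases with h | h | ⟨j, -⟩ | h
  exacts [.inl h, .inr (.inl h), j.elim, .inr (.inr h)]

lemma step_cases {a a' : A.E × I} (h : A.jointed.Step a a') :
    (∃ s b, a.1 = A.splitIn s ∧ a.2 = half b a'.2 ∧ a'.1 = A.splitOut s b ∧ Irr a'.2) ∨
    (∃ m b, a.1 = A.mergeIn m b ∧ a'.2 = half b a.2 ∧ a'.1 = A.mergeOut m) ∨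
    a' = a ∧ a.1 ∉ A.tails := by
  obtain ⟨e, u, e', v, y, ht, hy, rfl, rfl⟩ := h
  rcases trans_cases ht with ⟨s, b, rfl, rfl, rfl, rfl⟩ | ⟨m, b, rfl, rfl, rfl, rfl⟩ |
    ⟨rfl, rfl, rfl, h⟩
  exacts [.inl ⟨s, b, rfl, rfl, rfl, hy⟩, .inr (.inl ⟨m, b, rfl, rfl, rfl⟩), .inr (.inr ⟨rfl, h⟩)]

lemma step_right_unique {a b b' : A.E × I} (h : A.jointed.Step a b) (h' : A.jointed.Step a b') :
    b = b' := by
  have free : ∀ {e}, e ∉ A.tails → e ∈ A.heads → False := fun h1 h2 => h1 (A.tails_eq_heads ▸ h2)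
  rcases step_cases h with ⟨s, i, h1, h2, h3, h4⟩ | ⟨m, i, h1, h2, h3⟩ | ⟨h1, h2⟩ <;>
    rcases step_cases h' with ⟨s', i', h1', h2', h3', h4'⟩ | ⟨m', i', h1', h2', h3'⟩ | ⟨h1', h2'⟩
  · obtain rfl := splitIn_injective (h1.symm.trans h1')
    obtain ⟨rfl, h5⟩ := half_inj h4 (h2.symm.trans h2')
    exact Prod.ext (h3.trans h3'.symm) h5
  · exact absurd (h1.symm.trans h1') splitIn_ne_mergeIn
  · exact (free h2' (h1 ▸ splitIn_mem_heads)).elim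
  · exact absurd (h1'.symm.trans h1) splitIn_ne_mergeIn
  · obtain ⟨rfl, rfl⟩ := mergeIn_inj.1 (h1.symm.trans h1')
    exact Prod.ext (h3.trans h3'.symm) (h2.trans h2'.symm)
  · exact (free h2' (h1 ▸ mergeIn_mem_heads)).elim
  · exact (free h2 (h1' ▸ splitIn_mem_heads)).elim
  · exact (free h2 (h1' ▸ mergeIn_mem_heads)).elim
  · exact h1.trans h1'.symm

lemma step_irr {a b : A.E × I} (h : A.jointed.Step a b) : Irr a.2 := by
  obtain ⟨e, u, e', v, y, ht, hy, rfl, rfl⟩ := h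
  rcases trans_cases ht with ⟨s, b, rfl, rfl, rfl, rfl⟩ | ⟨m, b, rfl, rfl, rfl, rfl⟩ |
    ⟨rfl, rfl, rfl, h⟩
  exacts [half_irrational.2 hy, hy, hy]

lemma step_left_unique {a a' b : A.E × I} (h : A.jointed.Step a b) (h' : A.jointed.Step a' b) :
    a = a' := by
  rcases step_cases h with ⟨s, i, h1, h2, h3, h4⟩ | ⟨m, i, h1, h2, h3⟩ | ⟨h1, h2⟩ <;>
    rcases step_cases h' with ⟨s', i', h1', h2', h3', h4'⟩ | ⟨m', i', h1', h2', h3'⟩ | ⟨h1', h2'⟩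
  · obtain ⟨rfl, rfl⟩ := splitOut_inj.1 (h3.symm.trans h3')
    exact Prod.ext (h1.trans h1'.symm) (h2.trans h2'.symm)
  · exact absurd (h3.symm.trans h3') splitOut_ne_mergeOut
  · subst h1'; exact absurd (h3 ▸ splitOut_mem_tails) h2'
  · exact absurd (h3'.symm.trans h3) splitOut_ne_mergeOut
  · obtain rfl := mergeOut_injective (h3.symm.trans h3')
    obtain ⟨rfl, h5⟩ := half_inj (step_irr h) (h2.symm.trans h2')
    exact Prod.ext (h1.trans h1'.symm) h5
  · subst h1'; exact absurd (h3 ▸ mergeOut_mem_tails) h2'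
  · subst h1; exact absurd (h3' ▸ splitOut_mem_tails) h2
  · subst h1; exact absurd (h3' ▸ mergeOut_mem_tails) h2
  · exact h1.symm.trans h1'

lemma path_of_flow {a b : A.E × I} (h : A.jointed.Flow a b) :
    ReflTransGen A.jointed.Step a b ∨ ReflTransGen A.jointed.Step b a :=
  reflTransGen_of_eqvGen (r := A.jointed.Step) step_right_unique step_left_unique h

lemma mergeDesc_of_path (hA : A.IsReduced) {a b : A.E × I}
    (h : ReflTransGen A.jointed.Step a b) {m : A.M} {i : Bool}
    (ha : a.1 = A.mergeIn m i) : ∃ u, Desc A.MergeChild b.1 u a.1 ∧ b.2 = halves u a.2 := by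
  induction h with
  | refl => exact ⟨[], .nil _, rfl⟩
  | @tail b b' _ h ih =>
    obtain ⟨u, h1, h2⟩ := ih
    rcases step_cases h with ⟨s, j, h3, h4, h5, h6⟩ | ⟨m', j, h3, h4, h5⟩ | ⟨h3, h4⟩
    · rw [h3] at h1
      generalize hz : a.1 = z at h1 ha
      generalize hw : A.splitIn s = w at h1
      cases h1 with
      | nil => exact absurd (hw.trans ha) splitIn_ne_mergeIn
      | cons h7 _ =>
        obtain ⟨m'', h8, -⟩ := h7
        exact absurd (hw.trans h8).symm (hA.mergeOut_ne_splitIn _ _)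
    · exact ⟨j :: u, .cons ⟨m', h5, h3⟩ h1, by rw [h4, h2]; rfl⟩
    · rw [h3]; exact ⟨u, h1, h2⟩

lemma splitDesc_of_path (hA : A.IsReduced) {a b : A.E × I}
    (h : ReflTransGen A.jointed.Step a b) {s : A.S} {i : Bool}
    (hb : b.1 = A.splitOut s i) : ∃ u, Desc A.SplitChild a.1 u b.1 ∧ a.2 = halves u b.2 := by
  induction h using ReflTransGen.head_induction_on with
  | refl => exact ⟨[], .nil _, rfl⟩
  | @head a a' h _ ih =>
    obtain ⟨u, h1, h2⟩ := ih
    rcases step_cases h with ⟨s', j, h3, h4, h5, h6⟩ | ⟨m', j, h3, h4, h5⟩ | ⟨h3, h4⟩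
    · exact ⟨j :: u, .cons ⟨s', h3, h5⟩ h1, by rw [h4, h2]; rfl⟩
    · rw [h5] at h1
      generalize hz : b.1 = z at h1 hb
      generalize hw : A.mergeOut m' = w at h1
      cases h1 with
      | nil => exact absurd (hw.trans hb).symm splitOut_ne_mergeOut
      | cons h7 _ =>
        obtain ⟨s'', h8, -⟩ := h7
        exact absurd (hw.trans h8) (hA.mergeOut_ne_splitIn _ _)
    · rw [← h3]; exact ⟨u, h1, h2⟩

lemma mem_heads_of_mem_tails {e : A.E} (h : e ∈ A.tails) : e ∈ A.heads := A.tails_eq_heads ▸ h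

lemma mem_tails_of_mem_heads {e : A.E} (h : e ∈ A.heads) : e ∈ A.tails := A.tails_eq_heads ▸ h

/-- In a reduced diagram, an edge that leaves a merge enters a merge. -/
lemma IsReduced.mergeOut_eq (hA : A.IsReduced) (m : A.M) : ∃ m' b, A.mergeOut m = A.mergeIn m' b := by
  rcases mem_heads'.1 (mem_heads_of_mem_tails
    (mergeOut_mem_tails (m := m))) with ⟨s, h⟩ | h
  · exact absurd h (hA.mergeOut_ne_splitIn m s)
  · exact h

lemma IsReduced.splitIn_eq (hA : A.IsReduced) (s : A.S) : ∃ s' b, A.splitIn s = A.splitOut s' b := by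
  rcases mem_tails'.1 (mem_tails_of_mem_heads
    (splitIn_mem_heads (s := s))) with h | ⟨m, h⟩
  · exact h
  · exact absurd h.symm (hA.mergeOut_ne_splitIn m s)

lemma exists_weight (h : A.jointed.IsColoring f c T p) : ∃ (N : ℤ) (w : A.E → ℤ), 0 < N ∧
    ∀ {e u e' v}, A.jointed.Trans e u e' v → 0 < N * c e + (w e' - w e) := by
  obtain ⟨N, hN, φ, ψ, χ, hw⟩ := A.good_jointed.positive_of_isCut h.cut
  exact ⟨N, A.jointed.tpot φ ψ χ, hN, fun {e} _ _ _ ht => ht.hpot_eq_tpot φ ψ χ ▸ hw e⟩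

/-- The forest of the merges. -/
def mergeForest (hA : A.IsReduced) (h : A.jointed.IsColoring f c T p) : Forest f T where
  Child := A.MergeChild
  child_unique := by
    rintro e b x y ⟨m, rfl, rfl⟩ ⟨m', h1, rfl⟩
    rw [mergeOut_injective h1]
  parent_unique := by
    rintro e b x e' b' ⟨m, rfl, rfl⟩ ⟨m', rfl, h1⟩
    obtain ⟨rfl, rfl⟩ := mergeIn_inj.1 h1
    exact ⟨rfl, rfl⟩
  exists_child := by
    rintro e b x ⟨m, rfl, rfl⟩ b'
    exact ⟨_, m, rfl, rfl⟩
  exists_parent := by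
    rintro e b x ⟨m, rfl, rfl⟩
    obtain ⟨m', b', h1⟩ := hA.mergeOut_eq m
    exact ⟨_, b', m', rfl, h1⟩
  N := (exists_weight h).choose
  N_pos := (exists_weight h).choose_spec.choose_spec.1
  wt e := -(exists_weight h).choose_spec.choose e
  shift := by
    rintro e b x ⟨m, rfl, rfl⟩
    refine ⟨c (A.mergeIn m b), fun y => (h.eq (.merge (G := A.jointed) m b) y).symm, ?_⟩
    have h1 := (exists_weight h).choose_spec.choose_spec.2 (.merge (G := A.jointed) m b)
    linarith
  comp := by
    rintro e e' b b' x x' ⟨m, rfl, rfl⟩ ⟨m', rfl, rfl⟩ y y' hy hy' ho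
    rcases path_of_flow (h.inj _ _ _ _ hy hy' ho) with h1 | h1
    · obtain ⟨u, h2⟩ := mergeDesc_of_path hA h1 rfl
      exact ⟨u, .inr h2⟩
    · obtain ⟨u, h2⟩ := mergeDesc_of_path hA h1 rfl
      exact ⟨u, .inl h2⟩

/-- The forest of the splits. -/
def splitForest (hA : A.IsReduced) (h : A.jointed.IsColoring f c T p) : Forest f⁻¹ T where
  Child := A.SplitChild
  child_unique := by
    rintro e b x y ⟨s, rfl, rfl⟩ ⟨s', h1, rfl⟩
    rw [splitIn_injective h1]
  parent_unique := by
    rintro e b x e' b' ⟨s, rfl, rfl⟩ ⟨s', rfl, h1⟩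
    obtain ⟨rfl, rfl⟩ := splitOut_inj.1 h1
    exact ⟨rfl, rfl⟩
  exists_child := by
    rintro e b x ⟨s, rfl, rfl⟩ b'
    exact ⟨_, s, rfl, rfl⟩
  exists_parent := by
    rintro e b x ⟨s, rfl, rfl⟩
    obtain ⟨s', b', h1⟩ := hA.splitIn_eq s
    exact ⟨_, b', s', rfl, h1⟩
  N := (exists_weight h).choose
  N_pos := (exists_weight h).choose_spec.choose_spec.1
  wt e := (exists_weight h).choose_spec.choose e
  shift := by
    rintro e b x ⟨s, rfl, rfl⟩
    refine ⟨c (A.splitIn s), fun y => ?_, ?_⟩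
    · rw [zpow_inv_apply, ← zpow_eq_iff]
      exact h.eq (.split (G := A.jointed) s b) y
    · have h1 := (exists_weight h).choose_spec.choose_spec.2 (.split (G := A.jointed) s b)
      linarith
  comp := by
    rintro e e' b b' x x' ⟨s, rfl, rfl⟩ ⟨s', rfl, rfl⟩ y y' hy hy' ho
    have ho' := ho.inv
    rw [inv_inv] at ho'
    rcases path_of_flow (h.inj _ _ _ _ hy hy' ho') with h1 | h1
    · obtain ⟨u, h2⟩ := splitDesc_of_path hA h1 rfl
      exact ⟨u, .inl h2⟩
    · obtain ⟨u, h2⟩ := splitDesc_of_path hA h1 rfl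
      exact ⟨u, .inr h2⟩

section

variable {hA : A.IsReduced} {h : A.jointed.IsColoring f c T p} {e : A.E}

lemma mem_mergeForest_iff : (mergeForest hA h).Mem e ↔ ∃ m b, e = A.mergeIn m b :=
  ⟨fun ⟨_, b, m, _, h⟩ => ⟨m, b, h⟩, fun ⟨m, b, h⟩ => ⟨_, b, m, rfl, h⟩⟩

lemma mem_splitForest_iff : (splitForest hA h).Mem e ↔ ∃ s b, e = A.splitOut s b :=
  ⟨fun ⟨_, b, m, _, h⟩ => ⟨m, b, h⟩, fun ⟨m, b, h⟩ => ⟨_, b, m, rfl, h⟩⟩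

lemma node_mergeForest_iff : (mergeForest hA h).Node e ↔ ∃ m, e = A.mergeOut m :=
  ⟨fun ⟨_, _, m, h, _⟩ => ⟨m, h⟩, fun ⟨m, h⟩ => ⟨false, _, m, h, rfl⟩⟩

lemma node_splitForest_iff : (splitForest hA h).Node e ↔ ∃ s, e = A.splitIn s :=
  ⟨fun ⟨_, _, m, h, _⟩ => ⟨m, h⟩, fun ⟨m, h⟩ => ⟨false, _, m, h, rfl⟩⟩

lemma notMem_tails_of_notMem (h1 : ¬ (mergeForest hA h).Mem e) (h2 : ¬ (splitForest hA h).Mem e) :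
    e ∉ A.tails := by
  rw [mem_mergeForest_iff] at h1
  rw [mem_splitForest_iff] at h2
  intro h3
  rcases mem_tails'.1 h3 with h4 | ⟨m, rfl⟩
  · exact h2 h4
  · exact h1 (hA.mergeOut_eq m)

lemma fix_of_notMem_tails (h : A.jointed.IsColoring f c T p) (he : e ∉ A.tails) (y : I) :
    f.1 (T e y) = T e y :=
  h.fix_of_free A.good_jointed he (fun j => j.elim) y

/-- A split and a merge of a reduced colored diagram are not connected by both pairs of edges:
the region between the two edges would have no other edges, since such an edge would
have the same end point. -/
lemma not_both_eq (hA : A.IsReduced) (h : A.jointed.IsColoring f c T p) {s : A.S} {m : A.M}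
    (h1 : A.splitLeft s = A.mergeLeft m) (h2 : A.splitRight s = A.mergeRight m) : False := by
  have hpl := h.pl
  have e1 := h.orb_of_trans (.split (G := A.jointed) s false) 1
  have e2 := h.orb_of_trans (.split (G := A.jointed) s true) 0
  rw [← half_false_one] at e2
  have m1 : (mergeForest hA h).Child (A.mergeOut m) false (A.splitLeft s) := ⟨m, rfl, h1⟩
  have m2 : (mergeForest hA h).Child (A.mergeOut m) true (A.splitRight s) := ⟨m, rfl, h2⟩
  have s1 : (splitForest hA h).Child (A.splitIn s) false (A.splitLeft s) := ⟨s, rfl, rfl⟩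
  have s2 : (splitForest hA h).Child (A.splitIn s) true (A.splitRight s) := ⟨s, rfl, rfl⟩
  have n1 : ¬ (mergeForest hA h).Node (A.splitLeft s) := by
    rw [node_mergeForest_iff]; rintro ⟨m', h'⟩; exact splitLeft_ne_mergeOut h'
  have n2 : ¬ (mergeForest hA h).Node (A.splitRight s) := by
    rw [node_mergeForest_iff]; rintro ⟨m', h'⟩; exact splitRight_ne_mergeOut h'
  have n3 : ¬ (splitForest hA h).Node (A.splitLeft s) := by
    rw [node_splitForest_iff, h1]; rintro ⟨m', h'⟩; exact splitIn_ne_mergeLeft h'.symm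
  have n4 : ¬ (splitForest hA h).Node (A.splitRight s) := by
    rw [node_splitForest_iff, h2]; rintro ⟨m', h'⟩; exact splitIn_ne_mergeRight h'.symm
  have hp : Orb f (T (A.splitLeft s) 1) (p (A.right (A.splitLeft s))) := h.right _
  have hp' : Orb f (T (A.splitRight s) 0) (p (A.right (A.splitLeft s))) := e2.symm.trans (e1.trans hp)
  have lt1 : T (A.splitIn s) 0 < T (A.splitIn s) (half false 1) := h.strictMono _ half_false_one_pos
  have lt2 : T (A.splitIn s) (half false 1) < T (A.splitIn s) 1 := h.strictMono _ half_false_one_lt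
  refine hA.not_isBigon (s := s) (m := m) ⟨h1, h2, ?_, ?_, ?_, ?_⟩
  · intro h3
    rw [h3, show p A.inner = 1 from h.inner] at hp
    exact absurd (e1.trans hp).eq_one (lt2.trans_le le_one').ne
  · intro h3
    rw [h3, show p A.outer = 0 from h.outer] at hp
    exact absurd (e1.trans hp).eq_zero (nonneg'.trans_lt lt1).ne'
  · refine fun x => ⟨fun hx => ?_, fun hx => by rw [hx]⟩
    have h3 : Orb f (T x 1) (T (A.splitLeft s) 1) :=
      (h.right x).trans (by rw [show A.jointed.right x = _ from hx]; exact hp.symm)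
    by_cases q1 : (mergeForest hA h).Mem x
    · exact Forest.eq_of_right_end hpl m1 n1 q1 h3
    by_cases q2 : (splitForest hA h).Mem x
    · exact Forest.eq_of_right_end hpl s1 n3 q2 h3.inv
    have h4 := fix_of_notMem_tails h (notMem_tails_of_notMem q1 q2)
    have h5 := h3.symm.eq_of_fix (h4 1)
    obtain ⟨y, z, hy, hz, h6⟩ := (hpl x).exists_common_right (hpl (A.splitLeft s)) h5.symm
    exact absurd (h6 ▸ h4 y) (Forest.not_fix_of_irr hpl ⟨_, _, m1⟩ hz)
  · refine fun x => ⟨fun hx => ?_, fun hx => by rw [hx, (A.split_corners s).2.1]⟩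
    have h3 : Orb f (T x 0) (T (A.splitRight s) 0) :=
      (h.left x).trans (by rw [show A.jointed.left x = _ from hx]; exact hp'.symm)
    by_cases q1 : (mergeForest hA h).Mem x
    · exact Forest.eq_of_left_end hpl m2 n2 q1 h3
    by_cases q2 : (splitForest hA h).Mem x
    · exact Forest.eq_of_left_end hpl s2 n4 q2 h3.inv
    have h4 := fix_of_notMem_tails h (notMem_tails_of_notMem q1 q2)
    have h5 := h3.symm.eq_of_fix (h4 0)
    obtain ⟨y, z, hy, hz, h6⟩ := (hpl x).exists_common_left (hpl (A.splitRight s)) h5.symm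
    exact absurd (h6 ▸ h4 y) (Forest.not_fix_of_irr hpl ⟨_, _, m2⟩ hz)

end

/-- The merges and the splits of a reduced colored diagram. -/
def biForest (hA : A.IsReduced) (h : A.jointed.IsColoring f c T p) : BiForest f f⁻¹ T where
  inv := rfl
  fst := mergeForest hA h
  snd := splitForest hA h
  pl := h.pl
  cov := h.cov
  free e h1 h2 := fix_of_notMem_tails h (notMem_tails_of_notMem h1 h2)
  mem_snd := by
    intro e h1 h2
    rw [mem_mergeForest_iff] at h1
    rw [node_mergeForest_iff] at h2
    rw [mem_splitForest_iff]
    obtain ⟨m, b, rfl⟩ := h1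
    exact (mem_tails'.1
      (mem_tails_of_mem_heads mergeIn_mem_heads)).resolve_right h2
  mem_fst := by
    intro e h1 h2
    rw [mem_splitForest_iff] at h1
    rw [node_splitForest_iff] at h2
    rw [mem_mergeForest_iff]
    obtain ⟨m, b, rfl⟩ := h1
    exact (mem_heads'.1
      (mem_heads_of_mem_tails splitOut_mem_tails)).resolve_left h2
  not_node_snd := by
    intro e h1 h2
    obtain ⟨m, b, rfl⟩ := mem_mergeForest_iff.1 h1
    obtain ⟨s, h3⟩ := node_splitForest_iff.1 h2
    exact splitIn_ne_mergeIn h3.symm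
  not_node_fst := by
    intro e h1 h2
    obtain ⟨s, b, rfl⟩ := mem_splitForest_iff.1 h1
    obtain ⟨m, h3⟩ := node_mergeForest_iff.1 h2
    exact splitOut_ne_mergeOut h3
  noSib := by
    rintro e e' x₀ x₁ ⟨m, rfl, rfl⟩ ⟨m', h1, h2⟩ ⟨s, rfl, h3⟩ ⟨s', h4, rfl⟩
    obtain rfl := mergeOut_injective h1
    obtain rfl := splitIn_injective h4
    exact not_both_eq hA h h3.symm h2

end AnnularDiagram

/-! ### Rigidity of reduced diagrams -/

/-- In a planar graph with positive winding numbers, every region other than the inner and the outer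
one has edges on both sides: it is crossed by a curve which crosses all edges positively. -/
lemma JointedGraph.Good.exists_left_right {G : JointedGraph} (hG : G.Good) {r : G.R}
    (h1 : r ≠ G.inner) (h2 : r ≠ G.outer) : (∃ e, G.left e = r) ∧ ∃ e, G.right e = r := by
  obtain ⟨c, hc, N, hN, φ, ψ, χ, hpos⟩ := hG.positive
  have hsum : ∑ e, (N * c e + (G.hpot φ ψ χ e - G.tpot φ ψ χ e)) * G.inc e r = 0 := by
    simp only [add_mul, mul_assoc, sum_add_distrib, ← mul_sum]
    rw [hc r, G.sum_pot_mul_inc, ind_of_ne h2.symm, ind_of_ne h1.symm]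
    simp
  have hinc : (∃ e, G.left e = r) ∨ ∃ e, G.right e = r := by
    by_contra hcon
    push Not at hcon
    have key : ∀ a b, EqvGen (fun p q => ∃ e, G.left e = p ∧ G.right e = q) a b →
        (a = r) = (b = r) := fun a b h => by
      refine eq_of_eqvGen (F := fun a => a = r) ?_ h
      rintro _ _ ⟨e, rfl, rfl⟩
      exact propext ⟨fun h => (hcon.1 e h).elim, fun h => (hcon.2 e h).elim⟩
    exact h1 ((key _ _ (hG.connected r G.inner)).mp rfl).symm
  have hL : (∃ e, G.left e = r) → ∃ e, G.right e = r := by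
    rintro ⟨e, he⟩
    by_contra hcon
    push Not at hcon
    have h3 : ∀ e, G.inc e r = ind (G.left e) r := fun e => by
      rw [inc, ind_of_ne (hcon e), sub_zero]
    have h4 := (Finset.sum_eq_zero_iff_of_nonneg fun e _ => by
      rw [h3]; exact mul_nonneg (hpos e).le (ind_nonneg _ _)).1 hsum e (mem_univ e)
    rw [h3, he, ind_self, mul_one] at h4
    exact (hpos e).ne' h4
  have hR : (∃ e, G.right e = r) → ∃ e, G.left e = r := by
    rintro ⟨e, he⟩
    by_contra hcon
    push Not at hcon
    have h3 : ∀ e, G.inc e r = -ind (G.right e) r := fun e => by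
      rw [inc, ind_of_ne (hcon e), zero_sub]
    have h5 : ∑ e, (N * c e + (G.hpot φ ψ χ e - G.tpot φ ψ χ e)) * ind (G.right e) r = 0 := by
      simp only [h3, mul_neg, Finset.sum_neg_distrib] at hsum
      linarith
    have h4 := (Finset.sum_eq_zero_iff_of_nonneg fun e _ =>
      mul_nonneg (hpos e).le (ind_nonneg _ _)).1 h5 e (mem_univ e)
    rw [he, ind_self, mul_one] at h4
    exact (hpos e).ne' h4
  rcases hinc with h | h
  · exact ⟨h, hL h⟩
  · exact ⟨hR h, h⟩

namespace AnnularDiagram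

variable {A : AnnularDiagram} {f : ThompsonF} {c : A.E → ℤ} {T : A.E → I → I} {p : A.R → I}

/-- The trajectories on a free loop stay there. -/
lemma eq_of_flow_free {a b : A.E × I} (h : A.jointed.Flow a b) (ha : a.1 ∉ A.tails) :
    b.1 = a.1 := by
  replace h := path_of_flow h
  rcases h with h | h
  · induction h with
    | refl => rfl
    | tail _ h ih =>
      rcases step_cases h with ⟨s, b, h1, -⟩ | ⟨m, b, h1, -⟩ | ⟨h1, -⟩
      · rw [← ih, h1] at ha
        exact absurd (mem_tails_of_mem_heads splitIn_mem_heads) ha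
      · rw [← ih, h1] at ha
        exact absurd (mem_tails_of_mem_heads mergeIn_mem_heads) ha
      · rw [h1, ih]
  · induction h using ReflTransGen.head_induction_on with
    | refl => rfl
    | head h _ ih =>
      rcases step_cases h with ⟨s, b, -, -, h1, -⟩ | ⟨m, b, -, -, h1⟩ | ⟨h1, -⟩
      · rw [← ih, h1] at ha
        exact absurd splitOut_mem_tails ha
      · rw [← ih, h1] at ha
        exact absurd mergeOut_mem_tails ha
      · rw [← h1, ih]

section Colored

variable (hA : A.IsReduced) (h : A.jointed.IsColoring f c T p) {e e' a b : A.E}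

include hA h

lemma mem_or_mem (he : e ∈ A.tails) : (biForest hA h).fst.Mem e ∨ (biForest hA h).snd.Mem e := by
  by_contra hcon
  push Not at hcon
  exact notMem_tails_of_notMem (hA := hA) (h := h) hcon.1 hcon.2 he

lemma mem_tails_of_mem (he : (biForest hA h).fst.Mem e ∨ (biForest hA h).snd.Mem e) :
    e ∈ A.tails := by
  rcases he with he | he
  · obtain ⟨m, b, rfl⟩ := (mem_mergeForest_iff (hA := hA) (h := h)).1 he
    exact mem_tails_of_mem_heads mergeIn_mem_heads
  · obtain ⟨m, b, rfl⟩ := (mem_splitForest_iff (hA := hA) (h := h)).1 he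
    exact splitOut_mem_tails

lemma not_fix_of_mem_tails (he : e ∈ A.tails) {y : I} (hy : Irr y) : f.1 (T e y) ≠ T e y := by
  rcases mem_or_mem hA h he with h1 | h1
  · exact Forest.not_fix_of_irr h.pl h1 hy
  · have h2 := Forest.not_fix_of_irr h.pl h1 hy
    intro h3
    exact h2 ((f.1.symm_apply_eq).2 h3.symm)

omit hA in
/-- A free loop is determined by an irrational point of its interval. -/
lemma eq_of_free (ha : a ∉ A.tails) {y z : I} (hy : Irr y) (hz : Irr z) (hyz : T a y = T e z) :
    e = a :=
  eq_of_flow_free (h.inj _ _ _ _ hy hz (Orb.of_eq hyz)) ha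

omit hA in
lemma eq_of_free_right (ha : a ∉ A.tails) (h1 : T a 1 = T e 1) : e = a := by
  obtain ⟨y, z, hy, hz, h2⟩ := (h.pl a).exists_common_right (h.pl e) h1
  exact eq_of_free h ha hy hz h2

omit hA in
lemma eq_of_free_left (ha : a ∉ A.tails) (h1 : T a 0 = T e 0) : e = a := by
  obtain ⟨y, z, hy, hz, h2⟩ := (h.pl a).exists_common_left (h.pl e) h1
  exact eq_of_free h ha hy hz h2

omit hA h in
lemma right_eq_of_mergeDesc {u : List Bool} (h : Desc A.MergeChild e u e')
    (hu : ∀ b ∈ u, b = true) : A.right e = A.right e' := by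
  induction h with
  | nil => rfl
  | @cons e x e' b u h1 _ ih =>
    obtain ⟨m, rfl, rfl⟩ := h1
    obtain rfl := hu b (by simp)
    rw [← ih fun b hb => hu b (by simp [hb])]
    exact (A.merge_corners m).2.2.symm

omit hA h in
lemma right_eq_of_splitDesc {u : List Bool} (h : Desc A.SplitChild e u e')
    (hu : ∀ b ∈ u, b = true) : A.right e = A.right e' := by
  induction h with
  | nil => rfl
  | @cons e x e' b u h1 _ ih =>
    obtain ⟨m, rfl, rfl⟩ := h1
    obtain rfl := hu b (by simp)
    rw [← ih fun b hb => hu b (by simp [hb])]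
    exact (A.split_corners m).2.2.symm

/-- Edges whose intervals have the same fixed point as right end have the same region to the right. -/
lemma right_eq_of_fix (hfix : f.1 (T e 1) = T e 1) (h1 : T e 1 = T e' 1) :
    A.right e = A.right e' := by
  by_cases he : e ∈ A.tails
  swap
  · rw [eq_of_free_right h he h1]
  by_cases he' : e' ∈ A.tails
  swap
  · rw [eq_of_free_right h he' h1.symm]
  have h0 : T e 1 = (f.1 ^ (0 : ℤ)) (T e' 1) := by simpa using h1
  have h0' : T e 1 = ((f⁻¹).1 ^ (0 : ℤ)) (T e' 1) := by simpa using h1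
  have mixed : ∀ {e e'}, (biForest hA h).fst.Mem e → (biForest hA h).snd.Mem e' →
      f.1 (T e 1) = T e 1 → T e 1 = T e' 1 → False := by
    intro e e' he he' hfix h1
    obtain ⟨y, z, hy, hz, h2⟩ := (h.pl e).exists_common_right (h.pl e') h1
    have h3 := (biForest hA h).eq_of_fix_overlap (k := 0) he he' hfix (by simpa using h1)
      (by simpa using h2)
    rw [h3] at hy
    exact hy ⟨1, by simp⟩
  rcases mem_or_mem hA h he with q | q <;> rcases mem_or_mem hA h he' with q' | q'
  · obtain ⟨u, ⟨h2, h3⟩ | ⟨h2, h3⟩⟩ := Forest.comp_below h.pl q q' one_pos one_pos h0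
    · exact right_eq_of_mergeDesc h2 (halves_eq_one h3.symm).1
    · exact (right_eq_of_mergeDesc h2 (halves_eq_one h3.symm).1).symm
  · exact (mixed q q' hfix h1).elim
  · exact (mixed q' q (h1 ▸ hfix) h1.symm).elim
  · obtain ⟨u, ⟨h2, h3⟩ | ⟨h2, h3⟩⟩ := Forest.comp_below h.pl q q' one_pos one_pos h0'
    · exact right_eq_of_splitDesc h2 (halves_eq_one h3.symm).1
    · exact (right_eq_of_splitDesc h2 (halves_eq_one h3.symm).1).symm

omit hA in
lemma ne_outer {r : A.R} (hr : p r ≠ 0) : r ≠ A.outer := by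
  rintro rfl; exact hr h.outer

omit hA in
lemma ne_inner {r : A.R} (hr : p r ≠ 1) : r ≠ A.inner := by
  rintro rfl; exact hr h.inner

omit hA in
lemma eq_inner {r : A.R} (hr : p r = 1) : r = A.inner := by
  by_contra h1
  obtain ⟨⟨e, he⟩, -⟩ := A.good_jointed.exists_left_right h1
    (ne_outer h (by rw [hr]; exact one_ne_zero))
  have h2 := h.left e
  rw [he, hr] at h2
  exact absurd (h.strictMono e one_pos) (by rw [h2.eq_one]; exact le_one'.not_gt)

omit hA in
lemma eq_outer {r : A.R} (hr : p r = 0) : r = A.outer := by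
  by_contra h1
  obtain ⟨-, ⟨e, he⟩⟩ := A.good_jointed.exists_left_right
    (ne_inner h (by rw [hr]; exact zero_ne_one)) h1
  have h2 := h.right e
  rw [he, hr] at h2
  exact absurd (h.strictMono e one_pos) (by rw [h2.eq_zero]; exact nonneg'.not_gt)

/-- A region is determined by its point, up to the action of `f`. -/
lemma region_eq {r r' : A.R} (ho : Orb f (p r) (p r')) : r = r' := by
  by_cases hfix : f.1 (p r') = p r'
  · have hp := ho.eq_of_fix hfix
    by_cases h1 : p r' = 1
    · rw [eq_inner h h1, eq_inner h (hp.trans h1)]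
    by_cases h0 : p r' = 0
    · rw [eq_outer h h0, eq_outer h (hp.trans h0)]
    obtain ⟨-, ⟨e', rfl⟩⟩ := A.good_jointed.exists_left_right (ne_inner h h1) (ne_outer h h0)
    rw [← hp] at h1 h0
    obtain ⟨-, ⟨e, rfl⟩⟩ := A.good_jointed.exists_left_right (ne_inner h h1) (ne_outer h h0)
    have h2 := (h.right e').eq_of_fix hfix
    have h3 := (h.right e).eq_of_fix (hp ▸ hfix)
    exact right_eq_of_fix hA h (by rw [h3]; exact hp ▸ hfix) (h3.trans (hp.trans h2.symm))
  · have key : ∀ r, f.1 (p r) ≠ p r → ∃ s, A.right (A.splitLeft s) = r ∧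
        Orb f (p r) (T (A.splitIn s) (half false 1)) := by
      intro r hr
      obtain ⟨-, ⟨e, rfl⟩⟩ := A.good_jointed.exists_left_right
        (ne_inner h fun h1 => hr (by rw [h1]; exact Orb.map_one f))
        (ne_outer h fun h1 => hr (by rw [h1]; exact Orb.map_zero f))
      obtain ⟨s, h1, h2⟩ := h.exists_split A.good_jointed (e := e)
        fun h1 => hr ((h.right e).symm.fix h1)
      exact ⟨s, h1, (h.right e).symm.trans h2⟩
    obtain ⟨s, rfl, h1⟩ := key r fun h1 => hfix (ho.symm.fix h1)
    obtain ⟨s', rfl, h2⟩ := key r' hfix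
    obtain ⟨k, h3⟩ := (h1.symm.trans (ho.trans h2)).inv
    have hmid : ∀ u : List Bool, half false 1 = halves u (half false 1) → u = [] := by
      intro u hu
      have hne1 : half false 1 ≠ (1 : I) := half_false_one_lt.ne
      have hne0 : half false 1 ≠ (0 : I) := half_false_one_pos.ne'
      cases u with
      | nil => rfl
      | cons b w =>
        cases b
        · exact absurd (halves_eq_one ((half_strictMono false).injective hu).symm).2 hne1
        · rw [half_false_one] at hu hne0
          exact absurd (halves_eq_zero ((half_strictMono true).injective hu).symm).2 hne0
    have q : ∀ s, (biForest hA h).snd.Mem (A.splitIn s) := fun s =>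
      (node_splitForest_iff.2 ⟨s, rfl⟩ : (splitForest hA h).Node _).mem
    obtain ⟨u, ⟨h4, h5⟩ | ⟨h4, h5⟩⟩ := Forest.comp_below h.pl (q s) (q s') half_false_one_pos
      half_false_one_pos h3 <;> obtain rfl := hmid u h5
    · rw [splitIn_injective h4.eq_of_nil]
    · rw [splitIn_injective h4.eq_of_nil]

/-- The interval of a free loop is a maximal interval of fixed points: otherwise there would be a
parallel free loop. -/
lemma exists_not_fix_right (ha : a ∉ A.tails) {z : I} (hz : T a 1 < z) :
    ∃ w, T a 1 < w ∧ w < z ∧ f.1 w ≠ w := by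
  by_contra hcon
  push Not at hcon
  have hfix := fix_of_notMem_tails h ha 1
  have hp : p (A.right a) = T a 1 := (h.right a).symm.eq_of_fix hfix
  have h1 : A.right a ≠ A.inner := ne_inner h (by rw [hp]; exact (hz.trans_le le_one').ne)
  have h2 : A.right a ≠ A.outer := ne_outer h
    (by rw [hp]; exact (nonneg'.trans_lt (h.strictMono a one_pos)).ne')
  obtain ⟨⟨b, hb⟩, -⟩ := A.good_jointed.exists_left_right h1 h2
  have key : ∀ x, A.left x = A.right a → T x 0 = T a 1 := fun x hx => by
    rw [← hp, ← hx]
    exact (h.left x).eq_of_fix (show f.1 (p (A.left x)) = p (A.left x) by rw [hx, hp, hfix])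
  have hb0 := key b hb
  have hb' : b ∉ A.tails := by
    intro hb'
    obtain ⟨y, -, hy, -, -, h4, h5⟩ := (h.pl b).exists_common (T := T b) (U := id) IsPL.id
      (a := T a 1) (b := min z (T b 1)) (u' := 0) (v' := 1)
      (lt_min hz (hb0 ▸ h.strictMono b one_pos)) hb0.le (min_le_right _ _)
      nonneg' le_one'
    exact not_fix_of_mem_tails hA h hb' hy (hcon _ h4 (h5.trans_le (min_le_left _ _)))
  refine hA.not_isParallel (a := a) (b := b) ⟨?_, ha, hb', h1, h2, fun x => ⟨fun hx => ?_, ?_⟩,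
    fun x => ⟨fun hx => ?_, ?_⟩⟩
  · rintro rfl
    exact (h.strictMono a one_pos).ne hb0
  · refine eq_of_free_right h ha ?_
    rw [← hp, ← hx]
    exact ((h.right x).eq_of_fix (show f.1 (p (A.right x)) = p (A.right x) by rw [hx, hp, hfix])).symm
  · rintro rfl; rfl
  · exact eq_of_free_left h hb' (hb0.trans (key x hx).symm)
  · rintro rfl; exact hb

lemma exists_not_fix_left (ha : a ∉ A.tails) {z : I} (hz : z < T a 0) :
    ∃ w, z < w ∧ w < T a 0 ∧ f.1 w ≠ w := by
  by_contra hcon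
  push Not at hcon
  have hfix := fix_of_notMem_tails h ha 0
  have hp : p (A.left a) = T a 0 := (h.left a).symm.eq_of_fix hfix
  have h1 : A.left a ≠ A.inner := ne_inner h
    (by rw [hp]; exact ((h.strictMono a one_pos).trans_le le_one').ne)
  have h2 : A.left a ≠ A.outer := ne_outer h (by rw [hp]; exact (nonneg'.trans_lt hz).ne')
  obtain ⟨-, ⟨b, hb⟩⟩ := A.good_jointed.exists_left_right h1 h2
  have key : ∀ x, A.right x = A.left a → T x 1 = T a 0 := fun x hx => by
    rw [← hp, ← hx]
    exact (h.right x).eq_of_fix (show f.1 (p (A.right x)) = p (A.right x) by rw [hx, hp, hfix])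
  have hb0 := key b hb
  have hb' : b ∉ A.tails := by
    intro hb'
    obtain ⟨y, -, hy, -, -, h4, h5⟩ := (h.pl b).exists_common (T := T b) (U := id) IsPL.id
      (a := max z (T b 0)) (b := T a 0) (u' := 0) (v' := 1)
      (max_lt hz (hb0 ▸ h.strictMono b one_pos)) (le_max_right _ _) hb0.ge
      nonneg' le_one'
    exact not_fix_of_mem_tails hA h hb' hy (hcon _ ((le_max_left _ _).trans_lt h4) h5)
  replace hb : A.right b = A.left a := hb
  refine hA.not_isParallel (a := b) (b := a) ⟨?_, hb', ha, hb ▸ h1, hb ▸ h2,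
    fun x => ⟨fun hx => ?_, ?_⟩, fun x => ⟨fun hx => ?_, ?_⟩⟩
  · rintro rfl
    exact (h.strictMono b one_pos).ne' hb0
  · exact eq_of_free_right h hb' (hb0.trans (key x (hx.trans hb)).symm)
  · rintro rfl; rfl
  · rw [hb] at hx
    refine eq_of_free_left h ha ?_
    rw [← hp, ← hx]
    exact ((h.left x).eq_of_fix (show f.1 (p (A.left x)) = p (A.left x) by rw [hx, hp, hfix])).symm
  · rintro rfl; exact hb.symm

end Colored

end AnnularDiagram

/-! ### Diagrams with the same coloring -/

namespace AnnularDiagram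

variable {A B : AnnularDiagram} {f : ThompsonF} {c : A.E → ℤ} {T : A.E → I → I} {p : A.R → I}
  {c' : B.E → ℤ} {T' : B.E → I → I} {p' : B.R → I}

/-- Two edges of colored diagrams carry the same interval, up to the action of `f`. -/
def EdgeMatch (A B : AnnularDiagram) (f : ThompsonF) (T : A.E → I → I) (T' : B.E → I → I)
    (e : A.E) (e' : B.E) : Prop :=
  e ∈ A.tails ∧ e' ∈ B.tails ∧ Sim f (T e) (T' e') ∨
    e ∉ A.tails ∧ e' ∉ B.tails ∧ T e 0 = T' e' 0 ∧ T e 1 = T' e' 1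

namespace EdgeMatch

variable {e e₁ : A.E} {e' e₁' : B.E}

lemma symm (h : EdgeMatch A B f T T' e e') : EdgeMatch B A f T' T e' e := by
  rcases h with ⟨h1, h2, h3⟩ | ⟨h1, h2, h3, h4⟩
  · exact .inl ⟨h2, h1, h3.symm⟩
  · exact .inr ⟨h2, h1, h3.symm, h4.symm⟩

lemma orb_zero (h : EdgeMatch A B f T T' e e') : Orb f (T e 0) (T' e' 0) := by
  rcases h with ⟨_, _, h⟩ | ⟨_, _, h, _⟩
  exacts [h.orb 0, .of_eq h]

lemma orb_one (h : EdgeMatch A B f T T' e e') : Orb f (T e 1) (T' e' 1) := by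
  rcases h with ⟨_, _, h⟩ | ⟨_, _, _, h⟩
  exacts [h.orb 1, .of_eq h]

lemma sim (h : EdgeMatch A B f T T' e e') (he : e ∈ A.tails) : Sim f (T e) (T' e') := by
  rcases h with ⟨_, _, h⟩ | ⟨h, _⟩
  exacts [h, absurd he h]

variable (hA : A.IsReduced) (h : A.jointed.IsColoring f c T p) (hB : B.IsReduced)
  (h' : B.jointed.IsColoring f c' T' p')

include hA h in
lemma unique (h1 : EdgeMatch A B f T T' e e') (h2 : EdgeMatch A B f T T' e₁ e') : e = e₁ := by
  rcases h1 with ⟨t, t', h1⟩ | ⟨t, t', h1, -⟩ <;> rcases h2 with ⟨q, q', h2⟩ | ⟨q, q', h2, -⟩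
  · exact (biForest hA h).eq_of_sim (mem_or_mem hA h t) (mem_or_mem hA h q) (h1.trans h2.symm)
  · exact absurd t' q'
  · exact absurd q' t'
  · exact eq_of_free_left h q (h2.trans h1.symm)

include hA h hB h' in
lemma exists_match (e : A.E) : ∃ e', EdgeMatch A B f T T' e e' := by
  by_cases he : e ∈ A.tails
  · rcases mem_or_mem hA h he with h1 | h1
    · obtain ⟨e', h2, h3⟩ := (biForest hA h).exists_sim (biForest hB h') h1
      exact ⟨e', .inl ⟨he, mem_tails_of_mem hB h' (.inl h2), h3⟩⟩
    · obtain ⟨e', h2, h3⟩ := (biForest hA h).swap.exists_sim (biForest hB h').swap h1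
      exact ⟨e', .inl ⟨he, mem_tails_of_mem hB h' (.inr h2), (biForest hA h).swap.sim_inv h3⟩⟩
  · obtain ⟨y, hy⟩ := exists_irr
    have hf := fix_of_notMem_tails h he
    obtain ⟨e', y', ho⟩ := h'.cov (T e y) ((h.pl e).irrational.2 hy)
    have h1 : T' e' y' = T e y := ho.symm.eq_of_fix (hf y)
    have hy' : Irr y' := (h'.pl e').irrational.1 (by
      show Irr (T' e' y'); rw [h1]; exact (h.pl e).irrational.2 hy)
    have he' : e' ∉ B.tails := fun he' =>
      not_fix_of_mem_tails hB h' he' hy' (by rw [h1]; exact hf y)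
    have hf' := fix_of_notMem_tails h' he'
    have fill : ∀ {E : Type} {T : E → I → I} {e : E} {w : I}, (IsPL fun y => (T e y : ℝ)) →
        (∀ y, f.1 (T e y) = T e y) → T e 0 ≤ w → w ≤ T e 1 → f.1 w = w := by
      intro E T e w hpl hfx h1 h2
      obtain ⟨z, rfl⟩ := hpl.exists_eq h1 h2
      exact hfx z
    have l1 : T e 0 ≤ T e y := (h.strictMono e).monotone nonneg'
    have l2 : T e y ≤ T e 1 := (h.strictMono e).monotone le_one'
    have l3 : T' e' 0 ≤ T e y := h1 ▸ (h'.strictMono e').monotone nonneg'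
    have l4 : T e y ≤ T' e' 1 := h1 ▸ (h'.strictMono e').monotone le_one'
    refine ⟨e', .inr ⟨he, he', ?_, ?_⟩⟩
    · rcases lt_trichotomy (T e 0) (T' e' 0) with h2 | h2 | h2
      · obtain ⟨w, h3, h4, h5⟩ := exists_not_fix_left hB h' he' h2
        exact absurd (fill (h.pl e) hf h3.le (h4.le.trans (l3.trans l2))) h5
      · exact h2
      · obtain ⟨w, h3, h4, h5⟩ := exists_not_fix_left hA h he h2
        exact absurd (fill (h'.pl e') hf' h3.le (h4.le.trans (l1.trans l4))) h5
    · rcases lt_trichotomy (T e 1) (T' e' 1) with h2 | h2 | h2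
      · obtain ⟨w, h3, h4, h5⟩ := exists_not_fix_right hA h he h2
        exact absurd (fill (h'.pl e') hf' ((l3.trans l2).trans h3.le) h4.le) h5
      · exact h2
      · obtain ⟨w, h3, h4, h5⟩ := exists_not_fix_right hB h' he' h2
        exact absurd (fill (h.pl e) hf ((l1.trans l4).trans h3.le) h4.le) h5

include hA h hB h' in
lemma mergeOut_eq {m : A.M} (h1 : EdgeMatch A B f T T' (A.mergeOut m) e') :
    ∃ m', e' = B.mergeOut m' := by
  have hn : (biForest hA h).fst.Node (A.mergeOut m) :=
    (node_mergeForest_iff (hA := hA) (h := h)).2 ⟨m, rfl⟩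
  obtain ⟨e₁', h2, h3⟩ := (biForest hA h).exists_sim (biForest hB h') hn.mem
  have ht : A.mergeOut m ∈ A.tails := mergeOut_mem_tails
  obtain rfl : e₁' = e' := unique hB h' (.inl ⟨mem_tails_of_mem hB h' (.inl h2), ht, h3.symm⟩) h1.symm
  exact (node_mergeForest_iff (hA := hB) (h := h')).1
    ((biForest hA h).node_of_sim (biForest hB h') hn h2 h3)

include hA h hB h' in
lemma splitIn_eq {s : A.S} (h1 : EdgeMatch A B f T T' (A.splitIn s) e') :
    ∃ s', e' = B.splitIn s' := by
  have hn : (biForest hA h).swap.fst.Node (A.splitIn s) :=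
    (node_splitForest_iff (hA := hA) (h := h)).2 ⟨s, rfl⟩
  obtain ⟨e₁', h2, h3⟩ := (biForest hA h).swap.exists_sim (biForest hB h').swap hn.mem
  have ht : A.splitIn s ∈ A.tails := mem_tails_of_mem_heads splitIn_mem_heads
  obtain rfl : e₁' = e' := unique hB h' (.inl ⟨mem_tails_of_mem hB h' (.inr h2), ht,
    ((biForest hA h).swap.sim_inv h3).symm⟩) h1.symm
  exact (node_splitForest_iff (hA := hB) (h := h')).1
    ((biForest hA h).swap.node_of_sim (biForest hB h').swap hn h2 h3)

include h h' in
lemma splitOut {s : A.S} {s' : B.S} (h1 : EdgeMatch A B f T T' (A.splitIn s) (B.splitIn s'))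
    (b : Bool) : EdgeMatch A B f T T' (A.splitOut s b) (B.splitOut s' b) := by
  refine .inl ⟨splitOut_mem_tails, splitOut_mem_tails, ?_⟩
  have h2 := (h1.sim (mem_tails_of_mem_heads splitIn_mem_heads)).comp [b]
  have h3 : Sim f (fun y => T (A.splitIn s) (half b y)) (T (A.splitOut s b)) := Sim.symm
    ⟨_, fun y => (h.eq (.split (G := A.jointed) s b) y).symm⟩
  have h4 : Sim f (fun y => T' (B.splitIn s') (half b y)) (T' (B.splitOut s' b)) := Sim.symm
    ⟨_, fun y => (h'.eq (.split (G := B.jointed) s' b) y).symm⟩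
  exact h3.symm.trans (h2.trans h4)

include h h' in
lemma mergeIn {m : A.M} {m' : B.M} (h1 : EdgeMatch A B f T T' (A.mergeOut m) (B.mergeOut m'))
    (b : Bool) : EdgeMatch A B f T T' (A.mergeIn m b) (B.mergeIn m' b) := by
  refine .inl ⟨mem_tails_of_mem_heads mergeIn_mem_heads,
    mem_tails_of_mem_heads mergeIn_mem_heads, ?_⟩
  have h2 := (h1.sim mergeOut_mem_tails).comp [b]
  have h3 : Sim f (fun y => T (A.mergeOut m) (half b y)) (T (A.mergeIn m b)) :=
    ⟨_, fun y => (h.eq (.merge (G := A.jointed) m b) y).symm⟩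
  have h4 : Sim f (fun y => T' (B.mergeOut m') (half b y)) (T' (B.mergeIn m' b)) :=
    ⟨_, fun y => (h'.eq (.merge (G := B.jointed) m' b) y).symm⟩
  exact h3.symm.trans (h2.trans h4)

include hA h hB h' in
lemma exists_region (r : A.R) : ∃ r', Orb f (p r) (p' r') := by
  by_cases h1 : r = A.inner
  · exact ⟨B.inner, .of_eq (by rw [h1]; exact h.inner.trans h'.inner.symm)⟩
  by_cases h2 : r = A.outer
  · exact ⟨B.outer, .of_eq (by rw [h2]; exact h.outer.trans h'.outer.symm)⟩
  obtain ⟨-, e, rfl⟩ := A.good_jointed.exists_left_right h1 h2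
  obtain ⟨e', h3⟩ := exists_match hA h hB h' e
  exact ⟨_, (h.right e).symm.trans (h3.orb_one.trans (h'.right e'))⟩

end EdgeMatch

open EdgeMatch (exists_match unique exists_region) in
/-- Reduced diagrams colored by the same element are isotopic. -/
theorem IsReduced.isotopic_of_colored (hA : A.IsReduced) (hB : B.IsReduced) (hAf : A.Colored f)
    (hBf : B.Colored f) : A.Isotopic B := by
  obtain ⟨c, T, p, h⟩ := hAf
  obtain ⟨c', T', p', h'⟩ := hBf
  choose π hπ using exists_match hA h hB h'
  choose ρ hρ using exists_region hA h hB h'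
  have hπ_unique : ∀ {e e'}, EdgeMatch A B f T T' e e' → e' = π e := fun h1 =>
    unique hB h' h1.symm (hπ _).symm
  have hρ_unique : ∀ {r r'}, Orb f (p r) (p' r') → r' = ρ r := fun h1 =>
    region_eq hB h' (h1.symm.trans (hρ _))
  have hS : ∀ s' : B.S, ∃ s, EdgeMatch A B f T T' (A.splitIn s) (B.splitIn s') := by
    intro s'
    obtain ⟨e, h1⟩ := exists_match hB h' hA h (B.splitIn s')
    obtain ⟨s, rfl⟩ := EdgeMatch.splitIn_eq hB h' hA h h1
    exact ⟨s, h1.symm⟩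
  have hM : ∀ m' : B.M, ∃ m, EdgeMatch A B f T T' (A.mergeOut m) (B.mergeOut m') := by
    intro m'
    obtain ⟨e, h1⟩ := exists_match hB h' hA h (B.mergeOut m')
    obtain ⟨m, rfl⟩ := EdgeMatch.mergeOut_eq hB h' hA h h1
    exact ⟨m, h1.symm⟩
  choose τ hτ using hS
  choose μ hμ using hM
  refine ⟨τ, μ, π, ρ, ?_, hρ_unique (.of_eq (h.inner.trans h'.inner.symm)),
    hρ_unique (.of_eq (h.outer.trans h'.outer.symm))⟩
  exact
  { split_injective := fun s s' hs => splitIn_injective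
      ((hπ_unique (hτ s)).trans (hs ▸ (hπ_unique (hτ s')).symm))
    split_range := by
      rw [Set.compl_empty]
      refine Set.range_eq_univ.2 fun s => ?_
      obtain ⟨s', h1⟩ := EdgeMatch.splitIn_eq hA h hB h' (hπ (A.splitIn s))
      have h2 := hπ (A.splitIn s)
      rw [h1] at h2
      exact ⟨s', splitIn_injective (unique hA h (hτ s') h2)⟩
    merge_injective := fun s s' hs => mergeOut_injective
      ((hπ_unique (hμ s)).trans (hs ▸ (hπ_unique (hμ s')).symm))
    merge_range := by
      rw [Set.compl_empty]
      refine Set.range_eq_univ.2 fun m => ?_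
      obtain ⟨m', h1⟩ := EdgeMatch.mergeOut_eq hA h hB h' (hπ (A.mergeOut m))
      have h2 := hπ (A.mergeOut m)
      rw [h1] at h2
      exact ⟨m', mergeOut_injective (unique hA h (hμ m') h2)⟩
    edge_surj := fun e' => by
      obtain ⟨e, h1⟩ := exists_match hB h' hA h e'
      exact ⟨e, id, (hπ_unique h1.symm).symm⟩
    edge_ker := fun e e' _ _ => by
      rw [eqvGen_false_iff]
      refine ⟨fun h1 => unique hA h (hπ e) (h1 ▸ hπ e'), fun h1 => by rw [h1]⟩
    region_surj := fun r' => by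
      obtain ⟨r, h1⟩ := exists_region hB h' hA h r'
      exact ⟨r, id, (hρ_unique h1.symm).symm⟩
    region_ker := fun r r' _ _ => by
      rw [eqvGen_false_iff]
      refine ⟨fun h1 => region_eq hA h ((hρ r).trans (h1 ▸ (hρ r').symm)), fun h1 => by rw [h1]⟩
    splitIn := fun s => hπ_unique (hτ s)
    splitLeft := fun s => hπ_unique (EdgeMatch.splitOut h h' (hτ s) false)
    splitRight := fun s => hπ_unique (EdgeMatch.splitOut h h' (hτ s) true)
    mergeLeft := fun s => hπ_unique (EdgeMatch.mergeIn h h' (hμ s) false)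
    mergeRight := fun s => hπ_unique (EdgeMatch.mergeIn h h' (hμ s) true)
    mergeOut := fun s => hπ_unique (hμ s)
    left := fun e _ _ => hρ_unique ((h.left e).symm.trans ((hπ e).orb_zero.trans (h'.left _)))
    right := fun e _ _ => hρ_unique ((h.right e).symm.trans ((hπ e).orb_one.trans (h'.right _))) }

end AnnularDiagram

/-! ### The coloring of the closure of a strand diagram -/

/-- Functions may be defined by well-founded recursion. -/
lemma WellFounded.exists_rec {α β : Type} [Inhabited β] {r : α → α → Prop} (hr : WellFounded r)
    (F : α → (α → β) → β) (hF : ∀ a L L', (∀ b, r b a → L b = L' b) → F a L = F a L') :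
    ∃ L, ∀ a, L a = F a L := by
  classical
  refine ⟨hr.fix fun a L => F a fun b => if h : r b a then L b h else default, fun a => ?_⟩
  rw [hr.fix_eq]
  exact hF _ _ _ fun b hb => by rw [dif_pos hb]

/-- In a planar graph, an integer weight on the edges which is conserved at the vertices is the
difference of a height of the regions. -/
lemma StrandGraph.IsPlanar.exists_height {G : StrandGraph} (hG : G.IsPlanar) (M : G.E → ℤ)
    (hS : ∀ s, M (G.splitIn s) = M (G.splitLeft s) + M (G.splitRight s))
    (hM : ∀ m, M (G.mergeOut m) = M (G.mergeLeft m) + M (G.mergeRight m)) :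
    ∃ P : G.R → ℤ, ∀ e, P (G.right e) = P (G.left e) + M e := by
  have key : ∀ a b, EqvGen (fun p q => ∃ e, G.left e = p ∧ G.right e = q) a b →
      ∃ c : G.E → ℤ, ∀ r, ∑ e, c e * G.inc e r = ind a r - ind b r := by
    intro a b h
    induction h with
    | rel a b h =>
      obtain ⟨e, rfl, rfl⟩ := h
      exact ⟨ind e, fun r => sum_ind_mul e _⟩
    | refl => exact ⟨0, by simp⟩
    | symm a b _ h =>
      obtain ⟨c, h⟩ := h
      refine ⟨fun e => -c e, fun r => ?_⟩
      simp only [neg_mul, Finset.sum_neg_distrib]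
      rw [h, neg_sub]
    | trans a b d _ _ h h' =>
      obtain ⟨c, h⟩ := h
      obtain ⟨c', h'⟩ := h'
      refine ⟨fun e => c e + c' e, fun r => ?_⟩
      simp only [add_mul, sum_add_distrib]
      rw [h, h']; ring
  rcases isEmpty_or_nonempty G.R with hR | ⟨⟨r₀⟩⟩
  · exact ⟨fun _ => 0, fun e => (hR.false (G.left e)).elim⟩
  choose c hc using fun r => key r r₀ (hG.1 _ _)
  refine ⟨fun r => -∑ e, c r e * M e, fun e => ?_⟩
  obtain ⟨φ, ψ, h⟩ := hG.2 (fun x => c (G.left e) x - c (G.right e) x - ind e x) fun r => by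
    rw [dualBoundary_eq]
    simp only [sub_mul, sum_sub_distrib, hc, sum_ind_mul]
    unfold inc; ring
  have h1 : ∑ x, (c (G.left e) x - c (G.right e) x - ind e x) * M x = 0 := by
    have h2 : ∀ x, c (G.left e) x - c (G.right e) x - ind e x =
        G.headPot φ ψ x - G.tailPot φ ψ x := fun x => by rw [← coboundary_eq, ← h]
    simp only [h2]
    simp only [sub_mul, sum_sub_distrib, sum_headPot_mul, sum_tailPot_mul, hS, hM]
    ring
  simp only [sub_mul, sum_sub_distrib, sum_ind_mul] at h1
  linarith

namespace StrandDiagram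

variable {D : StrandDiagram}

lemma mem_tails_iff {e : D.E} : e ∈ D.tails ↔ e ≠ D.source := by rw [D.tails_eq]; rfl

lemma mem_heads_iff {e : D.E} : e ∈ D.heads ↔ e ≠ D.sink := by rw [D.heads_eq]; rfl

variable (D) in
lemma exists_rank : ∃ rank : D.E → ℤ,
    (∀ s b, rank (D.splitIn s) < rank (D.splitOut s b)) ∧
    ∀ m b, rank (D.mergeIn m b) < rank (D.mergeOut m) := by
  obtain ⟨N, hN, φ, ψ, χ, h⟩ := D.good_jointed.positive_of_isCut D.isCut_ind_sink
  have key : ∀ {e u e' v}, D.jointed.Trans e u e' v → e ∈ D.heads →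
      D.jointed.tpot φ ψ χ e < D.jointed.tpot φ ψ χ e' := by
    intro e u e' v ht he
    have h1 := h e
    rw [ind_of_ne (mem_heads_iff.1 he).symm, ht.hpot_eq_tpot] at h1
    linarith
  exact ⟨_, fun s b => key (.split (G := D.jointed) s b) splitIn_mem_heads,
    fun m b => key (.merge (G := D.jointed) m b) mergeIn_mem_heads⟩

lemma wellFounded_rank (rank : D.E → ℤ) : WellFounded fun e e' => rank e < rank e' := by
  have : IsTrans D.E fun e e' => rank e < rank e' := ⟨fun _ _ _ h h' => h.trans h'⟩
  have : Std.Irrefl fun e e' : D.E => rank e < rank e' := ⟨fun _ => lt_irrefl _⟩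
  exact Finite.wellFounded_of_trans_of_irrefl _

/-- Induction along the strands, from the source downwards. -/
lemma edge_induction {P : D.E → Prop} (source : P D.source)
    (split : ∀ s b, P (D.splitIn s) → P (D.splitOut s b))
    (merge : ∀ m, (∀ b, P (D.mergeIn m b)) → P (D.mergeOut m)) (e : D.E) : P e := by
  obtain ⟨rank, h1, h2⟩ := D.exists_rank
  induction e using (wellFounded_rank rank).induction with
  | _ e ih =>
    by_cases he : e = D.source
    · exact he ▸ source
    · rcases mem_tails'.1 (mem_tails_iff.2 he) with ⟨s, b, rfl⟩ | ⟨m, rfl⟩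
      · exact split s b (ih _ (h1 s b))
      · exact merge m fun b => ih _ (h2 m b)

/-- Numbers entering at the source arrive at the sink. -/
lemma exists_carries_sink (x : ℝ) : ∃ y, D.Carries x D.sink y := by
  obtain ⟨rank, h1, h2⟩ := D.exists_rank
  obtain ⟨e, ⟨y, h⟩, hmax⟩ := Set.exists_max_image {e | ∃ y, D.Carries x e y} rank
    (Set.toFinite _) ⟨_, _, .source⟩
  by_cases he : e = D.sink
  · exact ⟨y, he ▸ h⟩
  rcases mem_heads.1 (mem_heads_iff.2 he) with ⟨s, rfl⟩ | ⟨m, rfl⟩ | ⟨m, rfl⟩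
  · rcases lt_or_ge y (1 / 2) with hy | hy
    · exact absurd (hmax _ ⟨_, .splitLeft s y h hy⟩) (h1 s false).not_ge
    · exact absurd (hmax _ ⟨_, .splitRight s y h hy⟩) (h1 s true).not_ge
  · exact absurd (hmax _ ⟨_, .mergeLeft m y h⟩) (h2 m false).not_ge
  · exact absurd (hmax _ ⟨_, .mergeRight m y h⟩) (h2 m true).not_ge

end StrandDiagram

/-- Labels on the edges by maps which are compatible with splits and merges. -/
structure StrandGraph.IsLabel {α : Type} (G : StrandGraph) (T : G.E → I → α) : Prop where
  split : ∀ s b y, T (G.splitOut s b) y = T (G.splitIn s) (half b y)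
  merge : ∀ m b y, T (G.mergeOut m) (half b y) = T (G.mergeIn m b) y

namespace StrandDiagram

variable {D : StrandDiagram} {f g : ThompsonF}

/-- Compatible labels are constant along the strands. -/
lemma Carries.label {α : Type} {T : D.E → I → α} (hT : D.IsLabel T) {x : I} {e : D.E} {y : ℝ}
    (h : D.Carries x e y) : ∃ z : I, (z : ℝ) = y ∧ T e z = T D.source x := by
  induction h with
  | source => exact ⟨x, rfl, rfl⟩
  | splitLeft s y _ hy ih =>
    obtain ⟨z, rfl, h⟩ := ih
    refine ⟨⟨2 * z, by linarith [z.2.1], by linarith⟩, rfl, ?_⟩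
    rw [← h, show D.splitLeft s = D.splitOut s false from rfl, hT.split]
    congr 1; exact Subtype.ext (by rw [half_false_coe]; ring)
  | splitRight s y _ hy ih =>
    obtain ⟨z, rfl, h⟩ := ih
    refine ⟨⟨2 * z - 1, by linarith, by linarith [z.2.2]⟩, rfl, ?_⟩
    rw [← h, show D.splitRight s = D.splitOut s true from rfl, hT.split]
    congr 1; exact Subtype.ext (by rw [half_true_coe]; ring)
  | mergeLeft m y _ ih =>
    obtain ⟨z, rfl, h⟩ := ih
    exact ⟨half false z, half_false_coe z, (hT.merge m false z).trans h⟩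
  | mergeRight m y _ ih =>
    obtain ⟨z, rfl, h⟩ := ih
    exact ⟨half true z, half_true_coe z, (hT.merge m true z).trans h⟩

variable (D) in
open Classical in
/-- The distance of the points of an edge from its left end, measured at the source. -/
lemma exists_lengths : ∃ L : D.E → I → ℝ, (∀ e, IsPL (L e)) ∧ (∀ e, L e 0 = 0) ∧
    (∀ y, L D.source y = y) ∧
    (∀ s y, L (D.splitLeft s) y = L (D.splitIn s) (half false y)) ∧
    (∀ s y, L (D.splitRight s) y = L (D.splitIn s) (half true y) - L (D.splitIn s) (half false 1)) ∧
    (∀ m y, L (D.mergeOut m) (half false y) = L (D.mergeLeft m) y) ∧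
    ∀ m y, L (D.mergeOut m) (half true y) = L (D.mergeLeft m) 1 + L (D.mergeRight m) y := by
  obtain ⟨rank, h1, h2⟩ := D.exists_rank
  let pr : ℝ → I := Set.projIcc 0 1 zero_le_one
  obtain ⟨L, hL⟩ := (wellFounded_rank rank).exists_rec (β := I → ℝ) (fun e L =>
    if h : ∃ s, e = D.splitLeft s then fun y => L (D.splitIn h.choose) (half false y)
    else if h : ∃ s, e = D.splitRight s then fun y =>
      L (D.splitIn h.choose) (half true y) - L (D.splitIn h.choose) (half false 1)
    else if h : ∃ m, e = D.mergeOut m then fun y =>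
      L (D.mergeLeft h.choose) (pr (2 * y)) + L (D.mergeRight h.choose) (pr (2 * y - 1))
    else fun y => y) (by
      intro e L L' h
      split_ifs with q1 q2 q3
      · rw [h _ ((h1 q1.choose false).trans_eq (congrArg rank q1.choose_spec.symm))]
      · rw [h _ ((h1 q2.choose true).trans_eq (congrArg rank q2.choose_spec.symm))]
      · have q := congrArg rank q3.choose_spec.symm
        rw [h (D.mergeLeft _) ((h2 q3.choose false).trans_eq q),
          h (D.mergeRight _) ((h2 q3.choose true).trans_eq q)]
      · rfl)
  have e1 : ∀ y, L D.source y = y := fun y => by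
    have q : D.source ∉ D.tails := fun h => mem_tails_iff.1 h rfl
    rw [hL, dif_neg (fun ⟨s, h⟩ => q (h ▸ splitLeft_mem_tails)),
      dif_neg (fun ⟨s, h⟩ => q (h ▸ splitRight_mem_tails)),
      dif_neg (fun ⟨s, h⟩ => q (h ▸ mergeOut_mem_tails))]
  have e2 : ∀ s y, L (D.splitLeft s) y = L (D.splitIn s) (half false y) := fun s y => by
    have q : ∃ t, D.splitLeft s = D.splitLeft t := ⟨s, rfl⟩
    rw [hL, dif_pos q, ← splitLeft_injective q.choose_spec]
  have e3 : ∀ s y, L (D.splitRight s) y =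
      L (D.splitIn s) (half true y) - L (D.splitIn s) (half false 1) := fun s y => by
    have q : ∃ t, D.splitRight s = D.splitRight t := ⟨s, rfl⟩
    rw [hL, dif_neg (fun ⟨_, h⟩ => splitLeft_ne_splitRight h.symm), dif_pos q,
      ← splitRight_injective q.choose_spec]
  have e4 : ∀ m y, L (D.mergeOut m) y =
      L (D.mergeLeft m) (pr (2 * y)) + L (D.mergeRight m) (pr (2 * y - 1)) := fun m y => by
    have q : ∃ t, D.mergeOut m = D.mergeOut t := ⟨m, rfl⟩
    rw [hL, dif_neg (fun ⟨_, h⟩ => splitLeft_ne_mergeOut h.symm),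
      dif_neg (fun ⟨_, h⟩ => splitRight_ne_mergeOut h.symm), dif_pos q,
      ← mergeOut_injective q.choose_spec]
  have hpr0 : ∀ t : ℝ, t ≤ 0 → pr t = 0 := fun t ht => Set.projIcc_of_le_left _ ht
  have hpr1 : ∀ t : ℝ, 1 ≤ t → pr t = 1 := fun t ht => Set.projIcc_of_right_le _ ht
  have hpr : ∀ (y : I) (t : ℝ), t = y → pr t = y := fun y t ht => ht ▸ Set.projIcc_val _ y
  have hz : ∀ e, L e 0 = 0 := by
    refine edge_induction (e1 0) (fun s b h => ?_) fun m h => ?_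
    · cases b
      · rw [show D.splitOut s false = D.splitLeft s from rfl, e2, half_false_zero, h]
      · rw [show D.splitOut s true = D.splitRight s from rfl, e3, half_false_one, sub_self]
    · rw [e4, hpr0 _ (by simp), hpr0 _ (by simp)]
      rw [show L (D.mergeLeft m) 0 = 0 from h false, show L (D.mergeRight m) 0 = 0 from h true,
        add_zero]
  have e5 : ∀ m y, L (D.mergeOut m) (half false y) = L (D.mergeLeft m) y := fun m y => by
    rw [e4, half_false_coe, hpr y _ (by ring), hpr0 _ (by linarith [y.2.2]), hz, add_zero]
  have e6 : ∀ m y, L (D.mergeOut m) (half true y) =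
      L (D.mergeLeft m) 1 + L (D.mergeRight m) y := fun m y => by
    rw [e4, half_true_coe, hpr1 (2 * ((y + 1) / 2)) (by linarith [y.2.1]), hpr y _ (by ring)]
  refine ⟨L, ?_, hz, e1, e2, e3, e5, e6⟩
  refine edge_induction (by rw [funext e1]; exact IsPL.id) (fun s b h => ?_) fun m h => ?_
  · cases b
    · show IsPL (L (D.splitLeft s)); rw [funext (e2 s)]; exact h.comp_half false
    · show IsPL (L (D.splitRight s)); rw [funext (e3 s)]
      exact (h.comp_half true).add_const (h.isDyadic (half_isDyadic (y := 1) IsDyadic.one)).neg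
  · refine .glue _ ?_ ?_
    · rw [funext (e5 m)]; exact h false
    · rw [funext (e6 m)]
      simp only [add_comm (L (D.mergeLeft m) 1)]
      exact (h true).add_const ((h false).isDyadic (y := 1) IsDyadic.one)

variable (D) in
/-- The point of the source at which a strand through a given point of an edge begins. -/
lemma exists_origin : ∃ (T : D.E → I → I) (p : D.R → I), D.IsLabel T ∧
    (∀ e, IsPL fun y => (T e y : ℝ)) ∧ (∀ y, T D.source y = y) ∧
    (∀ e, T e 0 = p (D.left e)) ∧ ∀ e, T e 1 = p (D.right e) := by
  obtain ⟨L, hpl, hz, e1, e2, e3, e4, e5⟩ := D.exists_lengths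
  choose n hn using fun e => isDyadic_mem_grid ((hpl e).isDyadic (y := 1) IsDyadic.one)
  choose M hM using fun e => hn e (Finset.univ.sup n) (Finset.le_sup (mem_univ e))
  set K : ℝ := 2 ^ Finset.univ.sup n with hK
  have hK0 : K ≠ 0 := by positivity
  obtain ⟨P, hP⟩ := D.planar.exists_height M (fun s => by
    have h1 := e3 s 1
    rw [half_true_one, ← e2, hM, hM, hM, div_eq_iff hK0] at h1
    field_simp at h1
    have h2 : (M (D.splitRight s) : ℝ) = M (D.splitIn s) - M (D.splitLeft s) := by linarith
    have h3 : M (D.splitRight s) = M (D.splitIn s) - M (D.splitLeft s) := by exact_mod_cast h2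
    linarith) (fun m => by
    have h1 := e5 m 1
    rw [half_true_one, hM, hM, hM] at h1
    field_simp at h1
    exact_mod_cast h1)
  set p : D.R → ℝ := fun r => (P r - P (D.left D.source)) / K with hp
  have hpr : ∀ e, p (D.right e) = p (D.left e) + L e 1 := fun e => by
    rw [hM, hp]; simp only [hP]; push_cast; ring
  set T : D.E → I → ℝ := fun e y => p (D.left e) + L e y with hT
  have lab : D.IsLabel T := by
    refine ⟨fun s b y => ?_, fun m b y => ?_⟩
    · obtain ⟨c1, c2, -⟩ := D.split_corners s
      cases b
      · show p (D.left (D.splitLeft s)) + L (D.splitLeft s) y = _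
        rw [e2, ← c1]
      · show p (D.left (D.splitRight s)) + L (D.splitRight s) y = _
        rw [e3, ← c2, hpr, e2, ← c1, hT]; ring
    · obtain ⟨c1, c2, -⟩ := D.merge_corners m
      cases b
      · show p (D.left (D.mergeOut m)) + _ = p (D.left (D.mergeLeft m)) + L (D.mergeLeft m) y
        rw [e4, c1]
      · show p (D.left (D.mergeOut m)) + _ = p (D.left (D.mergeRight m)) + L (D.mergeRight m) y
        rw [e5, ← c2, hpr, c1]; ring
  have hsrc : ∀ y, T D.source y = y := fun y => by rw [hT]; simp [hp, e1]
  have mem : ∀ e y, T e y ∈ Set.Icc (0 : ℝ) 1 := by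
    refine edge_induction (fun y => (hsrc y).symm ▸ y.2) (fun s b h y => ?_) fun m h y => ?_
    · rw [lab.split]; exact h _
    · obtain ⟨b, y, rfl⟩ := exists_half y
      rw [lab.merge]; exact h b y
  have hproj : ∀ (x : ℝ) (y : I), (y : ℝ) = x → y = Set.projIcc 0 1 zero_le_one x := fun x y h =>
    h ▸ (Set.projIcc_val zero_le_one y).symm
  refine ⟨fun e y => ⟨T e y, mem e y⟩, fun r => Set.projIcc 0 1 zero_le_one (p r),
    ⟨fun s b y => Subtype.ext (lab.split s b y), fun m b y => Subtype.ext (lab.merge m b y)⟩,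
    fun e => ?_, fun y => Subtype.ext (hsrc y), fun e => hproj _ _ ?_, fun e => hproj _ _ ?_⟩
  · have hd : IsDyadic (p (D.left e)) := by
      exact ⟨P (D.left e) - P (D.left D.source), Finset.univ.sup n, by rw [hp]; push_cast; rfl⟩
    simp only [hT, add_comm (p (D.left e))]
    exact (hpl e).add_const hd
  · show p (D.left e) + L e 0 = _
    rw [hz, add_zero]
  · exact (hpr e).symm

/-- The points in a strand diagram flow to the source. -/
lemma flow_source {T : D.E → I → I} (hT : D.IsLabel T) (hs : ∀ y, T D.source y = y) (e : D.E) :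
    ∀ y : I, Irr y → D.jointed.Flow (e, y) (D.source, T e y) := by
  revert e
  refine edge_induction (fun y _ => ?_) (fun s b h y hy => ?_) fun m h y hy => ?_
  · rw [hs]; exact .refl _
  · have h1 := (Trans.split (G := D.jointed) s b).step hy
    rw [hT.split]
    exact .trans _ _ _ (.symm _ _ h1) (h _ (half_irrational.2 hy))
  · obtain ⟨b, y, rfl⟩ := exists_half y
    have hy' := half_irrational.1 hy
    have h1 := (Trans.merge (G := D.jointed) m b).step hy'
    rw [hT.merge]
    exact .trans _ _ _ (.symm _ _ h1) (h b y hy')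

lemma Represents.colored (h : D.Represents f) : D.jointed.Colored f := by
  obtain ⟨T, p, hT, hpl, hs, hl, hr⟩ := D.exists_origin
  have hsink : ∀ x, T D.sink (f.1 x) = x := fun x => by
    obtain ⟨z, hz, h1⟩ := (h x).label hT
    rw [← Subtype.ext hz, h1, hs]
  have hstep : ∀ x : I, Irr x → D.jointed.Flow (D.source, x) (D.source, f.1 x) := fun x hx => by
    have hfx : Irr (f.1 x) := (isPL_thompsonF f IsPL.id).irrational.2 hx
    have h1 := flow_source hT hs D.sink (f.1 x) hfx
    rw [hsink] at h1
    exact .trans _ _ _ (.symm _ _ h1) ((Trans.joint (G := D.jointed) ()).step hfx)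
  have hnat : ∀ (n : ℕ) (x : I), Irr x →
      D.jointed.Flow (D.source, x) (D.source, (f.1 ^ (n : ℤ)) x) := by
    intro n x hx
    induction n with
    | zero => exact .refl _
    | succ n ih =>
      refine .trans _ _ _ ih ?_
      have h1 := hstep _ (irrational_zpow (f := f) (k := n).2 hx)
      rw [show ((n + 1 : ℕ) : ℤ) = 1 + n by push_cast; ring, orderIso_zpow_add, zpow_one]
      exact h1
  refine ⟨fun e => ind D.sink e, T, p, D.isCut_ind_sink, hpl, ?_, fun e => .of_eq (hl e),
    fun e => .of_eq (hr e), ?_, ?_, ?_, fun x _ => ⟨D.source, x, .of_eq (hs x).symm⟩⟩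
  · intro e u e' v ht y
    have h0 : ∀ {e}, e ∈ D.heads → ind D.sink e = 0 := fun he => ind_of_ne (mem_heads_iff.1 he).symm
    cases ht with
    | split s b =>
      rw [h0 splitIn_mem_heads]; exact (hT.split s b y).symm
    | merge m b =>
      rw [h0 mergeIn_mem_heads]; exact (hT.merge m b y).symm
    | joint j =>
      obtain ⟨x, rfl⟩ := f.1.surjective y
      show (f.1 ^ ind D.sink D.sink) (T D.sink (f.1 x)) = T D.source (f.1 x)
      rw [ind_self, zpow_one, hsink, hs]
    | free e he hj => exact (hj () (not_not.1 (mt mem_tails_iff.2 he)).symm).elim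
  · show p (D.right D.source) = 1
    rw [← hr, hs]
  · show p (D.left D.source) = 0
    rw [← hl, hs]
  · rintro e e' y y' hy hy' ⟨k, hk⟩
    have hy2 : Irr (T e' y') := (hpl e').irrational.2 hy'
    have h1 := flow_source hT hs e y hy
    have h2 := flow_source hT hs e' y' hy'
    refine .trans _ _ _ h1 (.trans _ _ _ ?_ (.symm _ _ h2))
    rcases le_total 0 k with h3 | h3
    · lift k to ℕ using h3
      rw [hk]; exact .symm _ _ (hnat k _ hy2)
    · obtain ⟨n, rfl⟩ := Int.exists_eq_neg_ofNat h3
      have h4 := hnat n _ ((hpl e).irrational.2 hy)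
      rwa [zpow_eq_iff.2 hk] at h4

/-- A coloring by `g` of the closure of a strand diagram for `f` contains, at the source, a map
conjugating `f` to `g`. -/
lemma Represents.isConj (h : D.Represents f) (hg : D.jointed.Colored g) : IsConj f g := by
  obtain ⟨c, T, p, h1⟩ := hg
  obtain ⟨T, h1⟩ := h1.exists_of_isCut D.good_jointed D.isCut_ind_sink
  have h0 : ∀ {e}, e ∈ D.heads → ind D.sink e = 0 := fun he => ind_of_ne (mem_heads_iff.1 he).symm
  have hT : D.IsLabel T := by
    refine ⟨fun s b y => ?_, fun m b y => ?_⟩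
    · have h2 := h1.eq (.split (G := D.jointed) s b) y
      rw [h0 splitIn_mem_heads, zpow_zero] at h2
      exact h2.symm
    · have h2 := h1.eq (.merge (G := D.jointed) m b) y
      rw [h0 mergeIn_mem_heads, zpow_zero] at h2
      exact h2.symm
  have hj : ∀ y, g.1 (T D.sink y) = T D.source y := fun y => by
    have h2 := h1.eq (.joint (G := D.jointed) ()) y
    rw [show ind D.sink (D.jointed.jointIn ()) = 1 from ind_self _, zpow_one] at h2
    exact h2
  have hz := h1.left D.source
  rw [show p (D.left D.source) = 0 from h1.outer] at hz
  have ho := h1.right D.source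
  rw [show p (D.right D.source) = 1 from h1.inner] at ho
  obtain ⟨k, hk⟩ := exists_thompsonF_of_isPL (h1.pl D.source) hz.eq_zero ho.eq_one
  refine isConj_iff.2 ⟨k, mul_inv_eq_of_eq_mul (Subtype.ext (OrderIso.ext (funext fun x => ?_)))⟩
  show k.1 (f.1 x) = g.1 (k.1 x)
  obtain ⟨z, hz, h2⟩ := (h x).label hT
  rw [Subtype.ext hz] at h2
  rw [hk, hk, ← hj, h2]

end StrandDiagram

/-! ### Strand diagrams for the elements of Thompson's group -/

namespace StrandGraph

variable (G : StrandGraph)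

/-- From the region `r` one reaches `r'` by crossing the edges of the list `l` from left to right. -/
def Row : G.R → List G.E → G.R → Prop
  | r, [], r' => r = r'
  | r, e :: l, r' => G.left e = r ∧ Row (G.right e) l r'

variable {G}

lemma row_append {r r' : G.R} {l l' : List G.E} :
    G.Row r (l ++ l') r' ↔ ∃ r₁, G.Row r l r₁ ∧ G.Row r₁ l' r' := by
  induction l generalizing r with
  | nil => simp [Row]
  | cons e l ih => simp only [List.cons_append, Row, ih]; grind

lemma row_iff {r r' : G.R} {l : List G.E} :
    G.Row r l r' ↔ l.map G.left ++ [r'] = r :: l.map G.right := by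
  induction l generalizing r with
  | nil => simp [Row, eq_comm]
  | cons e l ih => simp [Row, ih]

end StrandGraph

/-- `Connects L L'` says that some strand diagram with several sources and sinks has compatible
labels by maps, the labels at the sources, from left to right, being those in `L` and those at the
sinks those in `L'`. -/
def Connects (L L' : List (I → I)) : Prop :=
  ∃ (G : StrandGraph) (top bot : List G.E) (lab : G.E → I → I) (rank : G.E → ℤ) (r r' : G.R),
    G.IsPlanar ∧ top.Nodup ∧ bot.Nodup ∧ (∀ e, e ∈ G.tails ↔ e ∉ top) ∧
    (∀ e, e ∈ G.heads ↔ e ∉ bot) ∧ G.Row r top r' ∧ G.Row r bot r' ∧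
    (∀ e e', G.Follows e e' → rank e < rank e') ∧ G.IsLabel lab ∧ top.map lab = L ∧ bot.map lab = L'

namespace StrandGraph

/-- The graph turned upside down. -/
abbrev flip (G : StrandGraph) : StrandGraph where
  S := G.M
  M := G.S
  E := G.E
  R := G.R
  splitIn := G.mergeOut
  splitLeft := G.mergeLeft
  splitRight := G.mergeRight
  mergeLeft := G.splitLeft
  mergeRight := G.splitRight
  mergeOut := G.splitIn
  left := G.left
  right := G.right
  tail_injective := by
    have h := G.head_injective.comp
      (show Injective (Sum.elim (.inr ∘ .inl) (Sum.elim (.inr ∘ .inr) .inl) :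
        G.M ⊕ G.M ⊕ G.S → G.S ⊕ G.M ⊕ G.M) by rintro (_ | _ | _) (_ | _ | _) h <;> simp_all)
    convert h using 1
    ext (_ | _ | _) <;> rfl
  head_injective := by
    have h := G.tail_injective.comp
      (show Injective (Sum.elim (.inr ∘ .inr) (Sum.elim .inl (.inr ∘ .inl)) :
        G.M ⊕ G.S ⊕ G.S → G.S ⊕ G.S ⊕ G.M) by rintro (_ | _ | _) (_ | _ | _) h <;> simp_all)
    convert h using 1
    ext (_ | _ | _) <;> rfl
  split_corners := G.merge_corners
  merge_corners := G.split_corners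

variable {G : StrandGraph}

lemma mem_tails_flip {e : G.E} : e ∈ G.flip.tails ↔ e ∈ G.heads := by
  rw [mem_tails', mem_heads', or_comm]

lemma mem_heads_flip {e : G.E} : e ∈ G.flip.heads ↔ e ∈ G.tails := by
  rw [mem_tails', mem_heads', or_comm]

lemma IsPlanar.flip (h : G.IsPlanar) : G.flip.IsPlanar := by
  refine ⟨h.1, fun c hc => ?_⟩
  obtain ⟨φ, ψ, h1⟩ := h.2 (fun e => -c e) fun r => by
    have := hc r
    rw [dualBoundary_eq] at this ⊢
    simp only [neg_mul, Finset.sum_neg_distrib]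
    exact neg_eq_zero.2 this
  refine ⟨ψ, φ, funext fun e => ?_⟩
  have h2 := congrFun h1 e
  rw [coboundary_eq] at h2 ⊢
  have h3 : G.flip.headPot ψ φ e = G.tailPot φ ψ e := add_comm _ _
  have h4 : G.flip.tailPot ψ φ e = G.headPot φ ψ e := add_comm _ _
  rw [h3, h4]
  linarith

/-- Parallel strands. -/
abbrev strands (n : ℕ) : StrandGraph where
  S := Empty
  M := Empty
  E := Fin n
  R := Fin (n + 1)
  splitIn := Empty.elim
  splitLeft := Empty.elim
  splitRight := Empty.elim
  mergeLeft := Empty.elim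
  mergeRight := Empty.elim
  mergeOut := Empty.elim
  left := Fin.castSucc
  right := Fin.succ
  tail_injective := by rintro (a | a | a) <;> exact a.elim
  head_injective := by rintro (a | a | a) <;> exact a.elim
  split_corners a := a.elim
  merge_corners a := a.elim

lemma isPlanar_strands (n : ℕ) : (strands n).IsPlanar := by
  have key : ∀ r : Fin (n + 1), EqvGen
      (fun p q => ∃ e : Fin n, e.castSucc = p ∧ e.succ = q) 0 r := by
    refine Fin.induction (.refl _) fun i h => .trans _ _ _ h (.rel _ _ ⟨i, rfl, rfl⟩)
  refine ⟨fun r r' => .trans _ _ _ (.symm _ _ (key r)) (key r'), fun c hc => ?_⟩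
  replace hc : ∀ r : Fin (n + 1), ∑ e : Fin n, c e * (ind e.castSucc r - ind e.succ r) = 0 :=
    fun r => (dualBoundary_eq (G := strands n) c r).symm.trans (hc r)
  have h0 : ∀ i : Fin n, c i = 0 := by
    -- the chain vanishes on all strands before `r`
    have : ∀ r : Fin (n + 1), ∀ i : Fin n, i.succ = r → c i = 0 := by
      refine Fin.induction (fun i h => (Fin.succ_ne_zero i h).elim) fun i h j hj => ?_
      obtain rfl := Fin.succ_injective _ hj
      have h1 := hc j.castSucc
      rw [Finset.sum_eq_single j] at h1
      · rwa [ind_self, ind_of_ne (Fin.castSucc_lt_succ (i := j)).ne', sub_zero, mul_one] at h1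
      · intro k _ hk
        by_cases h2 : k.succ = j.castSucc
        · rw [h k h2, zero_mul]
        · rw [ind_of_ne h2, ind_of_ne fun h3 => hk (Fin.castSucc_injective _ h3)]; simp
      · simp
    exact fun i => this _ i rfl
  refine ⟨Empty.elim, Empty.elim, funext fun e => ?_⟩
  rw [h0 e, coboundary_eq]
  simp [headPot, tailPot, strands]

section AddMerge

variable (G)

/-- Two neighboring strands which end at the bottom are joined by a new merge. -/
abbrev addMerge (b₁ b₂ : G.E) (hne : b₁ ≠ b₂) (h₁ : b₁ ∉ G.heads) (h₂ : b₂ ∉ G.heads)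
    (hb : G.right b₁ = G.left b₂) : StrandGraph where
  S := G.S
  M := Option G.M
  E := Option G.E
  R := G.R
  splitIn s := some (G.splitIn s)
  splitLeft s := some (G.splitLeft s)
  splitRight s := some (G.splitRight s)
  mergeLeft m := m.elim (some b₁) (some ∘ G.mergeLeft)
  mergeRight m := m.elim (some b₂) (some ∘ G.mergeRight)
  mergeOut m := m.map G.mergeOut
  left e := e.elim (G.left b₁) G.left
  right e := e.elim (G.right b₂) G.right
  tail_injective := by
    have h := (Option.map_injective G.tail_injective).comp
      (show Injective (Sum.elim (some ∘ .inl) (Sum.elim (some ∘ .inr ∘ .inl)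
        (Option.map (.inr ∘ .inr))) : G.S ⊕ G.S ⊕ Option G.M → Option (G.S ⊕ G.S ⊕ G.M)) by
          rintro (_ | _ | _ | _) (_ | _ | _ | _) h <;> simp_all)
    convert h using 1
    ext1 (_ | _ | _ | _) <;> rfl
  head_injective := by
    have k1 : ∀ x, Sum.elim G.splitIn (Sum.elim G.mergeLeft G.mergeRight) x ≠ b₁ :=
      fun x h => h₁ ⟨x, h⟩
    have k2 : ∀ x, Sum.elim G.splitIn (Sum.elim G.mergeLeft G.mergeRight) x ≠ b₂ :=
      fun x h => h₂ ⟨x, h⟩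
    have k : ∀ x y, x ≠ y → Sum.elim G.splitIn (Sum.elim G.mergeLeft G.mergeRight) x ≠
      Sum.elim G.splitIn (Sum.elim G.mergeLeft G.mergeRight) y := fun x y => G.head_injective.ne
    simp only [Sum.forall, Sum.elim_inl, Sum.elim_inr] at k1 k2 k
    rintro (_ | (_ | _) | (_ | _)) (_ | (_ | _) | (_ | _)) h <;>
      simp only [Sum.elim_inl, Sum.elim_inr, Option.elim, Function.comp, Option.some.injEq] at h <;>
      grind
  split_corners := G.split_corners
  merge_corners m := by
    cases m with
    | none => exact ⟨rfl, hb, rfl⟩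
    | some m => exact G.merge_corners m

variable {G} {b₁ b₂ : G.E} {hne : b₁ ≠ b₂} {h₁ : b₁ ∉ G.heads} {h₂ : b₂ ∉ G.heads}
  {hb : G.right b₁ = G.left b₂}

lemma isPlanar_addMerge (h : G.IsPlanar) : (G.addMerge b₁ b₂ hne h₁ h₂ hb).IsPlanar := by
  refine ⟨fun r r' => EqvGen.mono (fun p q ⟨e, h1, h2⟩ => ⟨some e, h1, h2⟩) _ _ (h.1 r r'),
    fun c hc => ?_⟩
  have hs : ∀ {α : Type} (a b : α), ind (some a) (some b) = ind a b := fun a b => by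
    by_cases h : a = b
    · rw [h, ind_self, ind_self]
    · rw [ind_of_ne h, ind_of_ne (by simpa using h)]
  have hn : ∀ {α : Type} (a : α), ind (some a) none = 0 := fun a => by simp [ind]
  have hn' : ∀ {α : Type} (a : α), ind none (some a) = 0 := fun a => by simp [ind]
  replace hc : ∀ r, ∑ e : Option G.E, c e * (G.addMerge b₁ b₂ hne h₁ h₂ hb).inc e r = 0 :=
    fun r => (dualBoundary_eq (G := G.addMerge b₁ b₂ hne h₁ h₂ hb) c r).symm.trans (hc r)
  -- a curve across the new edge can be moved across the new vertex
  obtain ⟨φ, ψ, h1⟩ := h.2 (fun e => c (some e) + c none * (ind b₁ e + ind b₂ e)) fun r => by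
    rw [dualBoundary_eq, ← hc r, Fintype.sum_option]
    simp only [add_mul, mul_assoc, sum_add_distrib, ← mul_sum, sum_ind_mul]
    have h2 : (G.addMerge b₁ b₂ hne h₁ h₂ hb).inc none r = G.inc b₁ r + G.inc b₂ r := by
      show ind (G.left b₁) r - ind (G.right b₂) r = _
      unfold inc; rw [hb]; ring
    rw [h2, add_comm]; rfl
  refine ⟨φ, fun m => m.elim (-c none) ψ, funext fun e => ?_⟩
  rw [coboundary_eq]
  cases e with
  | none =>
    show _ = _ - (_ + ∑ m : Option G.M, _)
    simp [headPot, addMerge, Fintype.sum_option, hn, ind_self]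
  | some e =>
    have h2 := congrFun h1 e
    rw [coboundary_eq] at h2
    have h3 : (G.addMerge b₁ b₂ hne h₁ h₂ hb).headPot φ (fun m => m.elim (-c none) ψ) (some e) =
        G.headPot φ ψ e - c none * (ind b₁ e + ind b₂ e) := by
      simp only [headPot, addMerge, Fintype.sum_option, hs, Option.elim, Function.comp]
      ring
    have h4 : (G.addMerge b₁ b₂ hne h₁ h₂ hb).tailPot φ (fun m => m.elim (-c none) ψ) (some e) =
        G.tailPot φ ψ e := by
      simp only [tailPot, addMerge, Fintype.sum_option, hs, hn', Option.elim, Option.map]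
      ring
    rw [h3, h4]
    linarith

end AddMerge

end StrandGraph

namespace Connects

open StrandGraph

lemma symm {L L' : List (I → I)} (h : Connects L L') : Connects L' L := by
  obtain ⟨G, top, bot, lab, rank, r, r', hG, h1, h2, h3, h4, h5, h6, h7, h8, h9, h10⟩ := h
  have hrow : ∀ {r l}, G.Row r l r' → G.flip.Row r l r' := fun h => by
    rw [row_iff] at h ⊢; exact h
  refine ⟨G.flip, bot, top, lab, fun e => -rank e, r, r', hG.flip, h2, h1,
    fun e => mem_tails_flip.trans (h4 e), fun e => mem_heads_flip.trans (h3 e), hrow h6, hrow h5,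
    ?_, ⟨fun m b y => (h8.merge m b y).symm, fun s b y => (h8.split s b y).symm⟩, h10, h9⟩
  rintro e e' (⟨m, rfl, h | h⟩ | ⟨s, h | h, rfl⟩) <;> subst h <;> refine neg_lt_neg (h7 _ _ ?_)
  exacts [.inr ⟨m, .inl rfl, rfl⟩, .inr ⟨m, .inr rfl, rfl⟩, .inl ⟨s, rfl, .inl rfl⟩,
    .inl ⟨s, rfl, .inr rfl⟩]

lemma refl (L : List (I → I)) : Connects L L := by
  have hrow : (strands L.length).Row (0 : Fin (L.length + 1)) (List.finRange L.length)
      (Fin.last L.length) := by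
    rw [row_iff]
    exact List.finRange_succ_last.symm.trans List.finRange_succ
  refine ⟨strands L.length, List.finRange L.length, List.finRange L.length, L.get, fun _ => 0, _, _,
    isPlanar_strands _, List.nodup_finRange _, List.nodup_finRange _, fun e => ?_, fun e => ?_,
    hrow, hrow, ?_, ⟨fun s => s.elim, fun m => m.elim⟩, List.map_get_finRange L,
    List.map_get_finRange L⟩
  · refine iff_of_false ?_ (not_not.2 (List.mem_finRange e))
    rintro ⟨a | a | a, -⟩ <;> exact a.elim
  · refine iff_of_false ?_ (not_not.2 (List.mem_finRange e))
    rintro ⟨a | a | a, -⟩ <;> exact a.elim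
  · rintro e e' (⟨a, -⟩ | ⟨a, -⟩) <;> exact a.elim

/-- Two neighboring sinks with labels `φ ∘ half false`, `φ ∘ half true` can be merged. -/
lemma merge {K L L' : List (I → I)} {φ : I → I}
    (h : Connects K (L ++ (fun y => φ (half false y)) :: (fun y => φ (half true y)) :: L')) :
    Connects K (L ++ φ :: L') := by
  classical
  obtain ⟨G, top, bot, lab, rank, r, r', hG, h1, h2, h3, h4, h5, h6, h7, h8, h9, h10⟩ := h
  obtain ⟨l, l₀, rfl, rfl, h11⟩ := List.map_eq_append_iff.1 h10
  obtain ⟨b₁, l₁, rfl, e1, h12⟩ := List.map_eq_cons_iff.1 h11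
  obtain ⟨b₂, l', rfl, e2, rfl⟩ := List.map_eq_cons_iff.1 h12
  obtain ⟨r₁, h13, h14, h15, h16⟩ := row_append.1 h6
  have hn := List.nodup_append.1 h2
  have hn2 := hn.2.1
  simp only [List.nodup_cons, List.mem_cons, not_or] at hn2
  obtain ⟨⟨hne, n1⟩, n2, n3⟩ := hn2
  have m1 : b₁ ∉ l := fun h => hn.2.2 _ h b₁ (by simp) rfl
  have m2 : b₂ ∉ l := fun h => hn.2.2 _ h b₂ (by simp) rfl
  have q1 : b₁ ∉ G.heads := fun h => (h4 _).1 h (by simp)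
  have q2 : b₂ ∉ G.heads := fun h => (h4 _).1 h (by simp)
  set H := G.addMerge b₁ b₂ hne q1 q2 h15.symm with hH
  have hrow : ∀ {r l r'}, G.Row r l r' → H.Row r (l.map some) r' := fun h => by
    rw [row_iff, List.map_map, List.map_map]
    exact row_iff.1 h
  have hinj := Option.some_injective G.E
  refine ⟨H, top.map some, l.map some ++ none :: l'.map some,
    fun e => e.elim φ lab, fun e => e.elim (max (rank b₁) (rank b₂) + 1) rank, r, r',
    isPlanar_addMerge hG, h1.map hinj, ?_, ?_, ?_, hrow h5, ?_, ?_, ⟨?_, ?_⟩, ?_, ?_⟩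
  · simp only [List.nodup_append, List.nodup_cons, List.nodup_map_iff hinj, List.mem_map,
      List.mem_cons]
    refine ⟨hn.1, ⟨by simp, n3⟩, ?_⟩
    rintro _ ⟨a, ha, rfl⟩ _ (rfl | ⟨b, hb, rfl⟩) hab
    · simp at hab
    · exact hn.2.2 a ha b (by simp [hb]) (Option.some.inj hab)
  · intro e
    cases e with
    | none => exact iff_of_true ⟨.inr (.inr none), rfl⟩ (by simp)
    | some e =>
      have h17 : some e ∈ H.tails ↔ e ∈ G.tails := by
        constructor
        · rintro ⟨s | s | (_ | m), h⟩
          exacts [⟨.inl s, hinj h⟩, ⟨.inr (.inl s), hinj h⟩, (by cases h), ⟨.inr (.inr m), hinj h⟩]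
        · rintro ⟨s | s | m, rfl⟩
          exacts [⟨.inl s, rfl⟩, ⟨.inr (.inl s), rfl⟩, ⟨.inr (.inr (some m)), rfl⟩]
      rw [List.mem_map_of_injective hinj]
      exact h17.trans (h3 e)
  · intro e
    cases e with
    | none =>
      refine iff_of_false ?_ (by simp)
      rintro ⟨s | (_ | m) | (_ | m), h⟩ <;> cases h
    | some e =>
      have h17 : some e ∈ H.heads ↔ e ∈ G.heads ∨ e = b₁ ∨ e = b₂ := by
        constructor
        · rintro ⟨s | (_ | m) | (_ | m), h⟩
          exacts [.inl ⟨.inl s, hinj h⟩, .inr (.inl (hinj h).symm), .inl ⟨.inr (.inl m), hinj h⟩,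
            .inr (.inr (hinj h).symm), .inl ⟨.inr (.inr m), hinj h⟩]
        · rintro (⟨s | m | m, rfl⟩ | rfl | rfl)
          exacts [⟨.inl s, rfl⟩, ⟨.inr (.inl (some m)), rfl⟩, ⟨.inr (.inr (some m)), rfl⟩,
            ⟨.inr (.inl none), rfl⟩, ⟨.inr (.inr none), rfl⟩]
      refine h17.trans ?_
      rw [h4]
      simp only [List.mem_append, List.mem_cons, List.mem_map_of_injective hinj]
      by_cases k1 : e = b₁
      · subst k1; simp [m1, n1]
      by_cases k2 : e = b₂
      · subst k2; simp [m2, n2]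
      simp [k1, k2]
  · exact row_append.2 ⟨r₁, hrow h13, h14, hrow h16⟩
  · rintro e e' (⟨s, rfl, h | h⟩ | ⟨_ | m, h | h, rfl⟩) <;> subst h
    · exact h7 _ _ (.inl ⟨s, rfl, .inl rfl⟩)
    · exact h7 _ _ (.inl ⟨s, rfl, .inr rfl⟩)
    · exact Int.lt_add_one_of_le (le_max_left _ _)
    · exact Int.lt_add_one_of_le (le_max_right _ _)
    · exact h7 _ _ (.inr ⟨m, .inl rfl, rfl⟩)
    · exact h7 _ _ (.inr ⟨m, .inr rfl, rfl⟩)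
  · rintro s (_ | _) y
    exacts [h8.split s false y, h8.split s true y]
  · rintro (_ | m) b y
    · cases b
      · exact (congrFun e1 y).symm
      · exact (congrFun e2 y).symm
    · cases b
      exacts [h8.merge m false y, h8.merge m true y]
  · rw [List.map_map]; exact h9
  · rw [List.map_append, List.map_cons, List.map_map, List.map_map]; rfl

end Connects

/-- The list `L` arises from the map `φ` by repeatedly restricting to halves. -/
inductive Subdivides : (I → I) → List (I → I) → Prop
  | leaf (φ : I → I) : Subdivides φ [φ]
  | node {φ : I → I} {L L' : List (I → I)} (h : Subdivides (fun y => φ (half false y)) L)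
      (h' : Subdivides (fun y => φ (half true y)) L') : Subdivides φ (L ++ L')

namespace Subdivides

variable {φ χ : I → I} {K L L' A B : List (I → I)} {N : ℕ}

lemma connects (h : Subdivides φ L) (hL : Connects K (A ++ (L ++ B))) :
    Connects K (A ++ φ :: B) := by
  induction h generalizing A B with
  | leaf => exact hL
  | @node φ L L' _ _ ih ih' =>
    refine Connects.merge ?_
    rw [← List.singleton_append, ← List.append_assoc]
    refine ih' ?_
    rw [List.append_assoc, List.singleton_append]
    refine ih ?_
    rwa [← List.append_assoc L]

/-- A map whose graph is a line of slope `1 / 2 ^ N`. -/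
def IsLine (N : ℕ) (φ : I → I) : Prop := ∃ a : ℝ, ∀ y, (φ y : ℝ) = a + y / 2 ^ N

/-- A piecewise linear map can be subdivided into pieces of any sufficiently small slope. -/
lemma exists_isLine (hφ : IsPL fun y => (φ y : ℝ)) :
    ∃ N₀, ∀ N ≥ N₀, ∃ L, Subdivides φ L ∧ ∀ χ ∈ L, IsLine N χ := by
  generalize hg : (fun y => (φ y : ℝ)) = g at hφ
  induction hφ generalizing φ with
  | affine g k d hd h =>
    subst hg
    replace h : ∀ y, (φ y : ℝ) = 2 ^ k * y + d := h
    refine ⟨(-k).toNat, fun N hN => ?_⟩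
    obtain ⟨j, hj⟩ : ∃ j : ℕ, k + N = j := Int.eq_ofNat_of_zero_le (by omega)
    induction j generalizing φ k d with
    | zero =>
      refine ⟨[φ], .leaf φ, fun χ hχ => ⟨d, fun y => ?_⟩⟩
      rw [List.mem_singleton.1 hχ, h, show k = -N by omega, zpow_neg, zpow_natCast]
      ring
    | succ j ih =>
      have key : ∀ b, ∃ L, Subdivides (fun y => φ (half b y)) L ∧ ∀ χ ∈ L, IsLine N χ := by
        intro b
        refine ih (k - 1) (2 ^ k * (half b 0 : ℝ) + d)
          (((half_isDyadic (y := 0) IsDyadic.zero).zpow_mul k).add hd) (fun y => ?_) ?_ ?_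
        · rw [h, zpow_sub_one₀ two_ne_zero, half_coe, half_coe, Set.Icc.coe_zero]; ring
        · omega
        · push_cast at hj ⊢; omega
      obtain ⟨L, h1, h2⟩ := key false
      obtain ⟨L', h1', h2'⟩ := key true
      exact ⟨L ++ L', h1.node h1', fun χ hχ => (List.mem_append.1 hχ).elim (h2 χ) (h2' χ)⟩
  | glue g _ _ ih ih' =>
    subst hg
    obtain ⟨N, h⟩ := ih (φ := fun y => φ (half false y)) rfl
    obtain ⟨N', h'⟩ := ih' (φ := fun y => φ (half true y)) rfl
    refine ⟨max N N', fun n hn => ?_⟩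
    obtain ⟨L, h1, h2⟩ := h n ((le_max_left _ _).trans hn)
    obtain ⟨L', h1', h2'⟩ := h' n ((le_max_right _ _).trans hn)
    exact ⟨L ++ L', h1.node h1', fun χ hχ => (List.mem_append.1 hχ).elim (h2 χ) (h2' χ)⟩

/-- The graphs of the maps in the list fit together, from `x` to `x'`. -/
def Chain : I → List (I → I) → I → Prop
  | x, [], x' => x = x'
  | x, φ :: L, x' => φ 0 = x ∧ Chain (φ 1) L x'

lemma Chain.append {x x₁ x' : I} (h : Chain x L x₁) (h' : Chain x₁ L' x') :
    Chain x (L ++ L') x' := by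
  induction L generalizing x with
  | nil => exact (show x = x₁ from h) ▸ h'
  | cons φ L ih => exact ⟨h.1, ih h.2⟩

lemma chain (h : Subdivides φ L) : Chain (φ 0) L (φ 1) := by
  induction h with
  | leaf => exact ⟨rfl, rfl⟩
  | node _ _ h h' =>
    simp only [half_false_zero, half_false_one] at h
    simp only [half_true_one] at h'
    exact h.append h'

lemma Chain.le (hL : ∀ χ ∈ L, IsLine N χ) {x x' : I} (h : Chain x L x') : x ≤ x' := by
  induction L generalizing x with
  | nil => exact (show x = x' from h).le
  | cons φ L ih =>
    refine le_trans ?_ (ih (fun χ hχ => hL χ (by simp [hχ])) h.2)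
    obtain ⟨a, ha⟩ := hL φ (by simp)
    rw [← h.1, ← Subtype.coe_le_coe, ha, ha]
    gcongr
    exact zero_le_one

/-- A chain of lines of the same slope is determined by its ends. -/
lemma Chain.unique (hL : ∀ χ ∈ L, IsLine N χ) (hL' : ∀ χ ∈ L', IsLine N χ) {x x' : I}
    (h : Chain x L x') (h' : Chain x L' x') : L = L' := by
  have hlt : ∀ {φ}, IsLine N φ → φ 0 < φ 1 := by
    rintro φ ⟨a, ha⟩
    rw [← Subtype.coe_lt_coe, ha, ha]
    gcongr
    exact zero_lt_one
  induction L generalizing L' x with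
  | nil =>
    cases L' with
    | nil => rfl
    | cons φ L' =>
      have h1 := Chain.le (fun χ hχ => hL' χ (by simp [hχ])) h'.2
      rw [← show x = x' from h, ← h'.1] at h1
      exact absurd (hlt (hL' φ (by simp))) h1.not_gt
  | cons φ L ih =>
    cases L' with
    | nil =>
      have h1 := Chain.le (fun χ hχ => hL χ (by simp [hχ])) h.2
      rw [← show x = x' from h', ← h.1] at h1
      exact absurd (hlt (hL φ (by simp))) h1.not_gt
    | cons χ L' =>
      obtain ⟨a, ha⟩ := hL φ (by simp)
      obtain ⟨a', ha'⟩ := hL' χ (by simp)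
      have h1 := congrArg (fun t : I => (t : ℝ)) (h.1.trans h'.1.symm)
      simp only [ha, ha', add_left_inj] at h1
      obtain rfl : φ = χ := funext fun y => Subtype.ext (by rw [ha, ha', h1])
      rw [ih (fun χ hχ => hL χ (by simp [hχ])) (fun χ hχ => hL' χ (by simp [hχ])) h.2 h'.2]

end Subdivides

/-- Both `f` and the identity can be subdivided into lines of the same slope, which are then the
same lines. -/
lemma connects_thompsonF (f : ThompsonF) : Connects [fun y => f.1 y] [fun y => y] := by
  obtain ⟨N, h⟩ := Subdivides.exists_isLine (φ := fun y => f.1 y) (isPL_thompsonF f IsPL.id)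
  obtain ⟨N', h'⟩ := Subdivides.exists_isLine (φ := fun y => y) IsPL.id
  obtain ⟨L, h1, h2⟩ := h (max N N') (le_max_left _ _)
  obtain ⟨L', h1', h2'⟩ := h' (max N N') (le_max_right _ _)
  obtain rfl : L = L' := Subdivides.Chain.unique h2 h2' h1.chain
    (by rw [Orb.map_zero, Orb.map_one]; exact h1'.chain)
  have h3 := h1'.connects (A := []) (B := []) (K := L) (by simpa using Connects.refl L)
  exact (h1.connects (A := []) (B := []) (by simpa using h3.symm)).symm

/-- Every element of Thompson's group is represented by a strand diagram. -/
theorem exists_represents (f : ThompsonF) : ∃ D : StrandDiagram, D.Represents f := by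
  obtain ⟨G, top, bot, lab, rank, r, r', hG, -, -, h3, h4, h5, h6, h7, h8, h9, h10⟩ :=
    connects_thompsonF f
  obtain ⟨a, rfl, ha⟩ := List.map_eq_singleton_iff.1 h9
  obtain ⟨b, rfl, hb⟩ := List.map_eq_singleton_iff.1 h10
  let D : StrandDiagram :=
    { G with
      source := a
      sink := b
      tails_eq := by ext e; simp [h3 e]
      heads_eq := by ext e; simp [h4 e]
      acyclic := fun e l h => by
        have h11 : List.IsChain (fun e e' => rank e < rank e') (e :: (l ++ [e])) :=
          h.imp fun _ _ => h7 _ _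
        have : IsTrans G.E fun e e' => rank e < rank e' := ⟨fun _ _ _ h h' => h.trans h'⟩
        exact lt_irrefl _ (List.rel_of_pairwise_cons h11.pairwise (by simp : e ∈ l ++ [e]))
      planar := hG
      left_side := h5.1.trans h6.1.symm
      right_side := (show G.right a = r' from h5.2).trans (show G.right b = r' from h6.2).symm }
  refine ⟨D, fun x => ?_⟩
  obtain ⟨y, hy⟩ := D.exists_carries_sink x
  obtain ⟨z, rfl, h⟩ := hy.label (D := D) (T := lab) h8
  have h1 : z = f.1 x := (congrFun hb z).symm.trans (h.trans (congrFun ha x))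
  exact h1 ▸ hy

/-! ### Conjugacy -/

namespace AnnularDiagram

variable {A B : AnnularDiagram} {f g : ThompsonF}

lemma IsReducedDiagramOf.exists_represents (h : A.IsReducedDiagramOf f) :
    ∃ D : StrandDiagram, D.Represents f ∧ ∀ g, A.Colored g ↔ D.jointed.Colored g := by
  obtain ⟨-, D, A₀, h1, h2, h3⟩ := h
  refine ⟨D, h1, fun g => ?_⟩
  have h4 : D.closure.Equivalent A := .trans _ _ _ (.rel _ _ (.inl h2.isotopic)) h3
  rw [← h4.colored_iff]
  exact (colored_toAnnular (D.good_jointed.smooth ())).trans ⟨fun h => h.of_smooth, fun h => h.smooth ()⟩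

/-- The reduced diagram of `f` is colored exactly by the conjugates of `f`. -/
theorem IsReducedDiagramOf.colored_iff (h : A.IsReducedDiagramOf f) : A.Colored g ↔ IsConj f g := by
  obtain ⟨D, h1, h2⟩ := h.exists_represents
  rw [h2]
  refine ⟨h1.isConj, fun h3 => ?_⟩
  obtain ⟨k, rfl⟩ := isConj_iff.1 h3
  exact h1.colored.conj k

theorem exists_isReducedDiagramOf (f : ThompsonF) : ∃ A : AnnularDiagram, A.IsReducedDiagramOf f := by
  obtain ⟨D, hD⟩ := _root_.exists_represents f
  obtain ⟨A, h1, h2⟩ := D.closure.exists_isReduced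
  exact ⟨A, h1, D, D.closure, hD, D.isClosure_closure, h2⟩

lemma IsReducedDiagramOf.isotopic (hA : A.IsReducedDiagramOf f) (hB : B.IsReducedDiagramOf g)
    (h : IsConj f g) : A.Isotopic B :=
  hA.1.isotopic_of_colored hB.1 (hA.colored_iff.2 h) (hB.colored_iff.2 (.refl g))

end AnnularDiagram

end

/-- Every element of Thompson's group `F` has a reduced annular strand diagram, unique up to
isotopy, and two elements are conjugate if and only if their reduced annular strand diagrams
are the same. -/
theorem mainTheorem1 :
    (∀ f : ThompsonF, ∃ A : AnnularDiagram, A.IsReducedDiagramOf f) ∧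
    (∀ (f : ThompsonF) (A B : AnnularDiagram),
      A.IsReducedDiagramOf f → B.IsReducedDiagramOf f → A.Isotopic B) ∧
    (∀ f g : ThompsonF, IsConj f g ↔
      ∃ A B : AnnularDiagram, A.IsReducedDiagramOf f ∧ B.IsReducedDiagramOf g ∧ A.Isotopic B) := by
  refine ⟨AnnularDiagram.exists_isReducedDiagramOf, fun f A B hA hB => hA.isotopic hB (.refl f),
    fun f g => ⟨fun h => ?_, ?_⟩⟩
  · obtain ⟨A, hA⟩ := AnnularDiagram.exists_isReducedDiagramOf f
    obtain ⟨B, hB⟩ := AnnularDiagram.exists_isReducedDiagramOf g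
    exact ⟨A, B, hA, hB, hA.isotopic hB h⟩
  · rintro ⟨A, B, hA, hB, h⟩
    exact hA.colored_iff.1 (h.colored (hB.colored_iff.2 (.refl g)))
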